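/- **Setting.** Let $k$ be an algebraically closed field of characteristic $0$, $C$ a smooth curve over $k$ with a point $0$ and an étale morphism $t\colon C\to\mathbb A^1$ with $t^{-1}(0)=\{0\}$. Let $X\to C$ be a proper (for example projective) strict simple degeneration: $X$ is a smooth scheme over $k$, $X\to C$ is flat and is smooth outside the fibre $X_0$ over $0$, and $X_0$ is a strict normal crossing divisor with smooth singular locus (locally $t=xy$). Let the dual graph of $X_0$ be bipartite, with vertex set $V^-\sqcup V^+$, and orient all edges from $V^-$ to $V^+$; an arrow $D\colon [Y']\to[Y]$ is a component $D$ of $Y'\cap Y$ with $[Y']\in V^-$, $[Y]\in V^+$. Let $Y_{(0)}$ be the union of the components in $V^-$. Put $X[0]=X$, with $t_1=t$, and let $X[m+1]$ be the blow-up of $X[m]\times_{\mathbb A^1}\mathbb A^2$ (fibre product of the last coordinate $t_{m+1}\colon X[m]\to\mathbb A^1$ and of the multiplication $\mathbb A^2\to\mathbb A^1$) along the preimage of $Y_{(0)}\times V(t_{m+2})$, where $(t_{m+1},t_{m+2})$ now denote the coordinates of $\mathbb A^2$. Thus $X[n]$ comes with a morphism $p\colon X[n]\to X$ and functions $t_1,\dots,t_{n+1}$.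 The torus $G[n]=\{(\sigma_1,\dots,\sigma_{n+1})\in\mathbb G_m^{n+1}:\prod\sigma_i=1\}$ acts on $X[n]$ over $X$ by $t_i\mapsto\sigma_it_i$; put $\tau_i=\sigma_1\cdots\sigma_i$ $(1\le i\le n)$. For non-empty $I=\{a_1<\dots<a_r\}\subset[n+1]$ let $X[n]_I$ be the closed subscheme $t_i=0$ $(i\in I)$. For every arrow $D\colon[Y']\to[Y]$ its dual graph contains exactly one chain of distinct components $$\Delta^{D,0}_I\overset{a_1}{\text{—}}\Delta^{D,a_1}_I\overset{a_2}{\text{—}}\cdots\overset{a_r}{\text{—}}\Delta^{D,a_r}_I$$ such that $\Delta^{D,0}_I$ lies over $Y'$, $\Delta^{D,a_r}_I$ lies over $Y$, the others are contracted onto $D$ by $p$, and successive components meet over $D$. This defines $\Delta^{D,c}_I$ for $c\in I\cup\{0\}$. Let $\mathcal L$ be the following $G[n]$-linearized invertible sheaf on $X[n]$. For $1\le i\le n$ let $\mathcal J_i\subset\mathcal O_{X[n]}$ be the invertible ideal generated by the equations of $Y_{(0)}$ and by $t_{i+1}\cdots t_{n+1}$; it is the restriction to $X[n]$ of the sheaf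 $\mathcal O(1)$ of $\mathbb P(\mathcal O(-Y_{(0)})\oplus\mathcal O(-V(t_{i+1}\cdots t_{n+1})))$. Then $\mathcal L=\bigotimes_{i=1}^n\mathcal J_i^{\,n+1}$, where $\sigma\in G[n]$ acts by $f\mapsto\big(\prod_i\tau_i^{\,i}\big)\cdot(f\circ\sigma)$. For $\mathbf s=(s_1,\dots,s_n)\in\mathbb Z^n$ let $\lambda_{\mathbf s}\colon\mathbb G_m\to G[n]$ be the one-parameter subgroup $\tau_i=\tau^{s_i}$, and put $s_0=s_{n+1}=0$. Let $P\in X[n]$ be a closed point and let $P_0=\lim_{\tau\to0}\lambda_{\mathbf s}(\tau)\cdot P\in X[n]$, if it exists. In that case $\mu^{\mathcal L}(\lambda_{\mathbf s},P)$ is the negative of the $\mathbb G_m$-weight on the fibre $\mathcal L(P_0)$. Let $I=\{i\in[n+1]: t_i(P)=0\}$. **Proposition.** (a) The limit $P_0$ exists if and only if $s_{i-1}\le s_i$ for all $i\in[n+1]\setminus I$. In this case $t_i(P_0)=0$ if and only if $i\in J:=I\cup\{i\in[n+1]: s_{i-1}<s_i\}$. (b) Assume that $P_0$ exists and that $X[n]_I$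 is smooth at $P$. If $I\neq\emptyset$, then $P$ lies on a unique component of $X[n]_I$. Suppose that this component is $\Delta^{D,i}_I$, and let $j$ be the successor of $i$ in $I\cup\{n+2\}$. Then $s_i\le s_{i+1}\le\dots\le s_{j-1}$, and: (i) If $s_k\ne0$ for all $i\le k<j$, then $i\ne0$ and $i\neq\max I$. Define $a$ $(i\le a\le j)$ by: $s_k<0$ if and only if $k<a$, for all $i\le k<j$. Then $P_0\in\Delta^{D,a'}_J\cap\Delta^{D,a}_J$, where $a'$ is the predecessor of $a$ in $J\cup\{0\}$, and $$\mu^{\mathcal L}(\lambda_{\mathbf s},P)=\sum_{1\le k<a}(-k s_k)+\sum_{a\le k\le n}(n+1-k)s_k.$$ (ii) If $s_k=0$ for some $i\le k<j$, define $a,b\in[i,j]$ by: $s_k=0$ if and only if $a\le k<b$, for all $i\le k<j$. Then $P_0\in\Delta^{D,a}_J$, $X[n]_J$ is smooth at $P_0$, and $$\mu^{\mathcal L}(\lambda_{\mathbf s},P)=\sum_{1\le k<a}(-k s_k)+\sum_{b\le k\le n}(n+1-k)s_k.$$ (c) Assume that $P_0$ exists and that $X[n]_I$ is singular at $P$. Then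 there are an arrow $D$ and consecutive elements $i<j$ of $I\cup\{0\}$ with $p(P)\in D$ and $P\in\Delta^{D,i}_I\cap\Delta^{D,j}_I$. For all such $D,i,j$ one has $P_0\in\Delta^{D,j'}_J\cap\Delta^{D,j}_J$, where $j'$ $(i\le j'<j)$ is the predecessor of $j$ in $J\cup\{0\}$, and $$\mu^{\mathcal L}(\lambda_{\mathbf s},P)=\sum_{1\le k<j}(-k s_k)+\sum_{j\le k\le n}(n+1-k)s_k.$$ -/

import Mathlib

open CategoryTheory CategoryTheory.Limits AlgebraicGeometry

noncomputable section

universe u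

namespace ExpDeg

/-! ### Generalities on schemes -/

/-- The regular function `f` vanishes at the point `x`. -/
def VanishesAt {Y : Scheme.{u}} (f : Γ(Y, ⊤)) (x : Y) : Prop := x ∉ Y.basicOpen f

/-- The morphism `f` is smooth at the point `x` of its source. -/
def SmoothAt {Y S : Scheme.{u}} (f : Y ⟶ S) (x : Y) : Prop :=
  ∃ U : Y.Opens, x ∈ U ∧ Smooth (U.ι ≫ f)

/-- `Z` is an irreducible component of the (closed) subset `S` of a topological space. -/
def IsComponent {T : Type u} [TopologicalSpace T] (Z S : Set T) : Prop :=
  Maximal (fun W : Set T => IsIrreducible W ∧ W ⊆ S) Z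

/-- The ideal sheaf `J` is invertible, i.e. it is the ideal sheaf of an effective Cartier divisor:
locally it is generated by one nonzerodivisor. -/
def IsInvertible {Y : Scheme.{u}} (J : Y.IdealSheafData) : Prop :=
  ∀ x : Y, ∃ U : Y.affineOpens, x ∈ U.1 ∧
    ∃ f ∈ nonZeroDivisors Γ(Y, U), J.ideal U = Ideal.span {f}

/-- `b : B ⟶ Z` is the blow-up of `Z` along the ideal sheaf `J`: the inverse image ideal sheaf of
`J` on `B` is invertible, and `b` is universal (terminal) with this property. -/
def IsBlowUp {B Z : Scheme.{u}} (b : B ⟶ Z) (J : Z.IdealSheafData) : Prop :=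
  IsInvertible (J.comap b) ∧
    ∀ (T : Scheme.{u}) (h : T ⟶ Z), IsInvertible (J.comap h) → ∃! g : T ⟶ B, g ≫ b = h

/-- The stalk at `x` of an ideal sheaf, as an ideal of the local ring at `x`. -/
def stalkIdeal {Y : Scheme.{u}} (J : Y.IdealSheafData) (x : Y) : Ideal (Y.presheaf.stalk x) :=
  Ideal.span {a | ∃ (U : Y.affineOpens) (hx : x ∈ U.1), ∃ f ∈ J.ideal U,
    a = Y.presheaf.germ U.1 x hx f}

/-- The affine line over `S`. -/
abbrev Line (S : Scheme.{u}) : Scheme.{u} := AffineSpace PUnit.{u + 1} S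

/-- The affine plane over `S`. -/
abbrev Plane (S : Scheme.{u}) : Scheme.{u} := AffineSpace (ULift.{u} (Fin 2)) S

/-- The morphism to the affine line given by a regular function. -/
def toLine {Y S : Scheme.{u}} (q : Y ⟶ S) (f : Γ(Y, ⊤)) : Y ⟶ Line S :=
  AffineSpace.homOfVector q (fun _ => f)

/-- The two coordinate functions on the affine plane. -/
def planeCoord (S : Scheme.{u}) (i : Fin 2) : Γ(Plane S, ⊤) := AffineSpace.coord S ⟨i⟩

/-- The multiplication morphism from the affine plane to the affine line. -/
def mulMap (S : Scheme.{u}) : Plane S ⟶ Line S :=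
  toLine (Plane S ↘ S) (planeCoord S 0 * planeCoord S 1)

variable {k : Type u} [Field k]

/-- The constant function `a` on a `k`-scheme. -/
def const {Y : Scheme.{u}} (q : Y ⟶ Spec (.of k)) (a : k) : Γ(Y, ⊤) :=
  q.appTop ((Scheme.ΓSpecIso (.of k)).inv a)

/-- The `k`-point `a` of the affine line. -/
def linePoint (a : k) : Spec (.of k) ⟶ Line (Spec (.of k)) :=
  toLine (𝟙 _) (const (𝟙 _) a)

/-! ### Strict simple degenerations with a bipartite orientation -/

/-- A strict simple degeneration `π : X ⟶ C`, proper over a smooth curve `C` with a distinguished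
point `0` and an étale coordinate `t : C ⟶ 𝔸¹` such that `t⁻¹(0) = {0}`. -/
structure Degeneration (k : Type u) [Field k] where
  /-- the base curve -/
  C : Scheme.{u}
  /-- the total space -/
  X : Scheme.{u}
  /-- the structure morphism of the curve -/
  str : C ⟶ Spec (.of k)
  /-- the degeneration -/
  π : X ⟶ C
  /-- the distinguished point -/
  zero : C
  /-- the étale coordinate on the curve -/
  t : Γ(C, ⊤)
  integral : IsIntegral C
  separated : IsSeparated str
  quasiCompact : QuasiCompact str
  etale : Etale (toLine str t)
  vanishesAt_iff : ∀ c : C, VanishesAt t c ↔ c = zero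
  proper : IsProper π
  flat : Flat π
  smooth : Smooth (π ≫ str)
  smooth_off : ∀ x : X, π x ≠ zero → SmoothAt π x
  /-- The central fibre is a strict normal crossing divisor with smooth singular locus (hence
  without triple intersections): at each of its points, its local equation `t` is part of a
  regular system of parameters, or is a product `x * y` of two members of such a system. -/
  normalCrossing : ∀ p : X, π p = zero →
    X.presheaf.germ ⊤ p trivial (π.appTop t) ∉
        IsLocalRing.maximalIdeal (X.presheaf.stalk p) ^ 2 ∨
      ∃ x y : IsLocalRing.maximalIdeal (X.presheaf.stalk p),
        X.presheaf.germ ⊤ p trivial (π.appTop t) = x.1 * y.1 ∧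
        LinearIndependent (IsLocalRing.ResidueField (X.presheaf.stalk p))
          ![(IsLocalRing.maximalIdeal (X.presheaf.stalk p)).toCotangent x,
            (IsLocalRing.maximalIdeal (X.presheaf.stalk p)).toCotangent y]

/-- The central fibre, as a subset of `X`. -/
def Degeneration.centralFibre (𝒟 : Degeneration k) : Set 𝒟.X := {x | 𝒟.π x = 𝒟.zero}

/-- A bipartite orientation of the dual graph of the central fibre: the set of components (the
vertices) is the disjoint union of `neg` and `pos`, and there is no edge between two vertices in
`neg` or between two vertices in `pos`. All arrows point from `neg` to `pos`. -/
structure BipartiteOrientation (𝒟 : Degeneration k) where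
  /-- the vertices that are sources -/
  neg : Set (Set 𝒟.X)
  /-- the vertices that are sinks -/
  pos : Set (Set 𝒟.X)
  union : neg ∪ pos = {Z | IsComponent Z 𝒟.centralFibre}
  disjoint : Disjoint neg pos
  neg_indep : ∀ Y ∈ neg, ∀ Y' ∈ neg, Y ≠ Y' → Disjoint Y Y'
  pos_indep : ∀ Y ∈ pos, ∀ Y' ∈ pos, Y ≠ Y' → Disjoint Y Y'

variable {𝒟 : Degeneration k}

/-- An arrow `[Y'] ⟶ [Y]` of the oriented dual graph: a component `D` of the intersection of two
components `Y'` (the source) and `Y` (the target) of the central fibre. -/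
structure Arrow (B : BipartiteOrientation 𝒟) where
  /-- the component `Y'` at which the arrow starts -/
  source : Set 𝒟.X
  /-- the component `Y` at which the arrow ends -/
  target : Set 𝒟.X
  /-- the component `D` of the singular locus of the central fibre -/
  locus : Set 𝒟.X
  source_mem : source ∈ B.neg
  target_mem : target ∈ B.pos
  locus_component : IsComponent locus (source ∩ target)

/-- The ideal sheaf of the (reduced) union of all components of the central fibre that are sources
of the oriented dual graph. -/
def BipartiteOrientation.sourceIdeal (B : BipartiteOrientation 𝒟) : 𝒟.X.IdealSheafData :=
  Scheme.IdealSheafData.vanishingIdeal ⟨closure (⋃₀ B.neg), isClosed_closure⟩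

/-! ### The expanded degenerations -/

/-- A scheme over `X` together with functions `t₁, t₂, …`. For `X[n]` the functions
`t₁, …, tₙ₊₁` are the coordinates of the morphism to `𝔸ⁿ⁺¹` and the others play no role. -/
structure Family (𝒟 : Degeneration k) where
  /-- the total space -/
  space : Scheme.{u}
  /-- the morphism to `X` -/
  proj : space ⟶ 𝒟.X
  /-- the functions `tᵢ`, where `i` starts at `1` -/
  coord : ℕ → Γ(space, ⊤)

/-- The structure morphism over the ground field. -/
def Family.str (Y : Family 𝒟) : Y.space ⟶ Spec (.of k) := Y.proj ≫ 𝒟.π ≫ 𝒟.str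

/-- Pullback of a family along a morphism to its total space. -/
def Family.pull (Y : Family 𝒟) {Z : Scheme.{u}} (f : Z ⟶ Y.space) : Family 𝒟 where
  space := Z
  proj := f ≫ Y.proj
  coord := fun i => f.appTop (Y.coord i)

/-- `X[0] = X`, with `t₁` the given function `t`. -/
def Family.initial (𝒟 : Degeneration k) : Family 𝒟 where
  space := 𝒟.X
  proj := 𝟙 _
  coord := fun _ => 𝒟.π.appTop 𝒟.t

/-- The fibre product `Y ×_{𝔸¹} 𝔸²` of the last coordinate `t_{m+1} : Y ⟶ 𝔸¹` of a family
with coordinates `t₁, …, t_{m+1}` and of the multiplication `𝔸² ⟶ 𝔸¹`. -/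
def Family.double (Y : Family 𝒟) (m : ℕ) : Family 𝒟 where
  space := pullback (toLine Y.str (Y.coord (m + 1))) (mulMap (Spec (.of k)))
  proj := pullback.fst _ _ ≫ Y.proj
  coord := fun i =>
    if i ≤ m then
      (pullback.fst (toLine Y.str (Y.coord (m + 1))) (mulMap (Spec (.of k)))).appTop (Y.coord i)
    else if i = m + 1 then
      (pullback.snd (toLine Y.str (Y.coord (m + 1))) (mulMap (Spec (.of k)))).appTop
        (planeCoord _ 0)
    else
      (pullback.snd (toLine Y.str (Y.coord (m + 1))) (mulMap (Spec (.of k)))).appTop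
        (planeCoord _ 1)

/-- The ideal sheaf on the total space of a family over `X` that is generated by the equations of
the source components of the central fibre and by the regular function `f`. -/
def Family.centre (B : BipartiteOrientation 𝒟) (Y : Family 𝒟) (f : Γ(Y.space, ⊤)) :
    Y.space.IdealSheafData :=
  B.sourceIdeal.comap Y.proj ⊔ Scheme.IdealSheafData.ofIdealTop (Ideal.span {f})

/-- `IsExpansion B n Y` says that `Y` is the expanded degeneration `X[n]`: one has `X[0] = X`, and
`X[m+1]` is the blow-up of `X[m] ×_{𝔸¹} 𝔸²` along the preimage of
`Y₍₀₎ × V(t_{m+2})`, where `Y₍₀₎` is the union of the source components. As blow-ups are unique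
up to a unique isomorphism, so is `X[n]`. -/
inductive IsExpansion (B : BipartiteOrientation 𝒟) : ℕ → Family 𝒟 → Prop
  | zero : IsExpansion B 0 (Family.initial 𝒟)
  | succ (m : ℕ) (Y : Family 𝒟) (h : IsExpansion B m Y) (Z : Scheme.{u})
      (b : Z ⟶ (Y.double m).space)
      (hb : IsBlowUp b ((Y.double m).centre B ((Y.double m).coord (m + 2)))) :
      IsExpansion B (m + 1) ((Y.double m).pull b)

/-- The closed points, i.e. the `k`-points. -/
def Family.Point (Y : Family 𝒟) : Type u := {P : Spec (.of k) ⟶ Y.space // P ≫ Y.str = 𝟙 _}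

/-- The underlying point of the scheme. -/
def Family.Point.pt {Y : Family 𝒟} (P : Y.Point) : Y.space := P.1 (IsLocalRing.closedPoint k)

open Classical in
/-- The set of all `i ∈ [n+1]` with `tᵢ(P) = 0`. -/
def Family.Point.vanishing {Y : Family 𝒟} (P : Y.Point) (n : ℕ) : Finset ℕ :=
  {i ∈ Finset.Icc 1 (n + 1) | VanishesAt (Y.coord i) P.pt}

/-! ### The strata `X[n]_I` and their components -/

/-- `X[n]_I` as a subset of `X[n]`: the locus where `tᵢ = 0` for all `i ∈ I`. -/
def Family.stratum (Y : Family 𝒟) (I : Finset ℕ) : Set Y.space :=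
  {x | ∀ i ∈ I, VanishesAt (Y.coord i) x}

/-- The ideal sheaf of the closed subscheme `X[n]_I`. -/
def Family.stratumIdeal (Y : Family 𝒟) (I : Finset ℕ) : Y.space.IdealSheafData :=
  Scheme.IdealSheafData.ofIdealTop (Ideal.span (Y.coord '' (I : Set ℕ)))

/-- The closed subscheme `X[n]_I` contains the point `x` and is smooth (over `k`) there. -/
def Family.SmoothStratumAt (Y : Family 𝒟) (I : Finset ℕ) (x : Y.space) : Prop :=
  ∃ z : (Y.stratumIdeal I).subscheme, (Y.stratumIdeal I).subschemeι z = x ∧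
    SmoothAt ((Y.stratumIdeal I).subschemeι ≫ Y.str) z

/-- `i < j` are consecutive elements of `S`. -/
def Consecutive (S : Finset ℕ) (i j : ℕ) : Prop :=
  i ∈ S ∧ j ∈ S ∧ i < j ∧ ∀ m ∈ S, ¬ (i < m ∧ m < j)

/-- The family `Z c`, for `c ∈ I ∪ {0}`, is the chain of nodes over the arrow `D` in the dual graph
of `X[n]_I`: for `I = {a₁ < ⋯ < a_r}` it is the chain
`Z 0 —a₁— Z a₁ —a₂— ⋯ —a_r— Z a_r` of distinct components of `X[n]_I`, where `Z 0` and `Z a_r` are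
the components lying over the source and over the target of the arrow, the intermediate ones are
contracted onto `D`, and successive components meet over `D`. -/
structure IsChain {B : BipartiteOrientation 𝒟} (Y : Family 𝒟) (I : Finset ℕ) (D : Arrow B)
    (Z : ℕ → Set Y.space) : Prop where
  component : ∀ c ∈ insert 0 I, IsComponent (Z c) (Y.stratum I)
  first : Y.proj '' Z 0 = D.source
  last : ∀ c ∈ I, (∀ i ∈ I, i ≤ c) → Y.proj '' Z c = D.target
  middle : ∀ c ∈ I, (∃ i ∈ I, c < i) → Y.proj '' Z c = D.locus
  injOn : Set.InjOn Z (insert 0 I : Finset ℕ)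
  meet : ∀ c c', Consecutive (insert 0 I) c c' → (Z c ∩ Z c' ∩ Y.proj ⁻¹' D.locus).Nonempty

/-- The component `Δ^{D,c}_I` of `X[n]_I`, for `I` non-empty and `c ∈ I ∪ {0}`. In particular
`Δ^{D,0}_I` and `Δ^{D,max I}_I` are the components over the source and the target of `D`.
(There is exactly one chain; for other values of `I` and `c` the set is empty.) -/
def Family.delta {B : BipartiteOrientation 𝒟} (Y : Family 𝒟) (I : Finset ℕ) (D : Arrow B) (c : ℕ) :
    Set Y.space :=
  {x | I.Nonempty ∧ c ∈ insert 0 I ∧ ∃ Z, IsChain Y I D Z ∧ x ∈ Z c}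

/-! ### The torus `G[n]`, its action, and its one-parameter subgroups -/

/-- The group `G[n]` of all `(σ₁, …, σₙ₊₁)` with `∏ σᵢ = 1`. -/
def Torus (k : Type u) [Field k] (n : ℕ) : Subgroup (Finset.Icc 1 (n + 1) → kˣ) where
  carrier := {σ | ∏ i, σ i = 1}
  mul_mem' := by
    intro a b ha hb
    simp only [Set.mem_ofPred_eq, Pi.mul_apply, Finset.prod_mul_distrib] at *
    rw [ha, hb, one_mul]
  one_mem' := by simp
  inv_mem' := by
    intro a ha
    simp only [Set.mem_ofPred_eq, Pi.inv_apply, Finset.prod_inv_distrib] at *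
    rw [ha, inv_one]

/-- The coordinate `τᵢ = σ₁ ⋯ σᵢ` on `G[n]`. -/
def tau {n : ℕ} (i : ℕ) (σ : Torus k n) : kˣ := ∏ m with m.1 ≤ i, σ.1 m

/-- An `n`-tuple `(s₁, …, sₙ)` of integers, extended by `s₀ = sₙ₊₁ = 0`. -/
def extZero {n : ℕ} (s : Fin n → ℤ) (i : ℕ) : ℤ :=
  if h : 1 ≤ i ∧ i ≤ n then s ⟨i - 1, by omega⟩ else 0

theorem prod_zpow_sub (x : kˣ) (f : ℕ → ℤ) (N : ℕ) :
    ∏ i ∈ Finset.Icc 1 N, x ^ (f i - f (i - 1)) = x ^ (f N - f 0) := by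
  induction N with
  | zero => simp
  | succ N ih =>
    rw [Finset.prod_Icc_succ_top (by omega), ih, ← zpow_add]
    congr 1
    simp only [Nat.add_sub_cancel]
    ring

/-- The one-parameter subgroup `λ_s` of `G[n]`, given by `τᵢ = x ^ sᵢ` in the `τ`-coordinates,
i.e. by `σᵢ = x ^ (sᵢ - sᵢ₋₁)`. -/
def onePS {n : ℕ} (s : Fin n → ℤ) : kˣ →* Torus k n where
  toFun x := ⟨fun i => x ^ (extZero s i.1 - extZero s (i.1 - 1)), by
    change ∏ i : Finset.Icc 1 (n + 1), x ^ (extZero s i.1 - extZero s (i.1 - 1)) = 1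
    rw [Finset.prod_coe_sort (Finset.Icc 1 (n + 1)) (fun i => x ^ (extZero s i - extZero s (i - 1))),
      prod_zpow_sub]
    simp [extZero]⟩
  map_one' := by ext; simp
  map_mul' x y := by
    apply Subtype.ext
    funext i
    simp [mul_zpow]

/-- `g` is the action of `σ ∈ G[n]` on `X[n]`: the lift of the action on `X ×_{𝔸¹} 𝔸ⁿ⁺¹` which is
trivial on `X` and multiplies `tᵢ` by `σᵢ`. -/
def IsTranslation {n : ℕ} (Y : Family 𝒟) (σ : Torus k n) (g : Y.space ⟶ Y.space) : Prop :=
  g ≫ Y.proj = Y.proj ∧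
    ∀ i : Finset.Icc 1 (n + 1), g.appTop (Y.coord i.1) = const Y.str (σ.1 i : k) * Y.coord i.1

open Classical in
/-- The action of `σ ∈ G[n]` on `X[n]` (the lift exists and is unique). -/
def act {n : ℕ} (Y : Family 𝒟) (σ : Torus k n) : Y.space ⟶ Y.space :=
  if h : ∃ g, IsTranslation Y σ g then h.choose else 𝟙 _

/-- `P₀` is the limit of `l(x) · P` as `x` tends to `0`: the orbit morphism `x ↦ l(x) · P` extends
to a morphism from the affine line to `X[n]` which maps `0` to `P₀`. -/
def IsLimit {n : ℕ} (Y : Family 𝒟) (l : kˣ →* Torus k n) (P P₀ : Y.Point) : Prop :=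
  ∃ φ : Line (Spec (.of k)) ⟶ Y.space,
    (∀ x : kˣ, linePoint (x : k) ≫ φ = P.1 ≫ act Y (l x)) ∧ linePoint 0 ≫ φ = P₀.1

/-! ### The linearization and the Hilbert–Mumford invariant -/

/-- A `G[n]`-linearized invertible sheaf on `X[n]`, given by a `G[n]`-stable invertible ideal sheaf
and a character of `G[n]`. The linearization is the pullback of functions along the action,
multiplied by the character: `σ` maps a section `f` to `χ(σ) · (f ∘ σ)`. -/
structure LinearizedIdeal (Y : Family 𝒟) (n : ℕ) where
  /-- the ideal sheaf -/
  sheaf : Y.space.IdealSheafData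
  /-- the character -/
  char : Torus k n →* kˣ

/-- The linearized sheaf `𝓛` on `X[n]`. Its `i`-th factor is the inverse image on `X[n]` of the
ideal of the centre of the `i`-th blow-up, i.e. the restriction of the tautological sheaf `𝒪(1)` of
the `ℙ¹`-bundle `ℙ(𝒪(-Y₍₀₎) ⊕ 𝒪(-V(t_{i+1} ⋯ t_{n+1})))`, with its natural linearization;
locally it is generated by homogeneous coordinates `uᵢ, vᵢ`, where `uᵢ` is an equation of `Y₍₀₎`
and `vᵢ = t_{i+1} ⋯ t_{n+1}`. One takes the `(n+1)`-st power of each factor, twists it by the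
character `τᵢ ^ i`, and forms the tensor product over `i = 1, …, n`. -/
def linearization (B : BipartiteOrientation 𝒟) (Y : Family 𝒟) (n : ℕ) : LinearizedIdeal Y n where
  sheaf := ∏ i ∈ Finset.Icc 1 n,
    (Y.centre B (∏ m ∈ Finset.Icc (i + 1) (n + 1), Y.coord m)) ^ (n + 1)
  char :=
    { toFun := fun σ => ∏ i ∈ Finset.Icc 1 n, tau i σ ^ i
      map_one' := by simp [tau]
      map_mul' := by
        intro a b
        simp [tau, Finset.prod_mul_distrib, mul_pow] }

/-- `𝔾ₘ`, acting through `l`, fixes the point `x` and acts with weight `w` on the fibre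
`𝓛(x) = 𝓛ₓ / 𝔪ₓ 𝓛ₓ`. -/
def IsFibreWeight {n : ℕ} {Y : Family 𝒟} (L : LinearizedIdeal Y n) (l : kˣ →* Torus k n)
    (x : Y.space) (w : ℤ) : Prop :=
  ∀ z : kˣ, act Y (l z) x = x ∧
    ∀ (U : Y.space.affineOpens) (hx : x ∈ U.1) (hgx : x ∈ (act Y (l z)) ⁻¹ᵁ U.1),
      ∀ f ∈ L.sheaf.ideal U,
        Y.space.presheaf.germ ⊤ x trivial (const Y.str (L.char (l z) : k)) *
            Y.space.presheaf.germ ((act Y (l z)) ⁻¹ᵁ U.1) x hgx ((act Y (l z)).app U.1 f) -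
          Y.space.presheaf.germ ⊤ x trivial (const Y.str ((z ^ w : kˣ) : k)) *
            Y.space.presheaf.germ U.1 x hx f
        ∈ IsLocalRing.maximalIdeal (Y.space.presheaf.stalk x) * stalkIdeal L.sheaf x

open Classical in
/-- The Hilbert–Mumford invariant `μ^𝓛(l, P)`: the negative of the `𝔾ₘ`-weight on the fibre of `𝓛`
at the limit point, or `∞` if the limit does not exist. -/
def hilbertMumford {n : ℕ} {Y : Family 𝒟} (L : LinearizedIdeal Y n) (l : kˣ →* Torus k n)
    (P : Y.Point) : WithTop ℤ :=
  if h : ∃ w : ℤ, ∃ P₀ : Y.Point, IsLimit Y l P P₀ ∧ IsFibreWeight L l P₀.pt w then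
    ((-h.choose : ℤ) : WithTop ℤ)
  else ⊤

/-- The set `J = I ∪ {i ∈ [n+1] | sᵢ₋₁ < sᵢ}`. -/
def limitIndex {n : ℕ} (s : Fin n → ℤ) (I : Finset ℕ) : Finset ℕ :=
  I ∪ {i ∈ Finset.Icc 1 (n + 1) | extZero s (i - 1) < extZero s i}

end ExpDeg

end

-- The iterated blow-up is replaced by explicit charts, and the proposition is then read off from
-- weights of coordinates.
--
-- By the universal properties of fibre products and blow-ups, `X[n]` represents the following data:
-- a morphism to `X` and functions `t₁, …, tₙ₊₁` whose product is the pullback of `t`, such that for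
-- `1 ≤ i ≤ n` the ideal generated by the equations of the sources and by the tail `vᵢ = tᵢ₊₁ ⋯
-- tₙ₊₁` is invertible (`IsExpansion.isUniversal`). Locally on `X` there are smooth coordinates with
-- `t = x * y`, where `x` is an equation of the sources and `y` one of the targets; one of them may
-- be `1`. In a local ring, invertibility means that one of `x`, `vᵢ` divides the other. Hence `v_j
-- ∣ x ∣ v_{j-1}` for some `j`, that is, `x = x_j t_{j+1} ⋯ t_{n+1}`, `y = y_j t_1 ⋯ t_{j-1}` and
-- `t_j = x_j y_j`. These equations define an open chart which is smooth over the affine space with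
-- coordinates `x_j`, `y_j` (those that are not `1`) and `tᵢ` (`i ≠ j`), and such charts cover
-- `X[n]` (`IsUniversal.exists_expChart`, `IsUniversal.exists_mem_range_expChart`).
--
-- The geometry is encoded in the vanishing of the homogeneous coordinates `(x : vᵢ)` (`SourceZero`,
-- `TailZero`). The component of `X[n]_I` with index `l` lies over a stratum of `X`; there the
-- coordinate from `vᵢ` vanishes for `i < l`, and the one from `x` vanishes as soon as `i` is at
-- least the successor of `l` in `I` (`isComponent_iff`, `mem_delta_iff`). In the `j`-th chart
-- `X[n]_I` is singular exactly where `j ∈ I` and `x_j = y_j = 0` (`ExpChart.smoothStratumAt_iff`).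
--
-- The one-parameter subgroup acts with weight `sᵢ - sᵢ₋₁` on `tᵢ`, `s_j` on `x_j` and `-s_{j-1}` on
-- `y_j`. In a chart containing the limit, coordinates of weight zero keep their value and all
-- others become zero (`limit_chart`). Conversely, under the condition in (a) there is a chart
-- around `P` in which no nonvanishing coordinate has negative weight (`exists_limit`). Since `x /
-- vᵢ` has weight `sᵢ`, a homogeneous coordinate vanishing at `P` vanishes at `P₀`, and if neither
-- vanishes at `P`, then the sign of `sᵢ` decides which one does at `P₀`. So the index `j` of any
-- chart around `P₀` lies between two thresholds `a ≤ b` (`IsSeparated`).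
--
-- In the `j`-th chart the sheaf is generated by the product of `x ^ (n + 1)` over `i < j` and `vᵢ ^
-- (n + 1)` over `i ≥ j`. As `vᵢ` has weight `-sᵢ` and the character has weight `∑ i sᵢ`, the weight
-- on the fibre is `∑_{i<j} i sᵢ - ∑_{i≥j} (n + 1 - i) sᵢ` (`isFibreWeight_chartWeight`). The `sᵢ`
-- with `a ≤ i < b` are zero, so this depends on `a` and `b` only and gives the stated formulas.

universe u

/-! ### Smooth local algebras: the Jacobian criterion, integrality, spreading out -/

noncomputable section

namespace ExpDeg

section CommutativeAlgebra

open TensorProduct KaehlerDifferential IsLocalRing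

/-- The differentials of elements with independent classes in the cotangent space of a formally
smooth local algebra are part of a basis. -/
theorem linearIndependent_tmul_D {k O : Type*} [Field k] [CommRing O] [IsLocalRing O]
    [Algebra k O] [Algebra.FormallySmooth k O] [Algebra.FormallySmooth k (ResidueField O)]
    {σ : Type*} (z : σ → maximalIdeal O)
    (hz : LinearIndependent (ResidueField O) fun i => (maximalIdeal O).toCotangent (z i)) :
    LinearIndependent (ResidueField O)
      fun i => (1 : ResidueField O) ⊗ₜ[O] D k O (z i : O) := by
  -- As the residue field `κ` is formally smooth over `k` as well, the conormal map from `𝔪/𝔪²` to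
  -- `κ ⊗ Ω` has a left inverse. Relations between differentials therefore come from relations
  -- between cotangent classes.
  obtain ⟨l, hl⟩ := (Algebra.FormallySmooth.iff_split_injection (R := k) (P := O)
    (A := ResidueField O) IsLocalRing.residue_surjective).1 inferInstance
  have hker : RingHom.ker (algebraMap O (ResidueField O)) = maximalIdeal O := by
    rw [ResidueField.algebraMap_eq, ker_residue]
  have hinj : Function.Injective (kerCotangentToTensor k O (ResidueField O)) :=
    Function.HasLeftInverse.injective ⟨l, LinearMap.congr_fun hl⟩
  rw [linearIndependent_iff'] at hz ⊢
  intro s g hg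
  choose c hc using fun i => IsLocalRing.residue_surjective (R := O) (g i)
  refine hz s g ?_
  let m : ∀ i, RingHom.ker (algebraMap O (ResidueField O)) := fun i => ⟨z i,
      by rw [hker]; exact (z i).2⟩
  have h1 : kerCotangentToTensor k O (ResidueField O)
      (∑ i ∈ s, c i • (RingHom.ker (algebraMap O (ResidueField O))).toCotangent (m i)) = 0 := by
    rw [map_sum, ← hg]
    refine Finset.sum_congr rfl fun i _ => ?_
    rw [map_smul, kerCotangentToTensor_toCotangent, ← hc i, ← ResidueField.algebraMap_eq,
      algebraMap_smul]
  have h2 : ∑ i ∈ s, c i • (RingHom.ker (algebraMap O (ResidueField O))).toCotangent (m i) = 0 :=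
    hinj (by rw [h1, map_zero])
  have h3 : ∑ i ∈ s, c i • (maximalIdeal O).toCotangent (z i) = 0 := by
    simp only [← map_smul, ← map_sum, Ideal.toCotangent_eq_zero, Submodule.coe_sum,
      Submodule.coe_smul] at h2 ⊢
    simpa only [hker] using h2
  rw [← h3]
  refine Finset.sum_congr rfl fun i _ => ?_
  rw [← hc i, ← ResidueField.algebraMap_eq, algebraMap_smul]

/-- The Jacobian criterion: a formally smooth local algebra is formally smooth over the polynomial
ring in elements with independent classes in the cotangent space. -/
theorem formallySmooth_mvPolynomial {k O : Type*} [Field k] [CommRing O] [IsLocalRing O]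
    [Algebra k O] [Algebra.FormallySmooth k O] [Algebra.FormallySmooth k (ResidueField O)]
    [Module.Finite O Ω[O⁄k]] {σ : Type*} [Finite σ] (z : σ → maximalIdeal O)
    (hz : LinearIndependent (ResidueField O) fun i => (maximalIdeal O).toCotangent (z i))
    [Algebra (MvPolynomial σ k) O] [IsScalarTower k (MvPolynomial σ k) O]
    (hX : ∀ i, algebraMap (MvPolynomial σ k) O (.X i) = z i) :
    Algebra.FormallySmooth (MvPolynomial σ k) O := by
  have := Fintype.ofFinite σ
  have hfree : Module.Free O Ω[O⁄k] := Module.free_of_flat_of_isLocalRing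
  let b : Module.Basis σ O (O ⊗[MvPolynomial σ k] Ω[MvPolynomial σ k⁄k]) :=
    (mvPolynomialBasis k σ).baseChange O
  have hb : ∀ i, mapBaseChange k (MvPolynomial σ k) O (b i) = D k O (z i : O) := by
    intro i
    simp [b, hX]
  have : Module.Finite O (O ⊗[MvPolynomial σ k] Ω[MvPolynomial σ k⁄k]) := .of_basis b
  -- The map from `O ⊗ Ω` of the polynomial ring to `Ω[O⁄k]` is injective modulo the maximal ideal
  -- because the `D (z i)` are independent there. Between finite free modules this implies that it
  -- is split injective.
  have hinj : Function.Injective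
      ((mapBaseChange k (MvPolynomial σ k) O).lTensor (ResidueField O)) := by
    have hli := linearIndependent_tmul_D (k := k) z hz
    have : ((mapBaseChange k (MvPolynomial σ k) O).lTensor (ResidueField O)) =
      ((mapBaseChange k (MvPolynomial σ k) O).baseChange (ResidueField O)).restrictScalars O := rfl
    rw [this]
    change Function.Injective ((mapBaseChange k (MvPolynomial σ k) O).baseChange (ResidueField O))
    rw [injective_iff_map_eq_zero]
    intro x hx
    let b' := b.baseChange (ResidueField O)
    rw [← b'.sum_repr x, map_sum] at hx
    simp only [map_smul, b', Module.Basis.baseChange_apply, LinearMap.baseChange_tmul, hb] at hx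
    have := Fintype.linearIndependent_iff.1 hli _ hx
    exact b'.repr.map_eq_zero_iff.1 (Finsupp.ext this)
  obtain ⟨l, hl⟩ := (split_injective_iff_lTensor_residueField_injective
    (mapBaseChange k (MvPolynomial σ k) O)).2 hinj
  have hinj' : Function.Injective (mapBaseChange k (MvPolynomial σ k) O) :=
    Function.HasLeftInverse.injective ⟨l, LinearMap.congr_fun hl⟩
  -- With `Λ` the polynomial ring, both conditions follow from the exact sequence `H¹(O/k) → H¹(O/Λ)
  -- → O ⊗ Ω_Λ → Ω_O → Ω_{O/Λ} → 0`. Its first term vanishes and its third map is split injective,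
  -- so `H¹(O/Λ) = 0` and `Ω_{O/Λ}` is a direct summand of a free module.
  rw [Algebra.formallySmooth_iff]
  constructor
  · have hsplit := ((KaehlerDifferential.exact_mapBaseChange_map k
      (MvPolynomial σ k) O).split_tfae' ).out 0 1
    obtain ⟨-, g, hg⟩ := hsplit.2 ⟨KaehlerDifferential.map_surjective _ _ _, l, hl⟩
    exact .of_split _ _ hg
  · constructor
    intro x y
    suffices ∀ x : Algebra.H1Cotangent (MvPolynomial σ k) O, x = 0 by rw [this x, this y]
    intro x
    have h1 := Algebra.H1Cotangent.exact_δ_mapBaseChange k (MvPolynomial σ k) O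
    have h2 := Algebra.H1Cotangent.exact_map_δ k (MvPolynomial σ k) O
    have h3 : Algebra.H1Cotangent.δ k (MvPolynomial σ k) O x = 0 :=
      hinj' (by rw [h1.apply_apply_eq_zero, map_zero])
    obtain ⟨w, rfl⟩ := (h2 x).1 h3
    rw [Subsingleton.elim w 0, map_zero]

/-- Compares adic filtrations: a polynomial that is small as a power series has no monomials of low
degree, and so is small at every point where the variables take values in the maximal ideal. -/
theorem le_order_of_mem_pow {k σ : Type*} [Field k] (N : ℕ) (f : MvPowerSeries σ k)
    (hf : f ∈ (Ideal.span (Set.range MvPowerSeries.X) : Ideal (MvPowerSeries σ k)) ^ N) :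
    (N : ℕ∞) ≤ f.order := by
  have hadd : ∀ (M : ℕ) (a b : MvPowerSeries σ k), (M : ℕ∞) ≤ a.order → (M : ℕ∞) ≤ b.order →
      (M : ℕ∞) ≤ (a + b).order := fun M a b ha hb =>
    (le_min ha hb).trans MvPowerSeries.min_order_le_add
  induction N generalizing f with
  | zero => simp
  | succ N ih =>
    rw [pow_succ] at hf
    refine Submodule.mul_induction_on hf (fun a ha b hb => ?_) (hadd _)
    have hb1 : 1 ≤ b.order := by
      rw [MvPowerSeries.one_le_order_iff_constCoeff_eq_zero]
      have : Ideal.span (Set.range MvPowerSeries.X) ≤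
          RingHom.ker (MvPowerSeries.constantCoeff (σ := σ) (R := k)) := by
        rw [Ideal.span_le]
        rintro _ ⟨i, rfl⟩
        simp
      exact this hb
    calc ((N + 1 : ℕ) : ℕ∞) = N + 1 := by push_cast; rfl
      _ ≤ a.order + b.order := add_le_add (ih a ha) hb1
      _ ≤ _ := MvPowerSeries.le_order_mul

/-- A smooth local algebra with residue field `k` over the field `k` is a domain: it embeds into a
ring of formal power series. -/
theorem isDomain_of_formallySmooth {k O : Type*} [Field k] [CommRing O] [IsLocalRing O]
    [IsNoetherianRing O] [Algebra k O] [Algebra.FormallySmooth k O] [Module.Finite O Ω[O⁄k]]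
    (hk : Function.Bijective (algebraMap k (ResidueField O))) : IsDomain O := by
  let e : k ≃ₐ[k] ResidueField O := AlgEquiv.ofBijective (Algebra.ofId _ _) hk
  have : Algebra.FormallySmooth k (ResidueField O) := .of_equiv e
  obtain ⟨σ, b, _⟩ : ∃ (σ : Type) (_ : Module.Basis σ (ResidueField O) (CotangentSpace O)),
      Nonempty (Fintype σ) := ⟨_, Module.finBasis (ResidueField O) (CotangentSpace O),
          ⟨inferInstance⟩⟩
  obtain ⟨_⟩ := ‹Nonempty (Fintype σ)›
  choose z hz using fun i => (maximalIdeal O).toCotangent_surjective (b i)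
  have hli : LinearIndependent (ResidueField O) fun i => (maximalIdeal O).toCotangent (z i) := by
    simp only [hz]; exact b.linearIndependent
  have hspan : Ideal.span (Set.range fun i => (z i : O)) = maximalIdeal O := by
    have h1 : Submodule.span O (Set.range z) = ⊤ := by
      rw [← CotangentSpace.span_image_eq_top_iff, ← Set.range_comp]
      have : (maximalIdeal O).toCotangent ∘ z = b := funext hz
      rw [this, b.span_eq]
    have h2 := congrArg (Submodule.map (maximalIdeal O).subtype) h1
    rw [Submodule.map_span, ← Set.range_comp, Submodule.map_top, Submodule.range_subtype] at h2
    exact h2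
  let alg : Algebra (MvPolynomial σ k) O := (MvPolynomial.aeval fun i => (z i : O)).toAlgebra
  have hX : ∀ i, algebraMap (MvPolynomial σ k) O (.X i) = z i := fun i =>
    MvPolynomial.aeval_X _ i
  have : IsScalarTower k (MvPolynomial σ k) O := .of_algebraMap_eq fun a =>
    ((MvPolynomial.aeval fun i => (z i : O)).commutes a).symm
  have := formallySmooth_mvPolynomial (k := k) z hli hX
  let 𝔖 := MvPowerSeries σ k
  let I : Ideal 𝔖 := Ideal.span (Set.range MvPowerSeries.X)
  -- The reduction map, with target `𝔖 ⧸ I = k`. Since `𝔖` is `I`-adically complete, formal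
  -- smoothness over the polynomial ring lifts it to `g : O → 𝔖` with `g (z i)` the `i`-th variable.
  let f₀ : O →+* 𝔖 ⧸ I := (Ideal.Quotient.mk I).comp ((MvPowerSeries.C (σ := σ) (R := k)).comp
    ((e.symm : ResidueField O →+* k).comp (residue O)))
  have hf₀ : ∀ p : MvPolynomial σ k, f₀ (algebraMap _ O p) = algebraMap _ (𝔖 ⧸ I) p := by
    intro p
    suffices f₀.comp (algebraMap _ O) = algebraMap (MvPolynomial σ k) (𝔖 ⧸ I) from
      RingHom.congr_fun this p
    apply MvPolynomial.ringHom_ext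
    · intro r
      have h1 : algebraMap (MvPolynomial σ k) O (.C r) = algebraMap k O r :=
        (IsScalarTower.algebraMap_apply k (MvPolynomial σ k) O r).symm
      have h2 : residue O (algebraMap k O r) = e r := rfl
      rw [RingHom.comp_apply, h1]
      simp only [f₀, RingHom.comp_apply, h2, RingHom.coe_coe, AlgEquiv.symm_apply_apply]
      rw [IsScalarTower.algebraMap_apply (MvPolynomial σ k) 𝔖 (𝔖 ⧸ I)]
      congr 1
      simp [𝔖, MvPowerSeries.algebraMap_apply']
    · intro i
      rw [RingHom.comp_apply, hX, IsScalarTower.algebraMap_apply (MvPolynomial σ k) 𝔖 (𝔖 ⧸ I)]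
      have h1 : residue O (z i : O) = 0 := (residue_eq_zero_iff _).2 (z i).2
      simp only [f₀, RingHom.comp_apply, h1, map_zero]
      symm
      rw [Ideal.Quotient.algebraMap_eq, Ideal.Quotient.eq_zero_iff_mem]
      refine Ideal.subset_span ⟨i, ?_⟩
      simp [𝔖, MvPowerSeries.algebraMap_apply']
  let f : O →ₐ[MvPolynomial σ k] 𝔖 ⧸ I := { f₀ with commutes' := hf₀ }
  obtain ⟨g, hg⟩ := Algebra.FormallySmooth.exists_mkₐ_comp_eq_of_isAdicComplete
    (R := MvPolynomial σ k) (S := 𝔖) (I := I) f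
  have hgm : (maximalIdeal O) ≤ I.comap g := by
    intro a ha
    rw [Ideal.mem_comap, ← Ideal.Quotient.eq_zero_iff_mem]
    have := AlgHom.congr_fun hg a
    simp only [AlgHom.comp_apply, Ideal.Quotient.mkₐ_eq_mk] at this
    rw [this]
    change f₀ a = 0
    simp only [f₀, RingHom.comp_apply, (residue_eq_zero_iff _).2 ha, map_zero]
  -- Modulo any power of the maximal ideal, every element is a polynomial in the `z i`: they
  -- generate the maximal ideal, and the residue field is `k`.
  have happrox : ∀ (N : ℕ) (a : O), ∃ p : MvPolynomial σ k,
      a - algebraMap _ O p ∈ maximalIdeal O ^ N := by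
    intro N
    induction N with
    | zero => intro a; exact ⟨0, by simp⟩
    | succ N ih =>
      intro a
      obtain ⟨c, hc⟩ := e.surjective (residue O a)
      have hm : a - algebraMap k O c ∈ maximalIdeal O := by
        rw [← residue_eq_zero_iff, map_sub, ← hc]
        exact sub_self _
      rw [← hspan, Ideal.mem_span_range_iff_exists_fun] at hm
      obtain ⟨u, hu⟩ := hm
      choose q hq using fun i => ih (u i)
      refine ⟨.C c + ∑ i, q i * .X i, ?_⟩
      have h1 : algebraMap (MvPolynomial σ k) O (.C c) = algebraMap k O c :=
        (IsScalarTower.algebraMap_apply k (MvPolynomial σ k) O c).symm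
      have : a - algebraMap _ O (MvPolynomial.C c + ∑ i, q i * .X i) =
          ∑ i, (u i - algebraMap _ O (q i)) * z i := by
        simp only [map_add, map_sum, map_mul, hX, h1, sub_mul, Finset.sum_sub_distrib, hu]
        ring
      rw [this, pow_succ]
      exact Ideal.sum_mem _ fun i _ => Ideal.mul_mem_mul (hq i) (z i).2
  -- If `g a = 0`, then a polynomial approximating `a` modulo `𝔪 ^ N` has order at least `N`, so `a
  -- ∈ 𝔪 ^ N`. Krull's intersection theorem gives `a = 0`.
  have hinj : Function.Injective g := by
    rw [injective_iff_map_eq_zero]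
    intro a ha
    have : a ∈ ⨅ N : ℕ, maximalIdeal O ^ N := by
      rw [Ideal.mem_iInf]
      intro N
      obtain ⟨p, hp⟩ := happrox N a
      have h1 : g (a - algebraMap _ O p) ∈ I ^ N :=
        (Ideal.pow_right_mono hgm N).trans (Ideal.le_comap_pow g N) hp
      rw [map_sub, ha, zero_sub, AlgHom.commutes, neg_mem_iff] at h1
      have h2 := le_order_of_mem_pow N _ h1
      have h3 : p ∈ MvPolynomial.idealOfVars σ k ^ N := by
        rw [MvPolynomial.mem_pow_idealOfVars_iff']
        intro d hd
        have := MvPowerSeries.coeff_of_lt_order (lt_of_lt_of_le (Nat.cast_lt.2 hd) h2)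
        simpa [𝔖, MvPowerSeries.algebraMap_apply'] using this
      have h4 : MvPolynomial.idealOfVars σ k ≤ (maximalIdeal O).comap (algebraMap _ O) := by
        rw [MvPolynomial.idealOfVars, Ideal.span_le]
        rintro _ ⟨i, rfl⟩
        rw [SetLike.mem_coe, Ideal.mem_comap, hX]
        exact (z i).2
      have h5 : algebraMap _ O p ∈ maximalIdeal O ^ N :=
        (Ideal.pow_right_mono h4 N).trans (Ideal.le_comap_pow _ N) h3
      simpa using add_mem hp h5
    rwa [Ideal.iInf_pow_eq_bot_of_isLocalRing _ (Ideal.IsPrime.ne_top'), Ideal.mem_bot] at this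
  have : IsDomain 𝔖 := NoZeroDivisors.to_isDomain (MvPowerSeries σ k)
  exact hinj.isDomain g.toRingHom

/-- If a localization of a Noetherian ring at a prime is a domain, then so is a localization away
from an element outside the prime. -/
theorem exists_isDomain_away {B : Type*} [CommRing B] [IsNoetherianRing B] (𝔭 : Ideal B)
    [𝔭.IsPrime] [IsDomain (Localization.AtPrime 𝔭)] :
    ∃ f ∉ 𝔭, ∀ g ∉ 𝔭, f ∣ g → IsDomain (Localization.Away g) := by
  classical
  obtain ⟨s, hs⟩ := (isNoetherian_def.1 ‹_›)
    (RingHom.ker (algebraMap B (Localization.AtPrime 𝔭)))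
  have : ∀ a ∈ s, ∃ c ∉ 𝔭, c * a = 0 := by
    intro a ha
    have : a ∈ RingHom.ker (algebraMap B (Localization.AtPrime 𝔭)) := hs ▸ Ideal.subset_span ha
    obtain ⟨c, hc⟩ := (IsLocalization.map_eq_zero_iff 𝔭.primeCompl _ a).1 this
    exact ⟨c, c.2, hc⟩
  choose! c hc hca using this
  -- The element is a product of annihilators of finitely many generators of the kernel of `B →
  -- B_𝔭`. Once it divides `g ∉ 𝔭`, inverting `g` kills this kernel, so the localization embeds into
  -- the domain `B_𝔭`.
  refine ⟨∏ a ∈ s, c a, ?_, fun g hg hdvd => ?_⟩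
  · intro h
    obtain ⟨a, ha, h⟩ := (Ideal.IsPrime.prod_mem_iff).1 h
    exact hc a ha h
  have hker : ∀ a ∈ RingHom.ker (algebraMap B (Localization.AtPrime 𝔭)), g * a = 0 := by
    intro a ha
    rw [← hs] at ha
    refine Submodule.span_induction (fun a ha => ?_) (by simp) (fun a b _ _ ha hb => ?_)
      (fun r a _ ha => ?_) ha
    · obtain ⟨v, rfl⟩ := hdvd
      rw [← Finset.mul_prod_erase _ _ (show a ∈ s from ha)]
      linear_combination (v * ∏ x ∈ s.erase a, c x) * hca a ha
    · rw [mul_add, ha, hb, add_zero]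
    · rw [smul_eq_mul, mul_left_comm, ha, mul_zero]
  have hu : ∀ y : Submonoid.powers g, IsUnit (algebraMap B (Localization.AtPrime 𝔭) y) := by
    rintro ⟨_, m, rfl⟩
    exact IsLocalization.map_units (M := 𝔭.primeCompl) _ ⟨g ^ m, fun h => hg
      (Ideal.IsPrime.mem_of_pow_mem inferInstance _ h)⟩
  have hinj : Function.Injective (IsLocalization.lift (S := Localization.Away g) hu) := by
    rw [IsLocalization.lift_injective_iff]
    intro a b
    refine ⟨fun h => ?_, fun h => ?_⟩
    · have := congrArg (IsLocalization.lift (S := Localization.Away g) hu) h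
      simpa only [IsLocalization.lift_eq] using this
    · have := hker (a - b) (by rw [RingHom.mem_ker, map_sub, h, sub_self])
      have h2 : algebraMap B (Localization.Away g) (g * (a - b)) = 0 := by rw [this, map_zero]
      rw [map_mul, (IsLocalization.Away.algebraMap_isUnit g).mul_right_eq_zero, map_sub,
        sub_eq_zero] at h2
      exact h2
  exact hinj.isDomain _

end CommutativeAlgebra

end ExpDeg

end

/-! ### The coordinate rings of the charts -/

noncomputable section

namespace ExpDeg

section ChartRing

open TensorProduct

/-- The values `tᵢ` and `c = (xⱼ, yⱼ)` of the coordinates of the `j`-th chart of an expanded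
degeneration over a point with coordinates `x * y = t`. The coordinates not in `σ` equal `1`. -/
structure IsChartValue {B : Type*} [CommRing B] (σ : Set (Fin 2)) (v : Fin 2 → B) (n j : ℕ)
    (t : ℕ → B) (c : Fin 2 → B) : Prop where
  mul : t j = c 0 * c 1
  fst : v 0 = c 0 * ∏ i ∈ Finset.Icc (j + 1) (n + 1), t i
  snd : v 1 = c 1 * ∏ i ∈ Finset.Ico 1 j, t i
  one : ∀ i ∉ σ, c i = 1

/-- The free coordinates of the `j`-th chart. -/
abbrev ChartVar (σ : Set (Fin 2)) (n j : ℕ) : Type :=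
  σ ⊕ {i : ℕ // i ∈ Finset.Icc 1 (n + 1) ∧ i ≠ j}

/-- The functions `x, y` on `Spec A` are smooth coordinates of type `σ`. -/
structure IsCoord (k : Type*) [Field k] {A : Type*} [CommRing A] [Algebra k A] (σ : Set (Fin 2))
    (v : Fin 2 → A) : Prop where
  smooth : (MvPolynomial.aeval (R := k) fun i : σ => v i).toRingHom.Smooth
  one : ∀ i ∉ σ, v i = 1
  nonempty : σ.Nonempty

/-- The index `j` is the index of a chart over coordinates of type `σ`. -/
structure IsChartIndex (σ : Set (Fin 2)) (n j : ℕ) : Prop where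
  one_le : 1 ≤ j
  le : j ≤ n + 1
  fst : 0 ∉ σ → j = n + 1
  snd : 1 ∉ σ → j = 1

/-- The coordinate ring of the `j`-th chart of an expanded degeneration over `Spec A`. -/
structure ChartRing (k : Type u) [Field k] {A : Type u} [CommRing A] [Algebra k A]
    (σ : Set (Fin 2)) (v : Fin 2 → A) (n j : ℕ) where
  /-- the ring -/
  R : Type u
  [ring : CommRing R]
  /-- the structure map -/
  α : A →+* R
  /-- the coordinates `tᵢ` -/
  t : ℕ → R
  /-- the coordinates `xⱼ` and `yⱼ` -/
  c : Fin 2 → R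
  isValue : IsChartValue σ (fun i => α (v i)) n j t c
  exists_lift : ∀ {B : Type u} [CommRing B] (f : A →+* B) (t' : ℕ → B) (c' : Fin 2 → B),
    IsChartValue σ (fun i => f (v i)) n j t' c' →
      ∃ h : R →+* B, h.comp α = f ∧ (∀ i ∈ Finset.Icc 1 (n + 1), h (t i) = t' i) ∧
        ∀ i, h (c i) = c' i
  hom_ext : ∀ {B : Type u} [CommRing B] (h h' : R →+* B), h.comp α = h'.comp α →
    (∀ i ∈ Finset.Icc 1 (n + 1), i ≠ j → h (t i) = h' (t i)) → (∀ i, h (c i) = h' (c i)) → h = h'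
  /-- the free coordinates -/
  β : MvPolynomial (ChartVar σ n j) k →+* R
  β_C : ∀ a, β (.C a) = α (algebraMap k A a)
  β_inl : ∀ i, β (.X (.inl i)) = c i
  β_inr : ∀ i, β (.X (.inr i)) = t i
  smooth : β.Smooth

attribute [instance] ChartRing.ring

open Classical in
-- The chart is a base change of its toric model. Let `Λ` be the polynomial ring in the coordinates
-- of type `σ`, and `S` the polynomial ring in `ChartVar σ n j`. Sending `x` to `x_j t_{j+1} ⋯
-- t_{n+1}` and `y` to `y_j t_1 ⋯ t_{j-1}` makes `S` a `Λ`-algebra. In `S ⊗[Λ] A` the universal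
-- property is that of the tensor product, and smoothness over `S` is inherited from that of `A`
-- over `Λ`.
theorem nonempty_chartRing {k : Type u} [Field k] {A : Type u} [CommRing A] [Algebra k A]
    {σ : Set (Fin 2)} {v : Fin 2 → A} (hv : IsCoord k σ v) {n j : ℕ} (hj : IsChartIndex σ n j) :
    Nonempty (ChartRing k σ v n j) := by
  let Λ := MvPolynomial σ k
  let S := MvPolynomial (ChartVar σ n j) k
  let cS : Fin 2 → S := fun i => if h : i ∈ σ then .X (.inl ⟨i, h⟩) else 1
  let tS : ℕ → S := fun i => if i = j then cS 0 * cS 1 else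
    if h : i ∈ Finset.Icc 1 (n + 1) ∧ i ≠ j then .X (.inr ⟨i, h⟩) else 1
  let vS : Fin 2 → S := ![cS 0 * ∏ i ∈ Finset.Icc (j + 1) (n + 1), tS i,
    cS 1 * ∏ i ∈ Finset.Ico 1 j, tS i]
  have hvS0 : vS 0 = cS 0 * ∏ i ∈ Finset.Icc (j + 1) (n + 1), tS i := rfl
  have hvS1 : vS 1 = cS 1 * ∏ i ∈ Finset.Ico 1 j, tS i := rfl
  -- If `x = 1`, then `j = n + 1` by `IsChartIndex`, and the product following `x_j = 1` is empty.
  -- Likewise `j = 1` if `y = 1`.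
  have hvS : ∀ i ∉ σ, vS i = 1 := by
    intro i hi
    match i with
    | 0 => simp [hvS0, cS, hi, hj.fst hi]
    | 1 => simp [hvS1, cS, hi, hj.snd hi]
  let _ : Algebra Λ A := (MvPolynomial.aeval (R := k) fun i : σ => v i).toAlgebra
  let _ : Algebra Λ S := (MvPolynomial.aeval (R := k) fun i : σ => vS i).toAlgebra
  have : Algebra.Smooth Λ A := hv.smooth
  have hΛA : ∀ i, algebraMap Λ A (.X i) = v i := fun i => MvPolynomial.aeval_X _ i
  have hΛS : ∀ i, algebraMap Λ S (.X i) = vS i := fun i => MvPolynomial.aeval_X _ i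
  have hΛA' : ∀ a, algebraMap Λ A (.C a) = algebraMap k A a := fun a =>
    (MvPolynomial.aeval fun i : σ => v i).commutes a
  have hΛS' : ∀ a, algebraMap Λ S (.C a) = .C a := fun a =>
    (MvPolynomial.aeval fun i : σ => vS i).commutes a
  let iS : S →+* S ⊗[Λ] A := algebraMap S (S ⊗[Λ] A)
  let iA : A →+* S ⊗[Λ] A := (Algebra.TensorProduct.includeRight (R := Λ) (A := S)).toRingHom
  have hcomm : ∀ p, iA (algebraMap Λ A p) = iS (algebraMap Λ S p) := fun p => by
    have h1 := (Algebra.TensorProduct.includeRight (R := Λ) (A := S) (B := A)).commutes p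
    have h2 := (Algebra.TensorProduct.includeLeft (R := Λ) (S := Λ) (A := S) (B := A)).commutes p
    exact h1.trans h2.symm
  have hv' : ∀ i, iA (v i) = iS (vS i) := by
    intro i
    by_cases hi : i ∈ σ
    · rw [← hΛA ⟨i, hi⟩, ← hΛS ⟨i, hi⟩, hcomm]
    · rw [hv.one i hi, hvS i hi, map_one, map_one]
  have hval : IsChartValue σ (fun i => iA (v i)) n j (fun i => iS (tS i)) (fun i => iS (cS i)) := by
    refine ⟨?_, ?_, ?_, fun i hi => ?_⟩
    · simp only [tS, if_true, map_mul]
    · simp only [hv', hvS0, map_mul, map_prod]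
    · simp only [hv', hvS1, map_mul, map_prod]
    · simp only [cS, hi, dif_neg, not_false_iff, map_one]
  have htS : ∀ i (hi : i ∈ Finset.Icc 1 (n + 1) ∧ i ≠ j), tS i = .X (.inr ⟨i, hi⟩) := by
    intro i hi
    simp only [tS, hi.2, if_false, hi]
    simp [hi.2]
  have hcS : ∀ i (hi : i ∈ σ), cS i = .X (.inl ⟨i, hi⟩) := by
    intro i hi
    simp only [cS, hi, dif_pos]
  refine ⟨{
    R := S ⊗[Λ] A
    α := iA
    t := fun i => iS (tS i)
    c := fun i => iS (cS i)
    isValue := hval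
    exists_lift := ?_
    hom_ext := ?_
    β := iS
    β_C := fun a => ?_
    β_inl := fun i => ?_
    β_inr := fun i => ?_
    smooth := ?_ }⟩
  · intro B _ f t' c' h
    let g : S →+* B := MvPolynomial.eval₂Hom (f.comp (algebraMap k A))
      (Sum.elim (fun i => c' i) fun i => t' i)
    have hgc : ∀ i, g (cS i) = c' i := by
      intro i
      by_cases hi : i ∈ σ
      · rw [hcS i hi]; exact MvPolynomial.eval₂Hom_X' _ _ _
      · rw [h.one i hi]; simp only [cS, hi, dif_neg, not_false_iff, map_one]
    have hgt : ∀ i ∈ Finset.Icc 1 (n + 1), g (tS i) = t' i := by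
      intro i hi
      by_cases hij : i = j
      · subst hij
        rw [h.mul, ← hgc, ← hgc, ← map_mul]
        simp only [tS, if_true]
      · rw [htS i ⟨hi, hij⟩]; exact MvPolynomial.eval₂Hom_X' _ _ _
    have hgv : ∀ i, g (vS i) = f (v i) := by
      intro i
      match i with
      | 0 =>
        have := h.fst
        rw [this]
        simp only [hvS0, map_mul, map_prod, hgc]
        congr 1
        refine Finset.prod_congr rfl fun i hi => hgt i ?_
        simp only [Finset.mem_Icc] at hi ⊢
        omega
      | 1 =>
        have := h.snd
        rw [this]
        simp only [hvS1, map_mul, map_prod, hgc]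
        congr 1
        refine Finset.prod_congr rfl fun i hi => hgt i ?_
        have := hj.le
        simp only [Finset.mem_Icc, Finset.mem_Ico] at hi ⊢
        omega
    let _ : Algebra Λ B := (f.comp (algebraMap Λ A)).toAlgebra
    let fA : A →ₐ[Λ] B := { f with commutes' := fun _ => rfl }
    have hg : ∀ p, g (algebraMap Λ S p) = algebraMap Λ B p := by
      intro p
      suffices g.comp (algebraMap Λ S) = f.comp (algebraMap Λ A) from RingHom.congr_fun this p
      apply MvPolynomial.ringHom_ext
      · intro a
        rw [RingHom.comp_apply, RingHom.comp_apply, hΛA', hΛS']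
        exact MvPolynomial.eval₂Hom_C _ _ _
      · intro i
        rw [RingHom.comp_apply, RingHom.comp_apply, hΛA, hΛS, hgv]
    let gS : S →ₐ[Λ] B := { g with commutes' := hg }
    have hl : ∀ s, Algebra.TensorProduct.productMap gS fA (iS s) = g s := fun s =>
      Algebra.TensorProduct.productMap_left_apply gS fA s
    refine ⟨(Algebra.TensorProduct.productMap gS fA).toRingHom, ?_, fun i hi => ?_, fun i => ?_⟩
    · ext a
      exact Algebra.TensorProduct.productMap_right_apply gS fA a
    · exact (hl _).trans (hgt i hi)
    · exact (hl _).trans (hgc i)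
  · intro B _ h h' h1 h2 h3
    have hS : h.comp iS = h'.comp iS := by
      apply MvPolynomial.ringHom_ext
      · intro a
        have : iS (.C a) = iA (algebraMap k A a) := by rw [← hΛA', hcomm, hΛS']
        simp only [RingHom.comp_apply, this]
        exact RingHom.congr_fun h1 _
      · rintro (i | i)
        · have := h3 i
          rwa [hcS i i.2] at this
        · have := h2 i i.2.1 i.2.2
          rwa [htS i i.2] at this
    refine RingHom.ext fun x => ?_
    induction x using TensorProduct.induction_on with
    | zero => simp
    | add x y hx hy => rw [map_add, map_add, hx, hy]
    | tmul s a =>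
      have : s ⊗ₜ[Λ] a = iS s * iA a := by
        change _ = (s ⊗ₜ[Λ] (1 : A)) * ((1 : S) ⊗ₜ[Λ] a)
        rw [Algebra.TensorProduct.tmul_mul_tmul, mul_one, one_mul]
      rw [this, map_mul, map_mul]
      congr 1
      · exact RingHom.congr_fun hS s
      · exact RingHom.congr_fun h1 a
  · rw [← hΛA', hcomm, hΛS']
  · rw [hcS i i.2]
  · rw [htS i i.2]
  · exact (RingHom.smooth_algebraMap (R := S) (S := S ⊗[Λ] A)).2 inferInstance

end ChartRing

end ExpDeg

end

/-! ### Ideal sheaves: pullback, stalks, invertibility -/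

noncomputable section

namespace ExpDeg

section Sheaves

variable {X Y Z : Scheme.{u}}

theorem ideal_comap_top [IsAffine X] [IsAffine Y] (f : X ⟶ Y) (J : Y.IdealSheafData) :
    (J.comap f).ideal ⟨⊤, isAffineOpen_top X⟩ =
      (J.ideal ⟨⊤, isAffineOpen_top Y⟩).map f.appTop.hom := by
  apply le_antisymm
  · have key : J.comap f ≤ Scheme.IdealSheafData.ofIdealTop
        ((J.ideal ⟨⊤, isAffineOpen_top Y⟩).map f.appTop.hom) := by
      rw [← Scheme.IdealSheafData.le_map_iff_comap_le]
      apply Scheme.IdealSheafData.le_of_isAffine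
      rw [Scheme.IdealSheafData.ideal_map_of_isAffineHom, ← Ideal.map_le_iff_le_comap]
      have h1 : X.presheaf.map (homOfLE (le_refl (⊤ : X.Opens))).op = 𝟙 _ := X.presheaf.map_id _
      change _ ≤ Ideal.map (X.presheaf.map (homOfLE le_top).op).hom _
      erw [h1]
      erw [Ideal.map_id]
      exact le_rfl
    refine (key _).trans ?_
    have h1 : X.presheaf.map (homOfLE (le_refl (⊤ : X.Opens))).op = 𝟙 _ := X.presheaf.map_id _
    change Ideal.map (X.presheaf.map (homOfLE le_top).op).hom _ ≤ _
    erw [h1]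
    erw [Ideal.map_id]
  · have := Scheme.IdealSheafData.le_map_comap J f ⟨⊤, isAffineOpen_top Y⟩
    rw [Scheme.IdealSheafData.ideal_map_of_isAffineHom, ← Ideal.map_le_iff_le_comap] at this
    exact this

theorem ideal_comap_of_image_eq (f : X ⟶ Y) [IsOpenImmersion f] (J : Y.IdealSheafData)
    (V : X.affineOpens) (W : Y.affineOpens) (h : f ''ᵁ V.1 = W.1) :
    (J.comap f).ideal V =
      (J.ideal W).map (f.appLE W.1 V.1 (by rw [← h, f.preimage_image_eq])).hom := by
  obtain ⟨W, hW⟩ := W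
  dsimp only at h
  subst h
  rw [Scheme.IdealSheafData.ideal_comap_of_isOpenImmersion]
  have h1 : f.appLE (f ''ᵁ V.1) V.1 (by rw [f.preimage_image_eq]) = (f.appIso V.1).hom :=
    (f.appIso_hom' V.1).symm
  dsimp only
  rw [h1]
  exact (Ideal.map_comap_of_equiv ((f.appIso V.1).commRingCatIsoToRingEquiv)).symm

/-- The inverse image of an ideal sheaf is generated by the pullbacks of its sections. -/
theorem ideal_comap (f : X ⟶ Y) (J : Y.IdealSheafData) (U : Y.affineOpens) (V : X.affineOpens)
    (h : V.1 ≤ f ⁻¹ᵁ U.1) :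
    (J.comap f).ideal V = (J.ideal U).map (f.appLE U.1 V.1 h).hom := by
  have : IsAffine U.1 := U.2
  have : IsAffine V.1 := V.2
  have h1 := ideal_comap_of_image_eq U.1.ι J ⟨⊤, isAffineOpen_top _⟩ U (by simp)
  have h2 := ideal_comap_of_image_eq V.1.ι (J.comap f) ⟨⊤, isAffineOpen_top _⟩ V (by simp)
  have h3 := ideal_comap_top (f.resLE U.1 V.1 h) (J.comap U.1.ι)
  rw [← Scheme.IdealSheafData.comap_comp, Scheme.Hom.resLE_comp_ι,
    Scheme.IdealSheafData.comap_comp, h2, h1, Ideal.map_map] at h3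
  have h4 : (V.1.ι.appLE V.1 ⊤ (by simp)) = V.1.topIso.inv := by
    rw [Scheme.Opens.ι_appLE]; rfl
  have h5 : (U.1.ι.appLE U.1 ⊤ (by simp)) = U.1.topIso.inv := by
    rw [Scheme.Opens.ι_appLE]; rfl
  rw [h4, h5] at h3
  have h6 := congrArg (Ideal.map V.1.topIso.hom.hom) h3
  rw [Ideal.map_map, Ideal.map_map, ← CommRingCat.hom_comp, ← CommRingCat.hom_comp,
    ← CommRingCat.hom_comp, Iso.inv_hom_id, Scheme.Hom.appTop, Scheme.Hom.resLE_app_top] at h6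
  simp only [Category.assoc, Iso.inv_hom_id, Iso.inv_hom_id_assoc, Category.comp_id] at h6
  rw [← h6]
  exact (Ideal.map_id _).symm

/-- The germ of a global function. -/
def toStalk (x : X) : Γ(X, ⊤) →+* X.presheaf.stalk x := (X.presheaf.germ ⊤ x trivial).hom

theorem germ_res_top (U : X.Opens) (x : X) (hx : x ∈ U) (f : Γ(X, ⊤)) :
    X.presheaf.germ U x hx (X.presheaf.map (homOfLE le_top).op f) = toStalk x f :=
  TopCat.Presheaf.germ_res_apply X.presheaf (homOfLE le_top) x hx f

theorem stalkMap_toStalk (f : X ⟶ Y) (x : X) (a : Γ(Y, ⊤)) :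
    (f.stalkMap x).hom (toStalk (f x) a) = toStalk x (f.appTop a) :=
  f.germ_stalkMap_apply ⊤ x trivial a

theorem germ_appLE (f : X ⟶ Y) (U : Y.Opens) (V : X.Opens) (h : V ≤ f ⁻¹ᵁ U) (x : X) (hx : x ∈ V)
    (a : Γ(Y, U)) :
    X.presheaf.germ V x hx (f.appLE U V h a) =
      (f.stalkMap x).hom (Y.presheaf.germ U (f x) (h hx) a) := by
  refine Eq.trans ?_ (f.germ_stalkMap_apply U x (h hx) a).symm
  exact TopCat.Presheaf.germ_res_apply X.presheaf (homOfLE h) x hx _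

theorem vanishesAt_iff {f : Γ(X, ⊤)} {x : X} :
    VanishesAt f x ↔ toStalk x f ∈ IsLocalRing.maximalIdeal (X.presheaf.stalk x) := by
  rw [VanishesAt, Scheme.mem_basicOpen_top, IsLocalRing.mem_maximalIdeal, mem_nonunits_iff]
  rfl

/-- Any two affine neighbourhoods of `x` contain a common smaller one, so a single neighbourhood
generates the ideal defined through all of them. -/
theorem stalkIdeal_eq_map (J : X.IdealSheafData) (U : X.affineOpens) (x : X) (hx : x ∈ U.1) :
    stalkIdeal J x = (J.ideal U).map (X.presheaf.germ U.1 x hx).hom := by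
  apply le_antisymm
  · refine Ideal.span_le.2 ?_
    rintro _ ⟨V, hV, f, hf, rfl⟩
    obtain ⟨W, hW, hxW, hWUV⟩ := exists_isAffineOpen_mem_and_subset (U := U.1 ⊓ V.1) ⟨hx, hV⟩
    have hWU : (⟨W, hW⟩ : X.affineOpens) ≤ U := fun _ h => (hWUV h).1
    have hWV : (⟨W, hW⟩ : X.affineOpens) ≤ V := fun _ h => (hWUV h).2
    have h1 : X.presheaf.map (homOfLE hWV).op f ∈ J.ideal ⟨W, hW⟩ := by
      rw [← J.map_ideal hWV]
      exact Ideal.mem_map_of_mem _ hf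
    rw [← J.map_ideal hWU] at h1
    have h2 := Ideal.mem_map_of_mem (X.presheaf.germ W x hxW).hom h1
    rw [Ideal.map_map, ← CommRingCat.hom_comp] at h2
    erw [TopCat.Presheaf.germ_res] at h2
    have h3 : X.presheaf.germ W x hxW (X.presheaf.map (homOfLE hWV).op f) =
      X.presheaf.germ V.1 x hV f := TopCat.Presheaf.germ_res_apply X.presheaf (homOfLE hWV) x hxW f
    rw [← h3]
    exact h2
  · rw [Ideal.map_le_iff_le_comap]
    intro f hf
    exact Ideal.subset_span ⟨U, hx, f, hf, rfl⟩

theorem exists_affineOpen (x : X) {W : X.Opens} (hx : x ∈ W) :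
    ∃ U : X.affineOpens, x ∈ U.1 ∧ U.1 ≤ W := by
  obtain ⟨W, hW, hxW, h⟩ := exists_isAffineOpen_mem_and_subset hx
  exact ⟨⟨W, hW⟩, hxW, h⟩

theorem stalkIdeal_comap (f : X ⟶ Y) (J : Y.IdealSheafData) (x : X) :
    stalkIdeal (J.comap f) x = (stalkIdeal J (f x)).map (f.stalkMap x).hom := by
  obtain ⟨U, hU, -⟩ := exists_affineOpen (f x) (W := ⊤) trivial
  obtain ⟨V, hV, hVU⟩ := exists_affineOpen x (W := f ⁻¹ᵁ U.1) hU
  rw [stalkIdeal_eq_map _ V x hV, stalkIdeal_eq_map _ U _ hU, ideal_comap f J U V hVU,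
    Ideal.map_map, Ideal.map_map]
  congr 1
  ext a
  exact germ_appLE f U.1 V.1 hVU x hV a

theorem stalkIdeal_ofIdealTop (I : Ideal Γ(X, ⊤)) (x : X) :
    stalkIdeal (Scheme.IdealSheafData.ofIdealTop I) x = I.map (toStalk x) := by
  obtain ⟨U, hU, -⟩ := exists_affineOpen x (W := ⊤) trivial
  rw [stalkIdeal_eq_map _ U x hU, Scheme.IdealSheafData.ofIdealTop_ideal, Ideal.map_map]
  congr 1
  ext a
  exact germ_res_top _ _ _ _

theorem stalkIdeal_sup (I J : X.IdealSheafData) (x : X) :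
    stalkIdeal (I ⊔ J) x = stalkIdeal I x ⊔ stalkIdeal J x := by
  obtain ⟨U, hU, -⟩ := exists_affineOpen x (W := ⊤) trivial
  simp only [stalkIdeal_eq_map _ U x hU]
  exact Ideal.map_sup _ _ _

theorem stalkIdeal_mul (I J : X.IdealSheafData) (x : X) :
    stalkIdeal (I * J) x = stalkIdeal I x * stalkIdeal J x := by
  obtain ⟨U, hU, -⟩ := exists_affineOpen x (W := ⊤) trivial
  simp only [stalkIdeal_eq_map _ U x hU]
  exact Ideal.map_mul (X.presheaf.germ U.1 x hU).hom _ _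

theorem stalkIdeal_one (x : X) : stalkIdeal (1 : X.IdealSheafData) x = 1 := by
  obtain ⟨U, hU, -⟩ := exists_affineOpen x (W := ⊤) trivial
  have h1 : (1 : X.IdealSheafData) = ⊤ := by simp
  rw [stalkIdeal_eq_map _ U x hU, h1]
  exact (Ideal.map_top (X.presheaf.germ U.1 x hU).hom).trans Ideal.one_eq_top.symm

theorem stalkIdeal_pow (I : X.IdealSheafData) (x : X) (m : ℕ) :
    stalkIdeal (I ^ m) x = stalkIdeal I x ^ m := by
  induction m with
  | zero => rw [pow_zero, pow_zero, stalkIdeal_one]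
  | succ m ih => rw [pow_succ, pow_succ, stalkIdeal_mul, ih]

theorem stalkIdeal_prod {ι : Type*} (s : Finset ι) (I : ι → X.IdealSheafData) (x : X) :
    stalkIdeal (∏ i ∈ s, I i) x = ∏ i ∈ s, stalkIdeal (I i) x := by
  classical
  induction s using Finset.induction_on with
  | empty => exact stalkIdeal_one x
  | insert i s hi ih => rw [Finset.prod_insert hi, Finset.prod_insert hi, stalkIdeal_mul, ih]

theorem mem_nonZeroDivisors_of_germ {U : X.Opens} {f : Γ(X, U)}
    (h : ∀ x (hx : x ∈ U), X.presheaf.germ U x hx f ∈ nonZeroDivisors (X.presheaf.stalk x)) :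
    f ∈ nonZeroDivisors Γ(X, U) := by
  rw [mem_nonZeroDivisors_iff_right]
  intro a ha
  refine TopCat.Presheaf.section_ext X.sheaf U _ _ fun x hx => ?_
  have h1 : X.presheaf.germ U x hx a * X.presheaf.germ U x hx f = 0 := by
    rw [← map_mul, ha, map_zero]
  exact ((mem_nonZeroDivisors_iff_right.1 (h x hx)) _ h1).trans (map_zero _).symm

theorem germ_mem_nonZeroDivisors (U : X.affineOpens) {f : Γ(X, U.1)}
    (h : f ∈ nonZeroDivisors Γ(X, U.1)) (x : X) (hx : x ∈ U.1) :
    X.presheaf.germ U.1 x hx f ∈ nonZeroDivisors (X.presheaf.stalk x) := by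
  let := X.presheaf.algebra_section_stalk ⟨x, hx⟩
  have := U.2.isLocalization_stalk ⟨x, hx⟩
  exact IsLocalization.map_nonZeroDivisors_le (U.2.primeIdealOf ⟨x, hx⟩).asIdeal.primeCompl
    (X.presheaf.stalk x) ⟨f, h, rfl⟩

theorem exists_stalkIdeal_eq_span {J : X.IdealSheafData} (h : IsInvertible J) (x : X) :
    ∃ f ∈ nonZeroDivisors (X.presheaf.stalk x), stalkIdeal J x = Ideal.span {f} := by
  obtain ⟨U, hx, f, hf, hJ⟩ := h x
  refine ⟨X.presheaf.germ U.1 x hx f, germ_mem_nonZeroDivisors U hf x hx, ?_⟩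
  rw [stalkIdeal_eq_map J U x hx, hJ, Ideal.map_span, Set.image_singleton]

/-- The pullback of a local generator always generates the pulled back ideal. Only its regularity
may fail, and this is a condition on stalks. -/
theorem IsInvertible.comap {J : Y.IdealSheafData} (h : IsInvertible J) (f : X ⟶ Y)
    (hf : ∀ x g, stalkIdeal J (f x) = Ideal.span {g} →
      (f.stalkMap x).hom g ∈ nonZeroDivisors (X.presheaf.stalk x)) : IsInvertible (J.comap f) := by
  intro x
  obtain ⟨U, hU, g, hg, hJ⟩ := h (f x)
  obtain ⟨V, hV, hVU⟩ := exists_affineOpen x (W := f ⁻¹ᵁ U.1) hU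
  refine ⟨V, hV, f.appLE U.1 V.1 hVU g, mem_nonZeroDivisors_of_germ fun y hy => ?_, ?_⟩
  · rw [germ_appLE]
    apply hf
    rw [stalkIdeal_eq_map J U _ (hVU hy), hJ, Ideal.map_span, Set.image_singleton]
  · rw [ideal_comap f J U V hVU, hJ, Ideal.map_span, Set.image_singleton]

theorem stalkMap_mem_nonZeroDivisors (f : X ⟶ Y) [Flat f] (x : X) {g : Y.presheaf.stalk (f x)}
    (hg : g ∈ nonZeroDivisors (Y.presheaf.stalk (f x))) :
    (f.stalkMap x).hom g ∈ nonZeroDivisors (X.presheaf.stalk x) := by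
  have hfl := Flat.stalkMap f x
  algebraize [(f.stalkMap x).hom]
  rw [mem_nonZeroDivisors_iff_right]
  intro a ha
  refine Module.Flat.isSMulRegular_of_nonZeroDivisors (M := X.presheaf.stalk x) hg ?_
  simp only [smul_zero]
  rw [Algebra.smul_def, mul_comm]
  exact ha

/-- A function that is everywhere locally a multiple of a locally regular function `b` is a
multiple of `b`. -/
theorem exists_eq_mul_of_germ {a b : Γ(X, ⊤)}
    (hb : ∀ x, toStalk x b ∈ nonZeroDivisors (X.presheaf.stalk x))
    (h : ∀ x, toStalk x b ∣ toStalk x a) : ∃ c, a = b * c := by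
  have key : ∀ x : X, ∃ (U : X.Opens) (_ : x ∈ U) (c : Γ(X, U)),
      X.presheaf.map (homOfLE le_top).op a = X.presheaf.map (homOfLE le_top).op b * c := by
    intro x
    obtain ⟨c, hc⟩ := h x
    obtain ⟨U, hxU, c, rfl⟩ := X.presheaf.exists_germ_eq c
    obtain ⟨V, hxV, i, j, e⟩ := X.presheaf.germ_eq (U := U) (V := U) x hxU hxU
      (X.presheaf.map (homOfLE le_top).op a) (X.presheaf.map (homOfLE le_top).op b * c) (by
        rw [map_mul]
        erw [germ_res_top, germ_res_top]
        exact hc)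
    refine ⟨V, hxV, X.presheaf.map i.op c, ?_⟩
    rw [map_mul] at e
    have e1 : ∀ d : Γ(X, ⊤), X.presheaf.map i.op (X.presheaf.map (homOfLE (le_top : U ≤ ⊤)).op d) =
        X.presheaf.map (homOfLE (le_top : V ≤ ⊤)).op d := by
      intro d
      rw [← CommRingCat.comp_apply, ← X.presheaf.map_comp]
      rfl
    have e2 : X.presheaf.map j.op = X.presheaf.map i.op :=
      congrArg (fun l : V ⟶ U => X.presheaf.map l.op) (Subsingleton.elim j i)
    rw [e2] at e
    exact (e1 a).symm.trans (e.trans (congrArg (· * _) (e1 b)))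
  choose U hxU c hc using key
  have germ_c : ∀ x y (hy : y ∈ U x), toStalk y a =
      toStalk y b * X.presheaf.germ (U x) y hy (c x) := by
    intro x y hy
    have := congrArg (X.presheaf.germ (U x) y hy) (hc x)
    rw [map_mul] at this
    erw [germ_res_top, germ_res_top] at this
    exact this
  -- The local quotients agree on overlaps because division by a regular element is unique; hence
  -- they glue.
  have hcompat : TopCat.Presheaf.IsCompatible X.sheaf.1 U c := by
    intro x y
    refine TopCat.Presheaf.section_ext X.sheaf _ _ _ fun z hz => ?_
    refine (TopCat.Presheaf.germ_res_apply X.presheaf _ z hz _).trans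
      (Eq.trans ?_ (TopCat.Presheaf.germ_res_apply X.presheaf _ z hz _).symm)
    have h1 := germ_c x z hz.1
    have h2 := germ_c y z hz.2
    exact mul_cancel_left_mem_nonZeroDivisors (hb z) |>.1 (h1.symm.trans h2)
  obtain ⟨d, hd, -⟩ := X.sheaf.existsUnique_gluing' U ⊤ (fun x => homOfLE le_top)
    (fun x _ => TopologicalSpace.Opens.mem_iSup.2 ⟨x, hxU x⟩) c hcompat
  refine ⟨d, TopCat.Presheaf.section_ext X.sheaf _ _ _ fun x hx => ?_⟩
  have h1 := germ_c x x (hxU x)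
  refine h1.trans (Eq.trans ?_ (map_mul _ _ _).symm)
  congr 1
  rw [← hd x]
  exact TopCat.Presheaf.germ_res_apply X.presheaf _ x (hxU x) _

end Sheaves

end ExpDeg

end

/-! ### The universal property of the expanded degenerations -/

noncomputable section

namespace ExpDeg

section Universal

variable {X Y Z : Scheme.{u}}

theorem idealSheaf_ext {I J : X.IdealSheafData} (h : ∀ x, stalkIdeal I x = stalkIdeal J x) :
    I = J := by
  ext1
  funext U
  rw [U.2.ideal_ext_iff]
  intro x hx
  rw [← stalkIdeal_eq_map I U x hx, ← stalkIdeal_eq_map J U x hx, h]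

theorem comap_ofIdealTop_span_singleton (f : X ⟶ Y) (a : Γ(Y, ⊤)) :
    (Scheme.IdealSheafData.ofIdealTop (Ideal.span {a})).comap f =
      Scheme.IdealSheafData.ofIdealTop (Ideal.span {f.appTop a}) := by
  refine idealSheaf_ext fun x => ?_
  rw [stalkIdeal_comap, stalkIdeal_ofIdealTop, stalkIdeal_ofIdealTop, Ideal.map_span,
    Ideal.map_span, Ideal.map_span, Set.image_singleton, Set.image_singleton, Set.image_singleton,
    stalkMap_toStalk]

theorem toStalk_mem_nonZeroDivisors_of_flat (f : X ⟶ Y) [Flat f] (a : Γ(Y, ⊤)) (x : X)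
    (h : toStalk (f x) a ∈ nonZeroDivisors (Y.presheaf.stalk (f x))) :
    toStalk x (f.appTop a) ∈ nonZeroDivisors (X.presheaf.stalk x) := by
  rw [← stalkMap_toStalk]
  exact stalkMap_mem_nonZeroDivisors f x h

theorem toLine_appTop_coord {S : Scheme.{u}} (q : Y ⟶ S) (f : Γ(Y, ⊤)) (i : PUnit.{u + 1}) :
    (toLine q f).appTop (AffineSpace.coord S i) = f :=
  AffineSpace.homOfVector_appTop_coord _ _ _

theorem comp_toLine {S : Scheme.{u}} (g : X ⟶ Y) (q : Y ⟶ S) (f : Γ(Y, ⊤)) :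
    g ≫ toLine q f = toLine (g ≫ q) (g.appTop f) :=
  AffineSpace.comp_homOfVector _ _ _

theorem toLine_comp_over {S : Scheme.{u}} (q : Y ⟶ S) (f : Γ(Y, ⊤)) :
    toLine q f ≫ (Line S ↘ S) = q :=
  AffineSpace.homOfVector_over _ _

/-- Setting one factor equal to `1` is a left inverse of this map, so the target is a torsion-free
module. The source is a principal ideal domain, over which torsion-free modules are flat. -/
theorem flat_mulPolynomial (k : Type u) [Field k] :
    (MvPolynomial.aeval (R := k) (fun _ : PUnit.{u + 1} =>
      (MvPolynomial.X (ULift.up 0) * MvPolynomial.X (ULift.up 1) :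
        MvPolynomial (ULift.{u} (Fin 2)) k))).toRingHom.Flat := by
  set f := MvPolynomial.aeval (R := k) (fun _ : PUnit.{u + 1} =>
      (MvPolynomial.X (ULift.up 0) * MvPolynomial.X (ULift.up 1) :
        MvPolynomial (ULift.{u} (Fin 2)) k))
  have : IsPrincipalIdealRing (MvPolynomial PUnit.{u + 1} k) :=
    IsPrincipalIdealRing.of_surjective
      (MvPolynomial.uniqueAlgEquiv k PUnit.{u + 1}).symm.toRingEquiv.toRingHom
      (MvPolynomial.uniqueAlgEquiv k PUnit.{u + 1}).symm.surjective
  have hinj : Function.Injective f := by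
    let g : MvPolynomial (ULift.{u} (Fin 2)) k →ₐ[k] MvPolynomial PUnit.{u + 1} k :=
      MvPolynomial.aeval fun i => ![MvPolynomial.X PUnit.unit, 1] i.down
    have : g.comp f = AlgHom.id k _ := by
      ext i
      simp [f, g]
    exact Function.LeftInverse.injective (g := g) fun p => AlgHom.congr_fun this p
  algebraize [f.toRingHom]
  have : Module.IsTorsionFree (MvPolynomial PUnit.{u + 1} k) (MvPolynomial (ULift.{u} (Fin 2)) k) :=
    Module.isTorsionFree_iff_algebraMap_injective.2 hinj
  change Module.Flat _ _
  infer_instance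

theorem mulMap_eq (k : Type u) [Field k] :
    mulMap (Spec (.of k)) = (AffineSpace.SpecIso _ (.of k)).hom ≫
      Spec.map (CommRingCat.ofHom (MvPolynomial.aeval (R := k) (fun _ : PUnit.{u + 1} =>
      (MvPolynomial.X (ULift.up 0) * MvPolynomial.X (ULift.up 1) :
        MvPolynomial (ULift.{u} (Fin 2)) k))).toRingHom) ≫ (AffineSpace.SpecIso _ (.of k)).inv := by
  rw [← Iso.inv_comp_eq]
  refine AffineSpace.hom_ext ?_ fun i => ?_
  · rw [mulMap, Category.assoc, toLine_comp_over, Category.assoc]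
    simp only [AffineSpace.SpecIso_inv_over]
    rw [← Spec.map_comp]
    congr 1
    ext a
    simp
  · rw [mulMap, Scheme.Hom.comp_appTop, CommRingCat.comp_apply, toLine_appTop_coord,
      Scheme.Hom.comp_appTop, CommRingCat.comp_apply, AffineSpace.SpecIso_inv_appTop_coord]
    have h := Scheme.ΓSpecIso_inv_naturality (CommRingCat.ofHom (MvPolynomial.aeval (R := k)
      (fun _ : PUnit.{u + 1} => (MvPolynomial.X (ULift.up 0) * MvPolynomial.X (ULift.up 1) :
        MvPolynomial (ULift.{u} (Fin 2)) k))).toRingHom)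
    refine Eq.trans ?_ (congrArg (fun l => l.hom (MvPolynomial.X i)) h)
    simp only [CommRingCat.hom_comp, RingHom.comp_apply, CommRingCat.hom_ofHom,
      AlgHom.toRingHom_eq_coe, RingHom.coe_coe, MvPolynomial.aeval_X, map_mul, planeCoord]
    erw [AffineSpace.SpecIso_inv_appTop_coord, AffineSpace.SpecIso_inv_appTop_coord]

instance flat_mulMap (k : Type u) [Field k] : Flat (mulMap (Spec (.of k))) := by
  rw [mulMap_eq]
  have : Flat (Spec.map (CommRingCat.ofHom (MvPolynomial.aeval (R := k) (fun _ : PUnit.{u + 1} =>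
      (MvPolynomial.X (ULift.up 0) * MvPolynomial.X (ULift.up 1) :
        MvPolynomial (ULift.{u} (Fin 2)) k))).toRingHom)) :=
    Flat.SpecMap_iff.2 (flat_mulPolynomial k)
  infer_instance

end Universal

section

variable {k : Type u} [Field k]

instance : IsIntegral (Line (Spec (.of k))) := inferInstance

theorem toStalk_coord_mem_nonZeroDivisors (x : Line (Spec (.of k))) :
    toStalk x (AffineSpace.coord (Spec (.of k)) PUnit.unit) ∈
      nonZeroDivisors ((Line (Spec (.of k))).presheaf.stalk x) := by
  rw [mem_nonZeroDivisors_iff_ne_zero]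
  intro h
  have h1 : AffineSpace.coord (Spec (.of k)) (PUnit.unit : PUnit.{u + 1}) = 0 := by
    have : Function.Injective ((Line (Spec (.of k))).presheaf.germ ⊤ x trivial) :=
      germ_injective_of_isIntegral _ _ _
    apply this
    rw [map_zero]
    exact h
  have h2 := AffineSpace.SpecIso_inv_appTop_coord (n := PUnit.{u + 1}) (.of k) PUnit.unit
  rw [h1, map_zero] at h2
  have h3 := (ConcreteCategory.bijective_of_isIso
    (Scheme.ΓSpecIso (.of (MvPolynomial PUnit.{u + 1} k))).inv).1 ((map_zero _).trans h2)
  exact MvPolynomial.X_ne_zero _ h3.symm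

/-- The parameter is the pullback of the coordinate of the affine line along `π` followed by an
étale map. Both are flat, and flat pullback preserves regular elements. -/
theorem Degeneration.toStalk_t_mem_nonZeroDivisors (𝒟 : Degeneration k) (x : 𝒟.X) :
    toStalk x (𝒟.π.appTop 𝒟.t) ∈ nonZeroDivisors (𝒟.X.presheaf.stalk x) := by
  have := 𝒟.flat
  have := 𝒟.etale
  apply toStalk_mem_nonZeroDivisors_of_flat
  rw [← toLine_appTop_coord 𝒟.str 𝒟.t PUnit.unit]
  exact toStalk_mem_nonZeroDivisors_of_flat _ _ _ (toStalk_coord_mem_nonZeroDivisors _)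

theorem isInvertible_top {X : Scheme.{u}} : IsInvertible (⊤ : X.IdealSheafData) := by
  intro x
  obtain ⟨U, hU, -⟩ := exists_affineOpen x (W := ⊤) trivial
  exact ⟨U, hU, 1, one_mem _, by simp⟩

/-- Off the centre the pulled back ideal is the unit ideal, which is invertible. The universal
property thus yields a section over `W`, and its uniqueness clause makes the section an inverse. -/
theorem IsBlowUp.isIso_morphismRestrict {Z D : Scheme.{u}} {b : Z ⟶ D} {J : D.IdealSheafData}
    (hb : IsBlowUp b J) (W : D.Opens) (hW : Disjoint (W : Set D) J.support) : IsIso (b ∣_ W) := by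
  have key : ∀ {T : Scheme.{u}} (h : T ⟶ D), Set.range h ⊆ W → IsInvertible (J.comap h) := by
    intro T h hT
    have : J.comap h = ⊤ := by
      rw [← Scheme.IdealSheafData.support_eq_bot_iff, Scheme.IdealSheafData.support_comap]
      ext x
      simp only [TopologicalSpace.Closeds.coe_preimage, Set.mem_preimage,
        TopologicalSpace.Closeds.coe_bot, Set.mem_empty_iff_false, iff_false]
      exact Set.disjoint_left.1 hW (hT ⟨x, rfl⟩)
    rw [this]
    exact isInvertible_top
  obtain ⟨s, hs, -⟩ := hb.2 _ W.ι (key _ (by simp))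
  have hs' : Set.range s ⊆ Set.range (b ⁻¹ᵁ W).ι := by
    rintro _ ⟨x, rfl⟩
    rw [Scheme.Opens.range_ι]
    change b (s x) ∈ W
    rw [← Scheme.Hom.comp_apply, hs]
    exact x.2
  refine ⟨IsOpenImmersion.lift (b ⁻¹ᵁ W).ι s hs', ?_, ?_⟩
  · rw [← cancel_mono (b ⁻¹ᵁ W).ι, Category.assoc, IsOpenImmersion.lift_fac, Category.id_comp]
    obtain ⟨g, -, hg⟩ := hb.2 _ ((b ⁻¹ᵁ W).ι ≫ b) (key _ (by
      rintro _ ⟨x, rfl⟩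
      exact x.2))
    rw [hg (b ∣_ W ≫ s) ((Category.assoc _ _ _).trans (by rw [hs, morphismRestrict_ι])),
        hg (b ⁻¹ᵁ W).ι rfl]
  · rw [← cancel_mono W.ι, Category.assoc, morphismRestrict_ι, IsOpenImmersion.lift_fac_assoc, hs,
      Category.id_comp]

/-- Blow-ups need not be flat, so an argument is required. Off the exceptional divisor `b` is an
isomorphism onto its image, and `a` stays regular. A section `c` killed by `a` therefore vanishes
off the divisor, so a power of the local equation `f` kills it; as `f` is regular, `c = 0`. -/
theorem IsBlowUp.toStalk_mem_nonZeroDivisors {Z D : Scheme.{u}} {b : Z ⟶ D}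
    {J : D.IdealSheafData} (hb : IsBlowUp b J) (a : Γ(D, ⊤))
    (ha : ∀ x, toStalk x a ∈ nonZeroDivisors (D.presheaf.stalk x)) (z : Z) :
    toStalk z (b.appTop a) ∈ nonZeroDivisors (Z.presheaf.stalk z) := by
  obtain ⟨U, hz, f, hf, hJ⟩ := hb.1 z
  let W : D.Opens := J.support.compl
  have hW : Disjoint (W : Set D) J.support := disjoint_compl_left
  have := hb.isIso_morphismRestrict W hW
  have hfl : Flat ((b ⁻¹ᵁ W).ι ≫ b) := by
    rw [← morphismRestrict_ι]
    infer_instance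
  have h1 : ∀ y, b y ∈ W → toStalk y (b.appTop a) ∈ nonZeroDivisors (Z.presheaf.stalk y) := by
    intro y (hy : y ∈ b ⁻¹ᵁ W)
    have h2 := toStalk_mem_nonZeroDivisors_of_flat ((b ⁻¹ᵁ W).ι ≫ b) a ⟨y, hy⟩ (ha _)
    rw [Scheme.Hom.comp_appTop, CommRingCat.comp_apply] at h2
    have h6 := stalkMap_toStalk (b ⁻¹ᵁ W).ι ⟨y, hy⟩ (b.appTop a)
    rw [← h6] at h2
    have h7 : ∀ (x : (b ⁻¹ᵁ W).toScheme), IsIso ((b ⁻¹ᵁ W).ι.stalkMap x) := fun x => inferInstance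
    have := h7 ⟨y, hy⟩
    exact mem_nonZeroDivisors_of_injective
      (ConcreteCategory.bijective_of_isIso ((b ⁻¹ᵁ W).ι.stalkMap ⟨y, hy⟩)).1 h2
  have h3 : ∀ y ∈ Z.basicOpen f, b y ∈ W := by
    intro y hy hy'
    have h4 : y ∈ (J.comap b).support := by
      rw [Scheme.IdealSheafData.support_comap]
      exact hy'
    rw [Scheme.IdealSheafData.mem_support_iff_of_mem (Z.basicOpen_le f hy), hJ,
      Scheme.mem_zeroLocus_iff] at h4
    exact h4 f (Ideal.mem_span_singleton_self f) hy
  rw [← germ_res_top U.1 z hz]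
  refine germ_mem_nonZeroDivisors U (mem_nonZeroDivisors_iff_right.2 fun c hc => ?_) z hz
  have h5 : Z.presheaf.map (homOfLE (Z.basicOpen_le f)).op c = 0 := by
    refine TopCat.Presheaf.section_ext Z.sheaf _ _ _ fun y hy => ?_
    refine (TopCat.Presheaf.germ_res_apply Z.presheaf _ y hy c).trans ?_
    refine Eq.trans ?_ (map_zero _).symm
    refine mem_nonZeroDivisors_iff_right.1 (h1 y (h3 y hy)) _ ?_
    rw [← germ_res_top U.1 y (Z.basicOpen_le f hy)]
    exact ((map_mul _ _ _).symm.trans (congrArg _ hc)).trans (map_zero _)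
  obtain ⟨N, hN⟩ := exists_pow_mul_eq_zero_of_res_basicOpen_eq_zero_of_isAffineOpen Z U.2 c f h5
  exact mem_nonZeroDivisors_iff_left.1 (pow_mem hf N) _ hN

variable {𝒟 : Degeneration k}

/-- The product `tᵢ₊₁ ⋯ tₙ₊₁`. -/
abbrev tail {R : Type*} [CommRing R] (τ : ℕ → R) (n i : ℕ) : R :=
  ∏ m ∈ Finset.Icc (i + 1) (n + 1), τ m

theorem tail_mul {R : Type*} [CommRing R] (τ : ℕ → R) {n i : ℕ} (hi : i ≤ n + 1) :
    (∏ m ∈ Finset.Icc 1 i, τ m) * tail τ n i = ∏ m ∈ Finset.Icc 1 (n + 1), τ m := by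
  rw [← Finset.prod_union]
  · congr 1
    ext l
    simp only [Finset.mem_union, Finset.mem_Icc]
    omega
  · rw [Finset.disjoint_left]
    intro l
    simp only [Finset.mem_Icc]
    omega

/-- The pullback of `t`. -/
abbrev param {T : Scheme.{u}} (h : T ⟶ 𝒟.X) : Γ(T, ⊤) := h.appTop (𝒟.π.appTop 𝒟.t)

theorem param_comp {T S : Scheme.{u}} (g : T ⟶ S) (h : S ⟶ 𝒟.X) :
    param (g ≫ h) = g.appTop (param h) := by
  rw [param, Scheme.Hom.comp_appTop, CommRingCat.comp_apply]

/-- The ideal generated by the equations of the source components and by `a`. -/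
abbrev centreIdeal (B : BipartiteOrientation 𝒟) {T : Scheme.{u}} (h : T ⟶ 𝒟.X) (a : Γ(T, ⊤)) :
    T.IdealSheafData :=
  B.sourceIdeal.comap h ⊔ Scheme.IdealSheafData.ofIdealTop (Ideal.span {a})

theorem centreIdeal_comap (B : BipartiteOrientation 𝒟) {T S : Scheme.{u}} (g : T ⟶ S)
    (h : S ⟶ 𝒟.X) (a : Γ(S, ⊤)) :
    (centreIdeal B h a).comap g = centreIdeal B (g ≫ h) (g.appTop a) := by
  rw [Scheme.IdealSheafData.comap_sup, comap_ofIdealTop_span_singleton,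
    ← Scheme.IdealSheafData.comap_comp]

/-- The data over which the universal property of `X[n]` is tested: the product of the
coordinates is `t` and all the centres are invertible. -/
structure IsAdmissible (B : BipartiteOrientation 𝒟) (n : ℕ) {T : Scheme.{u}} (h : T ⟶ 𝒟.X)
    (τ : ℕ → Γ(T, ⊤)) : Prop where
  prod : ∏ i ∈ Finset.Icc 1 (n + 1), τ i = param h
  invertible : ∀ i ∈ Finset.Icc 1 n, IsInvertible (centreIdeal B h (tail τ n i))

/-- The universal property of the expansions. -/
structure IsUniversal (B : BipartiteOrientation 𝒟) (n : ℕ) {S : Scheme.{u}} (p : S ⟶ 𝒟.X)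
    (t : ℕ → Γ(S, ⊤)) : Prop where
  admissible : IsAdmissible B n p t
  regular : ∀ y, toStalk y (param p) ∈ nonZeroDivisors (S.presheaf.stalk y)
  existsUnique : ∀ {T : Scheme.{u}} (h : T ⟶ 𝒟.X) (τ : ℕ → Γ(T, ⊤)), IsAdmissible B n h τ →
    ∃! g : T ⟶ S, g ≫ p = h ∧ ∀ i ∈ Finset.Icc 1 (n + 1), g.appTop (t i) = τ i

theorem isUniversal_initial (B : BipartiteOrientation 𝒟) :
    IsUniversal B 0 (𝟙 𝒟.X) fun _ => 𝒟.π.appTop 𝒟.t := by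
  have h0 : param (𝟙 𝒟.X) = 𝒟.π.appTop 𝒟.t :=
    congrArg (fun l => l.hom (𝒟.π.appTop 𝒟.t)) (Scheme.Hom.id_appTop (X := 𝒟.X))
  refine ⟨⟨?_, by simp⟩, fun y => ?_, fun h τ hτ => ?_⟩
  · rw [h0]
    exact Finset.prod_singleton _ _
  · rw [h0]
    exact 𝒟.toStalk_t_mem_nonZeroDivisors y
  · have h1 := hτ.prod
    simp only [zero_add, Finset.Icc_self, Finset.prod_singleton] at h1
    refine ⟨h, ⟨Category.comp_id _, fun i hi => ?_⟩, fun g hg =>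
      (Category.comp_id g).symm.trans hg.1⟩
    simp only [zero_add, Finset.Icc_self, Finset.mem_singleton] at hi
    rw [hi, h1]

/-- The sequence obtained by multiplying the entries in the places `m + 1` and `m + 2`. -/
def merge {R : Type*} [CommRing R] (τ : ℕ → R) (m i : ℕ) : R :=
  if i ≤ m then τ i else τ (m + 1) * τ (m + 2)

theorem merge_of_le {R : Type*} [CommRing R] (τ : ℕ → R) {m i : ℕ} (h : i ≤ m) :
    merge τ m i = τ i := if_pos h

theorem merge_succ {R : Type*} [CommRing R] (τ : ℕ → R) (m : ℕ) :
    merge τ m (m + 1) = τ (m + 1) * τ (m + 2) := if_neg (by omega)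

theorem tail_merge {R : Type*} [CommRing R] (τ : ℕ → R) {m i : ℕ} (hi : i ≤ m) :
    tail (merge τ m) m i = tail τ (m + 1) i := by
  rw [tail, tail, Finset.prod_Icc_succ_top (by omega),
    Finset.prod_Icc_succ_top (by omega), Finset.prod_Icc_succ_top (by omega), mul_assoc, merge_succ]
  congr 1
  exact Finset.prod_congr rfl fun l hl => merge_of_le τ (Finset.mem_Icc.1 hl).2

/-- Merging the last two functions changes neither the product of all functions nor the tails with
index at most `m`. One invertibility condition is dropped. -/
theorem IsAdmissible.merge {B : BipartiteOrientation 𝒟} {m : ℕ} {T : Scheme.{u}} {h : T ⟶ 𝒟.X}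
    {τ : ℕ → Γ(T, ⊤)} (hτ : IsAdmissible B (m + 1) h τ) : IsAdmissible B m h (merge τ m) where
  prod := (tail_merge τ (Nat.zero_le m)).trans hτ.prod
  invertible i hi := by
    rw [Finset.mem_Icc] at hi
    rw [tail_merge τ hi.2]
    exact hτ.invertible i (Finset.mem_Icc.2 ⟨hi.1, by omega⟩)

theorem IsAdmissible.tail_dvd {B : BipartiteOrientation 𝒟} {n : ℕ} {T : Scheme.{u}} {h : T ⟶ 𝒟.X}
    {τ : ℕ → Γ(T, ⊤)} (hτ : IsAdmissible B n h τ) {i : ℕ} (hi : i ≤ n + 1) :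
    tail τ n i ∣ param h := by
  rw [← hτ.prod, ← tail_mul τ hi]
  exact Dvd.intro_left _ rfl

/-- A local generator of the ideal divides `a`, which divides the parameter. If the parameter stays
regular on `T`, then so does the generator. -/
theorem IsInvertible.centreIdeal_comap {B : BipartiteOrientation 𝒟} {T S : Scheme.{u}}
    {p : S ⟶ 𝒟.X} {a : Γ(S, ⊤)}
    (h : IsInvertible (centreIdeal B p a)) (ha : a ∣ param p) (g : T ⟶ S)
    (hg : ∀ z, toStalk z (param (g ≫ p)) ∈ nonZeroDivisors (T.presheaf.stalk z)) :
    IsInvertible (centreIdeal B (g ≫ p) (g.appTop a)) := by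
  rw [← ExpDeg.centreIdeal_comap]
  refine h.comap g fun z c hc => ?_
  have h1 : toStalk (g z) a ∈ stalkIdeal (centreIdeal B p a) (g z) := by
    rw [stalkIdeal_sup, stalkIdeal_ofIdealTop]
    exact Ideal.mem_sup_right (Ideal.mem_map_of_mem _ (Ideal.mem_span_singleton_self a))
  rw [hc, Ideal.mem_span_singleton] at h1
  have h2 : c ∣ toStalk (g z) (param p) := h1.trans (map_dvd _ ha)
  obtain ⟨d, hd⟩ := map_dvd (g.stalkMap z).hom h2
  have h3 := hg z
  rw [param_comp, ← stalkMap_toStalk, hd] at h3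
  exact (mul_mem_nonZeroDivisors.1 h3).1

theorem appTop_comp_apply {T S R : Scheme.{u}} (f : T ⟶ S) (g : S ⟶ R) (a : Γ(R, ⊤)) :
    (f ≫ g).appTop a = f.appTop (g.appTop a) := by
  rw [Scheme.Hom.comp_appTop, CommRingCat.comp_apply]

/-- The induction step. A datum of level `m + 1` is a datum of level `m`, together with a
factorization of its last function and with the invertibility of one more centre. The factorization
amounts to a morphism to the fibre product with the plane, and the extra invertibility to a lift to
the blow-up. The new parameter is still regular because `q` is flat, as a base change of the
multiplication map, and because blowing up preserves regular functions; this keeps the old centres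
invertible. -/
theorem IsUniversal.succ {B : BipartiteOrientation 𝒟} {m : ℕ} {S D Z : Scheme.{u}} {p : S ⟶ 𝒟.X}
    {t : ℕ → Γ(S, ⊤)} (hS : IsUniversal B m p t) {q : D ⟶ S} {r : D ⟶ Plane (Spec (.of k))}
    (hD : IsPullback q r (toLine (p ≫ 𝒟.π ≫ 𝒟.str) (t (m + 1))) (mulMap (Spec (.of k))))
    {tD : ℕ → Γ(D, ⊤)} (htD : ∀ i ≤ m, tD i = q.appTop (t i))
    (htD1 : tD (m + 1) = r.appTop (planeCoord _ 0)) (htD2 : tD (m + 2) = r.appTop (planeCoord _ 1))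
    (b : Z ⟶ D) (hb : IsBlowUp b (centreIdeal B (q ≫ p) (tD (m + 2)))) :
    IsUniversal B (m + 1) (b ≫ q ≫ p) fun i => b.appTop (tD i) := by
  have hqr := hD.w
  have hq : Flat q := MorphismProperty.of_isPullback hD.flip inferInstance
  have hmul : tD (m + 1) * tD (m + 2) = q.appTop (t (m + 1)) := by
    rw [htD1, htD2, ← map_mul]
    have := congrArg (fun l => l.appTop (AffineSpace.coord _ PUnit.unit)) hqr
    simp only [mulMap, comp_toLine, toLine_appTop_coord] at this
    exact this.symm
  have hover : q ≫ p ≫ 𝒟.π ≫ 𝒟.str = r ≫ (Plane (Spec (.of k)) ↘ Spec (.of k)) := by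
    have := congrArg (fun l => l ≫ (Line (Spec (.of k)) ↘ Spec (.of k))) hqr
    simpa only [mulMap, comp_toLine, toLine_comp_over] using this
  set V : ℕ → Γ(Z, ⊤) := fun i => b.appTop (tD i)
  have hVmerge : ∀ i ∈ Finset.Icc 1 (m + 1), merge V m i = (b ≫ q).appTop (t i) := by
    intro i hi
    rw [Finset.mem_Icc] at hi
    rw [appTop_comp_apply]
    by_cases h : i ≤ m
    · rw [← htD i h, merge_of_le _ h]
    · obtain rfl : i = m + 1 := by omega
      rw [← hmul, map_mul, merge_succ]
  have hVtail : ∀ i ≤ m, tail V (m + 1) i = (b ≫ q).appTop (tail t m i) := by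
    intro i hi
    rw [← tail_merge V hi, tail, tail, map_prod]
    refine Finset.prod_congr rfl fun l hl => hVmerge l ?_
    simp only [Finset.mem_Icc] at hl ⊢
    omega
  have hproj : b ≫ q ≫ p = (b ≫ q) ≫ p := (Category.assoc _ _ _).symm
  have hparam : param (b ≫ q ≫ p) = (b ≫ q).appTop (param p) := by
    rw [hproj, param_comp]
  have hreg : ∀ y, toStalk y (param (b ≫ q ≫ p)) ∈ nonZeroDivisors (Z.presheaf.stalk y) := by
    intro y
    rw [param_comp, param_comp]
    exact hb.toStalk_mem_nonZeroDivisors _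
      (fun x => toStalk_mem_nonZeroDivisors_of_flat q _ x (hS.regular _)) y
  refine ⟨⟨?_, fun i hi => ?_⟩, hreg, fun {T} h τ hτ => ?_⟩
  · exact (hVtail 0 (Nat.zero_le m)).trans ((congrArg _ hS.admissible.prod).trans hparam.symm)
  · rw [Finset.mem_Icc] at hi
    by_cases h : i ≤ m
    · rw [hproj, hVtail i h]
      refine (hS.admissible.invertible i (Finset.mem_Icc.2 ⟨hi.1, h⟩)).centreIdeal_comap
        (hS.admissible.tail_dvd (by omega)) (b ≫ q) ?_
      rw [← hproj]
      exact hreg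
    · obtain rfl : i = m + 1 := by omega
      have := hb.1
      rw [centreIdeal_comap] at this
      rw [tail, Finset.Icc_self, Finset.prod_singleton]
      exact this
  · obtain ⟨g₀, ⟨hg₀, hg₀'⟩, hg₀u⟩ := hS.existsUnique _ _ hτ.merge
    have hg₀m : g₀.appTop (t (m + 1)) = τ (m + 1) * τ (m + 2) :=
      (hg₀' (m + 1) (by simp)).trans (merge_succ _ _)
    have hg₀str : g₀ ≫ p ≫ 𝒟.π ≫ 𝒟.str = h ≫ 𝒟.π ≫ 𝒟.str := by
      rw [← Category.assoc, hg₀]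
    let w : T ⟶ Plane (Spec (.of k)) :=
      AffineSpace.homOfVector (h ≫ 𝒟.π ≫ 𝒟.str) fun i => ![τ (m + 1), τ (m + 2)] i.down
    have hw0 : w.appTop (planeCoord _ 0) = τ (m + 1) :=
      AffineSpace.homOfVector_appTop_coord _ _ _
    have hw1 : w.appTop (planeCoord _ 1) = τ (m + 2) :=
      AffineSpace.homOfVector_appTop_coord _ _ _
    have hwo : w ≫ (Plane (Spec (.of k)) ↘ Spec (.of k)) = h ≫ 𝒟.π ≫ 𝒟.str :=
      AffineSpace.homOfVector_over _ _
    have hw : g₀ ≫ toLine (p ≫ 𝒟.π ≫ 𝒟.str) (t (m + 1)) = w ≫ mulMap (Spec (.of k)) := by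
      rw [mulMap, comp_toLine, comp_toLine, hg₀str, hg₀m, map_mul, hw0, hw1, hwo]
    let l : T ⟶ D := hD.lift g₀ w hw
    have hlq : l ≫ q = g₀ := hD.lift_fst _ _ _
    have hlr : l ≫ r = w := hD.lift_snd _ _ _
    have hlproj : l ≫ q ≫ p = h := by
      rw [← hg₀, ← hlq, Category.assoc]
    have hlcoord : ∀ i ∈ Finset.Icc 1 (m + 1 + 1), l.appTop (tD i) = τ i := by
      intro i hi
      rw [Finset.mem_Icc] at hi
      by_cases h : i ≤ m
      · rw [htD i h, ← appTop_comp_apply, hlq, hg₀' i (Finset.mem_Icc.2 ⟨hi.1, by omega⟩),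
          merge_of_le _ h]
      · obtain rfl | rfl : i = m + 1 ∨ i = m + 2 := by omega
        · rw [htD1, ← appTop_comp_apply, hlr, hw0]
        · rw [htD2, ← appTop_comp_apply, hlr, hw1]
    obtain ⟨g, hg, hgu⟩ := hb.2 _ l (by
      rw [centreIdeal_comap, hlproj, hlcoord _ (by simp)]
      have := hτ.invertible (m + 1) (by simp)
      rw [tail, Finset.Icc_self, Finset.prod_singleton] at this
      exact this)
    refine ⟨g, ⟨?_, fun i hi => ?_⟩, fun g' ⟨hg', hg''⟩ => hgu g' ?_⟩
    · rw [← hlproj, ← hg, Category.assoc]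
    · rw [← hlcoord i hi, ← hg, appTop_comp_apply]
    · have hc : ∀ i ∈ Finset.Icc 1 (m + 1 + 1), (g' ≫ b).appTop (tD i) = τ i := by
        intro i hi
        rw [← hg'' i hi, appTop_comp_apply]
      -- For uniqueness, the composite with `b` is determined by its two projections: the one to `S`
      -- by uniqueness in level `m`, the one to the plane by its two coordinates.
      have h1 : (g' ≫ b) ≫ q = g₀ := by
        refine hg₀u _ ⟨?_, fun i hi => ?_⟩
        · rw [← hg']
          simp only [Category.assoc]
        · rw [Category.assoc, appTop_comp_apply, ← hVmerge i hi]
          rw [Finset.mem_Icc] at hi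
          by_cases h : i ≤ m
          · rw [merge_of_le _ h, merge_of_le _ h]
            exact hg'' i (Finset.mem_Icc.2 ⟨hi.1, by omega⟩)
          · obtain rfl : i = m + 1 := by omega
            rw [merge_succ, merge_succ, map_mul, hg'' (m + 1) (by simp), hg'' (m + 2) (by simp)]
      have h2 : (g' ≫ b) ≫ r = w := by
        refine AffineSpace.hom_ext ?_ fun i => ?_
        · rw [Category.assoc, ← hover, ← Category.assoc, h1, hg₀str]
          exact hwo.symm
        · rw [appTop_comp_apply]
          obtain ⟨i⟩ := i
          match i with
          | 0 => exact (congrArg _ htD1.symm).trans ((hc _ (by simp)).trans hw0.symm)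
          | 1 => exact (congrArg _ htD2.symm).trans ((hc _ (by simp)).trans hw1.symm)
      exact hD.hom_ext (h1.trans hlq.symm) (h2.trans hlr.symm)

theorem IsExpansion.isUniversal {B : BipartiteOrientation 𝒟} {n : ℕ} {Y : Family 𝒟}
    (h : IsExpansion B n Y) : IsUniversal B n Y.proj Y.coord := by
  induction h with
  | zero => exact isUniversal_initial B
  | succ m Y h Z b hb ih =>
    exact ih.succ (IsPullback.of_hasPullback _ _) (tD := (Y.double m).coord)
      (fun i hi => if_pos hi) ((if_neg (by omega)).trans (if_pos rfl))
      ((if_neg (by omega)).trans (if_neg (by omega))) b hb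

end

end ExpDeg

end

/-! ### Smooth coordinates on a neighbourhood of a closed point -/

noncomputable section

namespace ExpDeg

section Coordinates

open IsLocalRing

/-- A lifting problem for the quotient is one for `O` in which the variables in `S` become zero in
`B ⧸ I`. Lifts of the variables to `B` can be chosen freely, and those in `S` are lifted by `0`. A
lift of `O` over the polynomial ring then kills the ideal. -/
theorem formallySmooth_quotient {k : Type*} [Field k] {ι : Type*} {O : Type*} [CommRing O]
    [Algebra k O] [Algebra (MvPolynomial ι k) O] [IsScalarTower k (MvPolynomial ι k) O]
    [Algebra.FormallySmooth (MvPolynomial ι k) O] (S : Set ι) :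
    Algebra.FormallySmooth k
      (O ⧸ Ideal.span ((fun i => algebraMap (MvPolynomial ι k) O (.X i)) '' S)) := by
  classical
  set J := Ideal.span ((fun i => algebraMap (MvPolynomial ι k) O (.X i)) '' S)
  refine Algebra.FormallySmooth.of_comp_surjective fun B _ _ I hI f => ?_
  let f' : O →ₐ[k] B ⧸ I := f.comp (Ideal.Quotient.mkₐ k J)
  have hf' : ∀ i ∈ S, f' (algebraMap (MvPolynomial ι k) O (.X i)) = 0 := by
    intro i hi
    have : Ideal.Quotient.mkₐ k J (algebraMap (MvPolynomial ι k) O (.X i)) = 0 :=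
      Ideal.Quotient.eq_zero_iff_mem.2 (Ideal.subset_span ⟨i, hi, rfl⟩)
    change f (Ideal.Quotient.mkₐ k J _) = 0
    rw [this, map_zero]
  choose l hl using fun i => Ideal.Quotient.mk_surjective
    (f' (algebraMap (MvPolynomial ι k) O (.X i)))
  let φ : MvPolynomial ι k →ₐ[k] B := MvPolynomial.aeval fun i => if i ∈ S then 0 else l i
  let _ : Algebra (MvPolynomial ι k) B := φ.toRingHom.toAlgebra
  have hφ : ∀ p, f' (algebraMap (MvPolynomial ι k) O p) = Ideal.Quotient.mk I (φ p) := by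
    intro p
    suffices f'.comp (IsScalarTower.toAlgHom k (MvPolynomial ι k) O) =
      (Ideal.Quotient.mkₐ k I).comp φ from AlgHom.congr_fun this p
    ext i
    change f' (algebraMap (MvPolynomial ι k) O (.X i)) = Ideal.Quotient.mk I (φ (.X i))
    rw [MvPolynomial.aeval_X]
    by_cases hi : i ∈ S
    · rw [hf' i hi, if_pos hi, map_zero]
    · rw [if_neg hi, hl]
  let F : O →ₐ[MvPolynomial ι k] B ⧸ I := { f' with commutes' := hφ }
  obtain ⟨G, hG⟩ := Algebra.FormallySmooth.comp_surjective (MvPolynomial ι k) O I hI F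
  have hcomm : ∀ a, G (algebraMap k O a) = algebraMap k B a := by
    intro a
    rw [IsScalarTower.algebraMap_apply k (MvPolynomial ι k) O, G.commutes]
    exact φ.commutes a
  let G' : O →ₐ[k] B := { G.toRingHom with commutes' := hcomm }
  have hJ : ∀ a ∈ J, G' a = 0 := by
    intro a ha
    have : J ≤ RingHom.ker G'.toRingHom := by
      refine Ideal.span_le.2 ?_
      rintro _ ⟨i, hi, rfl⟩
      change G (algebraMap _ _ _) = 0
      rw [G.commutes]
      exact (MvPolynomial.aeval_X _ i).trans (if_pos hi)
    exact this ha
  refine ⟨Ideal.Quotient.liftₐ J G' hJ, ?_⟩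
  apply Ideal.Quotient.algHom_ext
  ext a
  exact AlgHom.congr_fun hG a

theorem bijective_algebraMap_residueField {k O O' : Type*} [Field k] [CommRing O] [IsLocalRing O]
    [CommRing O'] [IsLocalRing O'] [Algebra k O] [Algebra O O'] [Algebra k O'] [IsScalarTower k O O']
    (hk : Function.Bijective (algebraMap k (ResidueField O)))
    (h : Function.Surjective (algebraMap O O')) :
    Function.Bijective (algebraMap k (ResidueField O')) := by
  have : IsLocalHom (algebraMap O O') := Function.Surjective.isLocalHom _ h
  refine ⟨(algebraMap k (ResidueField O')).injective, ?_⟩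
  have h1 : algebraMap k (ResidueField O') =
      (ResidueField.map (algebraMap O O')).comp (algebraMap k (ResidueField O)) := by
    ext a
    change residue O' (algebraMap k O' a) = ResidueField.map _ (residue O (algebraMap k O a))
    rw [ResidueField.map_residue, ← IsScalarTower.algebraMap_apply]
  rw [h1]
  refine Function.Surjective.comp (g := ResidueField.map (algebraMap O O')) ?_ hk.2
  intro y
  obtain ⟨y, rfl⟩ := residue_surjective y
  obtain ⟨y, rfl⟩ := h y
  exact ⟨residue O y, ResidueField.map_residue _ _⟩

/-- Spreads out two properties of the local ring. Smoothness over the coordinates holds at `𝔪` by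
the Jacobian criterion, hence nearby. For each of the finitely many `S ⊆ σ`, the quotient of `O` by
the coordinates in `S` is a smooth local algebra with residue field `k`, hence a domain, and this
persists nearby. Each property passes to multiples of the localizing element, so one product serves
for all. -/
theorem exists_isCoord_away {k A O : Type u} [Field k] [CommRing A] [Algebra k A]
    [Algebra.Smooth k A] (𝔪 : Ideal A) [𝔪.IsMaximal] (hk : Function.Bijective (algebraMap k (A ⧸ 𝔪)))
    [CommRing O] [IsLocalRing O] [Algebra A O] [IsLocalization.AtPrime O 𝔪]
    {σ : Set (Fin 2)} (hσ : σ.Nonempty) {v : Fin 2 → A} (hone : ∀ i ∉ σ, v i = 1)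
    (z : σ → maximalIdeal O) (hvz : ∀ i : σ, algebraMap A O (v i) = z i)
    (hz : LinearIndependent (ResidueField O) fun i => (maximalIdeal O).toCotangent (z i)) :
    ∃ f ∉ 𝔪, ∀ g ∉ 𝔪, f ∣ g →
      IsCoord k σ (fun i => algebraMap A (Localization.Away g) (v i)) ∧
      ∀ S ⊆ σ, (Ideal.span ((fun i => algebraMap A (Localization.Away g) (v i)) '' S)).IsPrime := by
  classical
  let _ : Algebra k O := ((algebraMap A O).comp (algebraMap k A)).toAlgebra
  have : IsScalarTower k A O := .of_algebraMap_eq fun _ => rfl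
  let Λ := MvPolynomial σ k
  let _ : Algebra Λ A := (MvPolynomial.aeval (R := k) fun i : σ => v i).toAlgebra
  have : IsScalarTower k Λ A := .of_algebraMap_eq fun a =>
    ((MvPolynomial.aeval (R := k) fun i : σ => v i).commutes a).symm
  have hΛA : ∀ i, algebraMap Λ A (.X i) = v i := fun i => MvPolynomial.aeval_X _ i
  let _ : Algebra Λ O := ((algebraMap A O).comp (algebraMap Λ A)).toAlgebra
  have : IsScalarTower Λ A O := .of_algebraMap_eq fun _ => rfl
  have : IsScalarTower k Λ O := .of_algebraMap_eq fun a => by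
    rw [IsScalarTower.algebraMap_apply Λ A O, ← IsScalarTower.algebraMap_apply k Λ A,
      IsScalarTower.algebraMap_apply k A O]
  have hnoethA : IsNoetherianRing A := Algebra.FiniteType.isNoetherianRing k A
  have : IsNoetherianRing O := IsLocalization.isNoetherianRing 𝔪.primeCompl O hnoethA
  have : Algebra.FormallySmooth A O := .of_isLocalization 𝔪.primeCompl
  have : Algebra.FormallySmooth k O := .comp k A O
  have : Algebra.EssFiniteType A O := .of_isLocalization O 𝔪.primeCompl
  have : Algebra.EssFiniteType k O := .comp k A O
  have hkO : Function.Bijective (algebraMap k (ResidueField O)) := by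
    refine ⟨(algebraMap k (ResidueField O)).injective, fun y => ?_⟩
    obtain ⟨w, hw⟩ := (IsLocalization.AtPrime.equivQuotMaximalIdeal 𝔪 O).surjective y
    obtain ⟨c, rfl⟩ := hk.2 w
    exact ⟨c, hw⟩
  let e : k ≃ₐ[k] ResidueField O := AlgEquiv.ofBijective (Algebra.ofId _ _) hkO
  have : Algebra.FormallySmooth k (ResidueField O) := .of_equiv e
  have hsm : Algebra.FormallySmooth Λ O :=
    formallySmooth_mvPolynomial z hz fun i => by
      rw [IsScalarTower.algebraMap_apply Λ A O, hΛA, hvz]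
  have : Algebra.FinitePresentation Λ A :=
    Algebra.FinitePresentation.of_restrict_scalars_finitePresentation k Λ A
  have : Algebra.IsSmoothAt Λ 𝔪 :=
    Algebra.FormallySmooth.of_equiv ((IsLocalization.algEquiv 𝔪.primeCompl O
      (Localization.AtPrime 𝔪)).restrictScalars Λ)
  obtain ⟨f₀, hf₀, hf₀s⟩ := Algebra.IsSmoothAt.exists_notMem_smooth Λ 𝔪
  have key : ∀ S : Set (Fin 2), S ⊆ σ → ∃ f ∉ 𝔪, ∀ g ∉ 𝔪, f ∣ g →
      (Ideal.span ((fun i => algebraMap A (Localization.Away g) (v i)) '' S)).IsPrime := by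
    intro S hS
    set I := Ideal.span (v '' S)
    set J := Ideal.span ((fun i => algebraMap Λ O (.X i)) '' (Subtype.val ⁻¹' S : Set σ))
    have hJ : J = I.map (algebraMap A O) := by
      rw [Ideal.map_span]
      refine congrArg Ideal.span (Set.ext fun y => ?_)
      constructor
      · rintro ⟨i, hi, rfl⟩
        exact ⟨v i, ⟨i, hi, rfl⟩, by
          rw [← hΛA]; exact (IsScalarTower.algebraMap_apply Λ A O _).symm⟩
      · rintro ⟨_, ⟨i, hi, rfl⟩, rfl⟩
        exact ⟨⟨i, hS hi⟩, hi, by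
          rw [← hΛA ⟨i, hS hi⟩]; exact IsScalarTower.algebraMap_apply Λ A O _⟩
    have hIm : I ≤ 𝔪 := by
      refine Ideal.span_le.2 ?_
      rintro _ ⟨i, hi, rfl⟩
      have h1 := (z ⟨i, hS hi⟩).2
      rw [← hvz ⟨i, hS hi⟩] at h1
      exact (IsLocalization.AtPrime.to_map_mem_maximal_iff O 𝔪 _).1 h1
    have hJm : J ≤ maximalIdeal O := by
      rw [hJ, Ideal.map_le_iff_le_comap]
      exact fun a ha => (IsLocalization.AtPrime.to_map_mem_maximal_iff O 𝔪 _).2 (hIm ha)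
    have : Nontrivial (O ⧸ J) :=
      Ideal.Quotient.nontrivial_iff.2 fun h => (maximalIdeal.isMaximal O).ne_top
        (top_le_iff.1 (h ▸ hJm))
    have : IsLocalRing (O ⧸ J) := .of_surjective' (Ideal.Quotient.mk J) Ideal.Quotient.mk_surjective
    have : Algebra.FormallySmooth k (O ⧸ J) := formallySmooth_quotient _
    have : Algebra.EssFiniteType k (O ⧸ J) := .comp k O (O ⧸ J)
    have : IsDomain (O ⧸ J) := isDomain_of_formallySmooth (k := k)
      (bijective_algebraMap_residueField hkO Ideal.Quotient.mk_surjective)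
    set 𝔭 := 𝔪.map (Ideal.Quotient.mk I)
    have hcomap : 𝔭.comap (Ideal.Quotient.mk I) = 𝔪 := by
      rw [Ideal.comap_map_of_surjective _ Ideal.Quotient.mk_surjective, ← RingHom.ker_eq_comap_bot,
        Ideal.mk_ker, sup_eq_left.2 hIm]
    have : 𝔭.IsPrime := Ideal.map_isPrime_of_surjective Ideal.Quotient.mk_surjective
      (by rwa [Ideal.mk_ker])
    have hcompl : Submonoid.map (Ideal.Quotient.mk I) 𝔪.primeCompl = 𝔭.primeCompl := by
      ext y
      constructor
      · rintro ⟨a, ha, rfl⟩ h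
        exact ha (hcomap ▸ h)
      · intro hy
        obtain ⟨a, rfl⟩ := Ideal.Quotient.mk_surjective y
        exact ⟨a, fun h => hy (Ideal.mem_map_of_mem _ h), rfl⟩
    -- Localization commutes with quotients: `O → (A ⧸ I)_𝔭` is surjective with kernel `J`, and `O ⧸
    -- J` is already known to be a domain.
    have : IsDomain (Localization.AtPrime 𝔭) := by
      let ψ : O →+* Localization.AtPrime 𝔭 := IsLocalization.map _ (Ideal.Quotient.mk I)
        (hcompl ▸ Submonoid.le_comap_map _ : 𝔪.primeCompl ≤ 𝔭.primeCompl.comap _)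
      have hψ : RingHom.ker ψ = J := by
        rw [hJ]
        refine (IsLocalization.ker_map (Localization.AtPrime 𝔭) _ hcompl).trans ?_
        rw [Ideal.mk_ker]
      have hψs : Function.Surjective ψ := by
        intro y
        obtain ⟨b, c, rfl⟩ := IsLocalization.exists_mk'_eq 𝔭.primeCompl y
        obtain ⟨b, rfl⟩ := Ideal.Quotient.mk_surjective b
        obtain ⟨c, hc⟩ := c
        obtain ⟨a, ha, rfl⟩ := hcompl ▸ hc
        exact ⟨IsLocalization.mk' O b ⟨a, ha⟩, IsLocalization.map_mk' _ _ _⟩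
      have : (RingHom.ker ψ).IsPrime := by
        rw [hψ]
        exact (Ideal.Quotient.isDomain_iff_prime J).1 inferInstance
      have := (Ideal.Quotient.isDomain_iff_prime (RingHom.ker ψ)).2 this
      exact (RingHom.quotientKerEquivOfSurjective hψs).symm.toMulEquiv.isDomain _
    obtain ⟨f, hf, hfg⟩ := exists_isDomain_away 𝔭
    obtain ⟨f, rfl⟩ := Ideal.Quotient.mk_surjective f
    refine ⟨f, fun h => hf (Ideal.mem_map_of_mem _ h), fun g hg hdvd => ?_⟩
    have := hfg (Ideal.Quotient.mk I g) (fun h => hg (hcomap ▸ h)) (map_dvd _ hdvd)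
    have h2 := IsLocalization.ker_map (S := Localization.Away g)
      (Localization.Away (Ideal.Quotient.mk I g)) (Ideal.Quotient.mk I)
      (Submonoid.map_powers (Ideal.Quotient.mk I) g)
    rw [Ideal.mk_ker, Ideal.map_span, ← Set.image_comp] at h2
    change (Ideal.span ((algebraMap A (Localization.Away g) ∘ v) '' S)).IsPrime
    rw [← h2]
    exact RingHom.ker_isPrime _
  choose! F hF hFp using key
  refine ⟨f₀ * ∏ S : {S : Set (Fin 2) // S ⊆ σ}, F S, ?_, fun g hg hfg => ⟨?_, fun S hS => ?_⟩⟩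
  · intro h
    rcases Ideal.IsPrime.mem_or_mem inferInstance h with h | h
    · exact hf₀ h
    · obtain ⟨S, -, hS⟩ := Ideal.IsPrime.prod_mem_iff.1 h
      exact hF S S.2 hS
  · refine ⟨?_, fun i hi => by rw [hone i hi, map_one], hσ⟩
    have h1 : Algebra.Smooth Λ (Localization.Away g) := by
      rw [← Algebra.basicOpen_subset_smoothLocus_iff_smooth] at hf₀s ⊢
      refine subset_trans ?_ hf₀s
      obtain ⟨c, rfl⟩ := (Dvd.intro _ rfl : f₀ ∣ _).trans hfg
      exact PrimeSpectrum.basicOpen_mul_le_left _ _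
    have h2 : (MvPolynomial.aeval (R := k) fun i : σ =>
        algebraMap A (Localization.Away g) (v i)).toRingHom =
        algebraMap Λ (Localization.Away g) := by
      rw [IsScalarTower.algebraMap_eq Λ A (Localization.Away g)]
      apply MvPolynomial.ringHom_ext
      · intro a
        simp only [AlgHom.toRingHom_eq_coe, RingHom.coe_coe, MvPolynomial.algHom_C,
          RingHom.comp_apply]
        rw [IsScalarTower.algebraMap_apply k A]
        congr 1
        exact ((MvPolynomial.aeval (R := k) fun i : σ => v i).commutes a).symm
      · intro i
        simp only [AlgHom.toRingHom_eq_coe, RingHom.coe_coe, MvPolynomial.aeval_X,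
          RingHom.comp_apply, hΛA]
    rw [h2]
    exact RingHom.smooth_algebraMap.2 h1
  · refine hFp S hS g hg (Dvd.dvd.trans ?_ hfg)
    exact (Finset.dvd_prod_of_mem (fun S : {S : Set (Fin 2) // S ⊆ σ} => F S)
      (Finset.mem_univ ⟨S, hS⟩)).trans (Dvd.intro_left _ rfl)

end Coordinates

end ExpDeg

end

/-! ### Affine charts of the degeneration -/

noncomputable section

namespace ExpDeg

section Charts

/-- A ring element as a function on the spectrum. -/
def specFun (A : Type u) [CommRing A] : A →+* Γ(Spec (.of A), ⊤) :=
  (Scheme.ΓSpecIso (.of A)).inv.hom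

theorem specFun_bijective (A : Type u) [CommRing A] : Function.Bijective (specFun A) :=
  ConcreteCategory.bijective_of_isIso (Scheme.ΓSpecIso (.of A)).inv

theorem appTop_specFun {A B : Type u} [CommRing A] [CommRing B] (f : A →+* B) (a : A) :
    (Spec.map (CommRingCat.ofHom f)).appTop (specFun A a) = specFun B (f a) :=
  (congrArg (fun l => l.hom a) (Scheme.ΓSpecIso_inv_naturality (CommRingCat.ofHom f))).symm

theorem vanishesAt_specFun {A : Type u} [CommRing A] (a : A) (x : Spec (.of A)) :
    VanishesAt (specFun A a) x ↔ a ∈ x.asIdeal := by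
  rw [VanishesAt]
  have : (Spec (.of A)).basicOpen (specFun A a) = PrimeSpectrum.basicOpen a :=
    basicOpen_eq_of_affine (R := .of A) a
  rw [this]
  exact not_not

theorem vanishesAt_appTop {X Y : Scheme.{u}} (f : X ⟶ Y) (a : Γ(Y, ⊤)) (x : X) :
    VanishesAt (f.appTop a) x ↔ VanishesAt a (f x) := by
  rw [VanishesAt, VanishesAt]
  have := Scheme.preimage_basicOpen_top f a
  rw [← this]
  exact Iff.rfl

theorem fromSpec_appTop {X : Scheme.{u}} {U : X.Opens} (hU : IsAffineOpen U) (a : Γ(X, ⊤)) :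
    hU.fromSpec.appTop a = specFun Γ(X, U) (X.presheaf.map (homOfLE le_top).op a) := by
  have := hU.fromSpec_app_of_le ⊤ le_top
  refine (congrArg (fun l => l.hom a) this).trans ?_
  simp only [CommRingCat.hom_comp, RingHom.comp_apply]
  have h : (Spec Γ(X, U)).presheaf.map (homOfLE le_top).op = 𝟙 _ := (Spec Γ(X, U)).presheaf.map_id _
  exact (congrArg (fun l : Γ(Spec Γ(X, U), ⊤) ⟶ Γ(Spec Γ(X, U), ⊤) => l.hom
    (specFun Γ(X, U) (X.presheaf.map (homOfLE le_top).op a))) h)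

variable {k : Type u} [Field k] {𝒟 : Degeneration k}

/-- An affine chart of `X` with functions `x * y = t`, where `x` and `y` are smooth coordinates or
equal to `1`. -/
structure PreChart (𝒟 : Degeneration k) where
  /-- the coordinate ring -/
  A : Type u
  [commRing : CommRing A]
  [algebra : Algebra k A]
  /-- the chart -/
  e : Spec (.of A) ⟶ 𝒟.X
  [isOpenImmersion : IsOpenImmersion e]
  e_str : e ≫ 𝒟.π ≫ 𝒟.str = Spec.map (CommRingCat.ofHom (algebraMap k A))
  /-- the type of the coordinates -/
  σ : Set (Fin 2)
  /-- the coordinates -/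
  v : Fin 2 → A
  coord : IsCoord k σ v
  param : param e = specFun A (v 0 * v 1)
  -- The unit ideal has to be allowed: away from the central fibre the coordinate `t` is invertible
  -- on the chart.
  isPrime : ∀ S ⊆ σ, S.Nonempty → (Ideal.span (v '' S)).IsPrime ∨ Ideal.span (v '' S) = ⊤

attribute [instance] PreChart.commRing PreChart.algebra PreChart.isOpenImmersion

/-- The structure of a `k`-algebra on the ring of functions on an affine open. -/
abbrev sectionAlgebra (q : 𝒟.X ⟶ Spec (.of k)) {U : 𝒟.X.Opens} (hU : IsAffineOpen U) :
    Algebra k Γ(𝒟.X, U) :=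
  (Spec.preimage (hU.fromSpec ≫ q)).hom.toAlgebra

theorem bijective_quotient_of_isMaximal {k A : Type*} [Field k] [IsAlgClosed k] [CommRing A]
    [Algebra k A] [Algebra.FiniteType k A] (𝔪 : Ideal A) [𝔪.IsMaximal] :
    Function.Bijective (algebraMap k (A ⧸ 𝔪)) := by
  let _ := Ideal.Quotient.field 𝔪
  have := finite_of_finite_type_of_isJacobsonRing k (A ⧸ 𝔪)
  exact IsAlgClosed.algebraMap_bijective_of_isIntegral

open IsLocalRing in
-- Independent cotangent classes at a closed point become smooth coordinates on the basic open
-- subset supplied by `exists_isCoord_away`. Closedness of `p` and algebraic closedness of `k` make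
-- the residue field equal to `k`.
theorem exists_preChart [IsAlgClosed k] {p : 𝒟.X} (hp : IsClosed {p}) {U : 𝒟.X.Opens} (hU : IsAffineOpen U)
    (hpU : p ∈ U) {σ : Set (Fin 2)} (hσ : σ.Nonempty) {v : Fin 2 → Γ(𝒟.X, U)}
    (hone : ∀ i ∉ σ, v i = 1)
    (hv : 𝒟.X.presheaf.map (homOfLE le_top).op (𝒟.π.appTop 𝒟.t) = v 0 * v 1)
    (z : σ → maximalIdeal (𝒟.X.presheaf.stalk p))
    (hvz : ∀ i : σ, 𝒟.X.presheaf.germ U p hpU (v i) = z i)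
    (hz : LinearIndependent (ResidueField (𝒟.X.presheaf.stalk p))
      fun i => (maximalIdeal (𝒟.X.presheaf.stalk p)).toCotangent (z i)) :
    ∃ c : PreChart 𝒟, c.σ = σ ∧ ∃ w, c.e w = p ∧ ∀ i ∈ σ, c.v i ∈ w.asIdeal := by
  let _ := sectionAlgebra (𝒟.π ≫ 𝒟.str) hU
  have hstr : hU.fromSpec ≫ 𝒟.π ≫ 𝒟.str =
      Spec.map (CommRingCat.ofHom (algebraMap k Γ(𝒟.X, U))) := (Spec.map_preimage _).symm
  have hsm : Algebra.Smooth k Γ(𝒟.X, U) := by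
    have := 𝒟.smooth
    have := hU.isOpenImmersion_fromSpec
    have h1 : Smooth (hU.fromSpec ≫ 𝒟.π ≫ 𝒟.str) := inferInstance
    rw [hstr, HasRingHomProperty.Spec_iff (P := @Smooth)] at h1
    exact RingHom.smooth_algebraMap.1 h1
  let _ := 𝒟.X.presheaf.algebra_section_stalk ⟨p, hpU⟩
  have := hU.isLocalization_stalk ⟨p, hpU⟩
  have hmax := hU.primeIdealOf_isMaximal_of_isClosed ⟨p, hpU⟩ hp
  set 𝔪 := (hU.primeIdealOf ⟨p, hpU⟩).asIdeal with h𝔪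
  obtain ⟨f, hf, hfg⟩ := exists_isCoord_away (k := k) 𝔪 (bijective_quotient_of_isMaximal 𝔪) hσ hone
    z hvz hz
  obtain ⟨hc, hpr⟩ := hfg f hf dvd_rfl
  set A := Localization.Away f
  set e₀ := Spec.map (CommRingCat.ofHom (algebraMap Γ(𝒟.X, U) A))
  have : IsOpenImmersion e₀ := IsOpenImmersion.of_isLocalization f
  refine ⟨{
    A := A
    e := e₀ ≫ hU.fromSpec
    e_str := ?_
    σ := σ
    v := fun i => algebraMap Γ(𝒟.X, U) A (v i)
    coord := hc
    param := ?_
    isPrime := fun S hS _ => Or.inl (hpr S hS) }, rfl, ?_⟩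
  · rw [Category.assoc, hstr, ← Spec.map_comp]
    rfl
  · rw [param_comp, param, fromSpec_appTop, appTop_specFun, hv, map_mul]
  · have : hU.primeIdealOf ⟨p, hpU⟩ ∈ Set.range e₀ := by
      have h1 := PrimeSpectrum.localization_away_comap_range A f
      have h2 : hU.primeIdealOf ⟨p, hpU⟩ ∈ (PrimeSpectrum.basicOpen f : Set (PrimeSpectrum _)) := hf
      rw [← h1] at h2
      exact h2
    obtain ⟨w, hw⟩ := this
    refine ⟨w, ?_, fun i hi => ?_⟩
    · rw [Scheme.Hom.comp_apply, hw]
      exact hU.fromSpec_primeIdealOf ⟨p, hpU⟩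
    · change v i ∈ (e₀ w).asIdeal
      rw [hw]
      have h1 := (z ⟨i, hi⟩).2
      rw [← hvz ⟨i, hi⟩] at h1
      exact (IsLocalization.AtPrime.to_map_mem_maximal_iff _ 𝔪 _).1 h1

end Charts

end ExpDeg

end

/-! ### The components of the central fibre in charts, and their orientation -/

noncomputable section

namespace ExpDeg

section Components

theorem IsComponent.isClosed {T : Type u} [TopologicalSpace T] {Z S : Set T} (h : IsComponent Z S)
    (hS : IsClosed S) : IsClosed Z :=
  closure_subset_iff_isClosed.1
    (h.2 ⟨h.1.1.closure, hS.closure_subset_iff.2 h.1.2⟩ subset_closure)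

variable {T S : Type u} [TopologicalSpace T] [TopologicalSpace S] {e : T → S}

theorem subset_closure_image_preimage (he : Topology.IsOpenEmbedding e) {Z : Set S}
    (hZ : IsIrreducible Z) (hne : (e ⁻¹' Z).Nonempty) : Z ⊆ closure (e '' (e ⁻¹' Z)) := by
  rw [Set.image_preimage_eq_inter_range]
  obtain ⟨u, hu⟩ := hne
  exact subset_closure_inter_of_isPreirreducible_of_isOpen hZ.2 he.isOpen_range
    ⟨e u, hu, u, rfl⟩

/-- A component that meets an open subset is the closure of its trace there. So it is contained in
the closure of the image of `V`, and by maximality the two agree. -/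
theorem IsComponent.preimage_eq (he : Topology.IsOpenEmbedding e) {Z S' : Set S}
    (hZ : IsComponent Z S') (hS' : IsClosed S') {V : Set T} (hV : IsIrreducible V)
    (hVS : V ⊆ e ⁻¹' S') (hne : (e ⁻¹' Z).Nonempty) (hZV : e ⁻¹' Z ⊆ V) :
    e ⁻¹' Z = V ∧ Z = closure (e '' V) := by
  have h1 : Z ⊆ closure (e '' V) :=
    (subset_closure_image_preimage he hZ.1.1 hne).trans (closure_mono (Set.image_mono hZV))
  have h2 : closure (e '' V) ⊆ Z :=
    hZ.2 ⟨(hV.image e he.continuous.continuousOn).closure,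
      hS'.closure_subset_iff.2 (Set.image_subset_iff.2 hVS)⟩ h1
  exact ⟨hZV.antisymm fun v hv => h2 (subset_closure ⟨v, hv, rfl⟩), h1.antisymm h2⟩

theorem IsComponent.closure_image (he : Topology.IsOpenEmbedding e) {S' : Set S}
    (hS' : IsClosed S') {V : Set T} (hV : IsComponent V (e ⁻¹' S')) :
    IsComponent (closure (e '' V)) S' := by
  refine ⟨⟨(hV.1.1.image e he.continuous.continuousOn).closure,
    hS'.closure_subset_iff.2 (Set.image_subset_iff.2 hV.1.2)⟩, fun W hW h => ?_⟩
  have h1 : V ⊆ e ⁻¹' W := fun v hv => h (subset_closure ⟨v, hv, rfl⟩)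
  have h2 : (e ⁻¹' W).Nonempty := hV.1.1.1.mono h1
  have h3 : e ⁻¹' W ⊆ V := hV.2 ⟨⟨h2, hW.1.2.preimage he⟩, Set.preimage_mono hW.2⟩ h1
  exact (subset_closure_image_preimage he hW.1 h2).trans (closure_mono (Set.image_mono h3))

end Components

section FlatCoordinates

/-- A point at which some of a flat family of coordinates vanish specializes a point at which
exactly these coordinates vanish. -/
theorem exists_prime_le_of_flat {k : Type*} [Field k] {ι A : Type*} [CommRing A]
    (φ : MvPolynomial ι k →+* A) (hφ : φ.Flat) (S : Set ι) (w : PrimeSpectrum A)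
    (hw : ∀ i ∈ S, φ (.X i) ∈ w.asIdeal) :
    ∃ w' ≤ w, ∀ i, φ (.X i) ∈ w'.asIdeal ↔ i ∈ S := by
  classical
  let ψ : MvPolynomial ι k →ₐ[k] MvPolynomial ι k :=
    MvPolynomial.aeval fun i => if i ∈ S then 0 else .X i
  have hψ : ∀ i, ψ (.X i) = if i ∈ S then 0 else .X i := fun i => MvPolynomial.aeval_X _ i
  let _ := φ.toAlgebra
  have : Module.Flat (MvPolynomial ι k) A := hφ
  -- The prime generated by the variables in `S`, written as the kernel of the map that sets them to
  -- zero. It lies in the contraction of `w`, and going-down for the flat map `φ` provides a prime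
  -- below `w` that lies over it.
  let p : Ideal (MvPolynomial ι k) := RingHom.ker ψ.toRingHom
  have hp : p.IsPrime := RingHom.ker_isPrime _
  let I : Ideal (MvPolynomial ι k) := w.asIdeal.under (MvPolynomial ι k)
  have hle : p ≤ I := by
    intro f hf
    have h : ((Ideal.Quotient.mkₐ k I).comp ψ) = Ideal.Quotient.mkₐ k I := by
      ext i
      simp only [AlgHom.comp_apply, hψ]
      split_ifs with hi
      · have hX : MvPolynomial.X i ∈ I := hw i hi
        rw [map_zero]
        exact (Ideal.Quotient.eq_zero_iff_mem.2 hX).symm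
      · rfl
    have h2 := AlgHom.congr_fun h f
    have h3 : ψ f = 0 := hf
    rw [AlgHom.comp_apply, h3, map_zero] at h2
    exact Ideal.Quotient.eq_zero_iff_mem.1 h2.symm
  have : I.IsPrime := inferInstance
  obtain ⟨P, hP, hPp, hPo⟩ := w.asIdeal.exists_ideal_le_liesOver_of_le (p := p) (q := I) hle
  refine ⟨⟨P, hPp⟩, hP, fun i => ?_⟩
  have : φ (.X i) ∈ P ↔ MvPolynomial.X i ∈ p := by
    rw [hPo.over]
    rfl
  rw [this]
  change ψ (.X i) = 0 ↔ _
  rw [hψ]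
  split_ifs with hi
  · simp [hi]
  · simp [hi, MvPolynomial.X_ne_zero]

end FlatCoordinates

variable {k : Type u} [Field k] {𝒟 : Degeneration k}

theorem Degeneration.mem_centralFibre_iff (x : 𝒟.X) :
    x ∈ 𝒟.centralFibre ↔ VanishesAt (𝒟.π.appTop 𝒟.t) x :=
  (𝒟.vanishesAt_iff _).symm.trans (vanishesAt_appTop 𝒟.π 𝒟.t x).symm

theorem Degeneration.isClosed_centralFibre (𝒟 : Degeneration k) : IsClosed 𝒟.centralFibre := by
  have : 𝒟.centralFibre = ((𝒟.X.basicOpen (𝒟.π.appTop 𝒟.t) : Set 𝒟.X))ᶜ :=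
    Set.ext fun x => 𝒟.mem_centralFibre_iff x
  rw [this]
  exact (𝒟.X.basicOpen _).2.isClosed_compl

namespace PreChart

variable (c : PreChart 𝒟)

/-- The locus where some of the coordinates vanish. -/
def locus (S : Set (Fin 2)) : Set (Spec (.of c.A)) := {w | ∀ i ∈ S, c.v i ∈ w.asIdeal}

theorem isOpenEmbedding : Topology.IsOpenEmbedding c.e := c.e.isOpenEmbedding

theorem mem_of_mem {i : Fin 2} {w : Spec (.of c.A)} (h : c.v i ∈ w.asIdeal) : i ∈ c.σ := by
  by_contra hi
  rw [c.coord.one i hi] at h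
  exact w.2.ne_top ((Ideal.eq_top_iff_one _).2 h)

theorem locus_eq (S : Set (Fin 2)) : c.locus S = PrimeSpectrum.zeroLocus (c.v '' S) := by
  ext w
  exact Set.image_subset_iff.symm

theorem isClosed_locus (S : Set (Fin 2)) : IsClosed (c.locus S) := by
  rw [locus_eq]
  exact PrimeSpectrum.isClosed_zeroLocus _

theorem isIrreducible_locus {S : Set (Fin 2)} (hS : S.Nonempty) (h : (c.locus S).Nonempty) :
    IsIrreducible (c.locus S) := by
  obtain ⟨w, hw⟩ := h
  have hSσ : S ⊆ c.σ := fun i hi => c.mem_of_mem (hw i hi)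
  have hp : (Ideal.span (c.v '' S)).IsPrime := by
    refine (c.isPrime S hSσ hS).resolve_right fun h => w.2.ne_top (top_le_iff.1 ?_)
    rw [← h, Ideal.span_le]
    exact Set.image_subset_iff.2 hw
  rw [locus_eq, ← PrimeSpectrum.zeroLocus_span]
  exact (PrimeSpectrum.isIrreducible_zeroLocus_iff_of_radical _ hp.isRadical).2 hp

theorem exists_generization {S : Set (Fin 2)} {w : Spec (.of c.A)} (hw : w ∈ c.locus S) :
    ∃ w' : Spec (.of c.A), w' ⤳ w ∧ ∀ i, c.v i ∈ w'.asIdeal ↔ i ∈ S := by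
  obtain ⟨w', h, hw'⟩ := exists_prime_le_of_flat _ c.coord.smooth.flat (Subtype.val ⁻¹' S) w
    (fun i hi => by
      have := hw i hi
      simpa using this)
  refine ⟨w', (PrimeSpectrum.le_iff_specializes _ _).1 h, fun i => ?_⟩
  by_cases hi : i ∈ c.σ
  · have := hw' ⟨i, hi⟩
    simpa using this
  · exact ⟨fun h => (hi (c.mem_of_mem h)).elim, fun h => (hi (c.mem_of_mem (hw i h))).elim⟩

theorem mem_centralFibre_iff (w : Spec (.of c.A)) :
    c.e w ∈ 𝒟.centralFibre ↔ ∃ i, c.v i ∈ w.asIdeal := by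
  have h : VanishesAt (ExpDeg.param c.e) w ↔ c.v 0 * c.v 1 ∈ w.asIdeal := by
    rw [c.param, vanishesAt_specFun]
  rw [Degeneration.mem_centralFibre_iff, ← vanishesAt_appTop, Fin.exists_fin_two]
  exact h.trans w.2.mul_mem_iff_mem_or_mem

theorem locus_subset (i : Fin 2) : c.locus {i} ⊆ c.e ⁻¹' 𝒟.centralFibre :=
  fun w hw => (c.mem_centralFibre_iff w).2 ⟨i, hw i rfl⟩

theorem exists_subset_locus {W : Set (Spec (.of c.A))} (hW : IsIrreducible W)
    (h : W ⊆ c.e ⁻¹' 𝒟.centralFibre) : ∃ i, W ⊆ c.locus {i} := by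
  have := isPreirreducible_iff_isClosed_union_isClosed.1 hW.2 _ _ (c.isClosed_locus {0})
    (c.isClosed_locus {1}) (fun w hw => by
      obtain ⟨i, hi⟩ := (c.mem_centralFibre_iff w).1 (h hw)
      match i with
      | 0 => exact Or.inl fun i h => h ▸ hi
      | 1 => exact Or.inr fun i h => h ▸ hi)
  exact this.elim (fun h => ⟨0, h⟩) (fun h => ⟨1, h⟩)

theorem eq_of_locus_subset {i j : Fin 2} (h : (c.locus {i}).Nonempty)
    (hij : c.locus {i} ⊆ c.locus {j}) : i = j := by
  obtain ⟨w, hw⟩ := h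
  obtain ⟨w', -, hw'⟩ := c.exists_generization hw
  have := hij (a := w') (fun l hl => (hw' l).2 hl) j rfl
  exact ((hw' j).1 this).symm

theorem isComponent_locus {i : Fin 2} (h : (c.locus {i}).Nonempty) :
    IsComponent (c.locus {i}) (c.e ⁻¹' 𝒟.centralFibre) := by
  refine ⟨⟨c.isIrreducible_locus (Set.singleton_nonempty i) h, c.locus_subset i⟩,
    fun W hW hiW => ?_⟩
  obtain ⟨j, hj⟩ := c.exists_subset_locus hW.1 hW.2
  rw [c.eq_of_locus_subset h (hiW.trans hj)]
  exact hj

theorem isComponent_closure_locus {i : Fin 2} (h : (c.locus {i}).Nonempty) :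
    IsComponent (closure (c.e '' c.locus {i})) 𝒟.centralFibre :=
  (c.isComponent_locus h).closure_image c.isOpenEmbedding 𝒟.isClosed_centralFibre

theorem preimage_closure_locus (S : Set (Fin 2)) :
    c.e ⁻¹' closure (c.e '' c.locus S) = c.locus S := by
  rw [← c.isOpenEmbedding.isInducing.closure_eq_preimage_closure_image,
    (c.isClosed_locus S).closure_eq]

theorem exists_preimage_eq {Z : Set 𝒟.X} (hZ : IsComponent Z 𝒟.centralFibre)
    (h : (c.e ⁻¹' Z).Nonempty) :
    ∃ i, c.e ⁻¹' Z = c.locus {i} ∧ Z = closure (c.e '' c.locus {i}) := by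
  obtain ⟨i, hi⟩ := c.exists_subset_locus ⟨h, hZ.1.1.2.preimage c.isOpenEmbedding⟩
    (Set.preimage_mono hZ.1.2)
  exact ⟨i, hZ.preimage_eq c.isOpenEmbedding 𝒟.isClosed_centralFibre
    (c.isIrreducible_locus (Set.singleton_nonempty i) (h.mono hi)) (c.locus_subset i) h hi⟩

end PreChart

theorem IsCoord.rev {A : Type u} [CommRing A] [Algebra k A] {σ : Set (Fin 2)} {v : Fin 2 → A}
    (h : IsCoord k σ v) : IsCoord k (Fin.rev ⁻¹' σ) (fun i => v (Fin.rev i)) where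
  smooth := by
    let E : (Fin.rev ⁻¹' σ : Set (Fin 2)) ≃ σ :=
      { toFun := fun i => ⟨Fin.rev i, i.2⟩
        invFun := fun i => ⟨Fin.rev i, by
          rw [Set.mem_preimage, Fin.rev_rev]
          exact i.2⟩
        left_inv := fun i => by simp
        right_inv := fun i => by simp }
    have : (MvPolynomial.aeval (R := k) fun i : (Fin.rev ⁻¹' σ : Set (Fin 2)) =>
        v (Fin.rev i)).toRingHom = (MvPolynomial.aeval (R := k) fun i : σ => v i).toRingHom.comp
          (MvPolynomial.renameEquiv k E).toAlgHom.toRingHom := by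
      refine MvPolynomial.ringHom_ext (fun a => ?_) fun i => ?_
      · simp
      · simp [E]
    rw [this]
    exact RingHom.Smooth.comp (.of_bijective (MvPolynomial.renameEquiv k E).bijective) h.smooth
  one i hi := h.one _ hi
  nonempty := by
    obtain ⟨i, hi⟩ := h.nonempty
    exact ⟨Fin.rev i, by simpa using hi⟩

/-- The chart with interchanged coordinates. -/
def PreChart.rev (c : PreChart 𝒟) : PreChart 𝒟 where
  A := c.A
  e := c.e
  e_str := c.e_str
  σ := Fin.rev ⁻¹' c.σ
  v := fun i => c.v (Fin.rev i)
  coord := c.coord.rev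
  param := by
    rw [c.param]
    exact congrArg _ (mul_comm _ _)
  isPrime S hS hne := by
    have := c.isPrime (Fin.rev '' S) (Set.image_subset_iff.2 hS) (hne.image _)
    rwa [← Set.image_comp] at this

theorem PreChart.locus_rev (c : PreChart 𝒟) (i : Fin 2) :
    c.rev.locus {i} = c.locus {Fin.rev i} := by
  ext w
  simp only [locus, rev, Set.mem_singleton_iff, forall_eq]
  exact Iff.rfl

variable (B : BipartiteOrientation 𝒟)

/-- An affine chart of `X` in which the coordinates `x` and `y` are equations of the sources and of
the targets. -/
structure Chart extends PreChart 𝒟 where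
  neg : (toPreChart.locus {0}).Nonempty → closure (e '' toPreChart.locus {0}) ∈ B.neg
  pos : (toPreChart.locus {1}).Nonempty → closure (e '' toPreChart.locus {1}) ∈ B.pos

variable {B}

theorem BipartiteOrientation.mem_or_mem (B : BipartiteOrientation 𝒟) {Z : Set 𝒟.X}
    (h : IsComponent Z 𝒟.centralFibre) : Z ∈ B.neg ∨ Z ∈ B.pos := by
  have : Z ∈ B.neg ∪ B.pos := B.union ▸ h
  exact this

theorem BipartiteOrientation.isComponent_neg (B : BipartiteOrientation 𝒟) {Z : Set 𝒟.X}
    (h : Z ∈ B.neg) : IsComponent Z 𝒟.centralFibre := by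
  have : Z ∈ B.neg ∪ B.pos := Or.inl h
  rwa [B.union] at this

theorem BipartiteOrientation.isComponent_pos (B : BipartiteOrientation 𝒟) {Z : Set 𝒟.X}
    (h : Z ∈ B.pos) : IsComponent Z 𝒟.centralFibre := by
  have : Z ∈ B.neg ∪ B.pos := Or.inr h
  rwa [B.union] at this

/-- If both coordinates vanish somewhere, their loci meet by hypothesis, so the two components are
distinct and adjacent. Bipartiteness puts one of them in `neg` and the other in `pos`; at worst the
coordinates have to be interchanged. -/
theorem PreChart.exists_chart (c : PreChart 𝒟) (B : BipartiteOrientation 𝒟)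
    (hc : (c.locus {0}).Nonempty → (c.locus {1}).Nonempty → (c.locus {0} ∩ c.locus {1}).Nonempty) :
    ∃ c' : Chart B, Set.range c'.e = Set.range c.e := by
  have key : ((∀ h : (c.locus {0}).Nonempty, closure (c.e '' c.locus {0}) ∈ B.neg) ∧
      ∀ h : (c.locus {1}).Nonempty, closure (c.e '' c.locus {1}) ∈ B.pos) ∨
      ((∀ h : (c.locus {0}).Nonempty, closure (c.e '' c.locus {0}) ∈ B.pos) ∧
      ∀ h : (c.locus {1}).Nonempty, closure (c.e '' c.locus {1}) ∈ B.neg) := by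
    by_cases h0 : (c.locus {0}).Nonempty
    · by_cases h1 : (c.locus {1}).Nonempty
      · have hne : closure (c.e '' c.locus {0}) ≠ closure (c.e '' c.locus {1}) := by
          intro h
          have h' := congrArg (c.e ⁻¹' ·) h
          simp only [c.preimage_closure_locus] at h'
          exact absurd (c.eq_of_locus_subset h0 h'.subset) (by decide)
        obtain ⟨w, hw0, hw1⟩ := hc h0 h1
        have hnd : ¬ Disjoint (closure (c.e '' c.locus {0})) (closure (c.e '' c.locus {1})) :=
          Set.not_disjoint_iff.2 ⟨c.e w, subset_closure ⟨w, hw0, rfl⟩, subset_closure ⟨w, hw1, rfl⟩⟩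
        rcases B.mem_or_mem (c.isComponent_closure_locus h0) with g0 | g0 <;>
          rcases B.mem_or_mem (c.isComponent_closure_locus h1) with g1 | g1
        · exact (hnd (B.neg_indep _ g0 _ g1 hne)).elim
        · exact Or.inl ⟨fun _ => g0, fun _ => g1⟩
        · exact Or.inr ⟨fun _ => g0, fun _ => g1⟩
        · exact (hnd (B.pos_indep _ g0 _ g1 hne)).elim
      · rcases B.mem_or_mem (c.isComponent_closure_locus h0) with g0 | g0
        · exact Or.inl ⟨fun _ => g0, fun h => (h1 h).elim⟩
        · exact Or.inr ⟨fun _ => g0, fun h => (h1 h).elim⟩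
    · by_cases h1 : (c.locus {1}).Nonempty
      · rcases B.mem_or_mem (c.isComponent_closure_locus h1) with g1 | g1
        · exact Or.inr ⟨fun h => (h0 h).elim, fun _ => g1⟩
        · exact Or.inl ⟨fun h => (h0 h).elim, fun _ => g1⟩
      · exact Or.inl ⟨fun h => (h0 h).elim, fun h => (h1 h).elim⟩
  rcases key with ⟨h0, h1⟩ | ⟨h0, h1⟩
  · exact ⟨⟨c, h0, h1⟩, rfl⟩
  · refine ⟨⟨c.rev, fun h => ?_, fun h => ?_⟩, rfl⟩
    · rw [c.locus_rev] at h ⊢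
      exact h1 h
    · rw [c.locus_rev] at h ⊢
      exact h0 h

namespace Chart

variable (c : Chart B)

theorem preimage_neg {N : Set 𝒟.X} (hN : N ∈ B.neg) (h : (c.e ⁻¹' N).Nonempty) :
    c.e ⁻¹' N = c.locus {0} := by
  obtain ⟨i, hi, hN'⟩ := c.exists_preimage_eq (B.isComponent_neg hN) h
  match i with
  | 0 => exact hi
  | 1 =>
    have := c.pos (hi ▸ h)
    rw [← hN'] at this
    exact (Set.disjoint_left.1 B.disjoint hN this).elim

theorem preimage_pos {N : Set 𝒟.X} (hN : N ∈ B.pos) (h : (c.e ⁻¹' N).Nonempty) :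
    c.e ⁻¹' N = c.locus {1} := by
  obtain ⟨i, hi, hN'⟩ := c.exists_preimage_eq (B.isComponent_pos hN) h
  match i with
  | 1 => exact hi
  | 0 =>
    have := c.neg (hi ▸ h)
    rw [← hN'] at this
    exact (Set.disjoint_left.1 B.disjoint this hN).elim

theorem mem_neg_iff {N : Set 𝒟.X} (hN : N ∈ B.neg) {u : Spec (.of c.A)} (hu : c.e u ∈ N)
    (w : Spec (.of c.A)) : c.e w ∈ N ↔ c.v 0 ∈ w.asIdeal := by
  have := Set.ext_iff.1 (c.preimage_neg hN ⟨u, hu⟩) w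
  simpa [PreChart.locus] using this

theorem mem_pos_iff {N : Set 𝒟.X} (hN : N ∈ B.pos) {u : Spec (.of c.A)} (hu : c.e u ∈ N)
    (w : Spec (.of c.A)) : c.e w ∈ N ↔ c.v 1 ∈ w.asIdeal := by
  have := Set.ext_iff.1 (c.preimage_pos hN ⟨u, hu⟩) w
  simpa [PreChart.locus] using this

theorem exists_neg {u : Spec (.of c.A)} (hu : c.v 0 ∈ u.asIdeal) : ∃ N ∈ B.neg, c.e u ∈ N := by
  have h : u ∈ c.locus {0} := fun i hi => hi ▸ hu
  exact ⟨_, c.neg ⟨u, h⟩, subset_closure ⟨u, h, rfl⟩⟩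

theorem exists_pos {u : Spec (.of c.A)} (hu : c.v 1 ∈ u.asIdeal) : ∃ N ∈ B.pos, c.e u ∈ N := by
  have h : u ∈ c.locus {1} := fun i hi => hi ▸ hu
  exact ⟨_, c.pos ⟨u, h⟩, subset_closure ⟨u, h, rfl⟩⟩

theorem mem_locus_univ (w : Spec (.of c.A)) :
    w ∈ c.locus Set.univ ↔ c.v 0 ∈ w.asIdeal ∧ c.v 1 ∈ w.asIdeal := by
  simp [PreChart.locus, Fin.forall_fin_two]

/-- On a chart meeting `D`, the intersection of source and target is `x = y = 0`, which is
irreducible. A component of the intersection that meets the chart must have all of it as its trace.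
-/
theorem mem_arrow_iff (D : Arrow B) {u : Spec (.of c.A)} (hu : c.e u ∈ D.locus)
    (w : Spec (.of c.A)) : c.e w ∈ D.locus ↔ c.v 0 ∈ w.asIdeal ∧ c.v 1 ∈ w.asIdeal := by
  have hs := D.locus_component.1.2 hu
  have h : c.e ⁻¹' (D.source ∩ D.target) = c.locus Set.univ := by
    ext w
    rw [mem_locus_univ, ← c.mem_neg_iff D.source_mem hs.1, ← c.mem_pos_iff D.target_mem hs.2]
    rfl
  have hsub : c.e ⁻¹' D.locus ⊆ c.locus Set.univ :=
    h ▸ Set.preimage_mono D.locus_component.1.2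
  have hcl : IsClosed (D.source ∩ D.target) :=
    ((B.isComponent_neg D.source_mem).isClosed 𝒟.isClosed_centralFibre).inter
      ((B.isComponent_pos D.target_mem).isClosed 𝒟.isClosed_centralFibre)
  have := (D.locus_component.preimage_eq c.isOpenEmbedding hcl
    (c.isIrreducible_locus Set.univ_nonempty ⟨u, hsub hu⟩) h.superset ⟨u, hu⟩ hsub).1
  rw [← mem_locus_univ, ← this]
  rfl

theorem exists_arrow {u : Spec (.of c.A)} (h0 : c.v 0 ∈ u.asIdeal) (h1 : c.v 1 ∈ u.asIdeal) :
    ∃ D : Arrow B, c.e u ∈ D.locus := by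
  obtain ⟨N, hN, hu⟩ := c.exists_neg h0
  obtain ⟨N', hN', hu'⟩ := c.exists_pos h1
  have h : c.e ⁻¹' (N ∩ N') = c.locus Set.univ := by
    ext w
    rw [mem_locus_univ, ← c.mem_neg_iff hN hu, ← c.mem_pos_iff hN' hu']
    rfl
  have hu2 : u ∈ c.locus Set.univ := (c.mem_locus_univ u).2 ⟨h0, h1⟩
  have hcl : IsClosed (N ∩ N') :=
    ((B.isComponent_neg hN).isClosed 𝒟.isClosed_centralFibre).inter
      ((B.isComponent_pos hN').isClosed 𝒟.isClosed_centralFibre)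
  refine ⟨⟨N, N', closure (c.e '' c.locus Set.univ), hN, hN', ?_⟩, subset_closure ⟨u, hu2, rfl⟩⟩
  refine IsComponent.closure_image c.isOpenEmbedding hcl ?_
  rw [h]
  exact ⟨⟨c.isIrreducible_locus Set.univ_nonempty ⟨u, hu2⟩, subset_rfl⟩, fun W hW _ => hW.2⟩

end Chart

end ExpDeg

end

/-! ### The local equation of the sources, and the existence of charts -/

noncomputable section

namespace ExpDeg

section Radical

theorem eq_of_isRadical_of_support_eq {X : Scheme.{u}} [IsAffine X] {I J : X.IdealSheafData}
    (hI : (I.ideal ⟨⊤, isAffineOpen_top X⟩).IsRadical)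
    (hJ : (J.ideal ⟨⊤, isAffineOpen_top X⟩).IsRadical) (h : I.support = J.support) : I = J := by
  have h1 : I.radical = I := Scheme.IdealSheafData.ext_of_isAffine hI.radical
  have h2 : J.radical = J := Scheme.IdealSheafData.ext_of_isAffine hJ.radical
  rw [← h1, ← h2, ← Scheme.IdealSheafData.vanishingIdeal_support, h,
    Scheme.IdealSheafData.vanishingIdeal_support]

theorem isRadical_vanishingIdeal {X : Scheme.{u}} (Z : TopologicalSpace.Closeds X)
    (U : X.affineOpens) : ((Scheme.IdealSheafData.vanishingIdeal Z).ideal U).IsRadical := by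
  rw [Scheme.IdealSheafData.vanishingIdeal_ideal]
  exact PrimeSpectrum.isRadical_vanishingIdeal _

theorem isRadical_map_of_bijective {A B : Type*} [CommRing A] [CommRing B] {f : A →+* B}
    (hf : Function.Bijective f) {I : Ideal A} (hI : I.IsRadical) : (I.map f).IsRadical := by
  have h := Ideal.map_radical_of_surjective hf.2 (I := I) (by
    rw [(RingHom.injective_iff_ker_eq_bot f).1 hf.1]
    exact bot_le)
  rw [hI.radical] at h
  exact Ideal.radical_eq_iff.1 h.symm

theorem isRadical_ideal_comap {X Y : Scheme.{u}} [IsAffine X] (f : X ⟶ Y) [IsOpenImmersion f]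
    (J : Y.IdealSheafData) (hJ : ∀ U, (J.ideal U).IsRadical) :
    ((J.comap f).ideal ⟨⊤, isAffineOpen_top X⟩).IsRadical := by
  have h : (⊤ : X.Opens) ≤ f ⁻¹ᵁ f.opensRange := by
    rw [Scheme.Hom.preimage_opensRange]
  rw [ideal_comap f J ⟨f.opensRange, isAffineOpen_opensRange f⟩ ⟨⊤, isAffineOpen_top X⟩ h]
  refine isRadical_map_of_bijective ?_ (hJ _)
  have h1 : IsIso (f.app f.opensRange) := f.isIso_app _ le_rfl
  have h2 : IsIso (homOfLE h) := ⟨homOfLE le_top, rfl, rfl⟩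
  have h3 : IsIso (f.appLE f.opensRange ⊤ h) := by
    rw [Scheme.Hom.appLE]
    infer_instance
  exact ConcreteCategory.bijective_of_isIso (f.appLE f.opensRange ⊤ h)

theorem mem_support_ofIdealTop_span_singleton {X : Scheme.{u}} (f : Γ(X, ⊤)) (x : X) :
    x ∈ (Scheme.IdealSheafData.ofIdealTop (Ideal.span {f})).support ↔ VanishesAt f x := by
  rw [← SetLike.mem_coe, Scheme.IdealSheafData.coe_support_ofIdealTop, Scheme.zeroLocus_span,
    Scheme.mem_zeroLocus_iff]
  simp [VanishesAt]

end Radical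

variable {k : Type u} [Field k] {𝒟 : Degeneration k} {B : BipartiteOrientation 𝒟}

theorem PreChart.isRadical_span (c : PreChart 𝒟) (i : Fin 2) :
    (Ideal.span {c.v i}).IsRadical := by
  by_cases h : i ∈ c.σ
  · have := c.isPrime {i} (Set.singleton_subset_iff.2 h) (Set.singleton_nonempty i)
    rw [Set.image_singleton] at this
    rcases this with h | h
    · exact h.isRadical
    · rw [h]
      exact fun _ _ => trivial
  · rw [c.coord.one i h, Ideal.span_singleton_one]
    exact fun _ _ => trivial

/-- Both ideals are radical, the second one because `x` generates a prime ideal or the unit ideal,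
and their supports agree because the sources have trace `x = 0` on the chart. -/
theorem Chart.comap_sourceIdeal (c : Chart B) :
    B.sourceIdeal.comap c.e =
      Scheme.IdealSheafData.ofIdealTop (Ideal.span {specFun c.A (c.v 0)}) := by
  refine eq_of_isRadical_of_support_eq
    (isRadical_ideal_comap c.e _ fun U => isRadical_vanishingIdeal _ U) ?_ ?_
  · rw [Scheme.IdealSheafData.ofIdealTop_ideal]
    have h : (Spec (.of c.A)).presheaf.map
      (homOfLE (le_top : (⊤ : (Spec (.of c.A)).Opens) ≤ ⊤)).op = 𝟙 _ :=
      (Spec (.of c.A)).presheaf.map_id _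
    have h' : ((Spec (.of c.A)).presheaf.map
      (homOfLE (le_top : (⊤ : (Spec (.of c.A)).Opens) ≤ ⊤)).op).hom = RingHom.id _ := by
      rw [h]
      rfl
    refine (congrArg Ideal.IsRadical (congrArg (fun l => Ideal.map l _) h')).mpr ?_
    rw [Ideal.map_id, ← Set.image_singleton, ← Ideal.map_span]
    exact isRadical_map_of_bijective (specFun_bijective c.A) (c.isRadical_span 0)
  · refine TopologicalSpace.Closeds.ext (Set.ext fun w => ?_)
    refine Iff.trans ?_ (mem_support_ofIdealTop_span_singleton _ w).symm
    rw [vanishesAt_specFun]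
    have h1 : (B.sourceIdeal.comap c.e).support = _ :=
      Scheme.IdealSheafData.support_comap (f := c.e) (I := B.sourceIdeal)
    rw [h1]
    change c.e w ∈ (B.sourceIdeal.support : Set 𝒟.X) ↔ _
    rw [BipartiteOrientation.sourceIdeal, Scheme.IdealSheafData.coe_support_vanishingIdeal]
    change w ∈ c.e ⁻¹' closure (⋃₀ B.neg) ↔ _
    rw [c.isOpenEmbedding.isOpenMap.preimage_closure_eq_closure_preimage
      c.isOpenEmbedding.continuous]
    have h2 : c.e ⁻¹' ⋃₀ B.neg = c.locus {0} := by
      ext w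
      constructor
      · rintro ⟨N, hN, hw⟩
        exact (c.preimage_neg hN ⟨w, hw⟩).subset hw
      · intro hw
        exact c.exists_neg (hw 0 rfl)
    rw [h2, (c.isClosed_locus _).closure_eq]
    simp [PreChart.locus]

section Existence

instance (𝒟 : Degeneration k) : CompactSpace 𝒟.X := by
  have := 𝒟.proper
  have := 𝒟.quasiCompact
  exact QuasiCompact.compactSpace_of_compactSpace (𝒟.π ≫ 𝒟.str)

/-- The functions `x, y` on a sufficiently small affine neighbourhood of a point of the
degeneration. -/
theorem exists_preChart_of_mem_centralFibre [IsAlgClosed k] {p : 𝒟.X} (hp : IsClosed {p})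
    (h0 : 𝒟.π p = 𝒟.zero) :
    ∃ c : PreChart 𝒟, ∃ w, c.e w = p ∧ ∀ i ∈ c.σ, c.v i ∈ w.asIdeal := by
  -- If `t ∉ 𝔪²`, then `t` is itself a coordinate and one takes `x = t`, `y = 1`. Otherwise the two
  -- factors of the germ are used, on an affine neighbourhood small enough for the product formula
  -- to hold.
  rcases 𝒟.normalCrossing p h0 with h | ⟨x, y, hxy, hli⟩
  · obtain ⟨U, hpU, -⟩ := exists_affineOpen (X := 𝒟.X) p (W := ⊤) trivial
    have hv : VanishesAt (𝒟.π.appTop 𝒟.t) p := (𝒟.mem_centralFibre_iff p).1 h0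
    rw [vanishesAt_iff] at hv
    obtain ⟨c, hc, w, hw, hcv⟩ := exists_preChart hp U.2 hpU (σ := {0}) (Set.singleton_nonempty 0)
      (v := ![𝒟.X.presheaf.map (homOfLE le_top).op (𝒟.π.appTop 𝒟.t), 1])
      (by
        intro i hi
        match i with
        | 0 => exact (hi rfl).elim
        | 1 => rfl)
      (by simp) (fun _ => ⟨_, hv⟩)
      (by
        rintro ⟨i, hi⟩
        obtain rfl : i = 0 := hi
        exact germ_res_top _ _ _ _)
      (by
        refine LinearIndependent.of_subsingleton ⟨0, rfl⟩ ?_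
        rw [Ne, Ideal.toCotangent_eq_zero]
        exact h)
    exact ⟨c, w, hw, by rwa [hc]⟩
  · obtain ⟨U, hpU, x', hx⟩ := 𝒟.X.presheaf.exists_germ_eq x.1
    obtain ⟨V, hpV, y', hy⟩ := 𝒟.X.presheaf.exists_germ_eq y.1
    have hpUV : p ∈ U ⊓ V := ⟨hpU, hpV⟩
    have h1 : 𝒟.X.presheaf.germ ⊤ p trivial (𝒟.π.appTop 𝒟.t) =
        𝒟.X.presheaf.germ (U ⊓ V) p hpUV
          (𝒟.X.presheaf.map (homOfLE inf_le_left).op x' *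
            𝒟.X.presheaf.map (homOfLE inf_le_right).op y') := by
      rw [hxy, map_mul]
      congr 1
      · exact ((𝒟.X.presheaf.germ_res_apply _ _ _ _).trans hx).symm
      · exact ((𝒟.X.presheaf.germ_res_apply _ _ _ _).trans hy).symm
    obtain ⟨W, hpW, iU, iV, h2⟩ := 𝒟.X.presheaf.germ_eq p _ _ _ _ h1
    obtain ⟨W', hpW', hW'⟩ := exists_affineOpen (X := 𝒟.X) p (W := W) hpW
    obtain ⟨c, hc, w, hw, hcv⟩ := exists_preChart hp W'.2 hpW' (σ := Set.univ) Set.univ_nonempty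
      (v := ![𝒟.X.presheaf.map (homOfLE (hW'.trans (iV.le.trans inf_le_left))).op x',
        𝒟.X.presheaf.map (homOfLE (hW'.trans (iV.le.trans inf_le_right))).op y'])
      (fun i hi => (hi trivial).elim)
      (by
        have := congrArg (𝒟.X.presheaf.map (homOfLE hW').op) h2
        simp only [map_mul] at this
        simp only [← CommRingCat.comp_apply (𝒟.X.presheaf.map _), ← Functor.map_comp,
          ← op_comp] at this
        exact this)
      (fun i => ![x, y] i)
      (by
        rintro ⟨i, -⟩
        match i with
        | 0 => exact (𝒟.X.presheaf.germ_res_apply _ _ _ _).trans hx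
        | 1 => exact (𝒟.X.presheaf.germ_res_apply _ _ _ _).trans hy)
      (by
        have := hli.comp (fun i : (Set.univ : Set (Fin 2)) => i.1) Subtype.val_injective
        convert this using 1
        funext i
        obtain ⟨i, -⟩ := i
        match i with
        | 0 => rfl
        | 1 => rfl)
    exact ⟨c, w, hw, by rwa [hc]⟩

theorem eq_spec_aeval {A : Type u} [CommRing A] [Algebra k A]
    (f : Spec (.of A) ⟶ Line (Spec (.of k))) (a : A)
    (h : f ≫ (Line (Spec (.of k)) ↘ Spec (.of k)) = Spec.map (CommRingCat.ofHom (algebraMap k A)))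
    (ha : f.appTop (AffineSpace.coord (Spec (.of k)) PUnit.unit) = specFun A a) :
    f ≫ (AffineSpace.SpecIso _ (.of k)).hom =
      Spec.map (CommRingCat.ofHom (MvPolynomial.aeval (R := k)
        (fun _ : PUnit.{u + 1} => a)).toRingHom) := by
  rw [← Iso.eq_comp_inv]
  refine AffineSpace.hom_ext ?_ fun i => ?_
  · rw [h, Category.assoc]
    simp only [AffineSpace.SpecIso_inv_over]
    rw [← Spec.map_comp]
    congr 1
    ext a
    simp
  · rw [ha, appTop_comp_apply, AffineSpace.SpecIso_inv_appTop_coord]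
    refine Eq.trans ?_ (appTop_specFun _ _).symm
    simp

theorem isCoord_of_smooth {A : Type u} [CommRing A] [Algebra k A]
    (f : Spec (.of A) ⟶ Line (Spec (.of k))) [Smooth f] (a : A)
    (h : f ≫ (Line (Spec (.of k)) ↘ Spec (.of k)) = Spec.map (CommRingCat.ofHom (algebraMap k A)))
    (ha : f.appTop (AffineSpace.coord (Spec (.of k)) PUnit.unit) = specFun A a) :
    IsCoord k {0} ![a, 1] where
  smooth := by
    have h1 : Smooth (f ≫ (AffineSpace.SpecIso _ (.of k)).hom) := inferInstance
    rw [eq_spec_aeval f a h ha, HasRingHomProperty.Spec_iff (P := @Smooth)] at h1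
    let E : ({0} : Set (Fin 2)) ≃ PUnit.{u + 1} :=
      ⟨fun _ => .unit, fun _ => ⟨0, rfl⟩, fun i => Subsingleton.elim _ _, fun _ => rfl⟩
    have : (MvPolynomial.aeval (R := k) fun i : ({0} : Set (Fin 2)) => ![a, 1] i.1).toRingHom =
        (MvPolynomial.aeval (R := k) (fun _ : PUnit.{u + 1} => a)).toRingHom.comp
          (MvPolynomial.renameEquiv k E).toAlgHom.toRingHom := by
      refine MvPolynomial.ringHom_ext (fun a => ?_) fun i => ?_
      · simp
      · obtain ⟨i, rfl⟩ := i
        simp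
    rw [this]
    exact RingHom.Smooth.comp (.of_bijective (MvPolynomial.renameEquiv k E).bijective) h1
  one i hi := by
    match i with
    | 0 => exact (hi rfl).elim
    | 1 => rfl
  nonempty := Set.singleton_nonempty 0

/-- Off the central fibre `π` is smooth, and the base is étale over the line, so `t` alone is a
smooth coordinate. It is invertible on a small chart, and with `x = t`, `y = 1` neither function
vanishes anywhere. -/
theorem exists_preChart_of_notMem_centralFibre {p : 𝒟.X} (h0 : 𝒟.π p ≠ 𝒟.zero) :
    ∃ c : PreChart 𝒟, p ∈ Set.range c.e ∧ ∀ (w : Spec (.of c.A)) (i), c.v i ∉ w.asIdeal := by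
  obtain ⟨U, hpU, hU⟩ := 𝒟.smooth_off p h0
  have hv : ¬ VanishesAt (𝒟.π.appTop 𝒟.t) p := fun h => h0 ((𝒟.mem_centralFibre_iff p).2 h)
  obtain ⟨V, hpV, hV⟩ := exists_affineOpen (X := 𝒟.X) p
    (W := U ⊓ 𝒟.X.basicOpen (𝒟.π.appTop 𝒟.t)) ⟨hpU, not_not.1 hv⟩
  have hVa : IsAffineOpen V.1 := V.2
  let _ := sectionAlgebra (𝒟.π ≫ 𝒟.str) hVa
  have := hVa.isOpenImmersion_fromSpec
  have hstr : hVa.fromSpec ≫ 𝒟.π ≫ 𝒟.str =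
      Spec.map (CommRingCat.ofHom (algebraMap k Γ(𝒟.X, V.1))) := (Spec.map_preimage _).symm
  have hr : Set.range hVa.fromSpec ⊆ Set.range U.ι := by
    rw [hVa.range_fromSpec, Scheme.Opens.range_ι]
    exact fun x hx => (hV hx).1
  have hsm : Smooth (hVa.fromSpec ≫ 𝒟.π) := by
    rw [← IsOpenImmersion.lift_fac U.ι hVa.fromSpec hr, Category.assoc]
    have : IsOpenImmersion (IsOpenImmersion.lift U.ι hVa.fromSpec hr) := by
      have : IsOpenImmersion (IsOpenImmersion.lift U.ι hVa.fromSpec hr ≫ U.ι) := by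
        rwa [IsOpenImmersion.lift_fac]
      exact .of_comp _ U.ι
    infer_instance
  have := 𝒟.etale
  have hcoord := isCoord_of_smooth (k := k) (A := Γ(𝒟.X, V.1))
    ((hVa.fromSpec ≫ 𝒟.π) ≫ toLine 𝒟.str 𝒟.t)
    (𝒟.X.presheaf.map (homOfLE le_top).op (𝒟.π.appTop 𝒟.t))
    (by rw [Category.assoc, toLine_comp_over, Category.assoc, hstr])
    (by rw [appTop_comp_apply, toLine_appTop_coord, appTop_comp_apply, fromSpec_appTop])
  have hvan : ∀ w : Spec Γ(𝒟.X, V.1),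
      𝒟.X.presheaf.map (homOfLE (le_top : V.1 ≤ ⊤)).op (𝒟.π.appTop 𝒟.t) ∉ w.asIdeal := by
    intro w hw
    have h1 := (vanishesAt_specFun (A := Γ(𝒟.X, V.1)) _ w).2 hw
    have h2 : VanishesAt (hVa.fromSpec.appTop (𝒟.π.appTop 𝒟.t)) w := by
      rw [fromSpec_appTop]
      exact h1
    rw [vanishesAt_appTop] at h2
    have h3 : hVa.fromSpec w ∈ (V.1 : Set 𝒟.X) := by
      rw [← hVa.range_fromSpec]
      exact ⟨w, rfl⟩
    exact h2 (hV h3).2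
  refine ⟨{
    A := Γ(𝒟.X, V.1)
    e := hVa.fromSpec
    e_str := hstr
    σ := {0}
    v := ![𝒟.X.presheaf.map (homOfLE le_top).op (𝒟.π.appTop 𝒟.t), 1]
    coord := hcoord
    param := ?_
    isPrime := ?_ }, ?_, ?_⟩
  · rw [ExpDeg.param, fromSpec_appTop]
    simp
  · intro S hS hne
    obtain rfl := Set.Nonempty.subset_singleton_iff hne |>.1 hS
    right
    rw [Set.image_singleton, Ideal.span_singleton_eq_top]
    by_contra hu
    obtain ⟨m, hm, hmem⟩ := exists_max_ideal_of_mem_nonunits hu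
    exact hvan ⟨m, hm.isPrime⟩ hmem
  · exact hVa.range_fromSpec.symm.subset hpV
  · intro w i
    match i with
    | 0 => exact hvan w
    | 1 => exact fun h => w.2.ne_top ((Ideal.eq_top_iff_one _).2 h)

/-- By quasi-compactness every point specializes to a closed point, and an open chart around the
latter contains the former. So only closed points have to be treated. -/
theorem exists_mem_range_chart [IsAlgClosed k] (B : BipartiteOrientation 𝒟) (x : 𝒟.X) :
    ∃ c : Chart B, x ∈ Set.range c.e := by
  obtain ⟨p, hp, hpc⟩ := IsClosed.exists_closed_singleton (isClosed_closure (s := {x}))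
    (Set.singleton_nonempty x).closure
  suffices ∃ c : Chart B, p ∈ Set.range c.e by
    obtain ⟨c, hc⟩ := this
    exact ⟨c, (specializes_iff_mem_closure.2 hp).mem_open c.isOpenEmbedding.isOpen_range hc⟩
  by_cases h0 : 𝒟.π p = 𝒟.zero
  · obtain ⟨c, w, hw, hv⟩ := exists_preChart_of_mem_centralFibre hpc h0
    obtain ⟨c', hc'⟩ := c.exists_chart B (by
      rintro ⟨u, hu⟩ ⟨u', hu'⟩
      exact ⟨w, fun i hi => hi ▸ hv 0 (c.mem_of_mem (hu 0 rfl)),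
        fun i hi => hi ▸ hv 1 (c.mem_of_mem (hu' 1 rfl))⟩)
    exact ⟨c', hc' ▸ ⟨w, hw⟩⟩
  · obtain ⟨c, hp, hv⟩ := exists_preChart_of_notMem_centralFibre h0
    obtain ⟨c', hc'⟩ := c.exists_chart B (by
      rintro ⟨u, hu⟩
      exact (hv u 0 (hu 0 rfl)).elim)
    exact ⟨c', hc' ▸ hp⟩

end Existence

end ExpDeg

end

/-! ### The charts of an expanded degeneration -/

noncomputable section

namespace ExpDeg

section ChartAlgebra

theorem map_mem_nonZeroDivisors_of_flat {S R : Type*} [CommRing S] [IsDomain S] [CommRing R]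
    {φ : S →+* R} (hφ : φ.Flat) {s : S} (hs : s ≠ 0) : φ s ∈ nonZeroDivisors R := by
  let _ := φ.toAlgebra
  have : Module.Flat S R := hφ
  have h := Module.Flat.isSMulRegular_of_nonZeroDivisors (M := R)
       (mem_nonZeroDivisors_of_ne_zero hs)
  refine mem_nonZeroDivisors_iff_right.2 fun a ha => h ?_
  change φ s * a = φ s * 0
  rw [mul_comm, ha, mul_zero]

namespace IsChartValue

variable {R : Type*} [CommRing R] {σ : Set (Fin 2)} {v : Fin 2 → R} {n j : ℕ} {t : ℕ → R}
  {c : Fin 2 → R}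

/-- With `tail_eq` this shows that all centres are principal on the `j`-th chart: the tail generates
the `i`-th one if `j ≤ i`, and `x` generates it if `i < j`. -/
theorem fst_eq (h : IsChartValue σ v n j t c) {i : ℕ} (hj : j ≤ i) (hi : i ≤ n + 1) :
    v 0 = (c 0 * ∏ m ∈ Finset.Icc (j + 1) i, t m) * tail t n i := by
  rw [h.fst, mul_assoc]
  congr 1
  simp only [← Finset.Ico_add_one_right_eq_Icc, tail]
  exact (Finset.prod_Ico_consecutive t (by omega) (by omega)).symm

theorem tail_eq (h : IsChartValue σ v n j t c) {i : ℕ} (hij : i < j) (hj : j ≤ n + 1) :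
    tail t n i = v 0 * (c 1 * ∏ m ∈ Finset.Ico (i + 1) j, t m) := by
  have h1 : tail t n i = (∏ m ∈ Finset.Ico (i + 1) j, t m) * (t j * tail t n j) := by
    simp only [← Finset.Ico_add_one_right_eq_Icc, tail]
    rw [← Finset.prod_Ico_consecutive t (show i + 1 ≤ j by omega) (show j ≤ n + 1 + 1 by omega),
      Finset.prod_eq_prod_Ico_succ_bot (show j < n + 1 + 1 by omega)]
  rw [h1, h.mul, h.fst]
  ring

theorem prod_eq (h : IsChartValue σ v n j t c) (h1 : 1 ≤ j) (hj : j ≤ n + 1) :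
    ∏ m ∈ Finset.Icc 1 (n + 1), t m = v 0 * v 1 := by
  have := h.tail_eq (i := 0) (by omega) hj
  rw [h.snd]
  exact this

theorem comp (h : IsChartValue σ v n j t c) {R' : Type*} [CommRing R'] (f : R →+* R') :
    IsChartValue σ (fun i => f (v i)) n j (fun i => f (t i)) fun i => f (c i) where
  mul := by rw [h.mul, map_mul]
  fst := by rw [h.fst, map_mul, map_prod]
  snd := by rw [h.snd, map_mul, map_prod]
  one i hi := by rw [h.one i hi, map_one]

theorem c_unique {c' : Fin 2 → R} (h : IsChartValue σ v n j t c) (h' : IsChartValue σ v n j t c')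
    (h1 : 1 ≤ j) (hj : j ≤ n + 1) (ht : tail t n j ∈ nonZeroDivisors R)
    (hv : v 0 ∈ nonZeroDivisors R) (i : Fin 2) : c i = c' i := by
  match i with
  | 0 =>
    refine (mul_cancel_right_mem_nonZeroDivisors ht).1 ?_
    exact h.fst.symm.trans h'.fst
  | 1 =>
    refine (mul_cancel_left_mem_nonZeroDivisors hv).1 ?_
    have e1 := h.tail_eq (i := j - 1) (by omega) hj
    have e2 := h'.tail_eq (i := j - 1) (by omega) hj
    rw [Nat.sub_add_cancel h1, Finset.Ico_self, Finset.prod_empty, mul_one] at e1 e2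
    exact e1.symm.trans e2

/-- The values of the coordinates `xⱼ` and `yⱼ` are determined by two divisibilities. -/
theorem of_eq (h1 : 1 ≤ j) (hj : j ≤ n + 1) (ht : tail t n j ∈ nonZeroDivisors R)
    (hv : v 0 ∈ nonZeroDivisors R) (hprod : ∏ m ∈ Finset.Icc 1 (n + 1), t m = v 0 * v 1)
    (e0 : v 0 = tail t n j * c 0) (e1 : tail t n (j - 1) = v 0 * c 1)
    (hσ0 : 0 ∉ σ → j = n + 1) (hσ1 : 1 ∉ σ → j = 1) (hσ : ∀ i ∉ σ, v i = 1) :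
    IsChartValue σ v n j t c where
  mul := by
    have h2 : tail t n (j - 1) = t j * tail t n j := by
      simp only [← Finset.Ico_add_one_right_eq_Icc, tail]
      rw [Nat.sub_add_cancel h1, Finset.prod_eq_prod_Ico_succ_bot (show j < n + 1 + 1 by omega)]
    refine (mul_cancel_right_mem_nonZeroDivisors ht).1 ?_
    rw [← h2, e1]
    nth_rewrite 1 [e0]
    ring
  fst := e0.trans (mul_comm _ _)
  snd := by
    refine (mul_cancel_left_mem_nonZeroDivisors hv).1 ?_
    rw [← hprod, ← mul_assoc, ← e1, ← tail_mul t (show j - 1 ≤ n + 1 by omega), mul_comm]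
    congr 1
  one i hi := by
    match i with
    | 0 =>
      rw [hσ 0 hi, hσ0 hi, tail, Finset.Icc_eq_empty (by omega), Finset.prod_empty, one_mul] at e0
      exact e0.symm
    | 1 =>
      refine (mul_cancel_left_mem_nonZeroDivisors hv).1 ?_
      rw [← e1, hσ1 hi, mul_one]
      rw [hσ 1 hi, mul_one] at hprod
      exact hprod

end IsChartValue

namespace ChartRing

variable {k : Type u} [Field k] {A : Type u} [CommRing A] [Algebra k A] {σ : Set (Fin 2)}
  {v : Fin 2 → A} {n j : ℕ} (R : ChartRing k σ v n j)

theorem c_mem_nonZeroDivisors (i : Fin 2) : R.c i ∈ nonZeroDivisors R.R := by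
  by_cases hi : i ∈ σ
  · rw [← R.β_inl ⟨i, hi⟩]
    exact map_mem_nonZeroDivisors_of_flat R.smooth.flat (MvPolynomial.X_ne_zero _)
  · rw [R.isValue.one i hi]
    exact one_mem _

theorem t_mem_nonZeroDivisors {i : ℕ} (hi : i ∈ Finset.Icc 1 (n + 1)) :
    R.t i ∈ nonZeroDivisors R.R := by
  by_cases hij : i = j
  · rw [hij, R.isValue.mul]
    exact mul_mem (R.c_mem_nonZeroDivisors 0) (R.c_mem_nonZeroDivisors 1)
  · rw [← R.β_inr ⟨i, hi, hij⟩]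
    exact map_mem_nonZeroDivisors_of_flat R.smooth.flat (MvPolynomial.X_ne_zero _)

theorem tail_mem_nonZeroDivisors (i : ℕ) : tail R.t n i ∈ nonZeroDivisors R.R :=
  prod_mem fun m hm => R.t_mem_nonZeroDivisors (by
    rw [Finset.mem_Icc] at hm ⊢
    omega)

theorem fst_mem_nonZeroDivisors : R.α (v 0) ∈ nonZeroDivisors R.R := by
  rw [R.isValue.fst]
  exact mul_mem (R.c_mem_nonZeroDivisors 0) (R.tail_mem_nonZeroDivisors j)

end ChartRing

end ChartAlgebra

variable {k : Type u} [Field k] {𝒟 : Degeneration k} {B : BipartiteOrientation 𝒟}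

section Divisibility

variable (B) {T S : Scheme.{u}}

/-- The stalk of the pullback of the ideal sheaf of the sources. -/
abbrev sourceStalk (h : T ⟶ 𝒟.X) (z : T) : Ideal (T.presheaf.stalk z) :=
  stalkIdeal (B.sourceIdeal.comap h) z

/-- The function `t_{i+1} ⋯ t_{n+1}` divides the equations of the sources. -/
def TailDvd (h : T ⟶ 𝒟.X) (τ : ℕ → Γ(T, ⊤)) (n i : ℕ) (z : T) : Prop :=
  sourceStalk B h z ≤ Ideal.span {toStalk z (tail τ n i)}

/-- The equation of the sources divides the function `t_{i+1} ⋯ t_{n+1}`. -/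
def SourceDvd (h : T ⟶ 𝒟.X) (τ : ℕ → Γ(T, ⊤)) (n i : ℕ) (z : T) : Prop :=
  toStalk z (tail τ n i) ∈ sourceStalk B h z

variable {B}

theorem appTop_tail (g : T ⟶ S) (τ : ℕ → Γ(S, ⊤)) (n i : ℕ) :
    g.appTop (tail τ n i) = tail (fun m => g.appTop (τ m)) n i := map_prod _ _ _

theorem sourceStalk_comp (g : T ⟶ S) (h : S ⟶ 𝒟.X) (z : T) :
    sourceStalk B (g ≫ h) z = (sourceStalk B h (g z)).map (g.stalkMap z).hom := by
  rw [sourceStalk, Scheme.IdealSheafData.comap_comp, stalkIdeal_comap]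

theorem mem_map_of_bijective {R R' : Type*} [CommRing R] [CommRing R'] {f : R →+* R'}
    (hf : Function.Bijective f) (I : Ideal R) (a : R) : f a ∈ I.map f ↔ a ∈ I := by
  refine ⟨fun h => ?_, Ideal.mem_map_of_mem f⟩
  obtain ⟨b, hb, hab⟩ := (Ideal.mem_map_iff_of_surjective f hf.2).1 h
  rwa [← hf.1 hab]

theorem map_le_map_of_bijective {R R' : Type*} [CommRing R] [CommRing R'] {f : R →+* R'}
    (hf : Function.Bijective f) (I J : Ideal R) : I.map f ≤ J.map f ↔ I ≤ J :=
  ⟨fun h a ha => (mem_map_of_bijective hf J a).1 (h (Ideal.mem_map_of_mem f ha)), Ideal.map_mono⟩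

theorem stalkMap_bijective (g : T ⟶ S) [IsOpenImmersion g] (z : T) :
    Function.Bijective (g.stalkMap z).hom :=
  ConcreteCategory.bijective_of_isIso (g.stalkMap z)

theorem tailDvd_comp (g : T ⟶ S) [IsOpenImmersion g] (h : S ⟶ 𝒟.X) (τ : ℕ → Γ(S, ⊤)) (n i : ℕ)
    (z : T) :
    TailDvd B (g ≫ h) (fun m => g.appTop (τ m)) n i z ↔ TailDvd B h τ n i (g z) := by
  rw [TailDvd, TailDvd, sourceStalk_comp, ← appTop_tail, ← stalkMap_toStalk,
    ← map_le_map_of_bijective (stalkMap_bijective g z), Ideal.map_span, Set.image_singleton]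

theorem sourceDvd_comp (g : T ⟶ S) [IsOpenImmersion g] (h : S ⟶ 𝒟.X) (τ : ℕ → Γ(S, ⊤)) (n i : ℕ)
    (z : T) :
    SourceDvd B (g ≫ h) (fun m => g.appTop (τ m)) n i z ↔ SourceDvd B h τ n i (g z) := by
  rw [SourceDvd, SourceDvd, sourceStalk_comp, ← appTop_tail, ← stalkMap_toStalk,
    mem_map_of_bijective (stalkMap_bijective g z)]

theorem Chart.sourceStalk_eq (c : Chart B) (d : T ⟶ Spec (.of c.A)) (z : T) :
    sourceStalk B (d ≫ c.e) z = Ideal.span {toStalk z (d.appTop (specFun c.A (c.v 0)))} := by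
  rw [sourceStalk, Scheme.IdealSheafData.comap_comp, c.comap_sourceIdeal,
    comap_ofIdealTop_span_singleton, stalkIdeal_ofIdealTop, Ideal.map_span, Set.image_singleton]

theorem Chart.tailDvd_iff (c : Chart B) (d : T ⟶ Spec (.of c.A)) (τ : ℕ → Γ(T, ⊤)) (n i : ℕ)
    (z : T) : TailDvd B (d ≫ c.e) τ n i z ↔
      toStalk z (tail τ n i) ∣ toStalk z (d.appTop (specFun c.A (c.v 0))) := by
  rw [TailDvd, c.sourceStalk_eq, Ideal.span_singleton_le_span_singleton]

theorem Chart.sourceDvd_iff (c : Chart B) (d : T ⟶ Spec (.of c.A)) (τ : ℕ → Γ(T, ⊤)) (n i : ℕ)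
    (z : T) : SourceDvd B (d ≫ c.e) τ n i z ↔
      toStalk z (d.appTop (specFun c.A (c.v 0))) ∣ toStalk z (tail τ n i) := by
  rw [SourceDvd, c.sourceStalk_eq, Ideal.mem_span_singleton]

/-- Dividing by the regular generator `f`, the cofactors of `a` and `b` generate the unit ideal. In
a local ring one of them is a unit, and the corresponding element divides the other. -/
theorem dvd_or_dvd_of_span_eq {R : Type*} [CommRing R] [IsLocalRing R] {a b f : R}
    (hf : f ∈ nonZeroDivisors R) (h : Ideal.span {a} ⊔ Ideal.span {b} = Ideal.span {f}) :
    a ∣ b ∨ b ∣ a := by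
  have ha : a ∈ Ideal.span {f} := h ▸ Ideal.mem_sup_left (Ideal.mem_span_singleton_self a)
  have hb : b ∈ Ideal.span {f} := h ▸ Ideal.mem_sup_right (Ideal.mem_span_singleton_self b)
  have hf' : f ∈ Ideal.span {a} ⊔ Ideal.span {b} := h ▸ Ideal.mem_span_singleton_self f
  obtain ⟨a', rfl⟩ := Ideal.mem_span_singleton.1 ha
  obtain ⟨b', rfl⟩ := Ideal.mem_span_singleton.1 hb
  rw [← Ideal.span_union, Set.singleton_union] at hf'
  obtain ⟨u, w, huw⟩ := Ideal.mem_span_pair.1 hf'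
  have h1 : u * a' + w * b' = 1 := by
    refine (mul_cancel_left_mem_nonZeroDivisors hf).1 ?_
    linear_combination huw
  rcases IsLocalRing.isUnit_or_isUnit_of_add_one h1 with h2 | h2
  · exact Or.inl (mul_dvd_mul_left f ((isUnit_of_mul_isUnit_right h2).dvd))
  · exact Or.inr (mul_dvd_mul_left f ((isUnit_of_mul_isUnit_right h2).dvd))

/-- Divisibility of germs of generators of an invertible ideal descends along local
homomorphisms. -/
theorem dvd_of_map_dvd {R R' : Type*} [CommRing R] [CommRing R'] {φ : R →+* R'} [IsLocalHom φ]
    {a b : R} (hab : a ∣ b ∨ b ∣ a) (hφa : φ a ∈ nonZeroDivisors R') (h : φ a ∣ φ b) : a ∣ b := by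
  refine hab.elim id ?_
  rintro ⟨c, rfl⟩
  obtain ⟨d, hd⟩ := h
  rw [map_mul] at hφa hd
  have h1 : φ c * d = 1 := by
    refine (mul_cancel_left_mem_nonZeroDivisors (mul_mem_nonZeroDivisors.1 hφa).1).1 ?_
    rw [mul_one, ← mul_assoc]
    exact hd.symm
  have h2 : IsUnit c := isUnit_of_map_unit φ c (IsUnit.of_mul_eq_one _ h1)
  exact h2.mul_right_dvd.2 dvd_rfl

theorem isOpen_toStalk_dvd (a b : Γ(T, ⊤)) : IsOpen {z : T | toStalk z a ∣ toStalk z b} := by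
  rw [isOpen_iff_forall_mem_open]
  rintro z ⟨c, hc⟩
  obtain ⟨U, hzU, c', rfl⟩ := T.presheaf.exists_germ_eq c
  rw [← germ_res_top U z hzU, ← germ_res_top U z hzU, ← map_mul] at hc
  obtain ⟨W, hzW, iU, iV, h⟩ := T.presheaf.germ_eq z _ _ _ _ hc
  refine ⟨W, fun w hw => ?_, W.2, hzW⟩
  refine ⟨T.presheaf.germ U w (iU.le hw) c', ?_⟩
  have h1 : T.presheaf.germ U w (iU.le hw) (T.presheaf.map (homOfLE le_top).op b) =
      T.presheaf.germ U w (iU.le hw) (T.presheaf.map (homOfLE le_top).op a * c') :=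
    (T.presheaf.germ_res_apply iU w hw _).symm.trans
      ((congrArg (T.presheaf.germ W w hw) h).trans (T.presheaf.germ_res_apply iV w hw _))
  rw [map_mul, germ_res_top, germ_res_top] at h1
  exact h1

end Divisibility

theorem specFun_mem_nonZeroDivisors {A : Type u} [CommRing A] {a : A} (ha : a ∈ nonZeroDivisors A)
    (z : Spec (.of A)) :
    toStalk z (specFun A a) ∈ nonZeroDivisors ((Spec (.of A)).presheaf.stalk z) :=
  germ_mem_nonZeroDivisors ⟨⊤, isAffineOpen_top _⟩ (f := specFun A a)
    (mem_nonZeroDivisors_iff_right.2 fun b hb => by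
      obtain ⟨b, rfl⟩ := (specFun_bijective A).2 b
      rw [← map_mul, map_eq_zero_iff _ (specFun_bijective A).1] at hb
      rw [mem_nonZeroDivisors_iff_right.1 ha b hb, map_zero]) z trivial

theorem isInvertible_ofIdealTop_specFun {A : Type u} [CommRing A] {a : A}
    (ha : a ∈ nonZeroDivisors A) :
    IsInvertible (Scheme.IdealSheafData.ofIdealTop (X := Spec (.of A))
      (Ideal.span {specFun A a})) := by
  intro z
  obtain ⟨U, hz, -⟩ := exists_affineOpen z (W := ⊤) trivial
  refine ⟨U, hz, (Spec (.of A)).presheaf.map (homOfLE le_top).op (specFun A a), ?_, ?_⟩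
  · refine mem_nonZeroDivisors_of_germ fun x hx => ?_
    rw [germ_res_top]
    exact specFun_mem_nonZeroDivisors ha x
  · rw [Scheme.IdealSheafData.ofIdealTop_ideal, Ideal.map_span, Set.image_singleton]

namespace ChartRing

variable {c : Chart B} {n j : ℕ} (R : ChartRing k c.σ c.v n j)

/-- The structure morphism of the spectrum of a chart ring. -/
abbrev proj : Spec (.of R.R) ⟶ 𝒟.X := Spec.map (CommRingCat.ofHom R.α) ≫ c.e

/-- The coordinate functions on the spectrum of a chart ring. -/
abbrev coord (i : ℕ) : Γ(Spec (.of R.R), ⊤) := specFun R.R (R.t i)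

theorem tail_coord (i : ℕ) : tail R.coord n i = specFun R.R (tail R.t n i) :=
  (map_prod _ _ _).symm

theorem centreIdeal_eq (a : R.R) : centreIdeal B R.proj (specFun R.R a) =
    Scheme.IdealSheafData.ofIdealTop
      (Ideal.span {specFun R.R (R.α (c.v 0)), specFun R.R a}) := by
  rw [centreIdeal, Scheme.IdealSheafData.comap_comp, c.comap_sourceIdeal,
    comap_ofIdealTop_span_singleton, appTop_specFun]
  refine idealSheaf_ext fun z => ?_
  rw [stalkIdeal_sup, stalkIdeal_ofIdealTop, stalkIdeal_ofIdealTop, stalkIdeal_ofIdealTop,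
    ← Ideal.map_sup, ← Ideal.span_union, Set.singleton_union]

theorem isAdmissible (hj : IsChartIndex c.σ n j) : IsAdmissible B n R.proj R.coord where
  prod := by
    rw [param_comp, c.param, appTop_specFun, ← map_prod, R.isValue.prod_eq hj.one_le hj.le,
      ← map_mul]
  invertible i hi := by
    rw [Finset.mem_Icc] at hi
    rw [tail_coord, R.centreIdeal_eq]
    rcases lt_or_ge i j with hij | hij
    · have : Ideal.span {specFun R.R (R.α (c.v 0)), specFun R.R (tail R.t n i)} =
          Ideal.span {specFun R.R (R.α (c.v 0))} := by
        rw [R.isValue.tail_eq hij hj.le, map_mul]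
        refine Ideal.span_pair_eq_span_left_iff_dvd.2 (Dvd.intro _ rfl)
      rw [this]
      exact isInvertible_ofIdealTop_specFun R.fst_mem_nonZeroDivisors
    · have : Ideal.span {specFun R.R (R.α (c.v 0)), specFun R.R (tail R.t n i)} =
          Ideal.span {specFun R.R (tail R.t n i)} := by
        rw [R.isValue.fst_eq hij (by omega), map_mul]
        refine Ideal.span_pair_eq_span_right_iff_dvd.2 (Dvd.intro_left _ rfl)
      rw [this]
      exact isInvertible_ofIdealTop_specFun (R.tail_mem_nonZeroDivisors i)

end ChartRing

namespace IsUniversal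

variable {S : Scheme.{u}} {p : S ⟶ 𝒟.X} {t : ℕ → Γ(S, ⊤)} {n : ℕ}

theorem admissible_comp (h : IsUniversal B n p t) {T : Scheme.{u}} (g : T ⟶ S)
    (hg : ∀ z, toStalk z (param (g ≫ p)) ∈ nonZeroDivisors (T.presheaf.stalk z)) :
    IsAdmissible B n (g ≫ p) fun i => g.appTop (t i) where
  prod := by rw [← map_prod, h.admissible.prod, param_comp]
  invertible i hi := by
    rw [← appTop_tail]
    exact (h.admissible.invertible i hi).centreIdeal_comap
      (h.admissible.tail_dvd (by rw [Finset.mem_Icc] at hi; omega)) g hg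

/-- Regularity of the parameter on `T` makes the datum pulled back along `g` admissible, and only
then does the uniqueness clause apply. -/
theorem hom_ext (h : IsUniversal B n p t) {T : Scheme.{u}} {g g' : T ⟶ S}
    (hg : ∀ z, toStalk z (param (g ≫ p)) ∈ nonZeroDivisors (T.presheaf.stalk z))
    (hp : g ≫ p = g' ≫ p)
    (ht : ∀ i ∈ Finset.Icc 1 (n + 1), g.appTop (t i) = g'.appTop (t i)) : g = g' :=
  (h.existsUnique _ _ (h.admissible_comp g hg)).unique ⟨rfl, fun _ _ => rfl⟩
    ⟨hp.symm, fun i hi => (ht i hi).symm⟩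

end IsUniversal

/-- An affine chart of an expanded degeneration. -/
structure ExpChart (B : BipartiteOrientation 𝒟) (n : ℕ) {S : Scheme.{u}} (p : S ⟶ 𝒟.X)
    (t : ℕ → Γ(S, ⊤)) where
  /-- the chart of `X` -/
  c : Chart B
  /-- the index of the chart -/
  j : ℕ
  isChartIndex : IsChartIndex c.σ n j
  /-- the coordinate ring -/
  R : ChartRing k c.σ c.v n j
  /-- the chart -/
  ι : Spec (.of R.R) ⟶ S
  [isOpenImmersion : IsOpenImmersion ι]
  ι_proj : ι ≫ p = R.proj
  ι_coord : ∀ i ∈ Finset.Icc 1 (n + 1), ι.appTop (t i) = R.coord i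
  mem_range : ∀ q, p q ∈ Set.range c.e → TailDvd B p t n j q → SourceDvd B p t n (j - 1) q →
    q ∈ Set.range ι

attribute [instance] ExpChart.isOpenImmersion

section Construction

variable {S : Scheme.{u}} {p : S ⟶ 𝒟.X} {t : ℕ → Γ(S, ⊤)} {n : ℕ}

/-- For `1 ≤ i ≤ n` this is invertibility of the centre. At the two ends it is automatic: the tail
is `x * y` for `i = 0`, and an empty product for `i = n + 1`. -/
theorem IsAdmissible.dvd_or_dvd {T : Scheme.{u}} (c : Chart B) (d : T ⟶ Spec (.of c.A))
    {τ : ℕ → Γ(T, ⊤)} (hτ : IsAdmissible B n (d ≫ c.e) τ) {i : ℕ} (hi : i ≤ n + 1) (z : T) :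
    toStalk z (tail τ n i) ∣ toStalk z (d.appTop (specFun c.A (c.v 0))) ∨
      toStalk z (d.appTop (specFun c.A (c.v 0))) ∣ toStalk z (tail τ n i) := by
  rcases Nat.eq_zero_or_pos i with rfl | h0
  · right
    have h1 : tail τ n 0 = param (d ≫ c.e) := hτ.prod
    rw [h1, param_comp, c.param, map_mul, map_mul, map_mul]
    exact Dvd.intro _ rfl
  rcases hi.lt_or_eq with h1 | rfl
  · obtain ⟨f, hf, hJ⟩ := exists_stalkIdeal_eq_span
      (hτ.invertible i (Finset.mem_Icc.2 ⟨h0, by omega⟩)) z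
    rw [stalkIdeal_sup, stalkIdeal_ofIdealTop, Ideal.map_span, Set.image_singleton] at hJ
    have h2 : sourceStalk B (d ≫ c.e) z ⊔ _ = _ := hJ
    rw [c.sourceStalk_eq] at h2
    exact (dvd_or_dvd_of_span_eq hf h2).symm
  · left
    rw [tail, Finset.Icc_eq_empty (by omega), Finset.prod_empty, map_one]
    exact one_dvd _

theorem exists_hom_specFun {T : Scheme.{u}} {A : Type u} [CommRing A] (f : A →+* Γ(T, ⊤)) :
    ∃ g : T ⟶ Spec (.of A), ∀ a, g.appTop (specFun A a) = f a := by
  refine ⟨T.toSpecΓ ≫ Spec.map (CommRingCat.ofHom f), fun a => ?_⟩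
  rw [appTop_comp_apply, appTop_specFun, Scheme.toSpecΓ_appTop]
  exact congrArg (fun l => l.hom (f a)) (Scheme.ΓSpecIso Γ(T, ⊤)).inv_hom_id

theorem hom_ext_specFun {T : Scheme.{u}} {A : Type u} [CommRing A] {g g' : T ⟶ Spec (.of A)}
    (h : ∀ a, g.appTop (specFun A a) = g'.appTop (specFun A a)) : g = g' := by
  refine ext_of_isAffine ?_
  ext a
  obtain ⟨a, rfl⟩ := (specFun_bijective A).2 a
  exact h a

variable (h : IsUniversal B n p t) (c : Chart B)

/-- The part of a scheme over `X` that lies over a chart. -/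
abbrev Chart.preimage (p : S ⟶ 𝒟.X) : S.Opens := p ⁻¹ᵁ c.e.opensRange

/-- The morphism to a chart. -/
def Chart.lift (p : S ⟶ 𝒟.X) : (c.preimage p).toScheme ⟶ Spec (.of c.A) :=
  IsOpenImmersion.lift c.e ((c.preimage p).ι ≫ p) (by
    rintro _ ⟨z, rfl⟩
    exact z.2)

theorem Chart.lift_comp (p : S ⟶ 𝒟.X) : c.lift p ≫ c.e = (c.preimage p).ι ≫ p :=
  IsOpenImmersion.lift_fac _ _ _

theorem toStalk_fst_mem {T : Scheme.{u}} (d : T ⟶ Spec (.of c.A)) (z : T)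
    (hz : toStalk z (param (d ≫ c.e)) ∈ nonZeroDivisors (T.presheaf.stalk z)) :
    toStalk z (d.appTop (specFun c.A (c.v 0))) ∈ nonZeroDivisors (T.presheaf.stalk z) := by
  rw [param_comp, c.param, map_mul, map_mul, map_mul] at hz
  exact (mul_mem_nonZeroDivisors.1 hz).1

include h in
theorem IsUniversal.regular_comp {T : Scheme.{u}} (g : T ⟶ S) [Flat g] (z : T) :
    toStalk z (param (g ≫ p)) ∈ nonZeroDivisors (T.presheaf.stalk z) := by
  rw [param_comp]
  exact toStalk_mem_nonZeroDivisors_of_flat g _ z (h.regular _)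

include h in
theorem tailDvd_or_sourceDvd {i : ℕ} (hi : i ≤ n + 1) (q : S) (hq : p q ∈ Set.range c.e) :
    TailDvd B p t n i q ∨ SourceDvd B p t n i q := by
  obtain ⟨q, rfl⟩ : q ∈ Set.range (c.preimage p).ι := by
    rw [Scheme.Opens.range_ι]
    exact hq
  have ha := h.admissible_comp (c.preimage p).ι (h.regular_comp (c.preimage p).ι)
  rw [← c.lift_comp] at ha
  rw [← tailDvd_comp, ← sourceDvd_comp, ← c.lift_comp, c.tailDvd_iff, c.sourceDvd_iff]
  exact ha.dvd_or_dvd c (c.lift p) hi q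

include h in
theorem sourceDvd_zero (q : S) (hq : p q ∈ Set.range c.e) : SourceDvd B p t n 0 q := by
  obtain ⟨q, rfl⟩ : q ∈ Set.range (c.preimage p).ι := by
    rw [Scheme.Opens.range_ι]
    exact hq
  rw [← sourceDvd_comp, ← c.lift_comp, c.sourceDvd_iff, ← appTop_tail, tail, zero_add,
    h.admissible.prod, ← param_comp, ← c.lift_comp, param_comp, c.param, map_mul, map_mul, map_mul]
  exact Dvd.intro _ rfl

theorem mem_nonZeroDivisors_of_toStalk {T : Scheme.{u}} {a : Γ(T, ⊤)}
    (ha : ∀ z, toStalk z a ∈ nonZeroDivisors (T.presheaf.stalk z)) :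
    a ∈ nonZeroDivisors Γ(T, ⊤) :=
  mem_nonZeroDivisors_of_germ fun x _ => ha x

/-- A morphism to the `j`-th chart, constructed from the divisibilities that describe it. -/
theorem ChartRing.exists_hom {c : Chart B} {j : ℕ} (hj : IsChartIndex c.σ n j)
    (R : ChartRing k c.σ c.v n j) {T : Scheme.{u}} (d : T ⟶ Spec (.of c.A)) {τ : ℕ → Γ(T, ⊤)}
    (hτ : IsAdmissible B n (d ≫ c.e) τ)
    (hr : ∀ z, toStalk z (param (d ≫ c.e)) ∈ nonZeroDivisors (T.presheaf.stalk z))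
    (h0 : ∀ z, toStalk z (tail τ n j) ∣ toStalk z (d.appTop (specFun c.A (c.v 0))))
    (h1 : ∀ z, toStalk z (d.appTop (specFun c.A (c.v 0))) ∣ toStalk z (tail τ n (j - 1))) :
    ∃ g : T ⟶ Spec (.of R.R), g ≫ Spec.map (CommRingCat.ofHom R.α) = d ∧
      ∀ i ∈ Finset.Icc 1 (n + 1), g.appTop (R.coord i) = τ i := by
  have ht : ∀ z, toStalk z (tail τ n j) ∈ nonZeroDivisors (T.presheaf.stalk z) := fun z => by
    have h1 := hr z
    rw [← hτ.prod, ← tail_mul τ hj.le, map_mul] at h1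
    exact (mul_mem_nonZeroDivisors.1 h1).2
  have hv := fun z => toStalk_fst_mem c d z (hr z)
  obtain ⟨c0, hc0⟩ := exists_eq_mul_of_germ ht h0
  obtain ⟨c1, hc1⟩ := exists_eq_mul_of_germ hv h1
  let f : c.A →+* Γ(T, ⊤) := d.appTop.hom.comp (specFun c.A)
  have hval : IsChartValue c.σ (fun i => f (c.v i)) n j τ ![c0, c1] := by
    refine .of_eq hj.one_le hj.le (mem_nonZeroDivisors_of_toStalk ht)
      (mem_nonZeroDivisors_of_toStalk hv) ?_ hc0 hc1 hj.fst hj.snd fun i hi => ?_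
    · rw [hτ.prod, param_comp, c.param, map_mul, map_mul]
      rfl
    · rw [c.coord.one i hi, map_one]
  obtain ⟨l, hl, hlt, -⟩ := R.exists_lift f τ _ hval
  obtain ⟨g, hg⟩ := exists_hom_specFun l
  refine ⟨g, hom_ext_specFun fun a => ?_, fun i hi => ?_⟩
  · rw [appTop_comp_apply, appTop_specFun, hg]
    exact RingHom.congr_fun hl a
  · rw [hg, hlt i hi]

/-- The functions `x_j` and `y_j` are quotients by regular elements of functions that `g` fixes, so
they are fixed too, and `R` is determined by its coordinates. -/
theorem ChartRing.hom_eq_id {c : Chart B} {j : ℕ} (hj : IsChartIndex c.σ n j)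
    (R : ChartRing k c.σ c.v n j) (g : Spec (.of R.R) ⟶ Spec (.of R.R))
    (hg : g ≫ Spec.map (CommRingCat.ofHom R.α) = Spec.map (CommRingCat.ofHom R.α))
    (hgt : ∀ i ∈ Finset.Icc 1 (n + 1), g.appTop (R.coord i) = R.coord i) : g = 𝟙 _ := by
  let ρ : R.R →+* Γ(Spec (.of R.R), ⊤) := g.appTop.hom.comp (specFun R.R)
  have hα : ∀ a, ρ (R.α a) = specFun R.R (R.α a) := fun a => by
    have := congrArg (fun l => l.appTop (specFun c.A a)) hg
    rwa [appTop_comp_apply, appTop_specFun] at this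
  have hρ : ρ = specFun R.R := by
    refine R.hom_ext _ _ (RingHom.ext hα) (fun i hi _ => hgt i hi) fun i => ?_
    have h1 := R.isValue.comp (specFun R.R)
    have h2 := R.isValue.comp ρ
    have hnz : ∀ a ∈ nonZeroDivisors R.R, specFun R.R a ∈ nonZeroDivisors Γ(Spec (.of R.R), ⊤) :=
      fun a ha => mem_nonZeroDivisors_of_toStalk fun z => specFun_mem_nonZeroDivisors ha z
    have ht : tail (fun i => specFun R.R (R.t i)) n j ∈ nonZeroDivisors Γ(Spec (.of R.R), ⊤) := by
      rw [tail, ← map_prod]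
      exact hnz _ (R.tail_mem_nonZeroDivisors j)
    refine (IsChartValue.c_unique (σ := c.σ) (v := fun i => specFun R.R (R.α (c.v i)))
      ⟨?_, ?_, ?_, h2.one⟩ h1 hj.one_le hj.le ht (hnz _ R.fst_mem_nonZeroDivisors) i)
    · rw [← h2.mul]
      exact (hgt j (Finset.mem_Icc.2 ⟨hj.one_le, hj.le⟩)).symm
    · rw [← hα, h2.fst]
      refine congrArg _ (Finset.prod_congr rfl fun i hi => hgt i ?_)
      rw [Finset.mem_Icc] at hi ⊢
      omega
    · rw [← hα, h2.snd]
      have := hj.le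
      refine congrArg _ (Finset.prod_congr rfl fun i hi => hgt i ?_)
      rw [Finset.mem_Icc]
      rw [Finset.mem_Ico] at hi
      omega
  refine hom_ext_specFun fun a => ?_
  rw [Scheme.Hom.id_appTop]
  exact RingHom.congr_fun hρ a

include h in
-- The chart is identified with the open set `W` over `c` on which `v_j ∣ x ∣ v_{j-1}`. Over `W` the
-- quotients `x_j` and `y_j` exist and define a morphism to the spectrum of the chart ring. It is
-- inverse to the morphism given by the universal property of `S`, because both composites are
-- determined by the coordinates.
theorem IsUniversal.exists_expChart {j : ℕ} (hj : IsChartIndex c.σ n j) :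
    ∃ E : ExpChart B n p t, E.c = c ∧ E.j = j := by
  obtain ⟨R⟩ := nonempty_chartRing c.coord hj
  obtain ⟨ι, ⟨hιp, hιt⟩, -⟩ := h.existsUnique _ _ (R.isAdmissible hj)
  let V := c.preimage p
  let d := c.lift p
  have hd : d ≫ c.e = V.ι ≫ p := c.lift_comp p
  have haV := h.admissible_comp V.ι (h.regular_comp V.ι)
  rw [← hd] at haV
  let ιV : Spec (.of R.R) ⟶ V.toScheme := IsOpenImmersion.lift V.ι ι (by
    rintro _ ⟨z, rfl⟩
    rw [Scheme.Opens.range_ι]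
    change p (ι z) ∈ Set.range c.e
    rw [← Scheme.Hom.comp_apply, hιp]
    exact ⟨_, rfl⟩)
  have hιV : ιV ≫ V.ι = ι := IsOpenImmersion.lift_fac _ _ _
  have hιd : ιV ≫ d = Spec.map (CommRingCat.ofHom R.α) := by
    rw [← cancel_mono c.e, Category.assoc, hd, ← Category.assoc, hιV, hιp]
  have hιVt : ∀ i ≤ n + 1, ιV.appTop (tail (fun m => V.ι.appTop (t m)) n i) =
      specFun R.R (tail R.t n i) := fun i hi => by
    rw [appTop_tail, ← R.tail_coord]
    refine Finset.prod_congr rfl fun m hm => ?_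
    refine (appTop_comp_apply ιV V.ι (t m)).symm.trans ?_
    rw [hιV, hιt m]
    rw [Finset.mem_Icc] at hm ⊢
    omega
  have hιVx : ιV.appTop (d.appTop (specFun c.A (c.v 0))) = specFun R.R (R.α (c.v 0)) := by
    rw [← appTop_comp_apply, hιd, appTop_specFun]
  let W : V.toScheme.Opens := ⟨{z | toStalk z (tail (fun m => V.ι.appTop (t m)) n j) ∣
      toStalk z (d.appTop (specFun c.A (c.v 0)))} ∩ {z | toStalk z (d.appTop (specFun c.A (c.v 0))) ∣
      toStalk z (tail (fun m => V.ι.appTop (t m)) n (j - 1))},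
    (isOpen_toStalk_dvd _ _).inter (isOpen_toStalk_dvd _ _)⟩
  have hjl := hj.le
  have hj1 := hj.one_le
  -- The divisibilities hold upstairs by `fst_eq` and `tail_eq`. They descend along the local
  -- homomorphism of stalks since below one of the two elements divides the other anyway.
  have hιW : ∀ z, ιV z ∈ W := fun z => by
    constructor
    · refine dvd_of_map_dvd (φ := (ιV.stalkMap z).hom) (haV.dvd_or_dvd c d hj.le _) ?_ ?_
      · rw [stalkMap_toStalk, hιVt j hj.le]
        exact specFun_mem_nonZeroDivisors (R.tail_mem_nonZeroDivisors j) z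
      · rw [stalkMap_toStalk, stalkMap_toStalk, hιVt j hj.le, hιVx,
          R.isValue.fst_eq le_rfl hj.le, map_mul, map_mul]
        exact Dvd.intro_left _ rfl
    · refine dvd_of_map_dvd (φ := (ιV.stalkMap z).hom)
        (haV.dvd_or_dvd c d (i := j - 1) (by omega) _).symm ?_ ?_
      · rw [stalkMap_toStalk, hιVx]
        exact specFun_mem_nonZeroDivisors R.fst_mem_nonZeroDivisors z
      · rw [stalkMap_toStalk, stalkMap_toStalk, hιVt _ (by omega), hιVx,
          R.isValue.tail_eq (i := j - 1) (by omega) hj.le, map_mul, map_mul]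
        exact Dvd.intro _ rfl
  let ιW : Spec (.of R.R) ⟶ W.toScheme := IsOpenImmersion.lift W.ι ιV (by
    rintro _ ⟨z, rfl⟩
    rw [Scheme.Opens.range_ι]
    exact hιW z)
  have hιWV : ιW ≫ W.ι = ιV := IsOpenImmersion.lift_fac _ _ _
  have haW := h.admissible_comp (W.ι ≫ V.ι) (h.regular_comp (W.ι ≫ V.ι))
  have hdW : (W.ι ≫ V.ι) ≫ p = (W.ι ≫ d) ≫ c.e := by
    rw [Category.assoc, Category.assoc, hd]
  rw [hdW] at haW
  have hrW := h.regular_comp (W.ι ≫ V.ι)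
  rw [hdW] at hrW
  have htW : ∀ i, tail (fun m => (W.ι ≫ V.ι).appTop (t m)) n i =
      W.ι.appTop (tail (fun m => V.ι.appTop (t m)) n i) := fun i => by
    rw [appTop_tail]
    simp only [appTop_comp_apply]
  obtain ⟨g, hg, hgt⟩ := R.exists_hom hj (W.ι ≫ d) haW hrW
    (fun z => by
      rw [htW, appTop_comp_apply, ← stalkMap_toStalk W.ι, ← stalkMap_toStalk W.ι]
      have h1 : W.ι z ∈ W := z.2
      exact map_dvd _ h1.1)
    (fun z => by
      rw [htW, appTop_comp_apply, ← stalkMap_toStalk W.ι, ← stalkMap_toStalk W.ι]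
      have h1 : W.ι z ∈ W := z.2
      exact map_dvd _ h1.2)
  have hgι : g ≫ ι = W.ι ≫ V.ι := by
    refine h.hom_ext ?_ ?_ fun i hi => ?_
    · rw [Category.assoc, hιp, ← Category.assoc, hg]
      exact hrW
    · rw [Category.assoc, hιp, ← Category.assoc, hg, hdW]
    · rw [appTop_comp_apply, hιt i hi, hgt i hi]
  have h1 : ιW ≫ g = 𝟙 _ := by
    refine R.hom_eq_id hj _ ?_ fun i hi => ?_
    · rw [Category.assoc, hg, ← Category.assoc, hιWV, hιd]
    · rw [appTop_comp_apply, hgt i hi, ← appTop_comp_apply, ← Category.assoc, hιWV, hιV, hιt i hi]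
  have hιw : ιW ≫ W.ι ≫ V.ι = ι := by rw [← Category.assoc, hιWV, hιV]
  have h2 : g ≫ ιW = 𝟙 _ := by
    rw [← cancel_mono (W.ι ≫ V.ι), Category.assoc, hιw, hgι, Category.id_comp]
  have hiso : IsIso ιW := ⟨g, h1, h2⟩
  have hopen : IsOpenImmersion ι := by
    rw [← hιw]
    infer_instance
  refine ⟨⟨c, j, hj, R, ι, hιp, hιt, fun q hq hq0 hq1 => ?_⟩, rfl, rfl⟩
  obtain ⟨q, rfl⟩ : q ∈ Set.range V.ι := by
    rw [Scheme.Opens.range_ι]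
    exact hq
  rw [← tailDvd_comp, ← hd, c.tailDvd_iff] at hq0
  rw [← sourceDvd_comp, ← hd, c.sourceDvd_iff] at hq1
  have hqW : q ∈ W := ⟨hq0, hq1⟩
  obtain ⟨q, rfl⟩ : q ∈ Set.range W.ι := by
    rw [Scheme.Opens.range_ι]
    exact hqW
  refine ⟨g q, ?_⟩
  rw [← Scheme.Hom.comp_apply, hgι, Scheme.Hom.comp_apply]

include h in
-- Take the least `j ≥ 1` with `v_j ∣ x`; it exists since `v_{n+1} = 1`. By minimality `v_{j-1}`
-- does not divide `x`, so `x` divides it, and for `j = 1` one has `x ∣ x * y = v_0`. If `y = 1` or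
-- `x = 1`, the index `1` or `n + 1` is forced.
theorem IsUniversal.exists_mem_range_expChart [IsAlgClosed k] (q : S) :
    ∃ E : ExpChart B n p t, q ∈ Set.range E.ι := by
  classical
  obtain ⟨c, hq⟩ := exists_mem_range_chart B (p q)
  obtain ⟨q, rfl⟩ : q ∈ Set.range (c.preimage p).ι := by
    rw [Scheme.Opens.range_ι]
    exact hq
  suffices ∃ j, IsChartIndex c.σ n j ∧ TailDvd B p t n j ((c.preimage p).ι q) ∧
      SourceDvd B p t n (j - 1) ((c.preimage p).ι q) by
    obtain ⟨j, hj, h0, h1⟩ := this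
    obtain ⟨E, rfl, rfl⟩ := h.exists_expChart c hj
    exact ⟨E, E.mem_range _ hq h0 h1⟩
  have hlast : TailDvd B p t n (n + 1) ((c.preimage p).ι q) := by
    rw [TailDvd, tail, Finset.Icc_eq_empty (by omega), Finset.prod_empty, map_one,
      Ideal.span_singleton_one]
    exact le_top
  have hz := sourceDvd_zero h c _ hq
  by_cases h0 : 0 ∈ c.σ
  · by_cases h1 : 1 ∈ c.σ
    · have hex : ∃ j, 1 ≤ j ∧ TailDvd B p t n j ((c.preimage p).ι q) :=
        ⟨n + 1, by omega, hlast⟩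
      refine ⟨Nat.find hex, ⟨(Nat.find_spec hex).1, Nat.find_min' hex ⟨by omega, hlast⟩,
        fun h => (h h0).elim, fun h => (h h1).elim⟩, (Nat.find_spec hex).2, ?_⟩
      have h2 := Nat.find_min' hex ⟨by omega, hlast⟩
      have h3 := (Nat.find_spec hex).1
      rcases Nat.eq_zero_or_pos (Nat.find hex - 1) with h4 | h4
      · rw [h4]
        exact hz
      · refine (tailDvd_or_sourceDvd h c (by omega) _ hq).resolve_left fun h5 => ?_
        exact Nat.find_min hex (m := Nat.find hex - 1) (by omega) ⟨h4, h5⟩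
    · refine ⟨1, ⟨le_rfl, by omega, fun h => (h h0).elim, fun _ => rfl⟩, ?_, hz⟩
      rw [← tailDvd_comp, ← c.lift_comp, c.tailDvd_iff]
      have h2 : param (c.lift p ≫ c.e) = (c.lift p).appTop (specFun c.A (c.v 0)) := by
        rw [param_comp, c.param, c.coord.one 1 h1, mul_one]
      rw [← h2, c.lift_comp, param_comp, ← h.admissible.prod,
        ← tail_mul t (show 1 ≤ n + 1 by omega), map_mul, map_mul,
        appTop_tail _ t n 1]
      exact Dvd.intro_left _ rfl
  · refine ⟨n + 1, ⟨by omega, le_rfl, fun _ => rfl, fun h1 => ?_⟩, hlast, ?_⟩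
    · obtain ⟨i, hi⟩ := c.coord.nonempty
      match i with
      | 0 => exact (h0 hi).elim
      | 1 => exact (h1 hi).elim
    · rw [← sourceDvd_comp, ← c.lift_comp, c.sourceDvd_iff, c.coord.one 0 h0, map_one, map_one,
        map_one]
      exact one_dvd _

end Construction

end ExpDeg

end

/-! ### Homogeneous coordinates and the cells of the strata -/

noncomputable section

namespace ExpDeg

variable {k : Type u} [Field k] {𝒟 : Degeneration k} {B : BipartiteOrientation 𝒟}

/-- The homogeneous coordinate of the `i`-th centre that comes from the sources vanishes. -/
def SourceZero (B : BipartiteOrientation 𝒟) {S : Scheme.{u}} (p : S ⟶ 𝒟.X) (t : ℕ → Γ(S, ⊤))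
    (n i : ℕ) (q : S) : Prop := ¬ SourceDvd B p t n i q

/-- The homogeneous coordinate of the `i`-th centre that comes from `t_{i+1} ⋯ t_{n+1}` vanishes. -/
def TailZero (B : BipartiteOrientation 𝒟) {S : Scheme.{u}} (p : S ⟶ 𝒟.X) (t : ℕ → Γ(S, ⊤))
    (n i : ℕ) (q : S) : Prop := ¬ TailDvd B p t n i q

theorem mul_dvd_self_iff {R : Type*} [CommRing R] {a b : R} (ha : a ∈ nonZeroDivisors R) :
    a * b ∣ a ↔ IsUnit b := by
  constructor
  · rintro ⟨d, hd⟩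
    refine IsUnit.of_mul_eq_one d ((mul_cancel_left_mem_nonZeroDivisors ha).1 ?_)
    rw [mul_one, ← mul_assoc]
    exact hd.symm
  · exact fun h => h.mul_right_dvd.2 dvd_rfl

theorem isUnit_toStalk_specFun {A : Type u} [CommRing A] (a : A) (z : Spec (.of A)) :
    IsUnit (toStalk z (specFun A a)) ↔ a ∉ z.asIdeal := by
  rw [← vanishesAt_specFun, vanishesAt_iff, IsLocalRing.mem_maximalIdeal, mem_nonunits_iff, not_not]

namespace ExpChart

variable {S : Scheme.{u}} {p : S ⟶ 𝒟.X} {t : ℕ → Γ(S, ⊤)} {n : ℕ} (E : ExpChart B n p t)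

theorem vanishesAt_iff {i : ℕ} (hi : i ∈ Finset.Icc 1 (n + 1)) (z : Spec (.of E.R.R)) :
    VanishesAt (t i) (E.ι z) ↔ E.R.t i ∈ z.asIdeal := by
  rw [← vanishesAt_appTop, E.ι_coord i hi, vanishesAt_specFun]

/-- The point of the chart of `X` below a point of the chart. -/
def below (z : Spec (.of E.R.R)) : Spec (.of E.c.A) := Spec.map (CommRingCat.ofHom E.R.α) z

theorem proj_ι (z : Spec (.of E.R.R)) : p (E.ι z) = E.c.e (E.below z) := by
  rw [← Scheme.Hom.comp_apply, E.ι_proj, Scheme.Hom.comp_apply]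
  rfl

theorem mem_below (z : Spec (.of E.R.R)) (a : E.c.A) :
    a ∈ (E.below z).asIdeal ↔ E.R.α a ∈ z.asIdeal := Iff.rfl

theorem tail_ι {i : ℕ} : tail (fun m => E.ι.appTop (t m)) n i = specFun E.R.R (tail E.R.t n i) := by
  rw [← E.R.tail_coord]
  refine Finset.prod_congr rfl fun m hm => E.ι_coord m ?_
  rw [Finset.mem_Icc] at hm ⊢
  omega

theorem tailDvd_iff (z : Spec (.of E.R.R)) (i : ℕ) : TailDvd B p t n i (E.ι z) ↔
    toStalk z (specFun E.R.R (tail E.R.t n i)) ∣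
      toStalk z (specFun E.R.R (E.R.α (E.c.v 0))) := by
  rw [← tailDvd_comp, E.ι_proj, E.c.tailDvd_iff, E.tail_ι, appTop_specFun]

theorem sourceDvd_iff (z : Spec (.of E.R.R)) (i : ℕ) : SourceDvd B p t n i (E.ι z) ↔
    toStalk z (specFun E.R.R (E.R.α (E.c.v 0))) ∣
      toStalk z (specFun E.R.R (tail E.R.t n i)) := by
  rw [← sourceDvd_comp, E.ι_proj, E.c.sourceDvd_iff, E.tail_ι, appTop_specFun]

/-- For `i < j` the ratio `vᵢ / x` is `y_j t_{i+1} ⋯ t_{j-1}` by `tail_eq`; for `j ≤ i` the tail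
divides `x`. Symmetrically, `x / vᵢ` is `x_j t_{j+1} ⋯ tᵢ` for `j ≤ i`, which gives
`sourceZero_iff`. -/
theorem tailZero_iff (z : Spec (.of E.R.R)) {i : ℕ} (hi : i ≤ n + 1) :
    TailZero B p t n i (E.ι z) ↔
      i < E.j ∧ (E.R.c 1 ∈ z.asIdeal ∨ ∃ m, i < m ∧ m < E.j ∧ E.R.t m ∈ z.asIdeal) := by
  rw [TailZero, tailDvd_iff]
  rcases lt_or_ge i E.j with h | h
  · rw [E.R.isValue.tail_eq h E.isChartIndex.le, map_mul, map_mul,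
      mul_dvd_self_iff (specFun_mem_nonZeroDivisors E.R.fst_mem_nonZeroDivisors z),
      isUnit_toStalk_specFun, not_not, z.2.mul_mem_iff_mem_or_mem, z.2.prod_mem_iff]
    simp only [Finset.mem_Ico, h, true_and, Nat.succ_le_iff, and_assoc]
  · rw [E.R.isValue.fst_eq h hi, map_mul, map_mul]
    simp [h.not_gt]

theorem sourceZero_iff (z : Spec (.of E.R.R)) {i : ℕ} (hi : i ≤ n + 1) :
    SourceZero B p t n i (E.ι z) ↔
      E.j ≤ i ∧ (E.R.c 0 ∈ z.asIdeal ∨ ∃ m, E.j < m ∧ m ≤ i ∧ E.R.t m ∈ z.asIdeal) := by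
  rw [SourceZero, sourceDvd_iff]
  rcases lt_or_ge i E.j with h | h
  · rw [E.R.isValue.tail_eq h E.isChartIndex.le, map_mul, map_mul]
    simp [h.not_ge]
  · rw [E.R.isValue.fst_eq h hi, map_mul, map_mul, mul_comm (toStalk z _),
      mul_dvd_self_iff (specFun_mem_nonZeroDivisors (E.R.tail_mem_nonZeroDivisors i) z),
      isUnit_toStalk_specFun, not_not, z.2.mul_mem_iff_mem_or_mem, z.2.prod_mem_iff]
    simp only [Finset.mem_Icc, h, true_and, Nat.succ_le_iff, and_assoc]

theorem t_mem_iff (z : Spec (.of E.R.R)) :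
    E.R.t E.j ∈ z.asIdeal ↔ E.R.c 0 ∈ z.asIdeal ∨ E.R.c 1 ∈ z.asIdeal := by
  rw [E.R.isValue.mul]
  exact z.2.mul_mem_iff_mem_or_mem

theorem fst_mem_iff (z : Spec (.of E.R.R)) :
    E.c.v 0 ∈ (E.below z).asIdeal ↔
      E.R.c 0 ∈ z.asIdeal ∨ ∃ m, E.j < m ∧ m ≤ n + 1 ∧ E.R.t m ∈ z.asIdeal := by
  rw [mem_below, E.R.isValue.fst, z.2.mul_mem_iff_mem_or_mem, z.2.prod_mem_iff]
  simp only [Finset.mem_Icc, Nat.succ_le_iff, and_assoc]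

theorem snd_mem_iff (z : Spec (.of E.R.R)) :
    E.c.v 1 ∈ (E.below z).asIdeal ↔
      E.R.c 1 ∈ z.asIdeal ∨ ∃ m, 0 < m ∧ m < E.j ∧ E.R.t m ∈ z.asIdeal := by
  rw [mem_below, E.R.isValue.snd, z.2.mul_mem_iff_mem_or_mem, z.2.prod_mem_iff]
  simp only [Finset.mem_Ico, Nat.succ_le_iff, and_assoc]

theorem c_mem {z : Spec (.of E.R.R)} {i : Fin 2} (h : E.R.c i ∈ z.asIdeal) : i ∈ E.c.σ := by
  by_contra hi
  rw [E.R.isValue.one i hi] at h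
  exact z.2.ne_top ((Ideal.eq_top_iff_one _).2 h)

end ExpChart

/-- On a chart through `x` both loci have the trace `x = y = 0`, and an irreducible closed set is
the closure of its trace. -/
theorem Arrow.locus_eq_of_mem [IsAlgClosed k] (D D' : Arrow B) {x : 𝒟.X} (hx : x ∈ D.locus)
    (hx' : x ∈ D'.locus) : D.locus = D'.locus := by
  obtain ⟨c, w, rfl⟩ := exists_mem_range_chart B x
  have key : ∀ D D' : Arrow B, c.e w ∈ D.locus → c.e w ∈ D'.locus → D.locus ⊆ D'.locus := by
    intro D D' h h'
    have hcl : IsClosed D'.locus := D'.locus_component.isClosed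
      (((B.isComponent_neg D'.source_mem).isClosed 𝒟.isClosed_centralFibre).inter
        ((B.isComponent_pos D'.target_mem).isClosed 𝒟.isClosed_centralFibre))
    refine (subset_closure_image_preimage c.isOpenEmbedding D.locus_component.1.1 ⟨w, h⟩).trans
      (hcl.closure_subset_iff.2 ?_)
    rintro _ ⟨u, hu, rfl⟩
    exact (c.mem_arrow_iff D' h' u).2 ((c.mem_arrow_iff D h u).1 hu)
  exact (key D D' hx hx').antisymm (key D' D hx' hx)

section Cells

variable (B) in
/-- The strata of `X` over which there is a component with index `l` of the stratum of an expanded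
degeneration for the index set `I`. -/
def IsBase (I : Finset ℕ) (l : ℕ) (L : Set 𝒟.X) : Prop :=
  (l = 0 ∧ L ∈ B.neg) ∨ (l ∈ I ∧ (∀ m ∈ I, m ≤ l) ∧ L ∈ B.pos) ∨
    (l ∈ I ∧ (∃ m ∈ I, l < m) ∧ ∃ D : Arrow B, L = D.locus)

variable (B) in
/-- The component with index `l` over `L` of the stratum for the index set `I`. -/
def cell {S : Scheme.{u}} (p : S ⟶ 𝒟.X) (t : ℕ → Γ(S, ⊤)) (n : ℕ) (I : Finset ℕ) (L : Set 𝒟.X)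
    (l : ℕ) : Set S :=
  {q | (∀ i ∈ I, VanishesAt (t i) q) ∧ p q ∈ L ∧ (∀ i < l, TailZero B p t n i q) ∧
    ∀ m ∈ I, l < m → ∀ i, m ≤ i → i ≤ n + 1 → SourceZero B p t n i q}

variable {S : Scheme.{u}} {p : S ⟶ 𝒟.X} {t : ℕ → Γ(S, ⊤)} {n : ℕ} {I : Finset ℕ}

/-- The index determines the kind of stratum, and distinct strata of the same kind are disjoint: for
sources and targets by bipartiteness, for loci of arrows by `Arrow.locus_eq_of_mem`. -/
theorem IsBase.unique [IsAlgClosed k] (h0 : 0 ∉ I) {l : ℕ} {L L' : Set 𝒟.X} (h : IsBase B I l L)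
    (h' : IsBase B I l L') (hne : (L ∩ L').Nonempty) : L = L' := by
  obtain ⟨x, hx, hx'⟩ := hne
  rcases h with ⟨h1, h2⟩ | ⟨h1, h2, h3⟩ | ⟨h1, ⟨m, hm, hlm⟩, D, rfl⟩ <;>
    rcases h' with ⟨h1', h2'⟩ | ⟨h1', h2', h3'⟩ | ⟨h1', ⟨m', hm', hlm'⟩, D', rfl⟩
  · by_contra hne
    exact Set.disjoint_left.1 (B.neg_indep _ h2 _ h2' hne) hx hx'
  · exact (h0 (h1 ▸ h1')).elim
  · exact (h0 (h1 ▸ h1')).elim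
  · exact (h0 (h1' ▸ h1)).elim
  · by_contra hne
    exact Set.disjoint_left.1 (B.pos_indep _ h3 _ h3' hne) hx hx'
  · exact absurd (h2 m' hm') (by omega)
  · exact (h0 (h1' ▸ h1)).elim
  · exact absurd (h2' m hm) (by omega)
  · exact D.locus_eq_of_mem D' hx hx'

/-- The coordinates of `X` that vanish on a stratum. -/
def IsLocalBase (c : Chart B) (T : Set (Fin 2)) (L : Set 𝒟.X) : Prop :=
  ∀ w, c.e w ∈ L ↔ ∀ i ∈ T, c.v i ∈ w.asIdeal

theorem IsBase.isLocalBase {l : ℕ} {L : Set 𝒟.X} (h : IsBase B I l L) (h0 : 0 ∉ I)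
    (hI : I.Nonempty) (c : Chart B) {u : Spec (.of c.A)} (hu : c.e u ∈ L) :
    IsLocalBase c {i | (i = 0 ∧ ∃ m ∈ I, l < m) ∨ (i = 1 ∧ l ∈ I)} L := by
  rcases h with ⟨rfl, h2⟩ | ⟨h1, h2, h3⟩ | ⟨h1, ⟨m, hm, hlm⟩, D, rfl⟩
  · obtain ⟨m, hm⟩ := hI
    have : 0 < m := Nat.pos_of_ne_zero fun h => h0 (h ▸ hm)
    intro w
    rw [c.mem_neg_iff h2 hu]
    simp only [Set.mem_ofPred_eq, h0, and_false, or_false]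
    exact ⟨fun h i hi => hi.1 ▸ h, fun h => h 0 ⟨rfl, m, hm, this⟩⟩
  · intro w
    rw [c.mem_pos_iff h3 hu]
    exact ⟨fun h i hi => hi.elim (fun h' => by
      obtain ⟨m, hm, hlm⟩ := h'.2
      exact absurd (h2 m hm) (by omega)) fun h' => h'.1 ▸ h, fun h => h 1 (Or.inr ⟨rfl, h1⟩)⟩
  · intro w
    rw [c.mem_arrow_iff D hu]
    exact ⟨fun h i hi => hi.elim (fun h' => h'.1 ▸ h.1) fun h' => h'.1 ▸ h.2,
      fun h => ⟨h 0 (Or.inl ⟨rfl, m, hm, hlm⟩), h 1 (Or.inr ⟨rfl, h1⟩)⟩⟩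

theorem IsBase.mem_insert {l : ℕ} {L : Set 𝒟.X} (h : IsBase B I l L) : l ∈ insert 0 I := by
  rcases h with ⟨rfl, -⟩ | ⟨h, -⟩ | ⟨h, -⟩
  · exact Finset.mem_insert_self _ _
  · exact Finset.mem_insert_of_mem h
  · exact Finset.mem_insert_of_mem h

/-- The equations of the component with index `l` in an affine chart. -/
structure ExpChart.CellCond (E : ExpChart B n p t) (I : Finset ℕ) (l : ℕ)
    (z : Spec (.of E.R.R)) : Prop where
  t_mem : ∀ i ∈ I, i ≠ E.j → E.R.t i ∈ z.asIdeal
  le : l ≤ E.j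
  ge : ∀ m ∈ I, l < m → E.j ≤ m
  snd : l = E.j → E.R.c 1 ∈ z.asIdeal
  fst : E.j ∈ I → l < E.j → E.R.c 0 ∈ z.asIdeal

/-- A vanishing coordinate of tail type at `i` forces `i < j`, and one of source type forces `j ≤
i`. So a chart that meets the cell has its index between `l` and the successor of `l` in `I`. The
product `t_j = x_j y_j` then has a prescribed vanishing factor at the boundary: `y_j` if `j = l`,
and `x_j` if `j` is the successor. -/
theorem ExpChart.mem_cell_iff (E : ExpChart B n p t) (hI : I ⊆ Finset.Icc 1 (n + 1)) {l : ℕ}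
    (hl : l ∈ insert 0 I) {L : Set 𝒟.X} (z : Spec (.of E.R.R)) :
    E.ι z ∈ cell B p t n I L l ↔ p (E.ι z) ∈ L ∧ E.CellCond I l z := by
  have hj1 := E.isChartIndex.one_le
  have hj := E.isChartIndex.le
  have hmem : ∀ m ∈ I, 1 ≤ m ∧ m ≤ n + 1 := fun m hm => Finset.mem_Icc.1 (hI hm)
  have hl' : l = 0 ∨ l ∈ I := Finset.mem_insert.1 hl
  have hln : l ≤ n + 1 := hl'.elim (fun h => by omega) fun h => (hmem l h).2
  constructor
  · rintro ⟨h1, h2, h3, h4⟩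
    have hle : l ≤ E.j := by
      rcases Nat.eq_zero_or_pos l with h | h
      · omega
      · have := ((E.tailZero_iff z (i := l - 1) (by omega)).1 (h3 _ (by omega))).1
        omega
    have hge : ∀ m ∈ I, l < m → E.j ≤ m := fun m hm hlm =>
      ((E.sourceZero_iff z (hmem m hm).2).1 (h4 m hm hlm m le_rfl (hmem m hm).2)).1
    refine ⟨h2, fun i hi _ => (E.vanishesAt_iff (hI hi) z).1 (h1 i hi), hle, hge, fun h => ?_,
      fun h h' => ?_⟩
    · refine ((E.tailZero_iff z (i := l - 1) (by omega)).1 (h3 _ (by omega))).2.elim id ?_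
      rintro ⟨m, hm1, hm2, -⟩
      omega
    · refine ((E.sourceZero_iff z hj).1 (h4 _ h h' _ le_rfl hj)).2.elim id ?_
      rintro ⟨m, hm1, hm2, -⟩
      omega
  · rintro ⟨h2, h⟩
    refine ⟨fun i hi => (E.vanishesAt_iff (hI hi) z).2 ?_, h2, fun i hi => ?_,
      fun m hm hlm i hmi hi => ?_⟩
    · by_cases hij : i = E.j
      · rw [hij, E.t_mem_iff]
        rcases h.le.lt_or_eq with h' | h'
        · exact Or.inl (h.fst (hij ▸ hi) h')
        · exact Or.inr (h.snd h')
      · exact h.t_mem i hi hij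
    · have h5 := h.le
      rw [E.tailZero_iff z (by omega)]
      refine ⟨by omega, ?_⟩
      rcases h.le.lt_or_eq with h' | h'
      · exact Or.inr ⟨l, hi, h', h.t_mem l (hl'.resolve_left (by omega)) (by omega)⟩
      · exact Or.inl (h.snd h')
    · have h5 := h.ge m hm hlm
      rw [E.sourceZero_iff z hi]
      refine ⟨by omega, ?_⟩
      rcases h5.lt_or_eq with h' | h'
      · exact Or.inr ⟨m, h', hmi, h.t_mem m hm (by omega)⟩
      · exact Or.inl (h.fst (h' ▸ hm) (by omega))

/-- The equations of the cell make the coordinates of `X` vanish that define `L`, so on a chart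
meeting `L` the condition that the image lies in `L` is redundant. -/
theorem ExpChart.CellCond.mem_base {E : ExpChart B n p t} (hI : I ⊆ Finset.Icc 1 (n + 1))
    (hne : I.Nonempty) {l : ℕ} {L : Set 𝒟.X} (hL : IsBase B I l L) {z : Spec (.of E.R.R)}
    (h : E.CellCond I l z) {u : Spec (.of E.c.A)} (hu : E.c.e u ∈ L) : p (E.ι z) ∈ L := by
  have hmem : ∀ m ∈ I, 1 ≤ m ∧ m ≤ n + 1 := fun m hm => Finset.mem_Icc.1 (hI hm)
  have h0 : 0 ∉ I := fun h => absurd (hmem 0 h).1 (by omega)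
  rw [E.proj_ι, hL.isLocalBase h0 hne E.c hu]
  rintro i (⟨rfl, m, hm, hlm⟩ | ⟨rfl, hl⟩)
  · rw [E.fst_mem_iff]
    have h5 := h.ge m hm hlm
    rcases h5.lt_or_eq with h' | h'
    · exact Or.inr ⟨m, h', (hmem m hm).2, h.t_mem m hm (by omega)⟩
    · exact Or.inl (h.fst (h' ▸ hm) (by omega))
  · rw [E.snd_mem_iff]
    have h5 := hmem l hl
    rcases h.le.lt_or_eq with h' | h'
    · exact Or.inr ⟨l, by omega, h', h.t_mem l hl (by omega)⟩
    · exact Or.inl (h.snd h')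

variable [IsAlgClosed k]

section

variable (h : IsUniversal B n p t) (hI : I ⊆ Finset.Icc 1 (n + 1)) (hne : I.Nonempty)
include h hI hne

/-- In the `j`-th chart take `l = j` if `j ∈ I` and `y_j = 0`, and otherwise the largest element of
`I ∪ {0}` below `j`. In the second case, `j ∈ I` forces `x_j = 0`. The base is a source, a target or
the locus of an arrow through the image point. -/
theorem exists_mem_cell {q : S} (hq : ∀ i ∈ I, VanishesAt (t i) q) :
    ∃ L l, IsBase B I l L ∧ q ∈ cell B p t n I L l := by
  obtain ⟨E, z, rfl⟩ := h.exists_mem_range_expChart q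
  have hmem : ∀ m ∈ I, 1 ≤ m ∧ m ≤ n + 1 := fun m hm => Finset.mem_Icc.1 (hI hm)
  have ht : ∀ i ∈ I, E.R.t i ∈ z.asIdeal := fun i hi => (E.vanishesAt_iff (hI hi) z).1 (hq i hi)
  have hj1 := E.isChartIndex.one_le
  have hj := E.isChartIndex.le
  suffices ∃ l ∈ insert 0 I, E.CellCond I l z by
    obtain ⟨l, hl, hc⟩ := this
    have key : ∃ L, IsBase B I l L ∧ p (E.ι z) ∈ L := by
      rw [E.proj_ι]
      have hv0 : ∀ m ∈ I, l < m → E.c.v 0 ∈ (E.below z).asIdeal := by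
        intro m hm hlm
        rw [E.fst_mem_iff]
        rcases (hc.ge m hm hlm).lt_or_eq with h' | h'
        · exact Or.inr ⟨m, h', (hmem m hm).2, ht m hm⟩
        · exact Or.inl (hc.fst (h' ▸ hm) (by omega))
      have hv1 : l ∈ I → E.c.v 1 ∈ (E.below z).asIdeal := by
        intro hl
        have h5 := hmem l hl
        rw [E.snd_mem_iff]
        rcases hc.le.lt_or_eq with h' | h'
        · exact Or.inr ⟨l, by omega, h', ht l hl⟩
        · exact Or.inl (hc.snd h')
      rcases Finset.mem_insert.1 hl with rfl | hl
      · obtain ⟨m, hm⟩ := hne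
        obtain ⟨N, hN, hu⟩ := E.c.exists_neg (hv0 m hm (hmem m hm).1)
        exact ⟨N, Or.inl ⟨rfl, hN⟩, hu⟩
      · by_cases hmax : ∃ m ∈ I, l < m
        · obtain ⟨m, hm, hlm⟩ := hmax
          obtain ⟨D, hD⟩ := E.c.exists_arrow (hv0 m hm hlm) (hv1 hl)
          exact ⟨D.locus, Or.inr (Or.inr ⟨hl, ⟨m, hm, hlm⟩, D, rfl⟩), hD⟩
        · obtain ⟨N, hN, hu⟩ := E.c.exists_pos (hv1 hl)
          push Not at hmax
          exact ⟨N, Or.inr (Or.inl ⟨hl, hmax, hN⟩), hu⟩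
    obtain ⟨L, hL, hp⟩ := key
    exact ⟨L, l, hL, (E.mem_cell_iff hI hl z).2 ⟨hp, hc⟩⟩
  by_cases hc1 : E.j ∈ I ∧ E.R.c 1 ∈ z.asIdeal
  · exact ⟨E.j, Finset.mem_insert_of_mem hc1.1, fun i hi _ => ht i hi, le_rfl,
      fun m _ hm => hm.le, fun _ => hc1.2, fun _ h => absurd h (lt_irrefl _)⟩
  · have hex : (insert 0 (I.filter (· < E.j))).Nonempty := ⟨0, Finset.mem_insert_self _ _⟩
    set l := (insert 0 (I.filter (· < E.j))).max' hex with hl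
    have hlmem : l = 0 ∨ l ∈ I ∧ l < E.j := by
      have := Finset.max'_mem _ hex
      rw [← hl, Finset.mem_insert, Finset.mem_filter] at this
      exact this
    refine ⟨l, ?_, fun i hi _ => ht i hi, ?_, fun m hm hlm => ?_, fun h => ?_, fun hjI hlt => ?_⟩
    · rw [Finset.mem_insert]
      exact hlmem.imp id And.left
    · omega
    · by_contra hlt
      have := Finset.le_max' (insert 0 (I.filter (· < E.j))) m
        (Finset.mem_insert_of_mem (Finset.mem_filter.2 ⟨hm, by omega⟩))
      omega
    · omega
    · have h5 := ht _ hjI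
      rw [E.t_mem_iff] at h5
      exact h5.resolve_right fun h6 => hc1 ⟨hjI, h6⟩

/-- Every point of a component specializes a point of it that lies on no other component. -/
theorem exists_generization_mem_cell {q : S} {l : ℕ} {L : Set 𝒟.X} (hL : IsBase B I l L)
    (hq : q ∈ cell B p t n I L l) :
    ∃ q' ∈ cell B p t n I L l, q' ⤳ q ∧ (∀ c : Chart B, p q ∈ Set.range c.e →
        p q' ∈ Set.range c.e) ∧
      (∀ i ≤ n + 1, (∀ m ∈ I, l < m → i < m) → ¬ SourceZero B p t n i q') ∧
      ∀ i, l ≤ i → i ≤ n + 1 → ¬ TailZero B p t n i q' := by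
  obtain ⟨E, z, rfl⟩ := h.exists_mem_range_expChart q
  have hmem : ∀ m ∈ I, 1 ≤ m ∧ m ≤ n + 1 := fun m hm => Finset.mem_Icc.1 (hI hm)
  have hj1 := E.isChartIndex.one_le
  have hj := E.isChartIndex.le
  obtain ⟨hp, hc⟩ := (E.mem_cell_iff hI hL.mem_insert z).1 hq
  -- The free coordinates whose vanishing is demanded by the equations of the cell. Flatness of the
  -- chart over affine space yields a generization at which exactly these vanish.
  let T : Set (ChartVar E.c.σ n E.j) := {x | Sum.elim
    (fun i : E.c.σ => (i.1 = 1 ∧ l = E.j) ∨ (i.1 = 0 ∧ E.j ∈ I ∧ l < E.j)) (fun i => i.1 ∈ I) x}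
  obtain ⟨z', hz', hT⟩ := exists_prime_le_of_flat E.R.β E.R.smooth.flat T z (by
    rintro (⟨i, hi⟩ | ⟨i, hi, hij⟩) hx
    · rw [E.R.β_inl]
      rcases hx with ⟨rfl, h⟩ | ⟨rfl, h, h'⟩
      · exact hc.snd h
      · exact hc.fst h h'
    · rw [E.R.β_inr]
      exact hc.t_mem i hx hij)
  have hspec : E.ι z' ⤳ E.ι z := ((PrimeSpectrum.le_iff_specializes _ _).1 hz').map E.ι.continuous
  have hT1 : E.R.c 1 ∈ z'.asIdeal ↔ l = E.j := by
    by_cases h1 : 1 ∈ E.c.σ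
    · have := hT (.inl ⟨1, h1⟩)
      rw [E.R.β_inl] at this
      simpa [T] using this
    · exact ⟨fun h => (h1 (E.c_mem h)).elim, fun h => (h1 (E.c_mem (hc.snd h))).elim⟩
  have hT0 : E.R.c 0 ∈ z'.asIdeal ↔ E.j ∈ I ∧ l < E.j := by
    by_cases h1 : 0 ∈ E.c.σ
    · have := hT (.inl ⟨0, h1⟩)
      rw [E.R.β_inl] at this
      simpa [T] using this
    · exact ⟨fun h => (h1 (E.c_mem h)).elim, fun h => (h1 (E.c_mem (hc.fst h.1 h.2))).elim⟩
  have hTt : ∀ i ∈ Finset.Icc 1 (n + 1), i ≠ E.j → (E.R.t i ∈ z'.asIdeal ↔ i ∈ I) := by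
    intro i hi hij
    have := hT (.inr ⟨i, hi, hij⟩)
    rwa [E.R.β_inr] at this
  have hc' : E.CellCond I l z' := ⟨fun i hi hij => (hTt i (hI hi) hij).2 hi, hc.le, hc.ge,
    hT1.2, fun h h' => hT0.2 ⟨h, h'⟩⟩
  have hp' : p (E.ι z') ∈ L := by
    rw [E.proj_ι] at hp
    exact hc'.mem_base hI hne hL hp
  refine ⟨E.ι z', (E.mem_cell_iff hI hL.mem_insert z').2 ⟨hp', hc'⟩, hspec, fun c hcr => ?_,
    fun i hi hlt hz => ?_, fun i hli hi hz => ?_⟩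
  · exact (hspec.map p.continuous).mem_open c.isOpenEmbedding.isOpen_range hcr
  · obtain ⟨h1, h2⟩ := (E.sourceZero_iff z' hi).1 hz
    rcases h2 with h2 | ⟨m, hm1, hm2, hm3⟩
    · obtain ⟨h3, h4⟩ := hT0.1 h2
      have := hlt _ h3 h4
      omega
    · have h3 := (hTt m (Finset.mem_Icc.2 ⟨by omega, by omega⟩) (by omega)).1 hm3
      have := hlt m h3 (by have := hc.le; omega)
      omega
  · obtain ⟨h1, h2⟩ := (E.tailZero_iff z' hi).1 hz
    rcases h2 with h2 | ⟨m, hm1, hm2, hm3⟩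
    · have := hT1.1 h2
      omega
    · have h3 := (hTt m (Finset.mem_Icc.2 ⟨by omega, by omega⟩) (by omega)).1 hm3
      have := hc.ge m h3 (by omega)
      omega

end

end Cells

end ExpDeg

end

/-! ### Irreducibility of the cells and the components of the strata -/

noncomputable section

namespace ExpDeg

variable {k : Type u} [Field k] {𝒟 : Degeneration k} {B : BipartiteOrientation 𝒟}
variable {S : Scheme.{u}} {p : S ⟶ 𝒟.X} {t : ℕ → Γ(S, ⊤)} {n : ℕ} {I : Finset ℕ}

theorem IsBase.isIrreducible {l : ℕ} {L : Set 𝒟.X} (h : IsBase B I l L) : IsIrreducible L := by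
  rcases h with ⟨-, h⟩ | ⟨-, -, h⟩ | ⟨-, -, D, rfl⟩
  · exact (B.isComponent_neg h).1.1
  · exact (B.isComponent_pos h).1.1
  · exact D.locus_component.1.1

theorem IsBase.isClosed {l : ℕ} {L : Set 𝒟.X} (h : IsBase B I l L) : IsClosed L := by
  rcases h with ⟨-, h⟩ | ⟨-, -, h⟩ | ⟨-, -, D, rfl⟩
  · exact (B.isComponent_neg h).isClosed 𝒟.isClosed_centralFibre
  · exact (B.isComponent_pos h).isClosed 𝒟.isClosed_centralFibre
  · exact D.locus_component.isClosed
      (((B.isComponent_neg D.source_mem).isClosed 𝒟.isClosed_centralFibre).inter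
        ((B.isComponent_pos D.target_mem).isClosed 𝒟.isClosed_centralFibre))

open Classical in
/-- In a suitable chart, the component with index `l` has a generic point and maps onto the
corresponding stratum of `X`. -/
theorem ExpChart.exists_generic (E : ExpChart B n p t) (hI : I ⊆ Finset.Icc 1 (n + 1))
    (hne : I.Nonempty) {l : ℕ} {L : Set 𝒟.X} (hL : IsBase B I l L) {u : Spec (.of E.c.A)}
    (hu : E.c.e u ∈ L) (hle : l ≤ E.j) (hge : ∀ m ∈ I, l < m → E.j ≤ m)
    (h0 : (∀ m ∈ I, m ≤ l) → E.j = n + 1) (h1 : l ∉ I → E.j = 1) :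
    ∃ z₀ : Spec (.of E.R.R), E.CellCond I l z₀ ∧
      (∀ z : Spec (.of E.R.R), E.CellCond I l z → z₀.asIdeal ≤ z.asIdeal) ∧
      ∀ w, E.c.e w ∈ L → ∃ z, E.CellCond I l z ∧ E.below z = w := by
  have hmem : ∀ m ∈ I, 1 ≤ m ∧ m ≤ n + 1 := fun m hm => Finset.mem_Icc.1 (hI hm)
  have hz : 0 ∉ I := fun h => absurd (hmem 0 h).1 (by omega)
  have hj1 := E.isChartIndex.one_le
  have hj := E.isChartIndex.le
  set Sp : Set (Fin 2) := {i | (i = 0 ∧ ∃ m ∈ I, l < m) ∨ (i = 1 ∧ l ∈ I)} with hSp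
  have hloc := hL.isLocalBase hz hne E.c hu
  have hSpu := (hloc u).1 hu
  have hSpσ : Sp ⊆ E.c.σ := fun i hi => E.c.mem_of_mem (hSpu i hi)
  have hSpne : Sp.Nonempty := by
    rcases Finset.mem_insert.1 hL.mem_insert with rfl | hl
    · obtain ⟨m, hm⟩ := hne
      exact ⟨0, Or.inl ⟨rfl, m, hm, (hmem m hm).1⟩⟩
    · exact ⟨1, Or.inr ⟨rfl, hl⟩⟩
  set 𝔭 : Ideal E.c.A := Ideal.span (E.c.v '' Sp) with h𝔭
  have h𝔭le : ∀ w : Spec (.of E.c.A), E.c.e w ∈ L → 𝔭 ≤ w.asIdeal := fun w hw =>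
    Ideal.span_le.2 (Set.image_subset_iff.2 ((hloc w).1 hw))
  have hprime : 𝔭.IsPrime := (E.c.isPrime Sp hSpσ hSpne).resolve_right fun h =>
    u.2.ne_top (top_le_iff.1 (h ▸ h𝔭le u hu))
  -- `Q` is the ring of `L` on the chart, a domain. The map `φ` below goes from `R` to a polynomial
  -- ring over `Q`, in which the variables of index at most `n + 1` stand for the `tᵢ`, and those of
  -- index `n + 2`, `n + 3` for `x_j`, `y_j`. Its kernel is the generic point.
  let Q := E.c.A ⧸ 𝔭
  let M := MvPolynomial ℕ Q
  let f : E.c.A →+* M := MvPolynomial.C.comp (Ideal.Quotient.mk 𝔭)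
  have hf0 : ∀ i ∈ Sp, f (E.c.v i) = 0 := fun i hi => by
    change MvPolynomial.C (Ideal.Quotient.mk 𝔭 _) = 0
    have h2 : E.c.v i ∈ 𝔭 := Ideal.subset_span (Set.mem_image_of_mem _ hi)
    rw [Ideal.Quotient.eq_zero_iff_mem.2 h2, map_zero]
  let Z : Fin 2 → Prop := fun i => (i = 1 ∧ l = E.j) ∨ (i = 0 ∧ E.j ∈ I ∧ l < E.j)
  have hZSp : ∀ i, Z i → i ∈ Sp := by
    rintro i (⟨rfl, hl⟩ | ⟨rfl, hl, hl'⟩)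
    · refine Or.inr ⟨rfl, ?_⟩
      exact (Finset.mem_insert.1 hL.mem_insert).resolve_left (by omega)
    · exact Or.inl ⟨rfl, E.j, hl, hl'⟩
  -- There are three cases: the coordinate vanishes on the cell; it is free because `x`,
  -- respectively `y`, vanishes on `L`; or it equals `x`, respectively `y`, because the accompanying
  -- product is empty. The hypotheses `h0` and `h1` ensure the emptiness in the last case.
  let c' : Fin 2 → M := fun i =>
    if Z i then 0 else if i ∈ Sp then .X (n + 2 + i) else f (E.c.v i)
  let t' : ℕ → M := fun i => if i = E.j then c' 0 * c' 1 else if i ∈ I then 0 else .X i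
  have ht' : ∀ i ∈ I, i ≠ E.j → t' i = 0 := fun i hi hij => by simp [t', hi, hij]
  have hS0 : 0 ∉ Sp → E.j = n + 1 := fun h => h0 fun m hm => by
    by_contra hlt
    exact h (Or.inl ⟨rfl, m, hm, by omega⟩)
  have hS1 : 1 ∉ Sp → E.j = 1 := fun h => h1 fun hl => h (Or.inr ⟨rfl, hl⟩)
  have hval : IsChartValue E.c.σ (fun i => f (E.c.v i)) n E.j t' c' := by
    refine ⟨by simp [t'], ?_, ?_, fun i hi => ?_⟩
    · by_cases hS : 0 ∈ Sp
      · rw [hf0 0 hS]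
        obtain ⟨-, m, hm, hlm⟩ : (0 : Fin 2) = 0 ∧ ∃ m ∈ I, l < m :=
          hS.resolve_right fun h => absurd h.1 (by decide)
        rcases (hge m hm hlm).lt_or_eq with h' | h'
        · rw [Finset.prod_eq_zero (i := m) (Finset.mem_Icc.2 ⟨h', (hmem m hm).2⟩)
            (ht' m hm (by omega)), mul_zero]
        · have : Z 0 := Or.inr ⟨rfl, h' ▸ hm, by omega⟩
          simp [c', this]
      · have hnZ : ¬ Z 0 := fun h => hS (hZSp 0 h)
        rw [Finset.Icc_eq_empty (by have := hS0 hS; omega), Finset.prod_empty, mul_one]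
        simp [c', hnZ, hS]
    · by_cases hS : 1 ∈ Sp
      · rw [hf0 1 hS]
        obtain ⟨-, hl⟩ : (1 : Fin 2) = 1 ∧ l ∈ I :=
          hS.resolve_left fun h => absurd h.1 (by decide)
        rcases hle.lt_or_eq with h' | h'
        · rw [Finset.prod_eq_zero (i := l) (Finset.mem_Ico.2 ⟨(hmem l hl).1, h'⟩)
            (ht' l hl (by omega)), mul_zero]
        · have : Z 1 := Or.inl ⟨rfl, h'⟩
          simp [c', this]
      · have hnZ : ¬ Z 1 := fun h => hS (hZSp 1 h)
        rw [hS1 hS, Finset.Ico_self, Finset.prod_empty, mul_one]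
        simp [c', hnZ, hS]
    · have hS : i ∉ Sp := fun h => hi (hSpσ h)
      have hnZ : ¬ Z i := fun h => hS (hZSp i h)
      simp only [c', hnZ, hS, if_false]
      rw [E.c.coord.one i hi, map_one]
  obtain ⟨φ, hφα, hφt, hφc⟩ := E.R.exists_lift f t' c' hval
  have hcond : ∀ {K : Type u} [CommRing K] [IsDomain K] (ρ : M →+* K),
      E.CellCond I l ⟨RingHom.ker (ρ.comp φ), RingHom.ker_isPrime _⟩ := by
    intro K _ _ ρ
    refine ⟨fun i hi hij => ?_, hle, hge, fun hl => ?_, fun hjI hl => ?_⟩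
    · change ρ (φ _) = 0
      rw [hφt i (hI hi), ht' i hi hij, map_zero]
    · change ρ (φ _) = 0
      have : Z 1 := Or.inl ⟨rfl, hl⟩
      rw [hφc]
      simp [c', this]
    · change ρ (φ _) = 0
      have : Z 0 := Or.inr ⟨rfl, hjI, hl⟩
      rw [hφc]
      simp [c', this]
  refine ⟨⟨RingHom.ker φ, RingHom.ker_isPrime _⟩, hcond (RingHom.id M), fun z hzc a ha => ?_,
    fun w hw => ?_⟩
  · have hzL : p (E.ι z) ∈ L := hzc.mem_base hI hne hL hu
    rw [E.proj_ι] at hzL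
    have h𝔭z := h𝔭le _ hzL
    let g : Q →+* E.R.R ⧸ z.asIdeal := Ideal.Quotient.lift 𝔭
      ((Ideal.Quotient.mk z.asIdeal).comp E.R.α) fun a ha =>
        Ideal.Quotient.eq_zero_iff_mem.2 (h𝔭z ha)
    -- At any point `z` of the cell the reduction map of `R` factors through `φ`, hence `ker φ ≤ z`.
    let ψ : M →+* E.R.R ⧸ z.asIdeal := MvPolynomial.eval₂Hom g fun m =>
      if m ≤ n + 1 then Ideal.Quotient.mk _ (E.R.t m) else
        if m = n + 2 then Ideal.Quotient.mk _ (E.R.c 0) else Ideal.Quotient.mk _ (E.R.c 1)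
    have hψf : ∀ a, ψ (f a) = Ideal.Quotient.mk _ (E.R.α a) := fun a =>
      (MvPolynomial.eval₂Hom_C _ _ _).trans (Ideal.Quotient.lift_mk _ _ _)
    have hψ : ψ.comp φ = Ideal.Quotient.mk z.asIdeal := by
      refine E.R.hom_ext _ _ ?_ (fun i hi hij => ?_) fun i => ?_
      · rw [RingHom.comp_assoc, hφα]
        exact RingHom.ext hψf
      · rw [RingHom.comp_apply, hφt i hi]
        by_cases hiI : i ∈ I
        · rw [ht' i hiI hij, map_zero]
          exact (Ideal.Quotient.eq_zero_iff_mem.2 (hzc.t_mem i hiI hij)).symm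
        · simp only [t', hij, hiI, if_false]
          refine (MvPolynomial.eval₂Hom_X' _ _ _).trans ?_
          rw [if_pos (Finset.mem_Icc.1 hi).2]
      · rw [RingHom.comp_apply, hφc]
        by_cases hZ : Z i
        · simp only [c', hZ, if_true, map_zero]
          refine (Ideal.Quotient.eq_zero_iff_mem.2 ?_).symm
          rcases hZ with ⟨rfl, hl⟩ | ⟨rfl, hl, hl'⟩
          · exact hzc.snd hl
          · exact hzc.fst hl hl'
        · by_cases hS : i ∈ Sp
          · simp only [c', hZ, hS, if_true, if_false]
            refine (MvPolynomial.eval₂Hom_X' _ _ _).trans ?_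
            match i with
            | 0 => simp
            | 1 => simp
          · simp only [c', hZ, hS, if_false]
            rw [hψf]
            congr 1
            match i with
            | 0 =>
              have := E.R.isValue.fst
              rwa [Finset.Icc_eq_empty (by have := hS0 hS; omega), Finset.prod_empty,
                mul_one] at this
            | 1 =>
              have := E.R.isValue.snd
              rwa [Finset.Ico_eq_empty (by have := hS1 hS; omega), Finset.prod_empty,
                mul_one] at this
    refine Ideal.Quotient.eq_zero_iff_mem.1 ?_
    have h2 := RingHom.congr_fun hψ a
    have h3 : φ a = 0 := ha
    rw [← h2, RingHom.comp_apply, h3, map_zero]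
  · let g : Q →+* E.c.A ⧸ w.asIdeal := Ideal.Quotient.factor (h𝔭le w hw)
    let ρ : M →+* E.c.A ⧸ w.asIdeal := MvPolynomial.eval₂Hom g fun _ => 1
    have : IsDomain (E.c.A ⧸ w.asIdeal) := by
      have := w.2
      exact Ideal.Quotient.isDomain _
    refine ⟨_, hcond ρ, PrimeSpectrum.ext (Ideal.ext fun a => ?_)⟩
    change ρ (φ (E.R.α a)) = 0 ↔ _
    have h2 : φ (E.R.α a) = f a := RingHom.congr_fun hφα a
    have h3 : ρ (f a) = Ideal.Quotient.mk _ a :=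
      (MvPolynomial.eval₂Hom_C _ _ _).trans (Ideal.Quotient.factor_mk _ _)
    rw [h2, h3]
    exact Ideal.Quotient.eq_zero_iff_mem

open Classical in
/-- The index of the charts that contain the generic point of a component. -/
def genericIndex (n : ℕ) (I : Finset ℕ) (l : ℕ) : ℕ :=
  if l = 0 then 1 else if ∃ m ∈ I, l < m then l else n + 1

variable [IsAlgClosed k]

section

variable (h : IsUniversal B n p t) (hI : I ⊆ Finset.Icc 1 (n + 1)) (hne : I.Nonempty)
include h hI hne

omit [IsAlgClosed k] in
-- The value of `genericIndex` reflects the hypotheses of `ExpChart.exists_generic`: over a source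
-- `y` is unconstrained, which requires `j = 1`, and over a target `x` is unconstrained, which
-- requires `j = n + 1`.
theorem exists_generic_chart {l : ℕ} {L : Set 𝒟.X} (hL : IsBase B I l L) (c : Chart B)
    {u : Spec (.of c.A)} (hu : c.e u ∈ L) :
    ∃ E : ExpChart B n p t, E.c = c ∧ E.j = genericIndex n I l ∧
      ∃ z₀ : Spec (.of E.R.R), E.CellCond I l z₀ ∧
        (∀ z : Spec (.of E.R.R), E.CellCond I l z → z₀.asIdeal ≤ z.asIdeal) ∧
        ∀ w, E.c.e w ∈ L → ∃ z, E.CellCond I l z ∧ E.below z = w := by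
  have hmem : ∀ m ∈ I, 1 ≤ m ∧ m ≤ n + 1 := fun m hm => Finset.mem_Icc.1 (hI hm)
  have hz : 0 ∉ I := fun h => absurd (hmem 0 h).1 (by omega)
  have hloc := (hL.isLocalBase hz hne c hu u).1 hu
  have hl := Finset.mem_insert.1 hL.mem_insert
  have hj : IsChartIndex c.σ n (genericIndex n I l) := by
    have h0 : 0 ∉ c.σ → ¬ ∃ m ∈ I, l < m := fun h hm =>
      h (c.mem_of_mem (hloc 0 (Or.inl ⟨rfl, hm⟩)))
    have h1 : 1 ∉ c.σ → l = 0 := fun h => hl.resolve_right fun hl =>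
      h (c.mem_of_mem (hloc 1 (Or.inr ⟨rfl, hl⟩)))
    have h2 : l = 0 → ∃ m ∈ I, l < m := fun h => by
      obtain ⟨m, hm⟩ := hne
      exact ⟨m, hm, by have := hmem m hm; omega⟩
    have h3 : l ∈ I → l ≤ n + 1 := fun h => (hmem l h).2
    unfold genericIndex
    refine ⟨?_, ?_, fun h => ?_, fun h => ?_⟩
    · split_ifs <;> omega
    · split_ifs with h4
      · omega
      · exact h3 (hl.resolve_left h4)
      · omega
    · have h4 := h0 h
      rw [if_neg fun h5 => h4 (h2 h5), if_neg h4]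
    · rw [if_pos (h1 h)]
  obtain ⟨E, rfl, hEj⟩ := h.exists_expChart c hj
  refine ⟨E, rfl, hEj, E.exists_generic hI hne hL hu ?_ ?_ ?_ ?_⟩
  · rw [hEj]
    unfold genericIndex
    split_ifs with h4 h5
    · omega
    · rfl
    · exact (hmem l (hl.resolve_left h4)).2
  · intro m hm hlm
    rw [hEj]
    unfold genericIndex
    split_ifs with h4 h5
    · exact (hmem m hm).1
    · exact hlm.le
    · exact (h5 ⟨m, hm, hlm⟩).elim
  · intro h4
    rw [hEj, genericIndex, if_neg, if_neg]
    · rintro ⟨m, hm, hlm⟩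
      exact absurd (h4 m hm) (by omega)
    · rintro rfl
      obtain ⟨m, hm⟩ := hne
      have := hmem m hm
      have := h4 m hm
      omega
  · intro h4
    rw [hEj, genericIndex, if_pos (hl.resolve_right h4)]

/-- Fix the generic point `η` found in one chart. Any point of the cell has a generization in the
chart of the same index over its own chart of `X`, hence specializes the generic point there. As `L`
is irreducible, the two charts of `X` overlap along `L`, and surjectivity onto `L` puts the second
generic point into the first chart, where `η` specializes to it. -/
theorem exists_genericPoint {l : ℕ} {L : Set 𝒟.X} (hL : IsBase B I l L) :
    ∃ η ∈ cell B p t n I L l, ∀ q ∈ cell B p t n I L l, η ⤳ q := by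
  have hlm := hL.mem_insert
  have hln : l ≤ n + 1 := by
    rcases Finset.mem_insert.1 hlm with rfl | h
    · omega
    · exact (Finset.mem_Icc.1 (hI h)).2
  have key : ∀ (E : ExpChart B n p t) (u : Spec (.of E.c.A)) (_ : E.c.e u ∈ L)
      (_ : E.j = genericIndex n I l) (q : S) (_ : q ∈ cell B p t n I L l)
      (_ : p q ∈ Set.range E.c.e) (_ : ¬ TailZero B p t n E.j q)
      (_ : ¬ SourceZero B p t n (E.j - 1) q), ∃ z, E.ι z = q ∧ E.CellCond I l z := by
    intro E u hu hEj q hq hqr h1 h2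
    obtain ⟨z, rfl⟩ := E.mem_range q hqr (not_not.1 h1) (not_not.1 h2)
    exact ⟨z, rfl, ((E.mem_cell_iff hI hlm z).1 hq).2⟩
  obtain ⟨x, hx⟩ := hL.isIrreducible.1
  obtain ⟨c, u, rfl⟩ := exists_mem_range_chart B x
  obtain ⟨E, rfl, hEj, z₀, hz₀, hmin, hsurj⟩ := exists_generic_chart h hI hne hL c hx
  have hη : E.ι z₀ ∈ cell B p t n I L l :=
    (E.mem_cell_iff hI hlm z₀).2 ⟨hz₀.mem_base hI hne hL hx, hz₀⟩
  refine ⟨E.ι z₀, hη, fun q hq => ?_⟩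
  obtain ⟨q', hq', hspec, hcr, hns, hnt⟩ := exists_generization_mem_cell h hI hne hL hq
  refine Specializes.trans ?_ hspec
  obtain ⟨c, w, hw⟩ := exists_mem_range_chart B (p q)
  have hwL : c.e w ∈ L := hw ▸ hq.2.1
  obtain ⟨E', rfl, hEj', z₀', hz₀', hmin', hsurj'⟩ := exists_generic_chart h hI hne hL c hwL
  have hj := E'.isChartIndex.le
  obtain ⟨z, rfl, hz⟩ := key E' w hwL hEj' q' hq' (hcr _ ⟨w, hw⟩)
    (by
      refine hnt _ ?_ hj
      rw [hEj', genericIndex]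
      split_ifs <;> omega)
    (by
      refine hns _ (by omega) fun m hm hlm => ?_
      have := (Finset.mem_Icc.1 (hI hm)).1
      rw [hEj', genericIndex]
      split_ifs with h4 h5
      · omega
      · omega
      · exact (h5 ⟨m, hm, hlm⟩).elim)
  have h1 : E'.ι z₀' ⤳ E'.ι z :=
    ((PrimeSpectrum.le_iff_specializes _ _).1 (hmin' z hz)).map E'.ι.continuous
  refine Specializes.trans ?_ h1
  have hη' : E'.ι z₀' ∈ cell B p t n I L l :=
    (E'.mem_cell_iff hI hlm z₀').2 ⟨hz₀'.mem_base hI hne hL hwL, hz₀'⟩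
  have hr : p (E'.ι z₀') ∈ Set.range E.c.e := by
    obtain ⟨y, hyL, ⟨y1, hy1⟩, ⟨y2, hy2⟩⟩ := hL.isIrreducible.2 _ _
      E.c.isOpenEmbedding.isOpen_range E'.c.isOpenEmbedding.isOpen_range
      ⟨_, hx, u, rfl⟩ ⟨_, hwL, w, rfl⟩
    obtain ⟨z', hz', hb⟩ := hsurj' y2 (hy2 ▸ hyL)
    have h2 : p (E'.ι z₀') ⤳ p (E'.ι z') :=
      ((PrimeSpectrum.le_iff_specializes _ _).1 (hmin' z' hz')).map
        (p.continuous.comp E'.ι.continuous)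
    refine h2.mem_open E.c.isOpenEmbedding.isOpen_range ⟨y1, ?_⟩
    rw [E'.proj_ι, hb, hy1, hy2]
  obtain ⟨z', hz'e, hz'⟩ := key E u hx hEj _ hη' hr
    (by
      rw [E'.tailZero_iff _ (by have := E.isChartIndex.le; omega)]
      omega)
    (by
      rw [E'.sourceZero_iff _ (by have := E.isChartIndex.le; omega)]
      have := E.isChartIndex.one_le
      omega)
  rw [← hz'e]
  exact ((PrimeSpectrum.le_iff_specializes _ _).1 (hmin z' hz')).map E.ι.continuous

theorem image_cell {l : ℕ} {L : Set 𝒟.X} (hL : IsBase B I l L) :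
    p '' cell B p t n I L l = L := by
  refine Set.Subset.antisymm (Set.image_subset_iff.2 fun q hq => hq.2.1) fun x hx => ?_
  obtain ⟨c, u, rfl⟩ := exists_mem_range_chart B x
  obtain ⟨E, rfl, hEj, z₀, hz₀, hmin, hsurj⟩ := exists_generic_chart h hI hne hL c hx
  obtain ⟨z, hz, rfl⟩ := hsurj u hx
  refine ⟨E.ι z, (E.mem_cell_iff hI hL.mem_insert z).2 ⟨?_, hz⟩, E.proj_ι z⟩
  rw [E.proj_ι]
  exact hx

omit hI hne in
theorem isClosed_of_expChart {Z : Set S}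
    (hZ : ∀ E : ExpChart B n p t, IsClosed (E.ι ⁻¹' Z)) : IsClosed Z := by
  rw [← isOpen_compl_iff, isOpen_iff_forall_mem_open]
  intro q hq
  obtain ⟨E, z, rfl⟩ := h.exists_mem_range_expChart q
  refine ⟨E.ι '' (E.ι ⁻¹' Z)ᶜ, ?_, E.ι.isOpenEmbedding.isOpenMap _ (hZ E).isOpen_compl, z, hq, rfl⟩
  rintro _ ⟨z, hz, rfl⟩
  exact hz

omit hne in
theorem isClosed_cell {l : ℕ} {L : Set 𝒟.X} (hL : IsBase B I l L) :
    IsClosed (cell B p t n I L l) := by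
  refine isClosed_of_expChart h fun E => ?_
  by_cases hc : l ≤ E.j ∧ ∀ m ∈ I, l < m → E.j ≤ m
  · have : E.ι ⁻¹' cell B p t n I L l = (fun z => p (E.ι z)) ⁻¹' L ∩ PrimeSpectrum.zeroLocus
        {a | (∃ i ∈ I, i ≠ E.j ∧ a = E.R.t i) ∨ (l = E.j ∧ a = E.R.c 1) ∨
          (E.j ∈ I ∧ l < E.j ∧ a = E.R.c 0)} := by
      ext z
      refine (E.mem_cell_iff hI hL.mem_insert z).trans (and_congr_right fun _ => ?_)
      constructor
      · rintro h a (⟨i, hi, hij, rfl⟩ | ⟨hl, rfl⟩ | ⟨hj, hl, rfl⟩)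
        · exact h.t_mem i hi hij
        · exact h.snd hl
        · exact h.fst hj hl
      · intro h
        exact ⟨fun i hi hij => h (Or.inl ⟨i, hi, hij, rfl⟩), hc.1, hc.2,
          fun hl => h (Or.inr (Or.inl ⟨hl, rfl⟩)), fun hj hl => h (Or.inr (Or.inr ⟨hj, hl, rfl⟩))⟩
    rw [this]
    exact (hL.isClosed.preimage (p.continuous.comp E.ι.continuous)).inter
      (PrimeSpectrum.isClosed_zeroLocus _)
  · have : E.ι ⁻¹' cell B p t n I L l = ∅ := by
      refine Set.eq_empty_iff_forall_notMem.2 fun z hz => hc ?_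
      have := ((E.mem_cell_iff hI hL.mem_insert z).1 hz).2
      exact ⟨this.le, this.ge⟩
    rw [this]
    exact isClosed_empty

/-- At a generic enough point of the smaller cell, only the homogeneous coordinates prescribed by
its index vanish, so the two indices agree. Then the bases meet and agree by `IsBase.unique`. -/
theorem cell_index_le {l l' : ℕ} {L L' : Set 𝒟.X} (hL : IsBase B I l L) (hL' : IsBase B I l' L')
    (hsub : cell B p t n I L l ⊆ cell B p t n I L' l') : l = l' ∧ L = L' := by
  have hmem : ∀ m ∈ I, 1 ≤ m ∧ m ≤ n + 1 := fun m hm => Finset.mem_Icc.1 (hI hm)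
  obtain ⟨q, hq, -⟩ := exists_genericPoint h hI hne hL
  obtain ⟨η, hη, -, -, hns, hnt⟩ := exists_generization_mem_cell h hI hne hL hq
  have hη' := hsub hη
  have hll : l = l' := by
    rcases lt_trichotomy l l' with hlt | heq | hgt
    · have h1 := hη'.2.2.1 l hlt
      have h2 : l' ≤ n + 1 := by
        rcases Finset.mem_insert.1 hL'.mem_insert with h3 | h3
        · omega
        · exact (hmem _ h3).2
      exact (hnt l le_rfl (by omega) h1).elim
    · exact heq
    · have hl : l ∈ I := (Finset.mem_insert.1 hL.mem_insert).resolve_left (by omega)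
      have h1 := hη'.2.2.2 l hl hgt l le_rfl (hmem l hl).2
      exact (hns l (hmem l hl).2 (fun m _ h => h) h1).elim
  subst hll
  exact ⟨rfl, hL.unique (fun h => absurd (hmem 0 h).1 (by omega)) hL' ⟨_, hη.2.1, hη'.2.1⟩⟩

/-- The cells are closed and irreducible, cover the stratum, and do not contain one another. An
irreducible subset lies in any cell that contains the generic point of its closure. -/
theorem isComponent_iff {Z : Set S} : IsComponent Z {q | ∀ i ∈ I, VanishesAt (t i) q} ↔
    ∃ L l, IsBase B I l L ∧ Z = cell B p t n I L l := by
  have hstr : IsClosed {q : S | ∀ i ∈ I, VanishesAt (t i) q} := by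
    rw [Set.ofPred_forall]
    refine isClosed_iInter fun i => ?_
    rw [Set.ofPred_forall]
    refine isClosed_iInter fun _ => ?_
    exact (S.basicOpen (t i)).2.isClosed_compl
  have hsub : ∀ W : Set S, IsIrreducible W → W ⊆ {q | ∀ i ∈ I, VanishesAt (t i) q} →
      ∃ L l, IsBase B I l L ∧ W ⊆ cell B p t n I L l := by
    intro W hW hWs
    obtain ⟨η, hη⟩ := QuasiSober.sober hW.closure isClosed_closure
    have h1 : η ∈ closure W := hη ▸ subset_closure rfl
    obtain ⟨L, l, hL, hm⟩ := exists_mem_cell h hI hne ((hstr.closure_subset_iff.2 hWs) h1)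
    refine ⟨L, l, hL, subset_closure.trans ?_⟩
    rw [← hη.def]
    exact (isClosed_cell h hI hL).closure_subset_iff.2 (Set.singleton_subset_iff.2 hm)
  have hirr : ∀ L l, IsBase B I l L → IsIrreducible (cell B p t n I L l) := by
    intro L l hL
    obtain ⟨η, hη, hs⟩ := exists_genericPoint h hI hne hL
    have : cell B p t n I L l = closure {η} :=
      Set.Subset.antisymm (fun q hq => specializes_iff_mem_closure.1 (hs q hq))
        ((isClosed_cell h hI hL).closure_subset_iff.2 (Set.singleton_subset_iff.2 hη))
    rw [this]
    exact isIrreducible_singleton.closure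
  constructor
  · intro hZ
    obtain ⟨L, l, hL, hm⟩ := hsub Z hZ.1.1 hZ.1.2
    exact ⟨L, l, hL, hm.antisymm (hZ.2 ⟨hirr L l hL, fun q hq => hq.1⟩ hm)⟩
  · rintro ⟨L, l, hL, rfl⟩
    refine ⟨⟨hirr L l hL, fun q hq => hq.1⟩, fun W hW hle => ?_⟩
    obtain ⟨L', l', hL', hm⟩ := hsub W hW.1 hW.2
    obtain ⟨rfl, rfl⟩ := cell_index_le h hI hne hL hL' (hle.trans hm)
    exact hm

end

end ExpDeg

end

/-! ### Chains of components over an arrow -/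

noncomputable section

namespace ExpDeg

variable {k : Type u} [Field k] {𝒟 : Degeneration k} {B : BipartiteOrientation 𝒟}

open Classical in
/-- The image in `X` of the component with index `l` in the chain over an arrow. -/
def Arrow.base (D : Arrow B) (I : Finset ℕ) (l : ℕ) : Set 𝒟.X :=
  if l = 0 then D.source else if ∃ m ∈ I, l < m then D.locus else D.target

theorem Arrow.isBase (D : Arrow B) {I : Finset ℕ} {l : ℕ} (hl : l ∈ insert 0 I) :
    IsBase B I l (D.base I l) := by
  unfold base
  split_ifs with h0 h1
  · exact Or.inl ⟨h0, D.source_mem⟩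
  · exact Or.inr (Or.inr ⟨(Finset.mem_insert.1 hl).resolve_left h0, h1, D, rfl⟩)
  · push Not at h1
    exact Or.inr (Or.inl ⟨(Finset.mem_insert.1 hl).resolve_left h0, h1, D.target_mem⟩)

theorem Arrow.locus_subset_base (D : Arrow B) (I : Finset ℕ) (l : ℕ) : D.locus ⊆ D.base I l := by
  unfold base
  split_ifs
  · exact D.locus_component.1.2.trans Set.inter_subset_left
  · exact subset_rfl
  · exact D.locus_component.1.2.trans Set.inter_subset_right

variable {S : Scheme.{u}} {p : S ⟶ 𝒟.X} {t : ℕ → Γ(S, ⊤)} {n : ℕ} {I : Finset ℕ}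

variable [IsAlgClosed k]

theorem not_tailZero_of_sourceZero (h : IsUniversal B n p t) {i : ℕ} (hi : i ≤ n + 1) {q : S}
    (hs : SourceZero B p t n i q) : ¬ TailZero B p t n i q := by
  obtain ⟨E, z, rfl⟩ := h.exists_mem_range_expChart q
  rw [E.sourceZero_iff z hi] at hs
  rw [E.tailZero_iff z hi]
  omega

/-- Over a point of the locus of an arrow, there is a point at which all the coordinates of
the `j`-th chart with index in `I` vanish. -/
theorem exists_mem_two_cells (h : IsUniversal B n p t) (hI : I ⊆ Finset.Icc 1 (n + 1)) (D : Arrow B)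
    {l l' : ℕ} (hl : Consecutive (insert 0 I) l l') :
    ∃ q, q ∈ cell B p t n I (D.base I l) l ∧ q ∈ cell B p t n I (D.base I l') l' ∧
      p q ∈ D.locus := by
  classical
  obtain ⟨hl1, hl2, hlt, hcon⟩ := hl
  have hl2' := (Finset.mem_insert.1 hl2).resolve_left (by omega)
  have hmem := Finset.mem_Icc.1 (hI hl2')
  obtain ⟨x, hx⟩ := D.locus_component.1.1.1
  obtain ⟨c, w, rfl⟩ := exists_mem_range_chart B x
  have hv := (c.mem_arrow_iff D hx w).1 hx
  have hσ : ∀ i, i ∈ c.σ := by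
    rw [Fin.forall_fin_two]
    exact ⟨c.mem_of_mem hv.1, c.mem_of_mem hv.2⟩
  obtain ⟨E, rfl, hEj⟩ := h.exists_expChart c (j := l')
    ⟨hmem.1, hmem.2, fun h => (h (hσ 0)).elim, fun h => (h (hσ 1)).elim⟩
  have hj : E.j ∈ I := hEj ▸ hl2'
  let f : E.c.A →+* E.c.A ⧸ w.asIdeal := Ideal.Quotient.mk _
  -- The point over `w` with `x_j = y_j = 0`, with `tᵢ = 0` for `i ∈ I`, and with the other `tᵢ`
  -- equal to `1`.
  obtain ⟨φ, hφ, hφt, hφc⟩ := E.R.exists_lift f (fun i => if i ∈ I then 0 else 1) (fun _ => 0)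
    ⟨by simp [hj], by simp [f, Ideal.Quotient.eq_zero_iff_mem.2 hv.1],
      by simp [f, Ideal.Quotient.eq_zero_iff_mem.2 hv.2], fun i hi => (hi (hσ i)).elim⟩
  have : IsDomain (E.c.A ⧸ w.asIdeal) := by
    have := w.2
    exact Ideal.Quotient.isDomain _
  let z : Spec (.of E.R.R) := ⟨RingHom.ker φ, RingHom.ker_isPrime _⟩
  have hz : E.below z = w := by
    refine PrimeSpectrum.ext (Ideal.ext fun a => ?_)
    change φ (E.R.α a) = 0 ↔ _
    have h2 : φ (E.R.α a) = f a := RingHom.congr_fun hφ a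
    rw [h2]
    exact Ideal.Quotient.eq_zero_iff_mem
  have hc : ∀ i, E.R.c i ∈ z.asIdeal := hφc
  have ht : ∀ i ∈ I, E.R.t i ∈ z.asIdeal := fun i hi => by
    change φ _ = 0
    rw [hφt i (hI hi), if_pos hi]
  have hp : p (E.ι z) ∈ D.locus := by
    rw [E.proj_ι, hz]
    exact hx
  refine ⟨E.ι z, (E.mem_cell_iff hI hl1 z).2 ⟨D.locus_subset_base _ _ hp, ?_⟩,
    (E.mem_cell_iff hI hl2 z).2 ⟨D.locus_subset_base _ _ hp, ?_⟩, hp⟩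
  · refine ⟨fun i hi _ => ht i hi, by omega, fun m hm hlm => ?_, fun _ => hc 1, fun _ _ => hc 0⟩
    have := hcon m (Finset.mem_insert_of_mem hm)
    omega
  · exact ⟨fun i hi _ => ht i hi, by omega, fun m hm hlm => by omega, fun _ => hc 1,
      fun _ _ => hc 0⟩

section Chains

variable {Y : Family 𝒟}

theorem isChain_cell (h : IsUniversal B n Y.proj Y.coord) (hI : I ⊆ Finset.Icc 1 (n + 1))
    (hne : I.Nonempty) (D : Arrow B) :
    IsChain Y I D fun l => cell B Y.proj Y.coord n I (D.base I l) l where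
  component c hc := (isComponent_iff h hI hne).2 ⟨_, c, D.isBase hc, rfl⟩
  first := by
    refine (image_cell h hI hne (D.isBase (Finset.mem_insert_self 0 I))).trans ?_
    simp [Arrow.base]
  last c hc hmax := by
    refine (image_cell h hI hne (D.isBase (Finset.mem_insert_of_mem hc))).trans ?_
    have h1 := Finset.mem_Icc.1 (hI hc)
    rw [Arrow.base, if_neg (by omega), if_neg]
    rintro ⟨m, hm, hlt⟩
    exact absurd (hmax m hm) (by omega)
  middle c hc hm := by
    refine (image_cell h hI hne (D.isBase (Finset.mem_insert_of_mem hc))).trans ?_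
    have h1 := Finset.mem_Icc.1 (hI hc)
    rw [Arrow.base, if_neg (by omega), if_pos hm]
  injOn l hl l' hl' heq :=
    (cell_index_le h hI hne (D.isBase hl) (D.isBase hl') (Set.Subset.antisymm_iff.1 heq).1).1
  meet l l' hl := by
    obtain ⟨q, h1, h2, h3⟩ := exists_mem_two_cells h hI D hl
    exact ⟨q, ⟨h1, h2⟩, h3⟩

theorem exists_pred {T : Finset ℕ} (h0 : 0 ∈ T) {l : ℕ} (hl : l ∈ T) (hpos : 0 < l) :
    ∃ d, Consecutive T d l := by
  have hex : (T.filter (· < l)).Nonempty := ⟨0, Finset.mem_filter.2 ⟨h0, hpos⟩⟩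
  have := Finset.mem_filter.1 (Finset.max'_mem _ hex)
  refine ⟨_, this.1, hl, this.2, fun m hm hlt => ?_⟩
  have := Finset.le_max' (T.filter (· < l)) m (Finset.mem_filter.2 ⟨hm, hlt.2⟩)
  omega

/-- Uniqueness of the chain, by induction on `l`. The image in `X` determines the base of the
component `Z l`, and it remains to exclude a wrong index `l'`. If `l' < l`, the component already
occurred in the chain. If `l' > l`, a common point with the preceding component would have both
homogeneous coordinates of index `l` equal to zero. -/
theorem IsChain.eq_cell (h : IsUniversal B n Y.proj Y.coord) (hI : I ⊆ Finset.Icc 1 (n + 1))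
    (hne : I.Nonempty) {D : Arrow B} {Z : ℕ → Set Y.space} (hZ : IsChain Y I D Z) {l : ℕ}
    (hl : l ∈ insert 0 I) : Z l = cell B Y.proj Y.coord n I (D.base I l) l := by
  have hmem : ∀ m ∈ I, 1 ≤ m ∧ m ≤ n + 1 := fun m hm => Finset.mem_Icc.1 (hI hm)
  have h0 : 0 ∉ I := fun h => absurd (hmem 0 h).1 (by omega)
  induction l using Nat.strong_induction_on with
  | _ l ih =>
    obtain ⟨L, l', hL, hZl⟩ := (isComponent_iff h hI hne).1 (hZ.component l hl)
    have himg : Y.proj '' Z l = D.base I l := by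
      unfold Arrow.base
      split_ifs with h1 h2
      · subst h1
        exact hZ.first
      · exact hZ.middle l ((Finset.mem_insert.1 hl).resolve_left h1) h2
      · push Not at h2
        exact hZ.last l ((Finset.mem_insert.1 hl).resolve_left h1) h2
    have hLb : L = D.base I l := by
      rw [← himg, hZl]
      exact (image_cell h hI hne hL).symm
    subst hLb
    suffices l' = l by rw [hZl, this]
    rcases Nat.eq_zero_or_pos l with rfl | hpos
    · have hb : D.base I 0 = D.source := by simp [Arrow.base]
      rw [hb] at hL
      rcases hL with ⟨h1, -⟩ | ⟨-, -, h1⟩ | ⟨-, -, D', h1⟩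
      · exact h1
      · exact (Set.disjoint_left.1 B.disjoint D.source_mem h1).elim
      -- A source cannot be the locus of an arrow: it would lie in a target and, by maximality of
      -- components, equal it.
      · have h2 : D.source ⊆ D'.target :=
          h1 ▸ D'.locus_component.1.2.trans Set.inter_subset_right
        have h3 : D.source = D'.target := h2.antisymm
          ((B.isComponent_neg D.source_mem).2 (B.isComponent_pos D'.target_mem).1 h2)
        exact (Set.disjoint_left.1 B.disjoint D.source_mem (h3 ▸ D'.target_mem)).elim
    · obtain ⟨d, hd⟩ := exists_pred (Finset.mem_insert_self 0 I) hl hpos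
      obtain ⟨hd1, hd2, hdl, hcon⟩ := hd
      have hle : ∀ m ∈ insert 0 I, m < l → l' ≠ m := by
        rintro m hm hml rfl
        have h1 := hL.unique h0 (D.isBase hm) (by
          obtain ⟨x, hx⟩ := D.locus_component.1.1.1
          exact ⟨x, D.locus_subset_base _ _ hx, D.locus_subset_base _ _ hx⟩)
        have h2 := ih l' hml hm
        rw [← h1, ← hZl] at h2
        have := hZ.injOn hm hl h2
        omega
      have hl'mem := hL.mem_insert
      have hge : l ≤ l' := by
        by_contra hlt
        exact hle l' hl'mem (by omega) rfl
      refine le_antisymm ?_ hge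
      by_contra hlt
      obtain ⟨q, ⟨hq1, hq2⟩, -⟩ := hZ.meet d l ⟨hd1, hd2, hdl, hcon⟩
      rw [ih d hdl hd1] at hq1
      rw [hZl] at hq2
      have hlI : l ∈ I := (Finset.mem_insert.1 hl).resolve_left (by omega)
      have h1 := hq1.2.2.2 l hlI hdl l le_rfl (hmem l hlI).2
      exact not_tailZero_of_sourceZero h (hmem l hlI).2 h1 (hq2.2.2.1 l (by omega))

theorem mem_delta_iff (h : IsUniversal B n Y.proj Y.coord) (hI : I ⊆ Finset.Icc 1 (n + 1))
    (hne : I.Nonempty) (D : Arrow B) {l : ℕ} (hl : l ∈ insert 0 I) (q : Y.space) :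
    q ∈ Y.delta I D l ↔ q ∈ cell B Y.proj Y.coord n I (D.base I l) l := by
  constructor
  · rintro ⟨-, -, Z, hZ, hq⟩
    rwa [hZ.eq_cell h hI hne hl] at hq
  · intro hq
    exact ⟨hne, hl, _, isChain_cell h hI hne D, hq⟩

end Chains

end ExpDeg

end

/-! ### Smoothness of the strata -/

noncomputable section

namespace ExpDeg

section SmoothAt

theorem smoothAt_comp_iff {Z Y S : Scheme.{u}} (g : Z ⟶ Y) [IsOpenImmersion g] (f : Y ⟶ S) (z : Z) :
    SmoothAt (g ≫ f) z ↔ SmoothAt f (g z) := by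
  constructor
  · rintro ⟨U, hz, hU⟩
    refine ⟨g ''ᵁ U, ⟨z, hz, rfl⟩, ?_⟩
    have h : (g ''ᵁ U).ι ≫ f = (g.isoImage U).inv ≫ U.ι ≫ g ≫ f := by
      rw [← Scheme.Hom.isoImage_inv_ι_assoc]
    rw [h]
    infer_instance
  · rintro ⟨U, hz, hU⟩
    refine ⟨g ⁻¹ᵁ U, hz, ?_⟩
    have h : (g ⁻¹ᵁ U).ι ≫ g ≫ f = (g ∣_ U) ≫ U.ι ≫ f := by
      rw [morphismRestrict_ι_assoc]
    rw [h]
    infer_instance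

theorem smoothAt_of_smooth {Y S : Scheme.{u}} (f : Y ⟶ S) [Smooth f] (y : Y) : SmoothAt f y :=
  ⟨⊤, trivial, inferInstance⟩

theorem exists_smooth_of_smoothAt {K A : Type u} [CommRing K] [CommRing A] (φ : K →+* A)
    (w : Spec (.of A)) (h : SmoothAt (Spec.map (CommRingCat.ofHom φ)) w) :
    ∃ a, a ∉ w.asIdeal ∧ ((algebraMap A (Localization.Away a)).comp φ).Smooth := by
  obtain ⟨U, hw, hU⟩ := h
  obtain ⟨_, ⟨_, ⟨a, rfl⟩, rfl⟩, ha, haU⟩ :=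
    PrimeSpectrum.isBasis_basic_opens.exists_subset_of_mem_open hw U.2
  refine ⟨a, ha, ?_⟩
  refine (HasRingHomProperty.Spec_iff (P := @Smooth) (φ := CommRingCat.ofHom
    ((algebraMap A (Localization.Away a)).comp φ))).1 ?_
  have : IsOpenImmersion (Spec.map (CommRingCat.ofHom (algebraMap A (Localization.Away a)))) :=
    IsOpenImmersion.of_isLocalization a
  have hr : Set.range (Spec.map (CommRingCat.ofHom (algebraMap A (Localization.Away a)))) ⊆
      Set.range U.ι := by
    rw [Scheme.Opens.range_ι]
    refine subset_trans ?_ haU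
    exact (PrimeSpectrum.localization_away_comap_range (Localization.Away a) a).subset
  have h : Spec.map (CommRingCat.ofHom ((algebraMap A (Localization.Away a)).comp φ)) =
      IsOpenImmersion.lift U.ι _ hr ≫ U.ι ≫ Spec.map (CommRingCat.ofHom φ) := by
    rw [IsOpenImmersion.lift_fac_assoc, CommRingCat.ofHom_comp, Spec.map_comp]
  have : IsOpenImmersion (IsOpenImmersion.lift U.ι _ hr) := by
    have h2 := IsOpenImmersion.lift_fac U.ι _ hr
    have : IsOpenImmersion (IsOpenImmersion.lift U.ι _ hr ≫ U.ι) := by rw [h2]; infer_instance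
    exact IsOpenImmersion.of_comp _ U.ι
  rw [h]
  infer_instance

theorem exists_closed_chart {S : Scheme.{u}} {O : Type u} [CommRing O] (g : Spec (.of O) ⟶ S)
    [IsOpenImmersion g] (J : S.IdealSheafData) (𝔞 : Ideal O)
    (hJ : J.comap g = Scheme.IdealSheafData.ofIdealTop (𝔞.map (specFun O))) :
    ∃ ρ : Spec (.of (O ⧸ 𝔞)) ⟶ J.subscheme, IsOpenImmersion ρ ∧
      ρ ≫ J.subschemeι = Spec.map (CommRingCat.ofHom (Ideal.Quotient.mk 𝔞)) ≫ g := by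
  obtain ⟨𝔟, e, he⟩ := IsClosedImmersion.Spec_iff.1
    (inferInstance : IsClosedImmersion (pullback.fst g J.subschemeι))
  have hker : (pullback.fst g J.subschemeι).ker =
      Scheme.IdealSheafData.ofIdealTop (𝔞.map (specFun O)) := hJ
  have hab : 𝔟 = 𝔞 := by
    have h1 : (Spec.map (CommRingCat.ofHom (Ideal.Quotient.mk 𝔟))).ker =
        Scheme.IdealSheafData.ofIdealTop (𝔞.map (specFun O)) := by
      rw [← hker, he, Scheme.Hom.ker_comp_of_isIso]
    rw [Scheme.ker_of_isAffine] at h1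
    have h2 := Scheme.IdealSheafData.equivOfIsAffine.symm.injective h1
    ext a
    rw [← Ideal.comap_map_of_bijective (specFun O) (specFun_bijective O) (I := 𝔞), ← h2,
      Ideal.mem_comap, RingHom.mem_ker]
    have h3 := appTop_specFun (Ideal.Quotient.mk 𝔟) a
    refine Iff.trans ?_ (Eq.congr_left h3).symm
    rw [map_eq_zero_iff _ (specFun_bijective _).1, Ideal.Quotient.eq_zero_iff_mem]
  subst hab
  refine ⟨e.inv ≫ pullback.snd g J.subschemeι, inferInstance, ?_⟩
  rw [Category.assoc, ← pullback.condition, he, Category.assoc, e.inv_hom_id_assoc]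

end SmoothAt

section Obstruction

theorem _root_.RingHom.Smooth.exists_lift {A D C C' : Type*} [CommRing A] [CommRing D] [CommRing C]
    [CommRing C'] {φ : A →+* D} (hφ : φ.Smooth) (q : C' →+* C) (hq : Function.Surjective q)
    (hn : IsNilpotent (RingHom.ker q)) (f : D →+* C) (w : A →+* C') (h : q.comp w = f.comp φ) :
    ∃ g : D →+* C', q.comp g = f ∧ g.comp φ = w := by
  algebraize [φ, w, q.comp w]
  have hs : Algebra.Smooth A D := hφ
  let q' : C' →ₐ[A] C := { q with commutes' := fun _ => rfl }
  let f' : D →ₐ[A] C := { f with commutes' := fun a => (RingHom.congr_fun h a).symm }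
  refine ⟨(Algebra.FormallySmooth.liftOfSurjective f' q' hq hn).toRingHom, ?_, ?_⟩
  · ext d
    exact Algebra.FormallySmooth.liftOfSurjective_apply f' q' hq hn d
  · ext a
    exact AlgHom.commutes _ a

open Polynomial in
-- Supplies the infinitesimal thickenings `k[ε]/ε^{m+1} → k[ε]/ε^m` used to test smoothness; the
-- kernel has square zero because `2 m ≥ m + 1`.
theorem exists_factor_pow (k : Type*) [Field k] (m : ℕ) (hm : 1 ≤ m) :
    ∃ q : (k[X] ⧸ Ideal.span {(X : k[X]) ^ (m + 1)}) →+* (k[X] ⧸ Ideal.span {(X : k[X]) ^ m}),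
      Function.Surjective q ∧ IsNilpotent (RingHom.ker q) ∧
        (∀ f, q (Ideal.Quotient.mk _ f) = Ideal.Quotient.mk _ f) := by
  have hle : Ideal.span {(X : k[X]) ^ (m + 1)} ≤ Ideal.span {(X : k[X]) ^ m} :=
    Ideal.span_singleton_le_span_singleton.2 (pow_dvd_pow X m.le_succ)
  refine ⟨Ideal.Quotient.factor hle, Ideal.Quotient.factor_surjective hle, ⟨2, ?_⟩, fun _ => rfl⟩
  rw [Ideal.Quotient.factor_ker, Ideal.map_span, Set.image_singleton, Ideal.span_singleton_pow,
    ← map_pow, Ideal.zero_eq_bot, Ideal.span_singleton_eq_bot, Ideal.Quotient.eq_zero_iff_mem,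
    Ideal.mem_span_singleton, ← pow_mul]
  exact pow_dvd_pow X (by omega)

open MvPolynomial in
theorem smooth_quotient_coord {k ι O : Type*} [Field k] [Finite ι] [CommRing O]
    (β : MvPolynomial ι k →+* O) (hβ : β.Smooth) (S : Set ι) :
    ((Ideal.Quotient.mk (Ideal.span ((fun i => β (X i)) '' S))).comp (β.comp C)).Smooth := by
  algebraize [β, β.comp C]
  have hs : Algebra.Smooth (MvPolynomial ι k) O := hβ
  have : IsScalarTower k (MvPolynomial ι k) O := .of_algebraMap_eq fun _ => rfl
  have hft : Algebra.FiniteType k O := Algebra.FiniteType.trans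
      (S := MvPolynomial ι k) inferInstance
    inferInstance
  have h1 : Algebra.FormallySmooth k (O ⧸ Ideal.span ((fun i => β (X i)) '' S)) :=
    formallySmooth_quotient S
  have h2 : Algebra.FinitePresentation k (O ⧸ Ideal.span ((fun i => β (X i)) '' S)) :=
    Algebra.FinitePresentation.of_finiteType.1 inferInstance
  exact (⟨h1, h2⟩ : Algebra.Smooth k (O ⧸ Ideal.span ((fun i => β (X i)) '' S)))

open MvPolynomial in
-- A node is not smooth: the tangent vector `a = b = ε` over `k[ε]/ε²` satisfies `a b = 0`, but any
-- lift to `k[ε]/ε³` has `a b = ε² ≠ 0`. The tangent vector lifts to `O` by smoothness over the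
-- polynomial ring, and it factors through the localization at `h` because `h` is nonzero at the
-- point, hence invertible modulo nilpotents.
theorem not_smooth_of_mul_coord {k ι O : Type*} [Field k] [CommRing O]
    (β : MvPolynomial ι k →+* O) (hβ : β.Smooth) {a b : ι} {T : Set ι} (ha : a ∉ T)
    (hb : b ∉ T) (𝔞 : Ideal O) (hab : β (X a) * β (X b) ∈ 𝔞)
    (hle : 𝔞 ≤ Ideal.span {β (X a) * β (X b)} ⊔ Ideal.span ((fun i => β (X i)) '' T))
    (e : O →+* k) (he : ∀ r, e (β (C r)) = r) (hea : e (β (X a)) = 0) (heb : e (β (X b)) = 0)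
    (heT : ∀ i ∈ T, e (β (X i)) = 0) (h : O) (hh : e h ≠ 0) :
    ¬ ((algebraMap (O ⧸ 𝔞) (Localization.Away (Ideal.Quotient.mk 𝔞 h))).comp
      ((Ideal.Quotient.mk 𝔞).comp (β.comp C))).Smooth := by
  classical
  intro hs
  let Q : ℕ → Type _ := fun m => Polynomial k ⧸ Ideal.span {(Polynomial.X : Polynomial k) ^ m}
  let mk : ∀ m, Polynomial k →+* Q m := fun m => Ideal.Quotient.mk _
  have hmk : ∀ m f, mk m f = 0 ↔ Polynomial.X ^ m ∣ f := fun m f =>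
    Ideal.Quotient.eq_zero_iff_mem.trans Ideal.mem_span_singleton
  obtain ⟨q1, hq1, hn1, hq1'⟩ := exists_factor_pow k 1 le_rfl
  obtain ⟨q2, hq2, hn2, hq2'⟩ := exists_factor_pow k 2 (by norm_num)
  let w : MvPolynomial ι k →+* Q 2 := eval₂Hom ((mk 2).comp Polynomial.C)
    (fun i => if i = a ∨ i = b then mk 2 Polynomial.X else mk 2 (Polynomial.C (e (β (X i)))))
  have hX1 : mk 1 Polynomial.X = 0 := (hmk 1 _).2 (by simp)
  obtain ⟨g, hg1, hg2⟩ := hβ.exists_lift q1 hq1 hn1 (((mk 1).comp Polynomial.C).comp e) w (by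
    refine MvPolynomial.ringHom_ext (fun r => ?_) (fun i => ?_)
    · simp only [w, RingHom.comp_apply, eval₂Hom_C, he]
      exact hq1' _
    · simp only [w, RingHom.comp_apply, eval₂Hom_X']
      split_ifs with hi
      · refine (hq1' _).trans ?_
        rcases hi with rfl | rfl
        · rw [hea, map_zero, map_zero]; exact hX1
        · rw [heb, map_zero, map_zero]; exact hX1
      · exact hq1' _)
  have hgβ : ∀ f, g (β f) = w f := fun f => RingHom.congr_fun hg2 f
  have hga : g (β (X a)) = mk 2 Polynomial.X := by rw [hgβ]; simp [w]
  have hgb : g (β (X b)) = mk 2 Polynomial.X := by rw [hgβ]; simp [w]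
  have hg𝔞 : ∀ y ∈ 𝔞, g y = 0 := by
    intro y hy
    refine (hle.trans (sup_le ?_ ?_) : 𝔞 ≤ RingHom.ker g) hy
    · rw [Ideal.span_le, Set.singleton_subset_iff]
      change g _ = 0
      rw [map_mul, hga, hgb, ← map_mul, hmk, sq]
    · rw [Ideal.span_le]
      rintro _ ⟨i, hi, rfl⟩
      change g _ = 0
      have : ¬ (i = a ∨ i = b) := by
        rintro (rfl | rfl)
        · exact ha hi
        · exact hb hi
      rw [hgβ]
      simp only [w, eval₂Hom_X', if_neg this, heT i hi, map_zero]
  let g' : O ⧸ 𝔞 →+* Q 2 := Ideal.Quotient.lift 𝔞 g hg𝔞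
  have hunit : IsUnit (g' (Ideal.Quotient.mk 𝔞 h)) := by
    change IsUnit (g h)
    obtain ⟨y, hy⟩ := hq1 (mk 1 (Polynomial.C (e h)⁻¹))
    obtain ⟨N, hN⟩ := hn1
    have h1 : g h * y - 1 ∈ RingHom.ker q1 := by
      have h2 : q1 (g h) = mk 1 (Polynomial.C (e h)) := RingHom.congr_fun hg1 h
      rw [RingHom.mem_ker, map_sub, map_mul, map_one, hy, h2, ← map_mul, ← map_mul,
        mul_inv_cancel₀ hh, map_one, map_one, sub_self]
    have h2 : IsNilpotent (g h * y - 1) := ⟨N, by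
      have := Ideal.pow_mem_pow h1 N
      rwa [hN] at this⟩
    have h3 := h2.isUnit_add_one
    rw [sub_add_cancel] at h3
    exact isUnit_of_mul_isUnit_left h3
  let f := IsLocalization.Away.lift (S := Localization.Away (Ideal.Quotient.mk 𝔞 h)) _ hunit
  have hf : ∀ y, f (algebraMap _ _ (Ideal.Quotient.mk 𝔞 y)) = g y := fun y =>
    IsLocalization.Away.lift_eq _ hunit _
  obtain ⟨l, hl1, -⟩ := hs.exists_lift q2 hq2 hn2 f ((mk 3).comp Polynomial.C) (by
    ext r
    simp only [RingHom.comp_apply]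
    rw [hf, hgβ]
    simp only [w, eval₂Hom_C]
    exact hq2' _)
  let l' : O →+* Q 3 := l.comp ((algebraMap _ _).comp (Ideal.Quotient.mk 𝔞))
  have hl' : ∀ y, q2 (l' y) = g y := fun y => (RingHom.congr_fun hl1 _).trans (hf y)
  have key : ∀ y, q2 y = mk 2 Polynomial.X → ∃ r, y = mk 3 (Polynomial.X +
      Polynomial.X ^ 2 * r) := by
    intro y hy
    obtain ⟨p, rfl⟩ := Ideal.Quotient.mk_surjective y
    have hy' : mk 2 p = mk 2 Polynomial.X := (hq2' p).symm.trans hy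
    rw [← sub_eq_zero, ← map_sub, hmk] at hy'
    obtain ⟨r, hr⟩ := hy'
    exact ⟨r, congrArg _ (by rw [← hr]; ring)⟩
  obtain ⟨r, hr⟩ := key _ ((hl' _).trans hga)
  obtain ⟨r', hr'⟩ := key _ ((hl' _).trans hgb)
  have h0 : l' (β (X a) * β (X b)) = 0 := by
    simp only [l', RingHom.comp_apply, Ideal.Quotient.eq_zero_iff_mem.2 hab, map_zero]
  rw [map_mul, hr, hr', ← map_mul, hmk] at h0
  have h1 : (Polynomial.X : Polynomial k) ^ 3 ∣ Polynomial.X ^ 2 := by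
    have h2 : (Polynomial.X : Polynomial k) ^ 2 = (Polynomial.X + Polynomial.X ^ 2 * r) *
      (Polynomial.X + Polynomial.X ^ 2 * r') -
        Polynomial.X ^ 3 * (r + r' + Polynomial.X * r * r') := by ring
    rw [h2]
    exact dvd_sub h0 (dvd_mul_right _ _)
  have := (pow_dvd_pow_iff Polynomial.X_ne_zero Polynomial.not_isUnit_X).1 h1
  omega

end Obstruction

section Strata

variable {k : Type u} [Field k] {𝒟 : Degeneration k} {B : BipartiteOrientation 𝒟}

/-- The ideal sheaf of the locus where the functions `tᵢ` with `i ∈ I` vanish. -/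
abbrev stratumSheaf {S : Scheme.{u}} (t : ℕ → Γ(S, ⊤)) (I : Finset ℕ) : S.IdealSheafData :=
  Scheme.IdealSheafData.ofIdealTop (Ideal.span (t '' (I : Set ℕ)))

theorem stratumSheaf_comap {S T : Scheme.{u}} (g : T ⟶ S) (t : ℕ → Γ(S, ⊤)) (I : Finset ℕ) :
    (stratumSheaf t I).comap g = stratumSheaf (fun i => g.appTop (t i)) I := by
  refine idealSheaf_ext fun x => ?_
  rw [stalkIdeal_comap, stalkIdeal_ofIdealTop, stalkIdeal_ofIdealTop, Ideal.map_span,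
    Ideal.map_span, Ideal.map_span, ← Set.image_comp, ← Set.image_comp, ← Set.image_comp]
  congr 1
  refine Set.image_congr fun i _ => ?_
  exact stalkMap_toStalk g x (t i)

theorem exists_closed_chart_stratum {S : Scheme.{u}} {t : ℕ → Γ(S, ⊤)} {I : Finset ℕ} {O : Type u}
    [CommRing O] (g : Spec (.of O) ⟶ S) [IsOpenImmersion g] (τ : ℕ → O)
    (h : ∀ i ∈ I, g.appTop (t i) = specFun O (τ i)) :
    ∃ ρ : Spec (.of (O ⧸ Ideal.span (τ '' (I : Set ℕ)))) ⟶ (stratumSheaf t I).subscheme,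
      IsOpenImmersion ρ ∧ ρ ≫ (stratumSheaf t I).subschemeι =
        Spec.map (CommRingCat.ofHom (Ideal.Quotient.mk (Ideal.span (τ '' (I : Set ℕ))))) ≫ g := by
  refine exists_closed_chart g _ _ ?_
  rw [stratumSheaf_comap, Ideal.map_span, ← Set.image_comp]
  exact congrArg (fun s => Scheme.IdealSheafData.ofIdealTop (Ideal.span s))
    (Set.image_congr fun i hi => h i hi)

theorem exists_quotient_point {O : Type u} [CommRing O] {I : Finset ℕ} (τ : ℕ → O)
    (x : Spec (.of O)) (hx : ∀ i ∈ I, τ i ∈ x.asIdeal) :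
    ∃ w : Spec (.of (O ⧸ Ideal.span (τ '' (I : Set ℕ)))),
      Spec.map (CommRingCat.ofHom (Ideal.Quotient.mk (Ideal.span (τ '' (I : Set ℕ))))) w = x := by
  have := range_comap_of_surjective _ _
    (Ideal.Quotient.mk_surjective (I := Ideal.span (τ '' (I : Set ℕ))))
  rw [Ideal.mk_ker] at this
  refine this.symm.subset (Ideal.span_le.2 ?_ : Ideal.span _ ≤ x.asIdeal)
  rintro _ ⟨i, hi, rfl⟩
  exact hx i hi

/-- The subscheme where the functions `tᵢ` with `i ∈ I` vanish contains the point `x` and is smooth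
over `T` there. -/
def SmoothStratum {S T : Scheme.{u}} (q : S ⟶ T) (t : ℕ → Γ(S, ⊤)) (I : Finset ℕ) (x : S) : Prop :=
  ∃ z : (stratumSheaf t I).subscheme, (stratumSheaf t I).subschemeι z = x ∧
    SmoothAt ((stratumSheaf t I).subschemeι ≫ q) z

theorem smoothStratum_iff {S : Scheme.{u}} {t : ℕ → Γ(S, ⊤)} {I : Finset ℕ} {O K : Type u}
    [CommRing O] [CommRing K] (q : S ⟶ Spec (.of K)) (g : Spec (.of O) ⟶ S) [IsOpenImmersion g]
    (φ : K →+* O) (hφ : g ≫ q = Spec.map (CommRingCat.ofHom φ)) (τ : ℕ → O)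
    (h : ∀ i ∈ I, g.appTop (t i) = specFun O (τ i)) (x : Spec (.of O))
    (hx : ∀ i ∈ I, τ i ∈ x.asIdeal) :
    SmoothStratum q t I (g x) ↔
      ∃ w : Spec (.of (O ⧸ Ideal.span (τ '' (I : Set ℕ)))),
        Spec.map (CommRingCat.ofHom (Ideal.Quotient.mk (Ideal.span (τ '' (I : Set ℕ))))) w = x ∧
        SmoothAt (Spec.map (CommRingCat.ofHom ((Ideal.Quotient.mk _).comp φ))) w := by
  obtain ⟨ρ, hρ, h1⟩ := exists_closed_chart_stratum g τ h
  have h2 : Spec.map (CommRingCat.ofHom ((Ideal.Quotient.mk (Ideal.span (τ '' (I : Set ℕ)))).comp φ))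
      = ρ ≫ (stratumSheaf t I).subschemeι ≫ q := by
    rw [reassoc_of% h1, hφ, CommRingCat.ofHom_comp, Spec.map_comp]
  have h3 : ∀ w, (stratumSheaf t I).subschemeι (ρ w) =
      g (Spec.map (CommRingCat.ofHom (Ideal.Quotient.mk (Ideal.span (τ '' (I : Set ℕ))))) w) := by
    intro w
    rw [← Scheme.Hom.comp_apply, h1, Scheme.Hom.comp_apply]
  constructor
  · rintro ⟨z, hz, hs⟩
    have := exists_quotient_point τ x hx
    obtain ⟨w, rfl⟩ := this
    refine ⟨w, rfl, ?_⟩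
    have hzw : z = ρ w := by
      refine (stratumSheaf t I).subschemeι.isClosedEmbedding.injective ?_
      rw [hz, h3]
    rw [h2, smoothAt_comp_iff, ← hzw]
    exact hs
  · rintro ⟨w, rfl, hs⟩
    refine ⟨ρ w, h3 w, ?_⟩
    rwa [h2, smoothAt_comp_iff] at hs

theorem smoothStratum_of_smooth {S : Scheme.{u}} {t : ℕ → Γ(S, ⊤)} {I : Finset ℕ} {O K : Type u}
    [CommRing O] [CommRing K] (q : S ⟶ Spec (.of K)) (g : Spec (.of O) ⟶ S) [IsOpenImmersion g]
    (φ : K →+* O) (hφ : g ≫ q = Spec.map (CommRingCat.ofHom φ)) (τ : ℕ → O)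
    (h : ∀ i ∈ I, g.appTop (t i) = specFun O (τ i)) (x : Spec (.of O))
    (hx : ∀ i ∈ I, τ i ∈ x.asIdeal)
    (hs : ((Ideal.Quotient.mk (Ideal.span (τ '' (I : Set ℕ)))).comp φ).Smooth) :
    SmoothStratum q t I (g x) := by
  obtain ⟨w, hw⟩ := exists_quotient_point τ x hx
  refine (smoothStratum_iff q g φ hφ τ h x hx).2 ⟨w, hw, ?_⟩
  have : Smooth (Spec.map (CommRingCat.ofHom
      ((Ideal.Quotient.mk (Ideal.span (τ '' (I : Set ℕ)))).comp φ))) :=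
    HasRingHomProperty.Spec_iff.2 hs
  exact smoothAt_of_smooth _ w

namespace ExpChart

variable {S : Scheme.{u}} {p : S ⟶ 𝒟.X} {t : ℕ → Γ(S, ⊤)} {n : ℕ} (E : ExpChart B n p t)

/-- The structure of a `k`-algebra on the coordinate ring of a chart. -/
abbrev scalar : k →+* E.R.R := E.R.β.comp MvPolynomial.C

theorem scalar_eq : E.scalar = E.R.α.comp (algebraMap k E.c.A) :=
  RingHom.ext E.R.β_C

instance (σ : Set (Fin 2)) (n j : ℕ) : Finite (ChartVar σ n j) := by
  have : Finite {i : ℕ // i ∈ Finset.Icc 1 (n + 1) ∧ i ≠ j} :=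
    ((Finset.Icc 1 (n + 1)).finite_toSet.subset fun _ h => h.1).to_subtype
  infer_instance

theorem ι_str : E.ι ≫ p ≫ 𝒟.π ≫ 𝒟.str = Spec.map (CommRingCat.ofHom E.scalar) := by
  rw [reassoc_of% E.ι_proj, E.c.e_str, scalar_eq,
    CommRingCat.ofHom_comp, Spec.map_comp]

/-- Where one factor of `t_j = x_j y_j` is invertible, the equation `t_j = 0` says that the other
factor vanishes. The stratum is then cut out by part of a smooth coordinate system. -/
theorem smoothStratum_of_mem {I : Finset ℕ} (hI : I ⊆ Finset.Icc 1 (n + 1)) (z : Spec (.of E.R.R))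
    (hz : ∀ i ∈ I, E.R.t i ∈ z.asIdeal) {i i' : Fin 2} (hi : E.R.c i ∉ z.asIdeal)
    (hi' : E.R.c i' ∈ z.asIdeal) (hj : E.j ∈ I) (hmul : E.R.t E.j = E.R.c i * E.R.c i') :
    SmoothStratum (p ≫ 𝒟.π ≫ 𝒟.str) t I (E.ι z) := by
  let O := Localization.Away (E.R.c i)
  let l : E.R.R →+* O := algebraMap E.R.R O
  have : IsOpenImmersion (Spec.map (CommRingCat.ofHom l)) :=
      IsOpenImmersion.of_isLocalization (E.R.c i)
  obtain ⟨x, rfl⟩ : z ∈ Set.range (Spec.map (CommRingCat.ofHom l)) :=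
    (PrimeSpectrum.localization_away_comap_range O (E.R.c i)).symm.subset hi
  rw [← Scheme.Hom.comp_apply]
  have hl : l.Smooth := RingHom.smooth_algebraMap.2 inferInstance
  refine smoothStratum_of_smooth (K := k) _ _ ((l.comp E.R.β).comp MvPolynomial.C) ?_
    (fun m => l (E.R.t m)) ?_ x hz ?_
  · rw [Category.assoc, E.ι_str, ← Spec.map_comp]
    rfl
  · intro m hm
    rw [Scheme.Hom.comp_appTop]
    exact (congrArg _ (E.ι_coord m (hI hm))).trans (appTop_specFun l _)
  · have hσ : i' ∈ E.c.σ := E.c_mem hi'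
    let T : Set (ChartVar E.c.σ n E.j) := {y | y = .inl ⟨i', hσ⟩ ∨ ∃ m, m.1 ∈ I ∧ y = .inr m}
    have h1 : Ideal.span ((fun m => l (E.R.t m)) '' (I : Set ℕ)) =
        Ideal.span ((fun y => (l.comp E.R.β) (.X y)) '' T) := by
      apply le_antisymm
      · rw [Ideal.span_le]
        rintro _ ⟨m, hm, rfl⟩
        by_cases hmj : m = E.j
        · subst hmj
          simp only
          rw [hmul, map_mul]
          refine Ideal.mul_mem_left _ _ (Ideal.subset_span ⟨.inl ⟨i', hσ⟩, .inl rfl, ?_⟩)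
          exact congrArg l (E.R.β_inl _)
        · exact Ideal.subset_span ⟨.inr ⟨m, hI hm, hmj⟩, .inr ⟨_, hm, rfl⟩,
            congrArg l (E.R.β_inr _)⟩
      · rw [Ideal.span_le]
        rintro _ ⟨y, rfl | ⟨m, hm, rfl⟩, rfl⟩
        · have h2 : l (E.R.t E.j) ∈ Ideal.span ((fun m => l (E.R.t m)) '' (I : Set ℕ)) :=
            Ideal.subset_span ⟨_, hj, rfl⟩
          rw [hmul, map_mul] at h2
          have h3 := (Ideal.unit_mul_mem_iff_mem _
            (IsLocalization.Away.algebraMap_isUnit (S := O) (E.R.c i))).1 h2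
          simp only [SetLike.mem_coe, RingHom.comp_apply, E.R.β_inl]
          exact h3
        · simp only [SetLike.mem_coe, RingHom.comp_apply, E.R.β_inr]
          exact Ideal.subset_span ⟨m.1, hm, rfl⟩
    rw [h1]
    exact smooth_quotient_coord _ (E.R.smooth.comp hl) T

theorem smoothStratum_of_notMem {I : Finset ℕ} (hI : I ⊆ Finset.Icc 1 (n + 1))
    (z : Spec (.of E.R.R)) (hz : ∀ i ∈ I, E.R.t i ∈ z.asIdeal) (hj : E.j ∉ I) :
    SmoothStratum (p ≫ 𝒟.π ≫ 𝒟.str) t I (E.ι z) := by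
  refine smoothStratum_of_smooth _ _ _ E.ι_str E.R.t (fun m hm => E.ι_coord m (hI hm)) z hz ?_
  let T : Set (ChartVar E.c.σ n E.j) := {y | ∃ m, m.1 ∈ I ∧ y = .inr m}
  have h1 : E.R.t '' (I : Set ℕ) = (fun y => E.R.β (.X y)) '' T := by
    ext r
    constructor
    · rintro ⟨m, hm, rfl⟩
      exact ⟨.inr ⟨m, hI hm, fun h => hj (h ▸ hm)⟩, ⟨_, hm, rfl⟩, E.R.β_inr _⟩
    · rintro ⟨_, ⟨m, hm, rfl⟩, rfl⟩
      exact ⟨m.1, hm, (E.R.β_inr _).symm⟩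
  rw [h1]
  exact smooth_quotient_coord _ E.R.smooth T

theorem not_smoothStratum {I : Finset ℕ} (hI : I ⊆ Finset.Icc 1 (n + 1)) (z : Spec (.of E.R.R))
    (hz : ∀ i ∈ I, E.R.t i ∈ z.asIdeal) (hj : E.j ∈ I) (h0 : E.R.c 0 ∈ z.asIdeal)
    (h1 : E.R.c 1 ∈ z.asIdeal) (e : E.R.R →+* k) (he : ∀ r, e (E.scalar r) = r)
    (hez : ∀ r, e r = 0 ↔ r ∈ z.asIdeal) :
    ¬ SmoothStratum (p ≫ 𝒟.π ≫ 𝒟.str) t I (E.ι z) := by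
  rw [smoothStratum_iff _ _ _ E.ι_str E.R.t (fun m hm => E.ι_coord m (hI hm)) z hz]
  rintro ⟨w, rfl, hw⟩
  obtain ⟨a, ha, hs⟩ := exists_smooth_of_smoothAt _ w hw
  obtain ⟨h, rfl⟩ := Ideal.Quotient.mk_surjective a
  have hc : ∀ i : E.c.σ, e (E.R.β (.X (.inl i))) = e (E.R.c i) := fun i => by rw [E.R.β_inl]
  refine not_smooth_of_mul_coord E.R.β E.R.smooth (a := .inl ⟨0, E.c_mem h0⟩)
    (b := .inl ⟨1, E.c_mem h1⟩) (T := {y | ∃ m, m.1 ∈ I ∧ y = .inr m}) (by simp) (by simp) _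
    ?_ ?_ e he ?_ ?_ ?_ h (fun h' => ha ((hez h).1 h')) hs
  · rw [E.R.β_inl, E.R.β_inl, ← E.R.isValue.mul]
    exact Ideal.subset_span ⟨_, hj, rfl⟩
  · rw [Ideal.span_le]
    rintro _ ⟨m, hm, rfl⟩
    by_cases hmj : m = E.j
    · subst hmj
      refine Ideal.mem_sup_left (Ideal.mem_span_singleton.2 ?_)
      rw [E.R.β_inl, E.R.β_inl, ← E.R.isValue.mul]
    · exact Ideal.mem_sup_right (Ideal.subset_span ⟨.inr ⟨m, hI hm, hmj⟩, ⟨_, hm, rfl⟩,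
        E.R.β_inr _⟩)
  · rw [hc, hez]; exact h0
  · rw [hc, hez]; exact h1
  · rintro _ ⟨m, hm, rfl⟩
    rw [E.R.β_inr, hez]
    exact hz _ hm

theorem smoothStratum_iff_notMem {I : Finset ℕ} (hI : I ⊆ Finset.Icc 1 (n + 1))
    (z : Spec (.of E.R.R)) (hz : ∀ i ∈ I, E.R.t i ∈ z.asIdeal) (e : E.R.R →+* k)
    (he : ∀ r, e (E.scalar r) = r) (hez : ∀ r, e r = 0 ↔ r ∈ z.asIdeal) :
    SmoothStratum (p ≫ 𝒟.π ≫ 𝒟.str) t I (E.ι z) ↔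
      ¬ (E.j ∈ I ∧ E.R.c 0 ∈ z.asIdeal ∧ E.R.c 1 ∈ z.asIdeal) := by
  constructor
  · rintro h ⟨hj, h0, h1⟩
    exact E.not_smoothStratum hI z hz hj h0 h1 e he hez h
  · intro h
    by_cases hj : E.j ∈ I
    · rcases (E.t_mem_iff z).1 (hz _ hj) with h0 | h1
      · exact E.smoothStratum_of_mem hI z hz (fun h1 => h ⟨hj, h0, h1⟩) h0 hj
          (E.R.isValue.mul.trans (mul_comm _ _))
      · exact E.smoothStratum_of_mem hI z hz (fun h0 => h ⟨hj, h0, h1⟩) h1 hj E.R.isValue.mul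
    · exact E.smoothStratum_of_notMem hI z hz hj

end ExpChart

end Strata

end ExpDeg
end

/-! ### One-parameter subgroups acting on charts -/

noncomputable section

namespace ExpDeg

variable {k : Type u} [Field k] {𝒟 : Degeneration k} {B : BipartiteOrientation 𝒟}

/-- The constant functions on a `k`-scheme. -/
def constHom {Y : Scheme.{u}} (q : Y ⟶ Spec (.of k)) : k →+* Γ(Y, ⊤) :=
  q.appTop.hom.comp (specFun k)

theorem constHom_apply {Y : Scheme.{u}} (q : Y ⟶ Spec (.of k)) (a : k) : constHom q a = const q a :=
  rfl

theorem appTop_constHom {Y Z : Scheme.{u}} (g : Z ⟶ Y) (q : Y ⟶ Spec (.of k)) (a : k) :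
    g.appTop (constHom q a) = constHom (g ≫ q) a := by
  rw [constHom, constHom, RingHom.comp_apply, RingHom.comp_apply]
  exact (appTop_comp_apply g q _).symm

theorem constHom_spec {O : Type u} [CommRing O] (f : k →+* O) (a : k) :
    constHom (Spec.map (CommRingCat.ofHom f)) a = specFun O (f a) :=
  appTop_specFun f a

/-- The weight of the function `tᵢ`. -/
def weight {n : ℕ} (s : Fin n → ℤ) (i : ℕ) : ℤ := extZero s i - extZero s (i - 1)

theorem extZero_zero {n : ℕ} (s : Fin n → ℤ) : extZero s 0 = 0 := by simp [extZero]

theorem extZero_succ {n : ℕ} (s : Fin n → ℤ) : extZero s (n + 1) = 0 := by simp [extZero]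

theorem prod_zpow_weight {n : ℕ} (s : Fin n → ℤ) (x : kˣ) {a b : ℕ} (hab : a ≤ b) :
    ∏ i ∈ Finset.Icc (a + 1) b, x ^ weight s i = x ^ (extZero s b - extZero s a) := by
  induction b, hab using Nat.le_induction with
  | base => simp
  | succ b hb ih =>
    rw [Finset.prod_Icc_succ_top (by omega), ih, ← zpow_add, weight, Nat.add_sub_cancel]
    congr 1
    ring

section Scaling

variable {S : Scheme.{u}}

/-- The morphism `g` is the action of the value at `x` of the one-parameter subgroup given by
`s`. -/
structure IsScaling (p : S ⟶ 𝒟.X) (t : ℕ → Γ(S, ⊤)) {n : ℕ} (s : Fin n → ℤ) (x : kˣ)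
    (g : S ⟶ S) : Prop where
  proj : g ≫ p = p
  coord : ∀ i ∈ Finset.Icc 1 (n + 1),
    g.appTop (t i) = constHom (p ≫ 𝒟.π ≫ 𝒟.str) ((x ^ weight s i : kˣ) : k) * t i

variable {p : S ⟶ 𝒟.X} {t : ℕ → Γ(S, ⊤)} {n : ℕ} (h : IsUniversal B n p t) (s : Fin n → ℤ) (x : kˣ)

include h in
-- Multiplying the `tᵢ` by constants with product `1` multiplies the tails by units. The centres do
-- not change, so the new datum is again admissible.
theorem IsUniversal.exists_isScaling : ∃ g : S ⟶ S, IsScaling p t s x g := by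
  set q := p ≫ 𝒟.π ≫ 𝒟.str
  have hadm : IsAdmissible B n p fun i => constHom q ((x ^ weight s i : kˣ) : k) * t i := by
    refine ⟨?_, fun i hi => ?_⟩
    · rw [Finset.prod_mul_distrib, h.admissible.prod, ← map_prod, ← Units.coe_prod,
        prod_zpow_weight s x (Nat.zero_le (n + 1)), extZero_zero, extZero_succ]
      simp
    · have h1 : tail (fun i => constHom q ((x ^ weight s i : kˣ) : k) * t i) n i =
          tail t n i * constHom q ((∏ m ∈ Finset.Icc (i + 1) (n + 1), x ^ weight s m : kˣ) : k) := by
        rw [tail, Finset.prod_mul_distrib, mul_comm, Units.coe_prod, map_prod]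
      rw [h1, centreIdeal, Ideal.span_singleton_mul_right_unit ((Units.isUnit _).map _)]
      exact h.admissible.invertible i hi
  obtain ⟨g, ⟨hg1, hg2⟩, -⟩ := h.existsUnique _ _ hadm
  exact ⟨g, hg1, hg2⟩

include h in
theorem IsUniversal.comp_isScaling {g g' : S ⟶ S} (hg : IsScaling p t s x g)
    (hg' : IsScaling p t s x⁻¹ g') : g ≫ g' = 𝟙 S := by
  refine h.hom_ext (fun z => ?_) ?_ fun i hi => ?_
  · rw [Category.assoc, hg'.proj, hg.proj]
    exact h.regular z
  · rw [Category.assoc, hg'.proj, hg.proj, Category.id_comp]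
  · rw [appTop_comp_apply, hg'.coord i hi, map_mul, appTop_constHom, hg.coord i hi,
      reassoc_of% hg.proj,
      ← mul_assoc, ← map_mul, ← Units.val_mul, ← mul_zpow, inv_mul_cancel, one_zpow, Units.val_one,
      map_one, one_mul, Scheme.Hom.id_appTop]
    rfl

namespace ExpChart

variable (E : ExpChart B n p t)

/-- The action of the value at `x` of a one-parameter subgroup on a chart. -/
theorem exists_scale : ∃ f : E.R.R →+* E.R.R, f.comp E.R.α = E.R.α ∧
    (∀ i ∈ Finset.Icc 1 (n + 1), f (E.R.t i) = E.scalar ((x ^ weight s i : kˣ) : k) * E.R.t i) ∧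
    f (E.R.c 0) = E.scalar ((x ^ extZero s E.j : kˣ) : k) * E.R.c 0 ∧
    f (E.R.c 1) = E.scalar ((x ^ (-extZero s (E.j - 1)) : kˣ) : k) * E.R.c 1 := by
  -- The weights of `x_j` and `y_j` are forced: `x` and `y` are invariant, while `t_{j+1} ⋯ t_{n+1}`
  -- has weight `-s_j` and `t_1 ⋯ t_{j-1}` has weight `s_{j-1}`.
  let t' : ℕ → E.R.R := fun i => E.scalar ((x ^ weight s i : kˣ) : k) * E.R.t i
  let c' : Fin 2 → E.R.R := ![E.scalar ((x ^ extZero s E.j : kˣ) : k) * E.R.c 0,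
    E.scalar ((x ^ (-extZero s (E.j - 1)) : kˣ) : k) * E.R.c 1]
  have hv := E.R.isValue
  have hj := E.isChartIndex
  have hval : IsChartValue E.c.σ (fun i => E.R.α (E.c.v i)) n E.j t' c' := by
    refine ⟨?_, ?_, ?_, ?_⟩
    · simp only [t', c', Matrix.cons_val_zero, Matrix.cons_val_one]
      rw [mul_mul_mul_comm, ← hv.mul, ← map_mul, ← Units.val_mul, ← zpow_add]
      rfl
    · simp only [t', c', Matrix.cons_val_zero]
      rw [Finset.prod_mul_distrib, mul_mul_mul_comm, ← hv.fst, ← map_prod, ← map_mul,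
        ← Units.coe_prod, ← Units.val_mul, prod_zpow_weight s x hj.le, ← zpow_add, extZero_succ]
      simp
    · simp only [t', c', Matrix.cons_val_one, Matrix.cons_val_zero]
      have h1 : Finset.Ico 1 E.j = Finset.Icc (0 + 1) (E.j - 1) := by
        ext m
        have := hj.one_le
        rw [Finset.mem_Ico, Finset.mem_Icc]
        omega
      rw [Finset.prod_mul_distrib, mul_mul_mul_comm, ← hv.snd, ← map_prod, ← map_mul,
        ← Units.coe_prod, ← Units.val_mul, h1, prod_zpow_weight s x (Nat.zero_le _), ← zpow_add,
        extZero_zero]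
      simp
    · intro i hi
      fin_cases i
      · simp only [c', Fin.zero_eta, Matrix.cons_val_zero]
        have h0 : extZero s E.j = 0 := (congrArg _ (hj.fst hi)).trans (extZero_succ s)
        rw [hv.one 0 hi, h0]
        simp
      · simp only [c', Fin.mk_one, Matrix.cons_val_one, Matrix.cons_val_zero]
        have h0 : extZero s (E.j - 1) = 0 :=
          (congrArg _ (Nat.sub_eq_zero_of_le (hj.snd hi).le)).trans (extZero_zero s)
        rw [hv.one 1 hi, h0]
        simp
  obtain ⟨f, hf, hft, hfc⟩ := E.R.exists_lift E.R.α t' c' hval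
  exact ⟨f, hf, hft, hfc 0, hfc 1⟩

/-- The action of the value at `x` of a one-parameter subgroup on a chart. -/
def scale : E.R.R →+* E.R.R := (E.exists_scale s x).choose

theorem scale_α (a : E.c.A) : E.scale s x (E.R.α a) = E.R.α a :=
  RingHom.congr_fun (E.exists_scale s x).choose_spec.1 a

theorem scale_t {i : ℕ} (hi : i ∈ Finset.Icc 1 (n + 1)) :
    E.scale s x (E.R.t i) = E.scalar ((x ^ weight s i : kˣ) : k) * E.R.t i :=
  (E.exists_scale s x).choose_spec.2.1 i hi

theorem scale_fst : E.scale s x (E.R.c 0) = E.scalar ((x ^ extZero s E.j : kˣ) : k) * E.R.c 0 :=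
  (E.exists_scale s x).choose_spec.2.2.1

theorem scale_snd :
    E.scale s x (E.R.c 1) = E.scalar ((x ^ (-extZero s (E.j - 1)) : kˣ) : k) * E.R.c 1 :=
  (E.exists_scale s x).choose_spec.2.2.2

include h in
theorem scale_ι {g : S ⟶ S} (hg : IsScaling p t s x g) :
    Spec.map (CommRingCat.ofHom (E.scale s x)) ≫ E.ι = E.ι ≫ g := by
  have hα : Spec.map (CommRingCat.ofHom (E.scale s x)) ≫ E.ι ≫ p = E.ι ≫ p := by
    rw [E.ι_proj, ← Category.assoc, ← Spec.map_comp, ← CommRingCat.ofHom_comp]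
    congr 3
    exact (E.exists_scale s x).choose_spec.1
  refine h.hom_ext (fun z => ?_) ?_ fun i hi => ?_
  · rw [Category.assoc, hα]
    exact h.regular_comp E.ι z
  · rw [Category.assoc, hα, Category.assoc, hg.proj]
  · rw [appTop_comp_apply, appTop_comp_apply, hg.coord i hi, map_mul, E.ι_coord i hi,
      appTop_constHom,
      E.ι_str, constHom_spec, appTop_specFun, E.scale_t s x hi, map_mul]

/-- The point of an expanded degeneration given by a point of a chart. -/
def point (e : E.R.R →+* k) : Spec (.of k) ⟶ S := Spec.map (CommRingCat.ofHom e) ≫ E.ι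

theorem point_injective : Function.Injective E.point := by
  intro e e' he
  have := Spec.map_injective ((cancel_mono E.ι).1 he)
  exact congrArg (fun l => l.hom) this

include h in
theorem point_scale {g : S ⟶ S} (hg : IsScaling p t s x g) (e : E.R.R →+* k) :
    E.point e ≫ g = E.point (e.comp (E.scale s x)) := by
  rw [point, point, Category.assoc, ← E.scale_ι h s x hg, CommRingCat.ofHom_comp, Spec.map_comp,
    Category.assoc]

theorem exists_point {P : Spec (.of k) ⟶ S} (hP : P (IsLocalRing.closedPoint k) ∈ Set.range E.ι) :
    ∃ e, P = E.point e := by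
  have hr : Set.range P ⊆ Set.range E.ι := by
    rintro _ ⟨y, rfl⟩
    rwa [Subsingleton.elim y (IsLocalRing.closedPoint k)]
  refine ⟨(Spec.preimage (IsOpenImmersion.lift E.ι P hr)).hom, ?_⟩
  rw [point, CommRingCat.ofHom_hom, Spec.map_preimage, IsOpenImmersion.lift_fac]

theorem point_str (e : E.R.R →+* k) (he : E.point e ≫ p ≫ 𝒟.π ≫ 𝒟.str = 𝟙 _) (a : k) :
    e (E.scalar a) = a := by
  rw [point, Category.assoc, E.ι_str, ← Spec.map_comp, ← Spec.map_id] at he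
  exact congrArg (fun l => l.hom a) (Spec.map_injective he)

/-- The point of a chart given by a homomorphism to the ground field. -/
def pt (e : E.R.R →+* k) : Spec (.of E.R.R) :=
    Spec.map (CommRingCat.ofHom e) (IsLocalRing.closedPoint k)

theorem mem_pt (e : E.R.R →+* k) (r : E.R.R) : r ∈ (E.pt e).asIdeal ↔ e r = 0 := by
  change e r ∈ (IsLocalRing.closedPoint k).asIdeal ↔ _
  change e r ∈ IsLocalRing.maximalIdeal k ↔ _
  rw [IsLocalRing.mem_maximalIdeal, mem_nonunits_iff, isUnit_iff_ne_zero, not_not]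

theorem point_closedPoint (e : E.R.R →+* k) :
    E.point e (IsLocalRing.closedPoint k) = E.ι (E.pt e) :=
  Scheme.Hom.comp_apply _ _ _

end ExpChart

end Scaling

end ExpDeg
end

/-! ### Coordinates of the limit point -/

noncomputable section

namespace ExpDeg

variable {k : Type u} [Field k] {𝒟 : Degeneration k} {B : BipartiteOrientation 𝒟}

open Polynomial in
-- A fraction `F / g ^ N` that is regular at `0` and agrees with `a x ^ w` on an infinite set is
-- this monomial, as polynomials are determined by infinitely many values. A negative exponent
-- forces `a = 0`, and a positive one gives the value `0` at `0`.
theorem eval_zero_of_zpow {k : Type*} [Field k] [Infinite k] (F g : k[X]) (N : ℕ) (a : k) (w : ℤ)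
    (hg : g.eval 0 ≠ 0)
    (h : ∀ x : kˣ, g.eval (x : k) ≠ 0 → F.eval (x : k) =
        ((x ^ w : kˣ) : k) * a * g.eval (x : k) ^ N) :
    (a ≠ 0 → 0 ≤ w) ∧ F.eval 0 = (if w = 0 then a else 0) * g.eval 0 ^ N := by
  have hg0 : g ≠ 0 := by rintro rfl; simp at hg
  have hinf : {x : k | x ≠ 0 ∧ g.eval x ≠ 0}.Infinite := by
    have h1 : ((X * g).rootSet k).Finite := rootSet_finite _ _
    refine h1.infinite_compl.mono fun x hx => ?_
    rw [Set.mem_compl_iff, mem_rootSet] at hx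
    by_contra hcon
    refine hx ⟨mul_ne_zero X_ne_zero hg0, ?_⟩
    rw [map_mul, aeval_X, coe_aeval_eq_eval]
    by_contra h2
    exact hcon (mul_ne_zero_iff.1 h2)
  rcases le_or_gt 0 w with hw | hw
  · lift w to ℕ using hw
    have h1 : F = X ^ w * C a * g ^ N := by
      refine eq_of_infinite_eval_eq _ _ (hinf.mono ?_)
      rintro x ⟨hx, hgx⟩
      have := h (Units.mk0 x hx) hgx
      simp only [zpow_natCast, Units.val_pow_eq_pow_val, Units.val_mk0] at this
      simp only [Set.mem_ofPred_eq, eval_mul, eval_pow, eval_X, eval_C, this]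
    refine ⟨fun _ => by positivity, ?_⟩
    rw [h1]
    rcases Nat.eq_zero_or_pos w with rfl | hw
    · simp
    · simp [hw.ne']
  · obtain ⟨m, rfl⟩ : ∃ m : ℕ, w = -(m : ℤ) := ⟨w.natAbs, by omega⟩
    have hm : m ≠ 0 := by omega
    have h1 : X ^ m * F = C a * g ^ N := by
      refine eq_of_infinite_eval_eq _ _ (hinf.mono ?_)
      rintro x ⟨hx, hgx⟩
      have := h (Units.mk0 x hx) hgx
      simp only [Units.val_mk0] at this
      simp only [Set.mem_ofPred_eq, eval_mul, eval_pow, eval_X, eval_C, this]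
      rw [mul_assoc, ← mul_assoc]
      simp [hx]
    have h2 : a = 0 := by
      have := congrArg (eval 0) h1
      simp only [eval_mul, eval_pow, eval_X, eval_C, zero_pow hm, zero_mul] at this
      exact (mul_eq_zero.1 this.symm).resolve_right (pow_ne_zero _ hg)
    refine ⟨fun h => absurd h2 h, ?_⟩
    rw [h2, C_0, zero_mul] at h1
    rw [(mul_eq_zero.1 h1).resolve_left (pow_ne_zero _ X_ne_zero), h2]
    simp

section Limit

open Polynomial in
/-- The morphism to the affine line from the spectrum of the polynomial ring. -/
def lineChart (k : Type u) [Field k] : Spec (.of k[X]) ⟶ Line (Spec (.of k)) :=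
  toLine (Spec.map (CommRingCat.ofHom C)) (specFun k[X] X)

open Polynomial in
theorem eval_lineChart (a : k) :
    Spec.map (CommRingCat.ofHom (evalRingHom a)) ≫ lineChart k = linePoint a := by
  have h1 : Spec.map (CommRingCat.ofHom (evalRingHom a)) ≫ Spec.map (CommRingCat.ofHom C) =
      𝟙 (Spec (.of k)) := by
    rw [← Spec.map_comp, ← Spec.map_id, ← CommRingCat.ofHom_comp]
    congr 2
    ext; simp
  have h2 : evalRingHom a X = a := by simp
  rw [lineChart, comp_toLine, h1, appTop_specFun, h2, linePoint, ← constHom_apply,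
    ← Spec.map_id, ← CommRingCat.ofHom_id, constHom_spec]
  rfl

variable {S : Scheme.{u}} {p : S ⟶ 𝒟.X} {t : ℕ → Γ(S, ⊤)} {n : ℕ} (h : IsUniversal B n p t)
  {s : Fin n → ℤ} {g : kˣ → (S ⟶ S)} (hg : ∀ x, IsScaling p t s x (g x))

theorem ExpChart.mem_range_of_comp (E : ExpChart B n p t) {T : Scheme.{u}} (a : Spec (.of k) ⟶ T)
    (θ : T ⟶ S) (e : E.R.R →+* k) (he : a ≫ θ = E.point e)
    (y : Spec (.of k)) : θ (a y) ∈ Set.range E.ι := by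
  rw [← Scheme.Hom.comp_apply, he]
  exact ⟨_, (Scheme.Hom.comp_apply _ _ y).symm⟩

open Polynomial in
include h hg in
-- The extended orbit maps a neighbourhood of `0` in the line into the chart of the limit. There a
-- coordinate of weight `w` has the value `x ^ w * e r` at `x ≠ 0`, and `eval_zero_of_zpow`
-- evaluates it at `0`.
theorem limit_chart [Infinite k] {P : Spec (.of k) ⟶ S} {φ : Line (Spec (.of k)) ⟶ S}
    (hφ : ∀ x : kˣ, linePoint (x : k) ≫ φ = P ≫ g x)
    (hP : P ≫ p ≫ 𝒟.π ≫ 𝒟.str = 𝟙 _) (E : ExpChart B n p t)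
    (e₀ : E.R.R →+* k) (h0 : linePoint 0 ≫ φ = E.point e₀) :
    ∃ e : E.R.R →+* k, P = E.point e ∧ ∀ (r : E.R.R) (w : ℤ),
      (∀ x : kˣ, E.scale s x r = E.scalar ((x ^ w : kˣ) : k) * r) →
        (e r ≠ 0 → 0 ≤ w) ∧ e₀ r = if w = 0 then e r else 0 := by
  classical
  set θ := lineChart k ≫ φ with hθ
  have hev : ∀ a : k, Spec.map (CommRingCat.ofHom (evalRingHom a)) ≫ θ = linePoint a ≫ φ :=
      fun a => by
    rw [hθ, ← Category.assoc, eval_lineChart]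
  let o : Spec (.of k[X]) :=
    Spec.map (CommRingCat.ofHom (evalRingHom (0 : k))) (IsLocalRing.closedPoint k)
  have ho : o ∈ (θ ⁻¹ᵁ E.ι.opensRange : (Spec (.of k[X])).Opens) := by
    exact E.mem_range_of_comp _ θ e₀ ((hev 0).trans h0) _
  obtain ⟨_, ⟨_, ⟨f, rfl⟩, rfl⟩, hf, hfU⟩ :=
    PrimeSpectrum.isBasis_basic_opens.exists_subset_of_mem_open ho (θ ⁻¹ᵁ E.ι.opensRange).2
  have hf0 : f.eval 0 ≠ 0 := by
    intro hf0
    refine hf ?_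
    change evalRingHom 0 f ∈ IsLocalRing.maximalIdeal k
    rw [coe_evalRingHom, hf0]
    exact zero_mem _
  let Λ := Localization.Away f
  let l : k[X] →+* Λ := algebraMap _ _
  have hr : Set.range (Spec.map (CommRingCat.ofHom l) ≫ θ) ⊆ Set.range E.ι := by
    rintro _ ⟨y, rfl⟩
    rw [Scheme.Hom.comp_apply]
    refine hfU ?_
    exact (PrimeSpectrum.localization_away_comap_range Λ f).subset ⟨y, rfl⟩
  let F : E.R.R →+* Λ := (Spec.preimage (IsOpenImmersion.lift E.ι _ hr)).hom
  have hF : Spec.map (CommRingCat.ofHom F) ≫ E.ι = Spec.map (CommRingCat.ofHom l) ≫ θ := by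
    rw [CommRingCat.ofHom_hom, Spec.map_preimage, IsOpenImmersion.lift_fac]
  have hunit : ∀ a : k, f.eval a ≠ 0 → IsUnit (evalRingHom a f) := fun a ha => IsUnit.mk0 _ ha
  let ev : ∀ a : k, f.eval a ≠ 0 → Λ →+* k := fun a ha => IsLocalization.Away.lift f (hunit a ha)
  have hev1 : ∀ a ha q, ev a ha (l q) = q.eval a := fun a ha q => IsLocalization.Away.lift_eq f _ q
  have hev2 : ∀ a ha, E.point ((ev a ha).comp F) = linePoint a ≫ φ := fun a ha => by
    rw [ExpChart.point, CommRingCat.ofHom_comp, Spec.map_comp, Category.assoc, hF, ← Category.assoc,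
      ← Spec.map_comp, ← CommRingCat.ofHom_comp, ← hev]
    congr 3
    ext q
    · exact (hev1 a ha _).trans rfl
    · exact (hev1 a ha _).trans rfl
  have he₀ : (ev 0 hf0).comp F = e₀ := E.point_injective ((hev2 0 hf0).trans h0)
  -- Some translate of `P` lies in the chart. The chart is stable under the action, so translating
  -- back shows that `P` lies in it too.
  obtain ⟨x₁, hx₁⟩ : ∃ x : kˣ, f.eval (x : k) ≠ 0 := by
    have hf' : f ≠ 0 := by rintro rfl; simp at hf0
    obtain ⟨a, ha⟩ := Infinite.exists_notMem_finset ((X * f).roots.toFinset)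
    rw [Multiset.mem_toFinset, mem_roots (mul_ne_zero X_ne_zero hf'), IsRoot, eval_mul, eval_X,
      mul_eq_zero, not_or] at ha
    exact ⟨Units.mk0 a ha.1, ha.2⟩
  let e : E.R.R →+* k := ((ev _ hx₁).comp F).comp (E.scale s x₁⁻¹)
  have heP : P = E.point e := by
    rw [← E.point_scale h s x₁⁻¹ (hg _), hev2 _ hx₁, hφ, Category.assoc,
        h.comp_isScaling s x₁ (hg _) (hg _),
      Category.comp_id]
  refine ⟨e, heP, fun r w hw => ?_⟩
  have hsc := E.point_str e (by rw [← heP]; exact hP)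
  have key : ∀ (x : kˣ) (hx : f.eval (x : k) ≠ 0), ev _ hx (F r) = ((x ^ w : kˣ) : k) * e r := by
    intro x hx
    have h1 : (ev _ hx).comp F = e.comp (E.scale s x) := E.point_injective (by
      rw [hev2 _ hx, hφ, heP, E.point_scale h s x (hg x)])
    refine (RingHom.congr_fun h1 r).trans ?_
    rw [RingHom.comp_apply, hw, map_mul, hsc]
  obtain ⟨N, q, hq⟩ := IsLocalization.Away.surj f (F r)
  have hq' : ∀ a ha, ev a ha (F r) * f.eval a ^ N = q.eval a := fun a ha => by
    have h1 : ev a ha (F r) * ev a ha (l (f ^ N)) = ev a ha (l q) := by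
      rw [← map_mul, map_pow]
      exact congrArg (ev a ha) hq
    rwa [hev1 a ha, hev1 a ha, eval_pow] at h1
  obtain ⟨h1, h2⟩ := eval_zero_of_zpow q f N (e r) w hf0 fun x hx => by rw [← hq' _ hx, key x hx]
  refine ⟨h1, ?_⟩
  rw [← hq' 0 hf0] at h2
  rw [← he₀]
  exact mul_right_cancel₀ (pow_ne_zero N hf0) h2

end Limit

end ExpDeg
end

/-! ### Homogeneous coordinates at the limit point -/

noncomputable section

namespace ExpDeg

variable {k : Type u} [Field k] {𝒟 : Degeneration k} {B : BipartiteOrientation 𝒟}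

/-- The behaviour of the vanishing of a coordinate of weight `w` under passage to a limit. -/
structure VanishLimit (w : ℤ) (v v₀ : Prop) : Prop where
  nonneg : ¬ v → 0 ≤ w
  iff : v₀ ↔ v ∨ w ≠ 0

variable {S : Scheme.{u}} {p : S ⟶ 𝒟.X} {t : ℕ → Γ(S, ⊤)} {n : ℕ}

/-- The relation between the coordinates of a point of a chart and of its limit. -/
structure ExpChart.IsLimitPair (E : ExpChart B n p t) (s : Fin n → ℤ) (z z₀ : Spec (.of E.R.R)) :
    Prop where
  below : E.below z₀ = E.below z
  coord : ∀ i ∈ Finset.Icc 1 (n + 1),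
    VanishLimit (weight s i) (E.R.t i ∈ z.asIdeal) (E.R.t i ∈ z₀.asIdeal)
  fst : VanishLimit (extZero s E.j) (E.R.c 0 ∈ z.asIdeal) (E.R.c 0 ∈ z₀.asIdeal)
  snd : VanishLimit (-extZero s (E.j - 1)) (E.R.c 1 ∈ z.asIdeal) (E.R.c 1 ∈ z₀.asIdeal)

section

variable (h : IsUniversal B n p t) {s : Fin n → ℤ} {g : kˣ → (S ⟶ S)}
  (hg : ∀ x, IsScaling p t s x (g x))

include h hg in
theorem exists_isLimitPair [IsAlgClosed k] {P P₀ : Spec (.of k) ⟶ S}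
    {φ : Line (Spec (.of k)) ⟶ S} (hφ : ∀ x : kˣ, linePoint (x : k) ≫ φ = P ≫ g x)
    (hP : P ≫ p ≫ 𝒟.π ≫ 𝒟.str = 𝟙 _) (h0 : linePoint 0 ≫ φ = P₀) :
    ∃ (E : ExpChart B n p t) (e e₀ : E.R.R →+* k), P = E.point e ∧ P₀ = E.point e₀ ∧
      E.IsLimitPair s (E.pt e) (E.pt e₀) := by
  have : Infinite k := IsAlgClosed.instInfinite
  obtain ⟨E, hE⟩ := h.exists_mem_range_expChart (P₀ (IsLocalRing.closedPoint k))
  obtain ⟨e₀, he₀⟩ := E.exists_point hE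
  obtain ⟨e, he, hlim⟩ := limit_chart h hg hφ hP E e₀ (h0.trans he₀)
  have key : ∀ (r : E.R.R) (w : ℤ),
      (∀ x : kˣ, E.scale s x r = E.scalar ((x ^ w : kˣ) : k) * r) →
        VanishLimit w (r ∈ (E.pt e).asIdeal) (r ∈ (E.pt e₀).asIdeal) := by
    intro r w hw
    obtain ⟨h1, h2⟩ := hlim r w hw
    rw [E.mem_pt, E.mem_pt, h2]
    refine ⟨h1, ?_⟩
    split_ifs with hw0
    · simp [hw0]
    · simp [hw0]
  refine ⟨E, e, e₀, he, he₀, ?_, fun i hi => key _ _ fun x => E.scale_t s x hi,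
    key _ _ fun x => E.scale_fst s x, key _ _ fun x => E.scale_snd s x⟩
  refine PrimeSpectrum.ext (Ideal.ext fun a => ?_)
  have h1 : e₀ (E.R.α a) = e (E.R.α a) := by
    have := (hlim (E.R.α a) 0 fun x => by simp [E.scale_α]).2
    simpa using this
  refine (E.mem_below _ a).trans (Iff.trans ?_ (E.mem_below _ a).symm)
  rw [E.mem_pt, E.mem_pt, h1]

end

namespace ExpChart.IsLimitPair

variable {E : ExpChart B n p t} {s : Fin n → ℤ} {z z₀ : Spec (.of E.R.R)}
  (H : E.IsLimitPair s z z₀)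

include H

theorem proj_eq : p (E.ι z₀) = p (E.ι z) := by
  rw [E.proj_ι, E.proj_ι, H.below]

theorem vanishesAt_iff {i : ℕ} (hi : i ∈ Finset.Icc 1 (n + 1)) :
    VanishesAt (t i) (E.ι z₀) ↔ VanishesAt (t i) (E.ι z) ∨ weight s i ≠ 0 := by
  rw [E.vanishesAt_iff hi, E.vanishesAt_iff hi]
  exact (H.coord i hi).iff

theorem weight_nonneg {i : ℕ} (hi : i ∈ Finset.Icc 1 (n + 1)) (hv : ¬ VanishesAt (t i) (E.ι z)) :
    0 ≤ weight s i := by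
  rw [E.vanishesAt_iff hi] at hv
  exact (H.coord i hi).nonneg hv

omit H in
theorem mem_Icc_of_lt {i m : ℕ} (h1 : i < m) (h2 : m ≤ n + 1) : m ∈ Finset.Icc 1 (n + 1) :=
  Finset.mem_Icc.2 ⟨by omega, h2⟩

/-- Along a range of coordinates that do not vanish, the exponents increase. -/
theorem extZero_le {a b : ℕ} (hab : a ≤ b) (hb : b ≤ n + 1)
    (hv : ∀ m, a < m → m ≤ b → E.R.t m ∉ z.asIdeal) : extZero s a ≤ extZero s b := by
  induction b, hab using Nat.le_induction with
  | base => rfl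
  | succ b hab ih =>
    have h1 := ih (by omega) fun m h1 h2 => hv m h1 (by omega)
    have h2 := (H.coord (b + 1) (mem_Icc_of_lt b.lt_succ_self hb)).nonneg
      (hv (b + 1) (by omega) le_rfl)
    rw [weight, Nat.add_sub_cancel] at h2
    omega

theorem fst_lim (hx : E.R.c 0 ∈ z.asIdeal) : E.R.c 0 ∈ z₀.asIdeal := H.fst.iff.2 (.inl hx)

theorem snd_lim (hx : E.R.c 1 ∈ z.asIdeal) : E.R.c 1 ∈ z₀.asIdeal := H.snd.iff.2 (.inl hx)

theorem coord_lim {i : ℕ} (hi : i ∈ Finset.Icc 1 (n + 1)) (hx : E.R.t i ∈ z.asIdeal) :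
    E.R.t i ∈ z₀.asIdeal := (H.coord i hi).iff.2 (.inl hx)

theorem sourceZero {i : ℕ} (hi : i ≤ n + 1) (hz : SourceZero B p t n i (E.ι z)) :
    SourceZero B p t n i (E.ι z₀) := by
  rw [E.sourceZero_iff _ hi] at hz ⊢
  exact ⟨hz.1, hz.2.imp H.fst_lim fun ⟨m, h1, h2, h3⟩ =>
    ⟨m, h1, h2, H.coord_lim (mem_Icc_of_lt h1 (h2.trans hi)) h3⟩⟩

theorem tailZero {i : ℕ} (hi : i ≤ n + 1) (hz : TailZero B p t n i (E.ι z)) :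
    TailZero B p t n i (E.ι z₀) := by
  rw [E.tailZero_iff _ hi] at hz ⊢
  have := E.isChartIndex.le
  exact ⟨hz.1, hz.2.imp H.snd_lim fun ⟨m, h1, h2, h3⟩ =>
    ⟨m, h1, h2, H.coord_lim (mem_Icc_of_lt h1 (by omega)) h3⟩⟩

omit H in
theorem exists_weight_ne {a b : ℕ} (hab : a ≤ b) (hne : extZero s a ≠ extZero s b) :
    ∃ m, a < m ∧ m ≤ b ∧ weight s m ≠ 0 := by
  by_contra! hcon
  refine hne ?_
  induction b, hab using Nat.le_induction with
  | base => rfl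
  | succ b hab ih =>
    have h1 := hcon (b + 1) (by omega) le_rfl
    rw [weight, Nat.add_sub_cancel] at h1
    by_contra hne
    refine hne ((ih (fun h2 => hne (h2.trans ?_)) fun m h1 h2 => hcon m h1 (by omega)).trans ?_) <;>
    omega

/-- The ratio `x / vᵢ` is finite at `P` and has positive weight `sᵢ`, hence tends to zero. In the
chart: `i < j` is impossible, since it would give `sᵢ ≤ s_{j-1} ≤ 0`. So `j ≤ i`, and either `s_j ≠
0`, which makes `x_j` vanish, or one of `t_{j+1}, …, tᵢ` has nonzero weight. The lemma
`tailZero_of_neg` is the mirror image. -/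
theorem sourceZero_of_pos {i : ℕ} (hi : i ≤ n + 1) (hs : 0 < extZero s i)
    (hz : ¬ TailZero B p t n i (E.ι z)) : SourceZero B p t n i (E.ι z₀) := by
  have hj := E.isChartIndex.le
  rw [E.tailZero_iff _ hi] at hz
  rw [E.sourceZero_iff _ hi]
  have hji : E.j ≤ i := by
    by_contra hlt
    push Not at hz hlt
    obtain ⟨h1, h2⟩ := hz hlt
    have h3 := H.extZero_le (a := i) (b := E.j - 1) (by omega) (by omega)
      fun m h1 h4 => h2 m h1 (by omega)
    have := H.snd.nonneg h1
    omega
  refine ⟨hji, ?_⟩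
  rcases eq_or_ne (extZero s E.j) 0 with h0 | h0
  · obtain ⟨m, h1, h2, h3⟩ := exists_weight_ne hji (s := s) (by omega)
    exact .inr ⟨m, h1, h2, (H.coord m (mem_Icc_of_lt h1 (by omega))).iff.2 (.inr h3)⟩
  · exact .inl (H.fst.iff.2 (.inr h0))

theorem tailZero_of_neg {i : ℕ} (hi : i ≤ n + 1) (hs : extZero s i < 0)
    (hz : ¬ SourceZero B p t n i (E.ι z)) : TailZero B p t n i (E.ι z₀) := by
  have hj := E.isChartIndex.le
  rw [E.sourceZero_iff _ hi] at hz
  rw [E.tailZero_iff _ hi]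
  have hji : i < E.j := by
    by_contra hlt
    push Not at hz hlt
    obtain ⟨h1, h2⟩ := hz hlt
    have h3 := H.extZero_le hlt hi h2
    have := H.fst.nonneg h1
    omega
  refine ⟨hji, ?_⟩
  rcases eq_or_ne (extZero s (E.j - 1)) 0 with h0 | h0
  · obtain ⟨m, h1, h2, h3⟩ := exists_weight_ne (show i ≤ E.j - 1 by omega) (s := s) (by omega)
    exact .inr ⟨m, h1, by omega,
      (H.coord m (mem_Icc_of_lt h1 (by omega))).iff.2 (.inr h3)⟩
  · exact .inl (H.snd.iff.2 (.inr (by omega)))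

/-- The ratio is finite and nonzero at `P` and has weight zero, so it keeps its value. In the chart:
if `i < j`, the exponents increase from `sᵢ = 0` to `s_{j-1} ≤ 0`, hence all vanish, and none of the
coordinates in the ratio changes its vanishing. The case `j ≤ i` is similar. -/
theorem not_zero_of_eq_zero {i : ℕ} (hi : i ≤ n + 1) (hs : extZero s i = 0)
    (hA : ¬ SourceZero B p t n i (E.ι z)) (hB : ¬ TailZero B p t n i (E.ι z)) :
    ¬ SourceZero B p t n i (E.ι z₀) ∧ ¬ TailZero B p t n i (E.ι z₀) := by
  have hj := E.isChartIndex.le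
  have hj1 := E.isChartIndex.one_le
  rw [E.sourceZero_iff _ hi] at hA ⊢
  rw [E.tailZero_iff _ hi] at hB ⊢
  push Not at hA hB
  rcases lt_or_ge i E.j with hlt | hge
  · refine ⟨fun hc => by omega, fun ⟨_, hc⟩ => ?_⟩
    obtain ⟨h1, h2⟩ := hB hlt
    have h3 := H.snd.nonneg h1
    have h4 : ∀ m, i ≤ m → m < E.j → extZero s m = 0 := by
      intro m hm1 hm2
      have h5 := H.extZero_le hm1 (by omega) fun l h1 h4 => h2 l h1 (by omega)
      have h6 := H.extZero_le (show m ≤ E.j - 1 by omega) (by omega)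
        fun l h1 h4 => h2 l (by omega) (by omega)
      omega
    rcases hc with hc | ⟨m, h5, h6, hc⟩
    · refine (H.snd.iff.1 hc).elim h1 fun h5 => h5 ?_
      rw [h4 _ (by omega) (by omega), neg_zero]
    · refine ((H.coord m (mem_Icc_of_lt h5 (by omega))).iff.1 hc).elim (h2 m h5 h6) fun h7 => h7 ?_
      rw [weight, h4 _ (by omega) h6, h4 _ (by omega) (by omega), sub_zero]
  · refine ⟨fun ⟨_, hc⟩ => ?_, fun hc => by omega⟩
    obtain ⟨h1, h2⟩ := hA hge
    have h3 := H.fst.nonneg h1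
    have h4 : ∀ m, E.j ≤ m → m ≤ i → extZero s m = 0 := by
      intro m hm1 hm2
      have h5 := H.extZero_le hm1 (by omega) fun l h1 h4 => h2 l h1 (by omega)
      have h6 := H.extZero_le hm2 (by omega) fun l h1 h4 => h2 l (by omega) (by omega)
      omega
    rcases hc with hc | ⟨m, h5, h6, hc⟩
    · exact (H.fst.iff.1 hc).elim h1 fun h5 => h5 (h4 _ le_rfl hge)
    · refine ((H.coord m (mem_Icc_of_lt h5 (by omega))).iff.1 hc).elim (h2 m h5 h6) fun h7 => h7 ?_
      rw [weight, h4 _ (by omega) h6, h4 _ (by omega) (by omega), sub_zero]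

end ExpChart.IsLimitPair

end ExpDeg
end

/-! ### Existence of the limit -/

noncomputable section

namespace ExpDeg

variable {k : Type u} [Field k] {𝒟 : Degeneration k} {B : BipartiteOrientation 𝒟}

section Line

/-- The coordinate on the affine line. -/
abbrev lineCoord (k : Type u) [Field k] : Γ(Line (Spec (.of k)), ⊤) :=
  AffineSpace.coord (Spec (.of k)) PUnit.unit

/-- The scalars in the ring of functions on the affine line. -/
abbrev lineConst (k : Type u) [Field k] : k →+* Γ(Line (Spec (.of k)), ⊤) :=
  constHom (Line (Spec (.of k)) ↘ Spec (.of k))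

theorem linePoint_lineCoord (a : k) : (linePoint a).appTop (lineCoord k) = specFun k a := by
  have h1 : constHom (𝟙 (Spec (.of k))) a = specFun k a := by
    rw [← Spec.map_id, ← CommRingCat.ofHom_id, constHom_spec]
    rfl
  rw [← h1]
  exact toLine_appTop_coord _ _ _

theorem linePoint_lineConst (a b : k) : (linePoint a).appTop (lineConst k b) = specFun k b := by
  have h1 : constHom (𝟙 (Spec (.of k))) b = specFun k b := by
    rw [← Spec.map_id, ← CommRingCat.ofHom_id, constHom_spec]
    rfl
  rw [← h1, appTop_constHom, linePoint, toLine, AffineSpace.homOfVector_over]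

/-- A function `a * T ^ w` on the affine line. -/
def monomial (a : k) (w : ℤ) : Γ(Line (Spec (.of k)), ⊤) := lineConst k a * lineCoord k ^ w.toNat

/-- The truncation in `toNat` is harmless: a negative exponent is only permitted when the
coefficient is zero. -/
theorem monomial_mul {a b : k} {v w : ℤ} (ha : a ≠ 0 → 0 ≤ v) (hb : b ≠ 0 → 0 ≤ w) :
    monomial a v * monomial b w = monomial (a * b) (v + w) := by
  by_cases ha0 : a = 0
  · simp [monomial, ha0]
  by_cases hb0 : b = 0
  · simp [monomial, hb0]
  rw [monomial, monomial, monomial, map_mul, Int.toNat_add (ha ha0) (hb hb0), pow_add]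
  ring

theorem monomial_prod {a : ℕ → k} {w : ℕ → ℤ} (A : Finset ℕ) (h : ∀ i ∈ A, a i ≠ 0 → 0 ≤ w i) :
    (∏ i ∈ A, monomial (a i) (w i) = monomial (∏ i ∈ A, a i) (∑ i ∈ A, w i)) ∧
      (∏ i ∈ A, a i ≠ 0 → 0 ≤ ∑ i ∈ A, w i) := by
  classical
  refine ⟨?_, fun h0 => Finset.sum_nonneg fun i hi => h i hi (Finset.prod_ne_zero_iff.1 h0 i hi)⟩
  induction A using Finset.induction_on with
  | empty => simp [monomial]
  | insert i A hi ih =>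
    rw [Finset.prod_insert hi, Finset.prod_insert hi, Finset.sum_insert hi,
      ih fun i hi => h i (Finset.mem_insert_of_mem hi),
          monomial_mul (h i (Finset.mem_insert_self _ _))]
    exact fun h0 => Finset.sum_nonneg fun i hi =>
      h i (Finset.mem_insert_of_mem hi) (Finset.prod_ne_zero_iff.1 h0 i hi)

theorem monomial_zero (a : k) : monomial a 0 = lineConst k a := by simp [monomial]

theorem linePoint_monomial (x : kˣ) {a : k} {w : ℤ} (h : a ≠ 0 → 0 ≤ w) :
    (linePoint (x : k)).appTop (monomial a w) = specFun k (((x ^ w : kˣ) : k) * a) := by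
  rw [monomial, map_mul, map_pow, linePoint_lineCoord, linePoint_lineConst, map_mul, mul_comm]
  by_cases ha : a = 0
  · simp [ha]
  · congr 1
    obtain ⟨w, rfl⟩ := Int.eq_ofNat_of_zero_le (h ha)
    simp

theorem sum_weight {n : ℕ} (s : Fin n → ℤ) {a b : ℕ} (hab : a ≤ b) :
    ∑ i ∈ Finset.Icc (a + 1) b, weight s i = extZero s b - extZero s a := by
  induction b, hab using Nat.le_induction with
  | base => simp
  | succ b hb ih =>
    rw [Finset.sum_Icc_succ_top (by omega), ih, weight, Nat.add_sub_cancel]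
    ring

end Line

section Existence

variable {S : Scheme.{u}} {p : S ⟶ 𝒟.X} {t : ℕ → Γ(S, ⊤)} {n : ℕ} (h : IsUniversal B n p t)
  {s : Fin n → ℤ} {g : kˣ → (S ⟶ S)} (hg : ∀ x, IsScaling p t s x (g x))

include h hg in
/-- The limit exists if no coordinate of negative weight is nonzero at the point. -/
theorem ExpChart.exists_limit (E : ExpChart B n p t) (e : E.R.R →+* k)
    (he : ∀ a, e (E.scalar a) = a)
    (ht : ∀ i ∈ Finset.Icc 1 (n + 1), e (E.R.t i) ≠ 0 → 0 ≤ weight s i)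
    (h0 : e (E.R.c 0) ≠ 0 → 0 ≤ extZero s E.j)
    (h1 : e (E.R.c 1) ≠ 0 → 0 ≤ -extZero s (E.j - 1)) :
    ∃ φ : Line (Spec (.of k)) ⟶ S, (∀ x : kˣ, linePoint (x : k) ≫ φ = E.point e ≫ g x) ∧
      linePoint 0 ≫ φ ≫ p ≫ 𝒟.π ≫ 𝒟.str = 𝟙 _ := by
  have hj := E.isChartIndex
  have hv := E.R.isValue
  -- Along the orbit, a coordinate of weight `w` with value `a` at the point becomes the function `a
  -- T ^ w` on the line. The chart equations are homogeneous, so these functions define a morphism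
  -- to the chart.
  let t' : ℕ → Γ(Line (Spec (.of k)), ⊤) := fun i => monomial (e (E.R.t i)) (weight s i)
  let c' : Fin 2 → Γ(Line (Spec (.of k)), ⊤) := ![monomial (e (E.R.c 0)) (extZero s E.j),
    monomial (e (E.R.c 1)) (-extZero s (E.j - 1))]
  have hval : IsChartValue E.c.σ (fun i => ((lineConst k).comp (e.comp E.R.α)) (E.c.v i)) n E.j
      t' c' := by
    refine ⟨?_, ?_, ?_, ?_⟩
    · simp only [t', c', Matrix.cons_val_zero, Matrix.cons_val_one]
      rw [monomial_mul h0 h1, ← map_mul, ← hv.mul]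
      rfl
    · simp only [t', c', Matrix.cons_val_zero, RingHom.comp_apply]
      obtain ⟨h2, h3⟩ := monomial_prod (a := fun i => e (E.R.t i)) (w := weight s)
        (Finset.Icc (E.j + 1) (n + 1)) (by
          intro i hi
          refine ht i ?_
          rw [Finset.mem_Icc] at hi ⊢
          omega)
      rw [h2, monomial_mul h0 h3, ← map_prod, ← map_mul, ← hv.fst, sum_weight s hj.le, extZero_succ,
        zero_sub, add_neg_cancel, monomial_zero]
    · simp only [t', c', Matrix.cons_val_zero, Matrix.cons_val_one, RingHom.comp_apply]
      have h4 : Finset.Ico 1 E.j = Finset.Icc (0 + 1) (E.j - 1) := by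
        ext m
        have := hj.one_le
        rw [Finset.mem_Ico, Finset.mem_Icc]
        omega
      obtain ⟨h2, h3⟩ := monomial_prod (a := fun i => e (E.R.t i)) (w := weight s)
        (Finset.Ico 1 E.j) (by
          intro i hi
          refine ht i ?_
          have := hj.le
          rw [Finset.mem_Icc]
          rw [Finset.mem_Ico] at hi
          omega)
      rw [h2, monomial_mul h1 h3, ← map_prod, ← map_mul, ← hv.snd, h4, sum_weight s (Nat.zero_le _),
        extZero_zero, sub_zero, neg_add_cancel, monomial_zero]
    · intro i hi
      fin_cases i
      · have h2 : extZero s E.j = 0 := (congrArg _ (hj.fst hi)).trans (extZero_succ s)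
        simp only [c', Fin.zero_eta, Matrix.cons_val_zero]
        rw [hv.one 0 hi, h2, monomial_zero, map_one, map_one]
      · have h2 : extZero s (E.j - 1) = 0 :=
          (congrArg _ (Nat.sub_eq_zero_of_le (hj.snd hi).le)).trans (extZero_zero s)
        simp only [c', Fin.mk_one, Matrix.cons_val_one, Matrix.cons_val_zero]
        rw [hv.one 1 hi, h2, neg_zero, monomial_zero, map_one, map_one]
  obtain ⟨f, hfα, hft, hfc⟩ := E.R.exists_lift _ t' c' hval
  have hfα : ∀ a, f (E.R.α a) = lineConst k (e (E.R.α a)) := RingHom.congr_fun hfα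
  obtain ⟨l, hl⟩ := exists_hom_specFun f
  have hl' : ∀ (y : Spec (.of k) ⟶ Line (Spec (.of k))) (f' : E.R.R →+* k),
      (y.appTop.hom.comp f) = (specFun k).comp f' → y ≫ l = Spec.map (CommRingCat.ofHom f') := by
    intro y f' hy
    refine hom_ext_specFun fun a => ?_
    rw [appTop_comp_apply, hl, appTop_specFun]
    exact RingHom.congr_fun hy a
  refine ⟨l ≫ E.ι, fun x => ?_, ?_⟩
  · rw [E.point_scale h s x (hg x), ← Category.assoc, ExpChart.point]
    congr 1
    refine hl' _ _ (E.R.hom_ext _ _ ?_ ?_ ?_)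
    · ext a
      simp only [RingHom.comp_apply, E.scale_α, hfα]
      exact linePoint_lineConst _ _
    · intro i hi _
      change (linePoint (x : k)).appTop (f (E.R.t i)) = specFun k (e (E.scale s x (E.R.t i)))
      rw [hft i hi, E.scale_t s x hi, map_mul e, he]
      exact linePoint_monomial x (ht i hi)
    · intro i
      simp only [RingHom.comp_apply, hfc]
      fin_cases i
      · simp only [Fin.zero_eta, E.scale_fst, map_mul, he]
        rw [← map_mul]
        exact linePoint_monomial x h0
      · simp only [Fin.mk_one, E.scale_snd, map_mul, he]
        rw [← map_mul]
        exact linePoint_monomial x h1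
  · rw [Category.assoc, E.ι_str]
    refine (hom_ext_specFun fun a => ?_ :
      linePoint (0 : k) ≫ l ≫ Spec.map (CommRingCat.ofHom E.scalar) = 𝟙 (Spec (.of k)))
    rw [appTop_comp_apply, appTop_comp_apply, appTop_specFun, hl, Scheme.Hom.id_appTop,
      E.scalar_eq, RingHom.comp_apply, hfα, linePoint_lineConst]
    have := he a
    rw [E.scalar_eq, RingHom.comp_apply] at this
    rw [this]
    rfl

include h hg in
-- It suffices to find a chart around `P` in which a nonvanishing `x_j` or `y_j` has nonnegative
-- weight. Take the least `j ≥ 1` such that, for all `i ≥ j`, the tail coordinate is nonzero at `P`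
-- and either `sᵢ ≥ 0` or the source coordinate is zero. If `x = 1` or `y = 1`, the index is forced,
-- one of `s_j`, `s_{j-1}` is zero, and the hypothesis on `t_j` suffices.
theorem exists_limit [IsAlgClosed k] (P : Spec (.of k) ⟶ S) (hP : P ≫ p ≫ 𝒟.π ≫ 𝒟.str = 𝟙 _)
    (ht : ∀ i ∈ Finset.Icc 1 (n + 1), ¬ VanishesAt (t i) (P (IsLocalRing.closedPoint k)) →
      0 ≤ weight s i) :
    ∃ φ : Line (Spec (.of k)) ⟶ S, (∀ x : kˣ, linePoint (x : k) ≫ φ = P ≫ g x) ∧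
      linePoint 0 ≫ φ ≫ p ≫ 𝒟.π ≫ 𝒟.str = 𝟙 _ := by
  classical
  suffices hE : ∃ (E : ExpChart B n p t) (e : E.R.R →+* k), P = E.point e ∧
      (E.R.c 0 ∉ (E.pt e).asIdeal → 0 ≤ extZero s E.j) ∧
      (E.R.c 1 ∉ (E.pt e).asIdeal → 0 ≤ -extZero s (E.j - 1)) by
    obtain ⟨E, e, rfl, h0, h1⟩ := hE
    rw [E.mem_pt] at h0 h1
    refine E.exists_limit h hg e (E.point_str e hP) (fun i hi hne => ht i hi ?_) h0 h1
    rw [E.point_closedPoint, E.vanishesAt_iff hi, E.mem_pt]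
    exact hne
  obtain ⟨E, hE⟩ := h.exists_mem_range_expChart (P (IsLocalRing.closedPoint k))
  obtain ⟨e, he⟩ := E.exists_point hE
  have htE : ∀ i ∈ Finset.Icc 1 (n + 1), E.R.t i ∉ (E.pt e).asIdeal → 0 ≤ weight s i := by
    intro i hi hne
    refine ht i hi ?_
    rwa [he, E.point_closedPoint, E.vanishesAt_iff hi]
  have hjmem : E.j ∈ Finset.Icc 1 (n + 1) := Finset.mem_Icc.2 ⟨E.isChartIndex.one_le,
      E.isChartIndex.le⟩
  by_cases h0 : 0 ∈ E.c.σ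
  · by_cases h1 : 1 ∈ E.c.σ
    · set q := P (IsLocalRing.closedPoint k) with hq
      have hqc : p q ∈ Set.range E.c.e := by
        rw [hq, he, E.point_closedPoint, E.proj_ι]
        exact ⟨_, rfl⟩
      have hex : ∃ j, 1 ≤ j ∧ j ≤ n + 1 ∧ ∀ i, j ≤ i → i ≤ n + 1 → ¬ TailZero B p t n i q ∧
          (0 ≤ extZero s i ∨ SourceZero B p t n i q) := by
        refine ⟨n + 1, by omega, le_rfl, fun i h1 h2 => ?_⟩
        obtain rfl : i = n + 1 := by omega
        rw [extZero_succ, hq, he, E.point_closedPoint, E.tailZero_iff _ le_rfl]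
        have := E.isChartIndex.le
        exact ⟨fun h => by omega, .inl le_rfl⟩
      obtain ⟨hj1, hjn, hj⟩ := Nat.find_spec hex
      -- Minimality is only needed at `j - 1`: there either the tail coordinate vanishes, or the
      -- exponent is negative and the source coordinate is nonzero. Both cases put `P` into the
      -- `j`-th chart and control `y_j`.
      have hmin : ∀ i, 1 ≤ i → i < Nat.find hex → i = Nat.find hex - 1 → TailZero B p t n i q ∨
          (extZero s i < 0 ∧ ¬ SourceZero B p t n i q) := by
        intro i hi1 hi2 hi3
        by_contra! hcon
        refine Nat.find_min hex hi2 ⟨hi1, by omega, fun m h1 h2 => ?_⟩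
        rcases eq_or_lt_of_le h1 with rfl | h1
        · refine ⟨hcon.1, ?_⟩
          by_contra! hc
          exact hc.2 (hcon.2 hc.1)
        · exact hj m (by omega) h2
      generalize Nat.find hex = J at hj1 hjn hj hmin
      have hJ : IsChartIndex E.c.σ n (J) :=
        ⟨hj1, hjn, fun h => (h h0).elim, fun h => (h h1).elim⟩
      obtain ⟨E', hE'c, hE'j⟩ := h.exists_expChart E.c hJ
      have hB := (hj _ le_rfl hjn).1
      have hA : ¬ SourceZero B p t n (J - 1) q := by
        rcases Nat.eq_zero_or_pos (J - 1) with h4 | h4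
        · rw [h4, SourceZero, not_not]
          exact sourceDvd_zero h E.c q hqc
        · rcases hmin _ h4 (by omega) rfl with h5 | h5
          · rw [SourceZero, not_not]
            exact (tailDvd_or_sourceDvd h E.c (by omega) q hqc).resolve_left h5
          · exact h5.2
      have hmem : q ∈ Set.range E'.ι := by
        refine E'.mem_range q (by rw [hE'c]; exact hqc) ?_ ?_
        · rw [hE'j]; exact not_not.1 hB
        · rw [hE'j]; exact not_not.1 hA
      obtain ⟨e', he'⟩ := E'.exists_point hmem
      have hq' : q = E'.ι (E'.pt e') := by rw [hq, he', E'.point_closedPoint]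
      refine ⟨E', e', he', fun hc => ?_, fun hc => ?_⟩
      · have h2 := (hj _ le_rfl hjn).2
        rw [← hE'j] at h2
        refine h2.resolve_right fun h3 => ?_
        rw [hq', E'.sourceZero_iff _ E'.isChartIndex.le] at h3
        rcases h3.2 with h3 | ⟨m, h4, h5, -⟩
        · exact hc h3
        · omega
      · rcases Nat.eq_zero_or_pos (J - 1) with h4 | h4
        · rw [hE'j, h4, extZero_zero, neg_zero]
        · rcases hmin _ h4 (by omega) rfl with h5 | h5
          · rw [hq', ← hE'j, E'.tailZero_iff _ (by omega)] at h5
            rcases h5.2 with h3 | ⟨m, h6, h7, -⟩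
            · exact (hc h3).elim
            · omega
          · rw [hE'j]
            omega
    · have h2 : extZero s (E.j - 1) = 0 :=
        (congrArg _ (Nat.sub_eq_zero_of_le (E.isChartIndex.snd h1).le)).trans (extZero_zero s)
      refine ⟨E, e, he, fun hc => ?_, fun _ => by omega⟩
      have h3 := htE E.j hjmem fun h3 =>
        ((E.t_mem_iff _).1 h3).elim hc fun h4 => h1 (E.c_mem h4)
      rw [weight] at h3
      omega
  · have h2 : extZero s E.j = 0 := (congrArg _ (E.isChartIndex.fst h0)).trans (extZero_succ s)
    refine ⟨E, e, he, fun _ => by omega, fun hc => ?_⟩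
    have h3 := htE E.j hjmem fun h3 =>
      ((E.t_mem_iff _).1 h3).elim (fun h4 => h0 (E.c_mem h4)) hc
    rw [weight] at h3
    omega

end Existence

end ExpDeg
end

/-! ### The local generator of the linearized sheaf and its weight -/

noncomputable section

namespace ExpDeg

variable {k : Type u} [Field k] {𝒟 : Degeneration k} {B : BipartiteOrientation 𝒟}

theorem exists_toStalk_mul_eq {R : Type u} [CommRing R] (z : Spec (.of R))
    (q : (Spec (.of R)).presheaf.stalk z) : ∃ a b : R, b ∉ z.asIdeal ∧
      toStalk z (specFun R b) * q = toStalk z (specFun R a) := by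
  have hU := isAffineOpen_top (Spec (.of R))
  let : Algebra Γ(Spec (.of R), ⊤) ((Spec (.of R)).presheaf.stalk z) := (toStalk z).toAlgebra
  have hl : IsLocalization.AtPrime ((Spec (.of R)).presheaf.stalk z)
    (hU.primeIdealOf ⟨z, trivial⟩).asIdeal := hU.isLocalization_stalk ⟨z, trivial⟩
  obtain ⟨⟨a, b⟩, hab⟩ := IsLocalization.surj
    (hU.primeIdealOf ⟨z, trivial⟩).asIdeal.primeCompl q
  obtain ⟨a, rfl⟩ := (specFun_bijective R).2 a
  obtain ⟨b, hb⟩ := b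
  obtain ⟨b, rfl⟩ := (specFun_bijective R).2 b
  have hu := IsLocalization.map_units ((Spec (.of R)).presheaf.stalk z)
    (⟨_, hb⟩ : (hU.primeIdealOf ⟨z, trivial⟩).asIdeal.primeCompl)
  exact ⟨a, b, (isUnit_toStalk_specFun b z).1 hu, (mul_comm _ _).trans hab⟩

theorem toStalk_specFun_mem_maximalIdeal {R : Type u} [CommRing R] {z : Spec (.of R)} {a : R}
    (ha : a ∈ z.asIdeal) :
    toStalk z (specFun R a) ∈ IsLocalRing.maximalIdeal ((Spec (.of R)).presheaf.stalk z) := by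
  rw [IsLocalRing.mem_maximalIdeal, mem_nonunits_iff, isUnit_toStalk_specFun, not_not]
  exact ha

/-- Write `f = q F` with `q = a / b`. Since `γ` fixes `z` and acts trivially on the residue field,
`q` and its image have the same residue. Hence `f` is mapped to `c f` up to the maximal ideal times
`F`. -/
theorem exists_germ_eq_add {R : Type u} [CommRing R] (γ : R →+* R) (z : Spec (.of R))
    (W : (Spec (.of R)).Opens) (hz : z ∈ W) (hz' : z ∈ Spec.map (CommRingCat.ofHom γ) ⁻¹ᵁ W)
    (f : Γ(Spec (.of R), W)) {F c : R} (hγ : ∀ a, γ a - a ∈ z.asIdeal) (hF : γ F = c * F)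
    (hf : (Spec (.of R)).presheaf.germ W z hz f ∈ Ideal.span {toStalk z (specFun R F)}) :
    ∃ m ∈ IsLocalRing.maximalIdeal ((Spec (.of R)).presheaf.stalk z),
      (Spec (.of R)).presheaf.germ _ z hz' ((Spec.map (CommRingCat.ofHom γ)).app W f) =
        toStalk z (specFun R c) * (Spec (.of R)).presheaf.germ W z hz f +
          m * toStalk z (specFun R F) := by
  set g := Spec.map (CommRingCat.ofHom γ) with hg
  have hfix : g z = z := by
    refine PrimeSpectrum.ext (Ideal.ext fun a => ?_)
    change γ a ∈ z.asIdeal ↔ a ∈ z.asIdeal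
    exact ⟨fun h => by simpa using z.asIdeal.sub_mem h (hγ a),
      fun h => by simpa using z.asIdeal.add_mem (hγ a) h⟩
  obtain ⟨q, hq⟩ := Ideal.mem_span_singleton'.1 hf
  obtain ⟨a, b, hb, hab⟩ := exists_toStalk_mul_eq z q
  have h1 : ∀ (y : Spec (.of R)) (hy : y ∈ W), y = z →
      toStalk y (specFun R b) * (Spec (.of R)).presheaf.germ W y hy f =
        toStalk y (specFun R (a * F)) := by
    rintro y hy rfl
    rw [← hq, ← mul_assoc, hab, ← map_mul, ← map_mul]
  have h2 := congrArg (g.stalkMap z).hom (h1 (g z) hz' hfix)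
  rw [map_mul, stalkMap_toStalk, stalkMap_toStalk, appTop_specFun, appTop_specFun, map_mul γ,
      hF] at h2
  have h3 : (g.stalkMap z).hom ((Spec (.of R)).presheaf.germ W (g z) hz' f) =
    (Spec (.of R)).presheaf.germ _ z hz' (g.app W f) := g.germ_stalkMap_apply W z hz' f
  rw [h3] at h2
  have h4 := h1 z hz rfl
  have hγb : γ b ∉ z.asIdeal := fun h => hb (by simpa using z.asIdeal.sub_mem h (hγ b))
  obtain ⟨ub, hub⟩ := (isUnit_toStalk_specFun b z).2 hb
  obtain ⟨vb, hvb⟩ := (isUnit_toStalk_specFun (γ b) z).2 hγb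
  rw [← hub] at h4
  rw [← hvb] at h2
  have h5 : γ a * b - a * γ b ∈ z.asIdeal := by
    have : γ a * b - a * γ b = (γ a - a) * b - a * (γ b - b) := by ring
    rw [this]
    exact z.asIdeal.sub_mem (z.asIdeal.mul_mem_right _ (hγ a)) (z.asIdeal.mul_mem_left _ (hγ b))
  refine ⟨toStalk z (specFun R c) * toStalk z (specFun R (γ a * b - a * γ b)) * (↑ub⁻¹ * ↑vb⁻¹),
    Ideal.mul_mem_right _ _ (Ideal.mul_mem_left _ _ (toStalk_specFun_mem_maximalIdeal h5)), ?_⟩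
  refine (vb.isUnit.mul_right_inj).1 ((ub.isUnit.mul_right_inj).1 ?_)
  have h6 : (ub : (Spec (.of R)).presheaf.stalk z) * (ub⁻¹ : _) = 1 := ub.mul_inv
  have h7 : (vb : (Spec (.of R)).presheaf.stalk z) * (vb⁻¹ : _) = 1 := vb.mul_inv
  rw [h2]
  simp only [map_mul, map_sub, ← hub, ← hvb] at h4 ⊢
  linear_combination (-(vb : (Spec (.of R)).presheaf.stalk z) * toStalk z (specFun R c)) * h4 -
    toStalk z (specFun R c) * toStalk z (specFun R F) *
      (ub * toStalk z (specFun R (γ a)) - toStalk z (specFun R a) * vb) *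
      ((vb * (vb⁻¹ : _)) * h6 + h7)

variable {n : ℕ}

/-- The local generator of the linearized sheaf on a chart. -/
def ExpChart.generator {S : Scheme.{u}} {p : S ⟶ 𝒟.X} {t : ℕ → Γ(S, ⊤)} (E : ExpChart B n p t) :
    E.R.R :=
  ∏ i ∈ Finset.Icc 1 n, (if i < E.j then E.R.α (E.c.v 0) else tail E.R.t n i) ^ (n + 1)

/-- The weight of the linearized sheaf at a fixed point of the `j`-th chart. -/
def chartWeight (s : Fin n → ℤ) (j : ℕ) : ℤ :=
  ∑ i ∈ Finset.Icc 1 n, if i < j then i * extZero s i else (i - (n + 1)) * extZero s i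

section

variable {S : Scheme.{u}} {p : S ⟶ 𝒟.X} {t : ℕ → Γ(S, ⊤)} (E : ExpChart B n p t)

theorem ExpChart.generator_mem_nonZeroDivisors : E.generator ∈ nonZeroDivisors E.R.R := by
  refine prod_mem fun i _ => pow_mem ?_ _
  split_ifs
  · exact E.R.fst_mem_nonZeroDivisors
  · exact E.R.tail_mem_nonZeroDivisors i

theorem ExpChart.map_stalkIdeal_centre {i : ℕ} (hi : i ≤ n + 1) (z : Spec (.of E.R.R)) :
    (stalkIdeal (centreIdeal B p (tail t n i)) (E.ι z)).map (E.ι.stalkMap z).hom =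
      Ideal.span {toStalk z (specFun E.R.R
        (if i < E.j then E.R.α (E.c.v 0) else tail E.R.t n i))} := by
  rw [← stalkIdeal_comap, centreIdeal_comap, E.ι_proj, appTop_tail, E.tail_ι, E.R.centreIdeal_eq,
    stalkIdeal_ofIdealTop]
  have h1 : Ideal.span {specFun E.R.R (E.R.α (E.c.v 0)), specFun E.R.R (tail E.R.t n i)} =
      Ideal.span {specFun E.R.R (if i < E.j then E.R.α (E.c.v 0) else tail E.R.t n i)} := by
    split_ifs with hij
    · rw [E.R.isValue.tail_eq hij E.isChartIndex.le, map_mul]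
      exact Ideal.span_pair_eq_span_left_iff_dvd.2 (Dvd.intro _ rfl)
    · rw [E.R.isValue.fst_eq (not_lt.1 hij) hi, map_mul]
      exact Ideal.span_pair_eq_span_right_iff_dvd.2 (Dvd.intro_left _ rfl)
  rw [h1, Ideal.map_span, Set.image_singleton]

theorem ExpChart.map_stalkIdeal_prod (z : Spec (.of E.R.R)) :
    (stalkIdeal (∏ i ∈ Finset.Icc 1 n, centreIdeal B p (tail t n i) ^ (n + 1)) (E.ι z)).map
      (E.ι.stalkMap z).hom = Ideal.span {toStalk z (specFun E.R.R E.generator)} := by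
  rw [stalkIdeal_prod]
  refine (map_prod (Ideal.mapHom (E.ι.stalkMap z).hom) _ _).trans ?_
  rw [ExpChart.generator, map_prod, map_prod, ← Ideal.prod_span_singleton]
  refine Finset.prod_congr rfl fun i hi => ?_
  rw [Finset.mem_Icc] at hi
  rw [stalkIdeal_pow, map_pow, map_pow, map_pow, ← Ideal.span_singleton_pow,
    ← E.map_stalkIdeal_centre (by omega) z]
  rfl

/-- The function `x` is invariant, and the tail of index `i` has weight `s_{n+1} - sᵢ = -sᵢ`. -/
theorem ExpChart.scale_generator (s : Fin n → ℤ) (x : kˣ) :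
    E.scale s x E.generator = E.scalar
      ((∏ i ∈ Finset.Icc 1 n, x ^ (if i < E.j then 0 else -((n + 1) * extZero s i)) : kˣ) : k) *
        E.generator := by
  rw [ExpChart.generator, map_prod, Units.coe_prod, map_prod, ← Finset.prod_mul_distrib]
  refine Finset.prod_congr rfl fun i hi => ?_
  rw [Finset.mem_Icc] at hi
  split_ifs with hij
  · simp [E.scale_α]
  · have h1 : E.scale s x (tail E.R.t n i) =
        E.scalar ((x ^ (-extZero s i) : kˣ) : k) * tail E.R.t n i := by
      rw [tail, map_prod, Finset.prod_congr rfl fun m hm => E.scale_t s x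
        (by rw [Finset.mem_Icc] at hm ⊢; omega), Finset.prod_mul_distrib, ← map_prod,
        ← Units.coe_prod, prod_zpow_weight s x (show i ≤ n + 1 by omega), extZero_succ, zero_sub]
    rw [map_pow, h1, mul_pow, ← map_pow, ← Units.val_pow_eq_pow_val, ← zpow_natCast, ← zpow_mul]
    congr 4
    push_cast
    ring

/-- All coordinates of nonzero weight vanish at the limit, so the limit is fixed by the subgroup. -/
theorem ExpChart.scale_sub_mem {s : Fin n → ℤ} {z z₀ : Spec (.of E.R.R)} {e₀ : E.R.R →+* k}
    (hz₀ : z₀ = E.pt e₀) (he₀ : ∀ a, e₀ (E.scalar a) = a) (H : E.IsLimitPair s z z₀) (x : kˣ) :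
    e₀.comp (E.scale s x) = e₀ := by
  have key : ∀ (r : E.R.R) (w : ℤ) (v : Prop), VanishLimit w v (r ∈ z₀.asIdeal) →
      E.scale s x r = E.scalar ((x ^ w : kˣ) : k) * r → e₀ (E.scale s x r) = e₀ r := by
    intro r w v hv hr
    rw [hr, map_mul, he₀]
    by_cases hw : w = 0
    · simp [hw]
    · have := hv.iff.2 (.inr hw)
      rw [hz₀, E.mem_pt] at this
      rw [this, mul_zero]
  refine E.R.hom_ext _ _ ?_ (fun i hi _ => key _ _ _ (H.coord i hi) (E.scale_t s x hi)) fun i => ?_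
  · ext a
    simp only [RingHom.comp_apply, E.scale_α]
  · fin_cases i
    · exact key _ _ _ H.fst (E.scale_fst s x)
    · exact key _ _ _ H.snd (E.scale_snd s x)

end

end ExpDeg
end

/-! ### The Hilbert–Mumford invariant in terms of charts -/

noncomputable section

namespace ExpDeg

variable {k : Type u} [Field k] {𝒟 : Degeneration k} {B : BipartiteOrientation 𝒟} {n : ℕ}

theorem prod_zpow_eq {G : Type*} [CommGroup G] (x : G) (A : Finset ℕ) (f : ℕ → ℤ) :
    ∏ i ∈ A, x ^ f i = x ^ ∑ i ∈ A, f i := by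
  induction A using Finset.induction_on with
  | empty => simp
  | insert i A hi ih => rw [Finset.prod_insert hi, Finset.sum_insert hi, ih, zpow_add]

theorem tau_onePS (s : Fin n → ℤ) (x : kˣ) {i : ℕ} (hi : i ≤ n + 1) :
    tau i (onePS s x) = x ^ extZero s i := by
  have h1 : tau i (onePS s x) = ∏ m : Finset.Icc 1 (n + 1),
      if m.1 ≤ i then x ^ weight s m.1 else 1 :=
    Finset.prod_filter _ _
  rw [h1, Finset.prod_coe_sort (Finset.Icc 1 (n + 1))
      (fun m => if m ≤ i then x ^ weight s m else 1),
    ← Finset.prod_filter]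
  have h2 : (Finset.Icc 1 (n + 1)).filter (· ≤ i) = Finset.Icc (0 + 1) i := by
    ext m
    rw [Finset.mem_filter, Finset.mem_Icc, Finset.mem_Icc]
    omega
  rw [h2, prod_zpow_weight s x (Nat.zero_le i), extZero_zero, sub_zero]

theorem linearization_char (B : BipartiteOrientation 𝒟) (Y : Family 𝒟) (s : Fin n → ℤ) (x : kˣ) :
    (linearization B Y n).char (onePS s x) =
      ∏ i ∈ Finset.Icc 1 n, x ^ ((i : ℤ) * extZero s i) := by
  change ∏ i ∈ Finset.Icc 1 n, tau i (onePS s x) ^ i = _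
  refine Finset.prod_congr rfl fun i hi => ?_
  rw [Finset.mem_Icc] at hi
  rw [tau_onePS s x (by omega), ← zpow_natCast, ← zpow_mul, mul_comm]

theorem char_mul_eq (B : BipartiteOrientation 𝒟) (Y : Family 𝒟) (s : Fin n → ℤ) (x : kˣ) (j : ℕ) :
    (linearization B Y n).char (onePS s x) *
        ∏ i ∈ Finset.Icc 1 n, x ^ (if i < j then 0 else -((n + 1) * extZero s i)) =
      x ^ chartWeight s j := by
  rw [linearization_char, ← Finset.prod_mul_distrib, chartWeight, ← prod_zpow_eq]
  refine Finset.prod_congr rfl fun i _ => ?_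
  rw [← zpow_add]
  split_ifs
  · rw [add_zero]
  · congr 1
    ring

theorem germ_app_congr {T S : Scheme.{u}} {a b : T ⟶ S} (h : a = b) (U : S.Opens) (f : Γ(S, U))
    (z : T) (ha : z ∈ a ⁻¹ᵁ U) (hb : z ∈ b ⁻¹ᵁ U) :
    T.presheaf.germ (a ⁻¹ᵁ U) z ha (a.app U f) = T.presheaf.germ (b ⁻¹ᵁ U) z hb (b.app U f) := by
  subst h
  rfl

theorem mem_map_maximalIdeal {R R' : Type*} [CommRing R] [CommRing R'] [IsLocalRing R]
    [IsLocalRing R'] {f : R →+* R'} (hf : Function.Surjective f) :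
    IsLocalRing.maximalIdeal R' ≤ (IsLocalRing.maximalIdeal R).map f := by
  intro m hm
  obtain ⟨m, rfl⟩ := hf m
  exact Ideal.mem_map_of_mem f fun hu => hm (hu.map f)

theorem map_sub_mul_mem {R R' : Type*} [CommRing R] [CommRing R'] (φ : R →+* R') {a b G G' : R}
    {a' b' c H H' F m : R'} {M : Ideal R'} (ha : φ a = a') (hb : φ b = b') (hG : φ G = H)
    (hG' : φ G' = H') (hH : H' = c * H + m * F) (hc : b' = a' * c) (hm : m ∈ M) :
    φ (a * G' - b * G) ∈ M * Ideal.span {F} := by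
  have h1 : φ (a * G' - b * G) = (a' * m) * F := by
    rw [map_sub, map_mul, map_mul, ha, hb, hG, hG', hH, hc]
    ring
  rw [h1]
  exact Ideal.mul_mem_mul (M.mul_mem_left _ hm) (Ideal.mem_span_singleton_self _)

variable {Y : Family 𝒟} (h : IsUniversal B n Y.proj Y.coord) (s : Fin n → ℤ)

include h in
theorem isScaling_act (x : kˣ) : IsScaling Y.proj Y.coord s x (act Y (onePS s x)) := by
  have hex : ∃ g, IsTranslation Y (onePS s x) g := by
    obtain ⟨g, hg⟩ := h.exists_isScaling s x
    exact ⟨g, hg.proj, fun i => hg.coord i.1 i.2⟩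
  have h1 : IsTranslation Y (onePS s x) (act Y (onePS s x)) := by
    rw [act, dif_pos hex]
    exact hex.choose_spec
  exact ⟨h1.1, fun i hi => h1.2 ⟨i, hi⟩⟩

theorem stalkMap_germ_const {S T : Scheme.{u}} (g : T ⟶ S) (q : S ⟶ Spec (.of k)) (z : T) (a : k) :
    (g.stalkMap z).hom (S.presheaf.germ ⊤ (g z) trivial (const q a)) =
      toStalk z (constHom (g ≫ q) a) :=
  (stalkMap_toStalk g z (constHom q a)).trans (congrArg _ (appTop_constHom g q a))

include h in
-- Membership in `𝔪 𝓛` is tested after the isomorphism of stalks with the chart. There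
-- `exists_germ_eq_add` applies to the generator, and its weight combines with the character to
-- `chartWeight` by `char_mul_eq`.
theorem isFibreWeight_chartWeight (E : ExpChart B n Y.proj Y.coord) {e₀ : E.R.R →+* k}
    {z z₀ : Spec (.of E.R.R)} (hz₀ : z₀ = E.pt e₀) (he₀ : ∀ a, e₀ (E.scalar a) = a)
    (H : E.IsLimitPair s z z₀) :
    IsFibreWeight (linearization B Y n) (onePS s) (E.ι z₀) (chartWeight s E.j) := by
  intro x
  have hg := isScaling_act h s x
  have hsc := E.scale_ι h s x hg
  have hfix := E.scale_sub_mem hz₀ he₀ H x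
  have hγ : ∀ a, E.scale s x a - a ∈ z₀.asIdeal := fun a => by
    rw [hz₀, E.mem_pt, map_sub, sub_eq_zero]
    exact RingHom.congr_fun hfix a
  refine ⟨?_, fun U hx hgx f hf => ?_⟩
  · have h1 : E.point e₀ ≫ act Y (onePS s x) = E.point e₀ := by
      rw [E.point_scale h s x hg, hfix]
    have h2 := congrArg (fun l => l (IsLocalRing.closedPoint k)) h1
    have h3 : E.ι z₀ = E.point e₀ (IsLocalRing.closedPoint k) := by
      rw [E.point_closedPoint, hz₀]
    rw [h3]
    exact (Scheme.Hom.comp_apply _ _ _).symm.trans h2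
  · set g := act Y (onePS s x)
    have hφ := stalkMap_bijective E.ι z₀
    rw [← mem_map_of_bijective hφ, Ideal.map_mul]
    have hL := E.map_stalkIdeal_prod z₀
    have hL' : (stalkIdeal (linearization B Y n).sheaf (E.ι z₀)).map (E.ι.stalkMap z₀).hom = _ := hL
    rw [hL']
    have hW : (E.ι.stalkMap z₀).hom (Y.space.presheaf.germ U.1 (E.ι z₀) hx f) =
        (Spec (.of E.R.R)).presheaf.germ (E.ι ⁻¹ᵁ U.1) z₀ hx (E.ι.app U.1 f) :=
      E.ι.germ_stalkMap_apply U.1 z₀ hx f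
    have hz' : z₀ ∈ Spec.map (CommRingCat.ofHom (E.scale s x)) ⁻¹ᵁ E.ι ⁻¹ᵁ U.1 := by
      have h1 : z₀ ∈ (Spec.map (CommRingCat.ofHom (E.scale s x)) ≫ E.ι) ⁻¹ᵁ U.1 := by
        rw [hsc]
        exact hgx
      exact h1
    have hW' : (E.ι.stalkMap z₀).hom (Y.space.presheaf.germ (g ⁻¹ᵁ U.1) (E.ι z₀) hgx (g.app U.1 f)) =
        (Spec (.of E.R.R)).presheaf.germ _ z₀ hz'
          ((Spec.map (CommRingCat.ofHom (E.scale s x))).app _ (E.ι.app U.1 f)) := by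
      refine (E.ι.germ_stalkMap_apply (g ⁻¹ᵁ U.1) z₀ hgx (g.app U.1 f)).trans ?_
      have h1 := germ_app_congr hsc U.1 f z₀ hz' hgx
      rw [Scheme.Hom.comp_app, Scheme.Hom.comp_app] at h1
      exact h1.symm
    have hmem : (Spec (.of E.R.R)).presheaf.germ (E.ι ⁻¹ᵁ U.1) z₀ hx (E.ι.app U.1 f) ∈
        Ideal.span {toStalk z₀ (specFun E.R.R E.generator)} := by
      rw [← hW, ← hL]
      exact Ideal.mem_map_of_mem _ (Ideal.subset_span ⟨U, hx, f, hf, rfl⟩)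
    obtain ⟨m, hm, hmeq⟩ := exists_germ_eq_add (E.scale s x) z₀ _ hx hz' _ hγ
      (E.scale_generator s x) hmem
    have hstr : E.ι ≫ Y.str = Spec.map (CommRingCat.ofHom E.scalar) := E.ι_str
    have hconst : ∀ a : k, (E.ι.stalkMap z₀).hom
        (Y.space.presheaf.germ ⊤ (E.ι z₀) trivial (const Y.str a)) =
          toStalk z₀ (specFun E.R.R (E.scalar a)) := fun a => by
      rw [stalkMap_germ_const, hstr, constHom_spec]
    refine map_sub_mul_mem _ (hconst _) (hconst _) hW hW' hmeq ?_ (mem_map_maximalIdeal hφ.2 hm)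
    rw [← char_mul_eq B Y s x E.j, Units.val_mul, map_mul, map_mul, map_mul]

/-- If `x ^ v ≠ x ^ w` for some `x`, subtracting the two conditions gives `𝓛 ⊆ 𝔪 𝓛` at the point,
which is impossible for an ideal generated by a regular element. So `x ^ v = x ^ w` for all `x`, and
an infinite field has only finitely many roots of unity of a given order. -/
theorem fibreWeight_unique [IsAlgClosed k] (E : ExpChart B n Y.proj Y.coord) (z₀ : Spec (.of E.R.R))
    {v w : ℤ} (hv : IsFibreWeight (linearization B Y n) (onePS s) (E.ι z₀) v)
    (hw : IsFibreWeight (linearization B Y n) (onePS s) (E.ι z₀) w) : v = w := by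
  classical
  set L := linearization B Y n
  have key : ∀ x : kˣ, x ^ v = x ^ w := by
    intro x
    by_contra hne
    have hne' : ((x ^ v : kˣ) : k) - ((x ^ w : kˣ) : k) ≠ 0 := fun h0 =>
      hne (Units.ext (sub_eq_zero.1 h0))
    obtain ⟨U, hU, -⟩ := exists_affineOpen (E.ι z₀) (W := ⊤) trivial
    have hle : stalkIdeal L.sheaf (E.ι z₀) ≤
        IsLocalRing.maximalIdeal (Y.space.presheaf.stalk (E.ι z₀)) *
          stalkIdeal L.sheaf (E.ι z₀) := by
      rw [stalkIdeal_eq_map L.sheaf U _ hU, Ideal.map_le_iff_le_comap,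
          ← stalkIdeal_eq_map L.sheaf U _ hU]
      intro f hf
      have hgx : E.ι z₀ ∈ act Y (onePS s x) ⁻¹ᵁ U.1 := by
        change act Y (onePS s x) (E.ι z₀) ∈ U.1
        rw [(hv x).1]
        exact hU
      have h1 := Ideal.sub_mem _ ((hw x).2 U hU hgx f hf) ((hv x).2 U hU hgx f hf)
      rw [sub_sub_sub_cancel_left, ← sub_mul] at h1
      have hunit : IsUnit (Y.space.presheaf.germ ⊤ (E.ι z₀) trivial (const Y.str ((x ^ v : kˣ) : k)) -
          Y.space.presheaf.germ ⊤ (E.ι z₀) trivial (const Y.str ((x ^ w : kˣ) : k))) := by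
        have h2 := ((IsUnit.mk0 _ hne').map (constHom Y.str)).map (toStalk (E.ι z₀))
        rwa [map_sub, map_sub] at h2
      exact (Ideal.unit_mul_mem_iff_mem _ hunit).1 h1
    have hle' := Ideal.map_mono (f := (E.ι.stalkMap z₀).hom) hle
    have hL : (stalkIdeal L.sheaf (E.ι z₀)).map (E.ι.stalkMap z₀).hom = _ :=
        E.map_stalkIdeal_prod z₀
    rw [Ideal.map_mul, hL] at hle'
    have h3 : (IsLocalRing.maximalIdeal (Y.space.presheaf.stalk (E.ι z₀))).map (E.ι.stalkMap z₀).hom ≤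
        IsLocalRing.maximalIdeal _ := by
      rw [Ideal.map_le_iff_le_comap]
      intro a ha hu
      exact ha (isUnit_of_map_unit (E.ι.stalkMap z₀).hom a hu)
    have h4 := (hle'.trans (Ideal.mul_mono_left h3)) (Ideal.mem_span_singleton_self _)
    rw [Ideal.mem_mul_span_singleton] at h4
    obtain ⟨m, hm, hmF⟩ := h4
    have h5 := specFun_mem_nonZeroDivisors E.generator_mem_nonZeroDivisors z₀
    have h6 : m = 1 := by
      refine (mul_cancel_right_mem_nonZeroDivisors h5).1 ?_
      rw [hmF, one_mul]
    exact hm (h6 ▸ isUnit_one)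
  have : Infinite k := IsAlgClosed.instInfinite
  by_contra hne
  wlog hlt : v < w generalizing v w
  · exact this hw hv (fun x => (key x).symm) (fun h => hne h.symm) (by omega)
  obtain ⟨m, rfl⟩ : ∃ m : ℕ, w = v + m := ⟨(w - v).toNat, by omega⟩
  have hm : m ≠ 0 := by rintro rfl; simp at hne
  have h1 : ∀ x : kˣ, x ^ m = 1 := fun x => by
    have := key x
    rw [zpow_add, zpow_natCast] at this
    exact (mul_eq_left.1 this.symm)
  obtain ⟨y, hy⟩ := Infinite.exists_notMem_finset
    (insert 0 (Polynomial.nthRootsFinset m (1 : k)))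
  rw [Finset.mem_insert, not_or, Polynomial.mem_nthRootsFinset (Nat.pos_of_ne_zero hm)] at hy
  exact hy.2 (by simpa using congrArg Units.val (h1 (Units.mk0 y hy.1)))

theorem Family.Point.pt_eq {Y : Family 𝒟} {P : Y.Point} {E : ExpChart B n Y.proj Y.coord}
    {e : E.R.R →+* k} (hP : P.1 = E.point e) : P.pt = E.ι (E.pt e) := by
  rw [Family.Point.pt, hP, E.point_closedPoint]

variable {s}

include h in
theorem IsLimit.exists_isLimitPair [IsAlgClosed k] {P P₀ : Y.Point}
    (hl : IsLimit Y (onePS s) P P₀) :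
    ∃ (E : ExpChart B n Y.proj Y.coord) (e e₀ : E.R.R →+* k), P.1 = E.point e ∧
      P₀.1 = E.point e₀ ∧ E.IsLimitPair s (E.pt e) (E.pt e₀) := by
  obtain ⟨φ, hφ, h0⟩ := hl
  exact ExpDeg.exists_isLimitPair h (isScaling_act h s) hφ P.2 h0

include h in
theorem exists_isLimit_iff [IsAlgClosed k] (P : Y.Point) :
    (∃ P₀, IsLimit Y (onePS s) P P₀) ↔
      ∀ i ∈ Finset.Icc 1 (n + 1), ¬ VanishesAt (Y.coord i) P.pt → 0 ≤ weight s i := by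
  constructor
  · rintro ⟨P₀, hl⟩ i hi hv
    obtain ⟨E, e, e₀, hP, -, H⟩ := hl.exists_isLimitPair h
    rw [Family.Point.pt_eq hP] at hv
    exact H.weight_nonneg hi hv
  · intro ht
    obtain ⟨φ, hφ, h0⟩ := exists_limit h (isScaling_act h s) P.1 P.2 ht
    exact ⟨⟨linePoint 0 ≫ φ, (Category.assoc _ _ _).trans h0⟩, φ, hφ, rfl⟩

include h in
-- The definition chooses some weight at some limit. The hypothesis covers every chart that contains
-- `P` and a limit, so the chosen value is pinned down without knowing that limits are unique.
theorem hilbertMumford_eq [IsAlgClosed k] {P : Y.Point} (hex : ∃ P₀, IsLimit Y (onePS s) P P₀)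
    {μ : ℤ} (hμ : ∀ (E : ExpChart B n Y.proj Y.coord) (e e₀ : E.R.R →+* k), P.1 = E.point e →
      E.IsLimitPair s (E.pt e) (E.pt e₀) → chartWeight s E.j = -μ) :
    hilbertMumford (linearization B Y n) (onePS s) P = (μ : WithTop ℤ) := by
  have key : ∀ P₀, IsLimit Y (onePS s) P P₀ →
      IsFibreWeight (linearization B Y n) (onePS s) P₀.pt (-μ) ∧
        ∀ w, IsFibreWeight (linearization B Y n) (onePS s) P₀.pt w → w = -μ := by
    intro P₀ hl
    obtain ⟨E, e, e₀, hP, hP₀, H⟩ := hl.exists_isLimitPair h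
    have h1 := isFibreWeight_chartWeight h s E rfl (E.point_str e₀ (hP₀ ▸ P₀.2)) H
    rw [hμ E e e₀ hP H, ← Family.Point.pt_eq hP₀] at h1
    refine ⟨h1, fun w hw => ?_⟩
    rw [Family.Point.pt_eq hP₀] at h1 hw
    exact fibreWeight_unique s E _ hw h1
  obtain ⟨P₀, hl⟩ := hex
  have hw : ∃ w : ℤ, ∃ P₀ : Y.Point, IsLimit Y (onePS s) P P₀ ∧
      IsFibreWeight (linearization B Y n) (onePS s) P₀.pt w := ⟨-μ, P₀, hl, (key P₀ hl).1⟩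
  rw [hilbertMumford, dif_pos hw]
  obtain ⟨P₁, hl₁, hw₁⟩ := hw.choose_spec
  rw [(key P₁ hl₁).2 _ hw₁, neg_neg]

end ExpDeg
end

/-! ### Thresholds that locate the limit -/

noncomputable section

namespace ExpDeg

variable {k : Type u} [Field k] {𝒟 : Degeneration k} {B : BipartiteOrientation 𝒟} {n : ℕ}

section Separation

variable {S : Scheme.{u}} (p : S ⟶ 𝒟.X) (t : ℕ → Γ(S, ⊤)) (n : ℕ)

variable (B) in
/-- The homogeneous coordinates of the centres that vanish at `q` are the second ones with index
less than `a` and the first ones with index at least `b`. -/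
structure IsSeparated (a b : ℕ) (q : S) : Prop where
  tail : ∀ l < a, TailZero B p t n l q
  source : ∀ l, b ≤ l → l ≤ n + 1 → SourceZero B p t n l q
  middle : ∀ l, a ≤ l → l < b → l ≤ n + 1 → ¬ SourceZero B p t n l q ∧ ¬ TailZero B p t n l q

variable {p t n}

theorem ExpChart.IsLimitPair.isSeparated {E : ExpChart B n p t} {s : Fin n → ℤ}
    {z z₀ : Spec (.of E.R.R)} (H : E.IsLimitPair s z z₀) {a b : ℕ} (ha : a ≤ n + 2)
    (ht : ∀ l < a, TailZero B p t n l (E.ι z) ∨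
      extZero s l < 0 ∧ ¬ SourceZero B p t n l (E.ι z))
    (hs : ∀ l, b ≤ l → l ≤ n + 1 → SourceZero B p t n l (E.ι z) ∨
      0 < extZero s l ∧ ¬ TailZero B p t n l (E.ι z))
    (hm : ∀ l, a ≤ l → l < b → l ≤ n + 1 → extZero s l = 0 ∧ ¬ SourceZero B p t n l (E.ι z) ∧
      ¬ TailZero B p t n l (E.ι z)) :
    IsSeparated B p t n a b (E.ι z₀) where
  tail l hl := (ht l hl).elim (H.tailZero (by omega)) fun h => H.tailZero_of_neg (by omega) h.1 h.2
  source l hl hn := (hs l hl hn).elim (H.sourceZero hn) fun h => H.sourceZero_of_pos hn h.1 h.2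
  middle l h1 h2 hn := H.not_zero_of_eq_zero hn (hm l h1 h2 hn).1 (hm l h1 h2 hn).2.1
    (hm l h1 h2 hn).2.2

namespace IsSeparated

variable {E : ExpChart B n p t} {z : Spec (.of E.R.R)} {a b : ℕ} {I : Finset ℕ}

theorem le_index (h : IsSeparated B p t n a b (E.ι z)) (ha : a ≤ n + 2) : a ≤ E.j := by
  rcases Nat.eq_zero_or_pos a with rfl | h0
  · exact Nat.zero_le _
  · have := ((E.tailZero_iff z (by omega)).1 (h.tail (a - 1) (by omega))).1
    omega

theorem index_le (h : IsSeparated B p t n a b (E.ι z)) : E.j ≤ b := by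
  have := E.isChartIndex.le
  rcases le_or_gt b (n + 1) with hb | hb
  · exact ((E.sourceZero_iff z hb).1 (h.source b le_rfl hb)).1
  · omega

/-- There is no vanishing coordinate strictly between the two indices. -/
theorem notMem (h : IsSeparated B p t n a b (E.ι z)) {m : ℕ} (hm : m ≤ n + 1) (ham : a < m)
    (hmb : m < b) : E.R.t m ∉ z.asIdeal := by
  intro ht
  have h1 := h.middle m ham.le hmb hm
  have h2 := h.middle (m - 1) (by omega) (by omega) (by omega)
  rw [E.sourceZero_iff z hm] at h1
  rw [E.tailZero_iff z (by omega : m - 1 ≤ n + 1)] at h2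
  rcases lt_trichotomy m E.j with hj | hj | hj
  · exact h2.2 ⟨by omega, .inr ⟨m, by omega, hj, ht⟩⟩
  · rw [hj, E.t_mem_iff] at ht
    rcases ht with ht | ht
    · exact h1.1 ⟨hj.ge, .inl ht⟩
    · exact h2.2 ⟨by omega, .inl ht⟩
  · exact h1.1 ⟨hj.le, .inr ⟨m, hj, le_rfl, ht⟩⟩

theorem not_singular (h : IsSeparated B p t n a b (E.ι z)) (hab : a < b) (ha : a ≤ n + 2) :
    ¬ (E.R.c 0 ∈ z.asIdeal ∧ E.R.c 1 ∈ z.asIdeal) := by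
  rintro ⟨h0, h1⟩
  have hj := h.le_index ha
  have hj' := h.index_le
  have hjn := E.isChartIndex.le
  rcases eq_or_lt_of_le hj' with hb | hb
  · have h2 := (h.middle (b - 1) (by omega) (by omega) (by omega)).2
    rw [E.tailZero_iff z (by omega)] at h2
    exact h2 ⟨by omega, .inl h1⟩
  · have h2 := (h.middle E.j hj hb hjn).1
    rw [E.sourceZero_iff z hjn] at h2
    exact h2 ⟨le_rfl, .inl h0⟩

/-- The ratio `v_{a-1} / x` is `t_a` times `v_a / x`. The tail coordinate vanishes at `a - 1` but
not at `a`, so `t_a` vanishes. -/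
theorem mem_insert (h : IsSeparated B p t n a b (E.ι z)) (hab : a < b) (ha : a ≤ n + 1)
    (hI : ∀ i ∈ Finset.Icc 1 (n + 1), E.R.t i ∈ z.asIdeal → i ∈ I) : a ∈ insert 0 I := by
  rcases Nat.eq_zero_or_pos a with rfl | h0
  · exact Finset.mem_insert_self _ _
  refine Finset.mem_insert_of_mem (hI a (Finset.mem_Icc.2 ⟨h0, ha⟩) ?_)
  have h1 := (E.tailZero_iff z (by omega)).1 (h.tail (a - 1) (by omega))
  have h2 := (h.middle a le_rfl hab ha).2
  rw [E.tailZero_iff z ha] at h2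
  push Not at h2
  have hj := h.le_index (by omega)
  rcases eq_or_lt_of_le hj with hj | hj
  · rcases h1.2 with h3 | ⟨m, h3, h4, -⟩
    · have h5 := (E.t_mem_iff z).2 (.inr h3)
      rw [hj]
      exact h5
    · omega
  · obtain ⟨h5, h6⟩ := h2 hj
    rcases h1.2 with h3 | ⟨m, h3, h4, h7⟩
    · exact (h5 h3).elim
    · rcases eq_or_ne m a with rfl | hne
      · exact h7
      · exact (h6 m (by omega) h4 h7).elim

theorem mem_cell (h : IsSeparated B p t n a b (E.ι z)) (hI : ∀ i ∈ I, VanishesAt (t i) (E.ι z))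
    {l : ℕ} {L : Set 𝒟.X} (hL : p (E.ι z) ∈ L) (hla : l ≤ a)
    (hlb : ∀ m ∈ I, l < m → b ≤ m) : E.ι z ∈ cell B p t n I L l :=
  ⟨hI, hL, fun i hi => h.tail i (by omega), fun m hm hlm i hmi hi =>
    h.source i ((hlb m hm hlm).trans hmi) hi⟩

/-- The index of the chart lies between `a` and `b`. The exponents in `[a, b)` are zero, so it does
not matter on which side of `j` they are counted. -/
theorem chartWeight_eq {s : Fin n → ℤ} (h : IsSeparated B p t n a b (E.ι z)) (ha : a ≤ n + 2)
    (hs : ∀ l, a ≤ l → l < b → extZero s l = 0) :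
    chartWeight s E.j = -∑ l ∈ Finset.Icc 1 n,
      if l < a then -(l : ℤ) * extZero s l else if b ≤ l then ((n : ℤ) + 1 - l) * extZero s l
      else 0 := by
  have h1 := h.le_index ha
  have h2 := h.index_le
  rw [chartWeight, ← Finset.sum_neg_distrib]
  refine Finset.sum_congr rfl fun l _ => ?_
  rcases lt_or_ge l a with hl | hl
  · rw [if_pos (by omega), if_pos hl]
    ring
  · rw [if_neg hl.not_gt]
    rcases le_or_gt b l with hb | hb
    · rw [if_pos hb, if_neg (by omega)]
      ring
    · rw [hs l hl hb, if_neg hb.not_ge]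
      simp

theorem chartWeight_eq_of_eq {s : Fin n → ℤ} (h : IsSeparated B p t n a a (E.ι z))
    (ha : a ≤ n + 2) :
    chartWeight s E.j = -∑ l ∈ Finset.Icc 1 n,
      if l < a then -(l : ℤ) * extZero s l else ((n : ℤ) + 1 - l) * extZero s l := by
  rw [h.chartWeight_eq ha (fun l h1 h2 => by omega)]
  refine congrArg _ (Finset.sum_congr rfl fun l _ => ?_)
  split_ifs <;> first | rfl | omega

theorem index_eq (h : IsSeparated B p t n a a (E.ι z)) (ha : a ≤ n + 1) (ha1 : 1 ≤ a) :
    E.j = a ∧ E.R.c 0 ∈ z.asIdeal ∧ E.R.c 1 ∈ z.asIdeal := by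
  have hj := h.index_le.antisymm (h.le_index (by omega))
  refine ⟨hj, ?_, ?_⟩
  · rcases ((E.sourceZero_iff z ha).1 (h.source a le_rfl ha)).2 with h1 | ⟨m, h1, h2, -⟩
    · exact h1
    · omega
  · rcases ((E.tailZero_iff z (by omega)).1 (h.tail (a - 1) (by omega))).2 with h1 | ⟨m, h1, h2, -⟩
    · exact h1
    · omega

end IsSeparated

/-- Smoothness of the stratum at a point of a cell excludes the vanishing of homogeneous coordinates
between the index of the cell and its successor. -/
theorem ExpChart.CellCond.not_zero {E : ExpChart B n p t} {I : Finset ℕ} {l : ℕ}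
    {z : Spec (.of E.R.R)} (C : E.CellCond I l z)
    (hI : ∀ i ∈ Finset.Icc 1 (n + 1), E.R.t i ∈ z.asIdeal → i ∈ I)
    (hsm : ¬ (E.j ∈ I ∧ E.R.c 0 ∈ z.asIdeal ∧ E.R.c 1 ∈ z.asIdeal)) {m : ℕ} (hlm : l ≤ m)
    (hm : m ≤ n + 1) (hlt : ∀ i ∈ I, l < i → m < i) :
    ¬ SourceZero B p t n m (E.ι z) ∧ ¬ TailZero B p t n m (E.ι z) := by
  have hj1 := E.isChartIndex.one_le
  have hjn := E.isChartIndex.le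
  have hl := C.le
  have hjI : E.R.c 0 ∈ z.asIdeal ∨ E.R.c 1 ∈ z.asIdeal → E.j ∈ I := fun h =>
    hI _ (Finset.mem_Icc.2 ⟨hj1, hjn⟩) ((E.t_mem_iff z).2 h)
  rw [E.sourceZero_iff z hm, E.tailZero_iff z hm]
  constructor
  · rintro ⟨h1, h2 | ⟨i, h2, h3, h4⟩⟩
    · have h3 := hjI (.inl h2)
      have h4 : l = E.j := by
        by_contra hne
        have := hlt _ h3 (by omega)
        omega
      exact hsm ⟨h3, h2, C.snd h4⟩
    · have := hlt i (hI i (Finset.mem_Icc.2 ⟨by omega, by omega⟩) h4) (by omega)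
      omega
  · rintro ⟨h1, h2 | ⟨i, h2, h3, h4⟩⟩
    · have h3 := hjI (.inr h2)
      exact hsm ⟨h3, C.fst h3 (by omega), h2⟩
    · have h5 := hI i (Finset.mem_Icc.2 ⟨by omega, by omega⟩) h4
      have := C.ge i h5 (by omega)
      omega

end Separation

/-- A decreasing property on an interval holds below a threshold. -/
theorem exists_threshold {q : ℕ → Prop} {i j : ℕ} (hij : i ≤ j)
    (hq : ∀ l, i ≤ l → l + 1 < j → q (l + 1) → q l) :
    ∃ a, i ≤ a ∧ a ≤ j ∧ ∀ l, i ≤ l → l < j → (q l ↔ l < a) := by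
  induction j, hij using Nat.le_induction with
  | base => exact ⟨i, le_rfl, le_rfl, fun l h1 h2 => by omega⟩
  | succ j hij ih =>
    obtain ⟨a, h1, h2, h3⟩ := ih fun l h1 h2 => hq l h1 (by omega)
    by_cases hj : q j
    · refine ⟨j + 1, by omega, le_rfl, fun l hl hlj => ⟨fun _ => hlj, fun _ => ?_⟩⟩
      have key : ∀ d, i ≤ j - d → q (j - d) := by
        intro d
        induction d with
        | zero => exact fun _ => hj
        | succ d ihd =>
          intro hd
          rcases Nat.lt_or_ge d j with hdj | hdj
          · refine hq _ hd (by omega) ?_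
            have := ihd (by omega)
            rwa [show j - d = j - (d + 1) + 1 by omega] at this
          · have := ihd (by omega)
            rwa [show j - d = j - (d + 1) by omega] at this
      have := key (j - l) (by omega)
      rwa [show j - (j - l) = l by omega] at this
    · refine ⟨a, h1, by omega, fun l hl hlj => ?_⟩
      rcases Nat.lt_succ_iff_lt_or_eq.1 hlj with h4 | rfl
      · exact h3 l hl h4
      · exact ⟨fun h => (hj h).elim, fun h => by omega⟩

end ExpDeg
end

/-! ### The limits of smooth and of singular points -/

noncomputable section

namespace ExpDeg

variable {k : Type u} [Field k] {𝒟 : Degeneration k} {B : BipartiteOrientation 𝒟} {n : ℕ}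
  {Y : Family 𝒟}

theorem Family.Point.mem_vanishing {P : Y.Point} {i : ℕ} :
    i ∈ P.vanishing n ↔ i ∈ Finset.Icc 1 (n + 1) ∧ VanishesAt (Y.coord i) P.pt := by
  classical
  rw [Family.Point.vanishing, Finset.mem_filter]

theorem Family.Point.vanishing_subset (P : Y.Point) : P.vanishing n ⊆ Finset.Icc 1 (n + 1) :=
  fun _ h => (Family.Point.mem_vanishing.1 h).1

section

variable {P : Y.Point} {E : ExpChart B n Y.proj Y.coord} {e : E.R.R →+* k}

theorem ExpChart.mem_vanishing_iff (hP : P.1 = E.point e) {i : ℕ}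
    (hi : i ∈ Finset.Icc 1 (n + 1)) : i ∈ P.vanishing n ↔ E.R.t i ∈ (E.pt e).asIdeal := by
  rw [Family.Point.mem_vanishing, Family.Point.pt_eq hP, E.vanishesAt_iff hi, and_iff_right hi]

theorem ExpChart.smoothStratumAt_iff (hP : P.1 = E.point e) :
    Y.SmoothStratumAt (P.vanishing n) P.pt ↔
      ¬ (E.j ∈ P.vanishing n ∧ E.R.c 0 ∈ (E.pt e).asIdeal ∧ E.R.c 1 ∈ (E.pt e).asIdeal) := by
  have h1 : Y.SmoothStratumAt (P.vanishing n) P.pt ↔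
    SmoothStratum (Y.proj ≫ 𝒟.π ≫ 𝒟.str) Y.coord (P.vanishing n) P.pt := Iff.rfl
  rw [h1, Family.Point.pt_eq hP]
  exact E.smoothStratum_iff_notMem P.vanishing_subset _
    (fun i hi => (E.mem_vanishing_iff hP (P.vanishing_subset hi)).1 hi) e
    (E.point_str e (hP ▸ P.2)) fun r => (E.mem_pt e r).symm

end

variable [IsAlgClosed k] (h : IsUniversal B n Y.proj Y.coord) {s : Fin n → ℤ} {P P₀ : Y.Point}

include h

theorem vanishing_limit (hl : IsLimit Y (onePS s) P P₀) :
    P₀.vanishing n = limitIndex s (P.vanishing n) := by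
  obtain ⟨E, e, e₀, hP, hP₀, H⟩ := hl.exists_isLimitPair h
  ext i
  have h1 : i ∈ limitIndex s (P.vanishing n) ↔ i ∈ P.vanishing n ∨
      i ∈ Finset.Icc 1 (n + 1) ∧ extZero s (i - 1) < extZero s i := by
    rw [limitIndex, Finset.mem_union, Finset.mem_filter]
  rw [h1, Family.Point.mem_vanishing, Family.Point.mem_vanishing]
  by_cases hi : i ∈ Finset.Icc 1 (n + 1)
  · have h2 := H.vanishesAt_iff hi
    have h3 := H.weight_nonneg hi
    rw [Family.Point.pt_eq hP, Family.Point.pt_eq hP₀, h2]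
    rw [weight] at h3 ⊢
    have h4 : extZero s (i - 1) < extZero s i ↔ 0 < extZero s i - extZero s (i - 1) := sub_pos.symm
    rw [h4]
    simp only [hi, true_and]
    by_cases hv : VanishesAt (Y.coord i) (E.ι (E.pt e))
    · simp [hv]
    · have := h3 hv
      simp only [hv, false_or]
      omega
  · simp [hi]

/-- A point over the locus of an arrow at which all homogeneous coordinates vanish lies on two
components. -/
theorem exists_mem_delta_inter {E : ExpChart B n Y.proj Y.coord} {e : E.R.R →+* k}
    (hP : P.1 = E.point e) {a : ℕ} (hs : IsSeparated B Y.proj Y.coord n a a (E.ι (E.pt e)))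
    (ha : a ≤ n + 1) (ha1 : 1 ≤ a) (D : Arrow B) (hD : Y.proj P.pt ∈ D.locus) :
    ∃ a', Consecutive (insert 0 (P.vanishing n)) a' a ∧
      P.pt ∈ Y.delta (P.vanishing n) D a' ∩ Y.delta (P.vanishing n) D a := by
  have hpt := Family.Point.pt_eq hP
  obtain ⟨hj, h0, h1⟩ := hs.index_eq ha ha1
  have haI : a ∈ P.vanishing n := by
    have h2 := (E.mem_vanishing_iff hP (Finset.mem_Icc.2
      ⟨E.isChartIndex.one_le, E.isChartIndex.le⟩)).2 ((E.t_mem_iff (E.pt e)).2 (.inl h0))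
    exact hj ▸ h2
  obtain ⟨a', ha'⟩ := exists_pred (Finset.mem_insert_self 0 (P.vanishing n))
    (Finset.mem_insert_of_mem haI) ha1
  have hI : ∀ i ∈ P.vanishing n, VanishesAt (Y.coord i) (E.ι (E.pt e)) := fun i hi => by
    rw [← hpt]
    exact (Family.Point.mem_vanishing.1 hi).2
  refine ⟨a', ha', ?_, ?_⟩
  · rw [mem_delta_iff h P.vanishing_subset ⟨a, haI⟩ D ha'.1, hpt]
    refine hs.mem_cell hI (D.locus_subset_base _ _ (hpt ▸ hD)) ha'.2.2.1.le fun m hm hlt => ?_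
    by_contra hcon
    exact ha'.2.2.2 m (Finset.mem_insert_of_mem hm) ⟨hlt, not_le.1 hcon⟩
  · rw [mem_delta_iff h P.vanishing_subset ⟨a, haI⟩ D ha'.2.1, hpt]
    exact hs.mem_cell hI (D.locus_subset_base _ _ (hpt ▸ hD)) le_rfl fun m _ hlt => hlt.le

/-- If the point lay on cells of indices `l < l'`, the second would make the tail coordinate of
index `l` vanish, which `ExpChart.CellCond.not_zero` forbids at a smooth point. With equal indices
the bases meet and agree. -/
theorem existsUnique_component (hne : (P.vanishing n).Nonempty)
    (hsm : Y.SmoothStratumAt (P.vanishing n) P.pt) :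
    ∃! Z, IsComponent Z (Y.stratum (P.vanishing n)) ∧ P.pt ∈ Z := by
  obtain ⟨E, hE⟩ := h.exists_mem_range_expChart P.pt
  obtain ⟨e, hP⟩ := E.exists_point (P := P.1) hE
  have hpt := Family.Point.pt_eq hP
  rw [E.smoothStratumAt_iff hP] at hsm
  have hI := P.vanishing_subset (n := n)
  have h0 : 0 ∉ P.vanishing n := fun h0 => by simpa using hI h0
  have hcomp := fun Z => isComponent_iff h hI hne (Z := Z)
  have hlt : ∀ {L L' : Set 𝒟.X} {l l' : ℕ}, IsBase B (P.vanishing n) l L →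
      IsBase B (P.vanishing n) l' L' →
      P.pt ∈ cell B Y.proj Y.coord n (P.vanishing n) L l →
      P.pt ∈ cell B Y.proj Y.coord n (P.vanishing n) L' l' → ¬ l < l' := by
    intro L L' l l' hL hL' hq hq' hlt
    have hl' : l' ∈ P.vanishing n := (Finset.mem_insert.1 hL'.mem_insert).resolve_left (by omega)
    have hn := (Finset.mem_Icc.1 (hI hl')).2
    rw [hpt, E.mem_cell_iff hI hL.mem_insert] at hq
    rw [hpt] at hq'
    by_cases hc : ∀ i ∈ P.vanishing n, l < i → l < i
    · exact (hq.2.not_zero (fun i hi ht => (E.mem_vanishing_iff hP hi).2 ht) hsm le_rfl (by omega) hc).2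
        (hq'.2.2.1 l hlt)
    · exact hc fun _ _ => id
  obtain ⟨L, l, hL, hq⟩ := exists_mem_cell h hI hne (q := P.pt)
    fun i hi => (Family.Point.mem_vanishing.1 hi).2
  refine ⟨_, ⟨(hcomp _).2 ⟨L, l, hL, rfl⟩, hq⟩, ?_⟩
  rintro Z ⟨hZ, hqZ⟩
  obtain ⟨L', l', hL', rfl⟩ := (hcomp Z).1 hZ
  obtain rfl : l = l' := by
    have h1 := hlt hL hL' hq hqZ
    have h2 := hlt hL' hL hqZ hq
    omega
  rw [hL.unique h0 hL' ⟨_, hq.2.1, hqZ.2.1⟩]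

/-- At a singular point in the `j`-th chart, `j ∈ I` and `x_j = y_j = 0`, so `P` lies on two cells
with consecutive indices. Conversely, on two cells of consecutive indices `i < j` all tail
coordinates below `j` and all source coordinates from `j` on vanish. Vanishing persists in the
limit, whence both thresholds of `P₀` are `j`. -/
theorem singular_limit {I J : Finset ℕ} (hI : I = P.vanishing n) (hJ : J = P₀.vanishing n)
    (hIJ : I ⊆ J) (hl : IsLimit Y (onePS s) P P₀) (hsing : ¬ Y.SmoothStratumAt I P.pt) :
    (∃ (D : Arrow B) (i j : ℕ), Consecutive (insert 0 I) i j ∧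
      Y.proj P.pt ∈ D.locus ∧ P.pt ∈ Y.delta I D i ∩ Y.delta I D j) ∧
    ∀ (D : Arrow B) (i j : ℕ), Consecutive (insert 0 I) i j →
      Y.proj P.pt ∈ D.locus → P.pt ∈ Y.delta I D i ∩ Y.delta I D j →
      (∃ j', i ≤ j' ∧ Consecutive (insert 0 J) j' j ∧
        P₀.pt ∈ Y.delta J D j' ∩ Y.delta J D j) ∧
      hilbertMumford (linearization B Y n) (onePS s) P =
        ((∑ l ∈ Finset.Icc 1 n, if l < j then -(l : ℤ) * extZero s l
          else ((n : ℤ) + 1 - l) * extZero s l : ℤ) : WithTop ℤ) := by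
  subst hI hJ
  obtain ⟨E, e, e₀, hP, hP₀, H⟩ := hl.exists_isLimitPair h
  have hpt := Family.Point.pt_eq hP
  rw [E.smoothStratumAt_iff hP, not_not] at hsing
  obtain ⟨hjI, h0, h1⟩ := hsing
  have hjn := E.isChartIndex.le
  have hj1 := E.isChartIndex.one_le
  constructor
  · obtain ⟨D, hD⟩ := E.c.exists_arrow (u := E.below (E.pt e)) ((E.fst_mem_iff _).2 (.inl h0))
      ((E.snd_mem_iff _).2 (.inl h1))
    rw [← E.proj_ι, ← hpt] at hD
    have hsep : IsSeparated B Y.proj Y.coord n E.j E.j (E.ι (E.pt e)) :=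
      ⟨fun l hl => (E.tailZero_iff _ (by omega)).2 ⟨hl, .inl h1⟩,
        fun l hl hn => (E.sourceZero_iff _ hn).2 ⟨hl, .inl h0⟩, fun l h1 h2 => by omega⟩
    obtain ⟨a', ha', hmem⟩ := exists_mem_delta_inter h hP hsep hjn hj1 D hD
    exact ⟨D, a', E.j, ha', hD, hmem⟩
  · intro D i j hij hD hmem
    have hI := P.vanishing_subset (n := n)
    have hj : j ∈ P.vanishing n :=
      (Finset.mem_insert.1 hij.2.1).resolve_left (by have := hij.2.2.1; omega)
    have hjn := Finset.mem_Icc.1 (hI hj)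
    rw [Set.mem_inter_iff, mem_delta_iff h hI ⟨j, hj⟩ D hij.1,
      mem_delta_iff h hI ⟨j, hj⟩ D hij.2.1] at hmem
    have key : ∀ (E : ExpChart B n Y.proj Y.coord) (e e₀ : E.R.R →+* k), P.1 = E.point e →
        E.IsLimitPair s (E.pt e) (E.pt e₀) →
        IsSeparated B Y.proj Y.coord n j j (E.ι (E.pt e₀)) := by
      intro E e e₀ hP H
      have hpt := Family.Point.pt_eq hP
      refine H.isSeparated (by omega) (fun l hl => .inl ?_) (fun l hl hn => .inl ?_)
        fun l h1 h2 => by omega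
      · rw [← hpt]
        exact hmem.2.2.2.1 l hl
      · rw [← hpt]
        exact hmem.1.2.2.2 j hj hij.2.2.1 l hl hn
    refine ⟨?_, hilbertMumford_eq h ⟨P₀, hl⟩ fun E e e₀ hP H =>
      (key E e e₀ hP H).chartWeight_eq_of_eq (by omega)⟩
    have hD₀ : Y.proj P₀.pt ∈ D.locus := by
      rw [Family.Point.pt_eq hP₀, H.proj_eq, ← hpt]
      exact hD
    obtain ⟨j', hj', hmem'⟩ := exists_mem_delta_inter h hP₀ (key E e e₀ hP H) hjn.2 hjn.1 D hD₀
    refine ⟨j', ?_, hj', hmem'⟩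
    by_contra hcon
    exact hj'.2.2.2 i (Finset.insert_subset_insert 0 hIJ hij.1) ⟨not_le.1 hcon, hij.2.2.1⟩

section Smooth

variable {I J : Finset ℕ} (hI : I = P.vanishing n) (hl : IsLimit Y (onePS s) P P₀)
  (hsm : Y.SmoothStratumAt I P.pt) {D : Arrow B} {i j : ℕ} (hmem : P.pt ∈ Y.delta I D i)
  (hij : Consecutive (insert 0 (insert (n + 2) I)) i j)

include hI hl hij in
theorem extZero_monotone {l : ℕ} (hil : i ≤ l) (hlj : l + 1 < j) :
    extZero s l ≤ extZero s (l + 1) := by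
  have hj : j ≤ n + 2 := by
    rcases Finset.mem_insert.1 hij.2.1 with h1 | h1
    · omega
    · rcases Finset.mem_insert.1 h1 with h2 | h2
      · omega
      · have := Finset.mem_Icc.1 (P.vanishing_subset (hI ▸ h2))
        omega
  have hmem : l + 1 ∈ Finset.Icc 1 (n + 1) := Finset.mem_Icc.2 ⟨by omega, by omega⟩
  have h1 := (exists_isLimit_iff h P).1 ⟨P₀, hl⟩ (l + 1) hmem fun hv => ?_
  · rw [weight, Nat.add_sub_cancel] at h1
    omega
  · have h2 : l + 1 ∈ I := by
      rw [hI, Family.Point.mem_vanishing]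
      exact ⟨hmem, hv⟩
    exact hij.2.2.2 (l + 1) (Finset.mem_insert_of_mem (Finset.mem_insert_of_mem h2))
      ⟨by omega, hlj⟩

include hI hsm hmem hij in
/-- The homogeneous coordinates that vanish at a smooth point of a component. -/
theorem zero_of_mem_delta : i ∈ insert 0 I ∧ (j = n + 2 ∨ j ∈ I) ∧ j ≤ n + 2 ∧
    (∀ m ∈ I, i < m → j ≤ m) ∧ Y.proj P.pt ∈ D.base I i ∧
    (∀ l < i, TailZero B Y.proj Y.coord n l P.pt) ∧
    (∀ l, j ≤ l → l ≤ n + 1 → SourceZero B Y.proj Y.coord n l P.pt) ∧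
    ∀ l, i ≤ l → l < j → l ≤ n + 1 → ¬ SourceZero B Y.proj Y.coord n l P.pt ∧
      ¬ TailZero B Y.proj Y.coord n l P.pt := by
  subst hI
  have hI := P.vanishing_subset (n := n)
  have hne := hmem.1
  have hi := hmem.2.1
  have hj : j = n + 2 ∨ j ∈ P.vanishing n :=
    Finset.mem_insert.1 ((Finset.mem_insert.1 hij.2.1).resolve_left (by have := hij.2.2.1; omega))
  have hjn : j ≤ n + 2 := by
    rcases hj with h2 | h2
    · omega
    · have := Finset.mem_Icc.1 (hI h2)
      omega
  have hsucc : ∀ m ∈ P.vanishing n, i < m → j ≤ m := fun m hm him => by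
    by_contra hcon
    exact hij.2.2.2 m (Finset.mem_insert_of_mem (Finset.mem_insert_of_mem hm))
      ⟨him, not_le.1 hcon⟩
  rw [mem_delta_iff h hI hne D hi] at hmem
  refine ⟨hi, hj, hjn, hsucc, hmem.2.1, hmem.2.2.1, fun l hjl hln => ?_, fun l hil hlj hln => ?_⟩
  · exact hmem.2.2.2 j (hj.resolve_left (by omega)) hij.2.2.1 l hjl hln
  · obtain ⟨E, hE⟩ := h.exists_mem_range_expChart P.pt
    obtain ⟨e, hP⟩ := E.exists_point (P := P.1) hE
    rw [E.smoothStratumAt_iff hP] at hsm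
    rw [Family.Point.pt_eq hP, E.mem_cell_iff hI hi] at hmem
    rw [Family.Point.pt_eq hP]
    exact hmem.2.not_zero (fun i hi ht => (E.mem_vanishing_iff hP hi).2 ht) hsm hil hln
      fun m hm him => lt_of_lt_of_le hlj (hsucc m hm him)

include hI hl hsm hmem hij in
-- Only the homogeneous coordinates with index in `[i, j)` are undecided at `P`, and there the sign
-- of the increasing `s_l` decides, with a single change at `a`. As `s_0 = s_{n+1} = 0`,
-- nonvanishing of the `s_l` excludes `i = 0` and `j = n + 2`.
theorem limit_of_ne_zero (hJ : J = P₀.vanishing n)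
    (hs : ∀ l, i ≤ l → l < j → extZero s l ≠ 0) :
    i ≠ 0 ∧ (∃ m ∈ I, i < m) ∧
      ∃ a, i ≤ a ∧ a ≤ j ∧ (∀ l, i ≤ l → l < j → (extZero s l < 0 ↔ l < a)) ∧
        (∃ a', Consecutive (insert 0 J) a' a ∧ P₀.pt ∈ Y.delta J D a' ∩ Y.delta J D a) ∧
        hilbertMumford (linearization B Y n) (onePS s) P =
          ((∑ l ∈ Finset.Icc 1 n, if l < a then -(l : ℤ) * extZero s l
            else ((n : ℤ) + 1 - l) * extZero s l : ℤ) : WithTop ℤ) := by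
  subst hJ
  have hmono := fun l => extZero_monotone h hI hl hij (l := l)
  obtain ⟨hi, hj, hjn, hsucc, hD, hB, hA, hmid⟩ := zero_of_mem_delta h hI hsm hmem hij
  have hlt := hij.2.2.1
  have hi0 : i ≠ 0 := by
    rintro rfl
    exact hs 0 le_rfl hlt (extZero_zero s)
  have hjI : j ∈ I := hj.resolve_left fun h1 =>
    hs (n + 1) (by omega) (by omega) (extZero_succ s)
  refine ⟨hi0, ⟨j, hjI, hlt⟩, ?_⟩
  obtain ⟨a, hia, haj, ha⟩ := exists_threshold (q := fun l => extZero s l < 0) hlt.le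
    fun l h1 h2 h3 => lt_of_le_of_lt (hmono l h1 h2) h3
  have hjn' := Finset.mem_Icc.1 (P.vanishing_subset (hI ▸ hjI))
  have key : ∀ (E : ExpChart B n Y.proj Y.coord) (e e₀ : E.R.R →+* k), P.1 = E.point e →
      E.IsLimitPair s (E.pt e) (E.pt e₀) →
      IsSeparated B Y.proj Y.coord n a a (E.ι (E.pt e₀)) := by
    intro E e e₀ hP H
    rw [Family.Point.pt_eq hP] at hB hA hmid
    refine H.isSeparated (by omega) (fun l hl => ?_) (fun l hl hn => ?_) fun l h1 h2 => by omega
    · rcases lt_or_ge l i with h1 | h1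
      · exact .inl (hB l h1)
      · exact .inr ⟨(ha l h1 (by omega)).2 hl, (hmid l h1 (by omega) (by omega)).1⟩
    · rcases le_or_gt j l with h1 | h1
      · exact .inl (hA l h1 hn)
      · have h2 := hs l (by omega) h1
        have h3 := (ha l (by omega) h1).not.2 (by omega)
        exact .inr ⟨by omega, (hmid l (by omega) h1 hn).2⟩
  obtain ⟨E, e, e₀, hP, hP₀, H⟩ := hl.exists_isLimitPair h
  refine ⟨a, hia, haj, ha, ?_, hilbertMumford_eq h ⟨P₀, hl⟩ fun E e e₀ hP H =>
    (key E e e₀ hP H).chartWeight_eq_of_eq (by omega)⟩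
  refine exists_mem_delta_inter h hP₀ (key E e e₀ hP H) (by omega) (by omega) D ?_
  rw [Family.Point.pt_eq hP₀, H.proj_eq, ← Family.Point.pt_eq hP]
  rwa [Arrow.base, if_neg hi0, if_pos ⟨j, hjI, hlt⟩] at hD

include hI hl hsm hmem hij in
-- The thresholds `a` and `b` are those of `s_l < 0` and `s_l ≤ 0` on `[i, j)`. A zero of `s` gives
-- `a < b`, so some pair of homogeneous coordinates is nonzero at the limit; this rules out a
-- singular point and singles out the component with index `a`.
theorem limit_of_eq_zero (hJ : J = P₀.vanishing n)
    (hs : ∃ l, i ≤ l ∧ l < j ∧ extZero s l = 0) :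
    ∃ a b, i ≤ a ∧ a ≤ j ∧ i ≤ b ∧ b ≤ j ∧
      (∀ l, i ≤ l → l < j → (extZero s l = 0 ↔ a ≤ l ∧ l < b)) ∧
      P₀.pt ∈ Y.delta J D a ∧ Y.SmoothStratumAt J P₀.pt ∧
      hilbertMumford (linearization B Y n) (onePS s) P =
        ((∑ l ∈ Finset.Icc 1 n, if l < a then -(l : ℤ) * extZero s l
          else if b ≤ l then ((n : ℤ) + 1 - l) * extZero s l else 0 : ℤ) : WithTop ℤ) := by
  subst hJ
  have hmono := fun l => extZero_monotone h hI hl hij (l := l)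
  have hne := hmem.1
  obtain ⟨hi, hj, hjn, hsucc, hD, hB, hA, hmid⟩ := zero_of_mem_delta h hI hsm hmem hij
  have hlt := hij.2.2.1
  obtain ⟨a, hia, haj, ha⟩ := exists_threshold (q := fun l => extZero s l < 0) hlt.le
    fun l h1 h2 h3 => lt_of_le_of_lt (hmono l h1 h2) h3
  obtain ⟨b, hib, hbj, hb⟩ := exists_threshold (q := fun l => extZero s l ≤ 0) hlt.le
    fun l h1 h2 h3 => (hmono l h1 h2).trans h3
  have hab : ∀ l, i ≤ l → l < j → (extZero s l = 0 ↔ a ≤ l ∧ l < b) := fun l h1 h2 => by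
    rw [← hb l h1 h2, ← not_lt, ← ha l h1 h2]
    omega
  have hlt' : a < b := by
    obtain ⟨l, h1, h2, h3⟩ := hs
    have := (hab l h1 h2).1 h3
    omega
  have key : ∀ (E : ExpChart B n Y.proj Y.coord) (e e₀ : E.R.R →+* k), P.1 = E.point e →
      E.IsLimitPair s (E.pt e) (E.pt e₀) →
      IsSeparated B Y.proj Y.coord n a b (E.ι (E.pt e₀)) := by
    intro E e e₀ hP H
    rw [Family.Point.pt_eq hP] at hB hA hmid
    refine H.isSeparated (by omega) (fun l hl => ?_) (fun l hl hn => ?_) fun l h1 h2 hn =>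
      ⟨(hab l (by omega) (by omega)).2 ⟨h1, h2⟩, hmid l (by omega) (by omega) hn⟩
    · rcases lt_or_ge l i with h1 | h1
      · exact .inl (hB l h1)
      · exact .inr ⟨(ha l h1 (by omega)).2 hl, (hmid l h1 (by omega) (by omega)).1⟩
    · rcases le_or_gt j l with h1 | h1
      · exact .inl (hA l h1 hn)
      · have h3 := (hb l (by omega) h1).not.2 (by omega)
        exact .inr ⟨by omega, (hmid l (by omega) h1 hn).2⟩
  obtain ⟨E, e, e₀, hP, hP₀, H⟩ := hl.exists_isLimitPair h
  have hsep := key E e e₀ hP H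
  have hpt₀ := Family.Point.pt_eq hP₀
  have hJ₀ := P₀.vanishing_subset (n := n)
  have hIJ : I ⊆ P₀.vanishing n := by
    rw [vanishing_limit h hl, hI]
    exact Finset.subset_union_left
  have haJ : a ∈ insert 0 (P₀.vanishing n) :=
    hsep.mem_insert hlt' (by omega) fun m hm ht => (E.mem_vanishing_iff hP₀ hm).2 ht
  have hJb : ∀ m ∈ P₀.vanishing n, a < m → b ≤ m := fun m hm h1 => by
    by_contra hcon
    exact hsep.notMem (Finset.mem_Icc.1 (hJ₀ hm)).2 h1 (not_le.1 hcon)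
      ((E.mem_vanishing_iff hP₀ (hJ₀ hm)).1 hm)
  refine ⟨a, b, hia, haj, hib, hbj, hab, ?_, ?_, hilbertMumford_eq h ⟨P₀, hl⟩ fun E e e₀ hP H =>
    (key E e e₀ hP H).chartWeight_eq (by omega) fun l h1 h2 =>
      (hab l (by omega) (by omega)).2 ⟨h1, h2⟩⟩
  · rw [mem_delta_iff h hJ₀ (hne.mono hIJ) D haJ, hpt₀]
    refine hsep.mem_cell (fun m hm => ?_) ?_ le_rfl hJb
    · rw [← hpt₀]
      exact (Family.Point.mem_vanishing.1 hm).2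
    · rw [H.proj_eq, ← Family.Point.pt_eq hP]
      rw [Arrow.base] at hD
      split_ifs at hD with h1 h2
      -- On a source component `i = 0`, and `s_0 = 0` is not negative, so the threshold stays at
      -- `0`.
      · have ha0 : a = 0 := by
          have h2 := ha 0 h1.le (by omega)
          rw [extZero_zero] at h2
          by_contra hcon
          exact lt_irrefl _ (h2.2 (Nat.pos_of_ne_zero hcon))
        rwa [Arrow.base, if_pos ha0]
      · exact D.locus_subset_base _ _ hD
      -- On a target component the successor is `n + 2`, and `s_{n+1} = 0` pushes `b` beyond `n +
      -- 1`. Hence `J` has no element above `a`, and the limit remains on the target.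
      · have hjeq : j = n + 2 := hj.resolve_right fun h3 => h2 ⟨j, h3, hlt⟩
        have hi' := (Finset.mem_insert.1 hi).resolve_left h1
        have hin := (Finset.mem_Icc.1 (hJ₀ (hIJ hi'))).2
        have hbn := ((hab (n + 1) (by omega) (by omega)).1 (extZero_succ s)).2
        rw [Arrow.base, if_neg (by omega), if_neg]
        · exact hD
        · rintro ⟨m, hm, ham⟩
          have h3 := hJb m hm ham
          have h4 := (Finset.mem_Icc.1 (hJ₀ hm)).2
          omega
  · rw [E.smoothStratumAt_iff hP₀]
    exact fun h1 => hsep.not_singular hlt' (by omega) h1.2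

end Smooth

end ExpDeg
end

theorem proposition2 {k : Type*} [Field k] [IsAlgClosed k] [CharZero k]
    (𝒟 : ExpDeg.Degeneration k) (B : ExpDeg.BipartiteOrientation 𝒟) (n : ℕ)
    (Y : ExpDeg.Family 𝒟) (hY : ExpDeg.IsExpansion B n Y)
    (s : Fin n → ℤ) (P : Y.Point) (I J : Finset ℕ)
    (hI : I = P.vanishing n) (hJ : J = ExpDeg.limitIndex s I) :
    -- (a)
    ((∃ P₀, ExpDeg.IsLimit Y (ExpDeg.onePS s) P P₀) ↔
      ∀ i ∈ Finset.Icc 1 (n + 1), i ∉ I → ExpDeg.extZero s (i - 1) ≤ ExpDeg.extZero s i) ∧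
    ∀ P₀ : Y.Point, ExpDeg.IsLimit Y (ExpDeg.onePS s) P P₀ →
      P₀.vanishing n = J ∧
      -- (b)
      (Y.SmoothStratumAt I P.pt →
        (I.Nonempty → ∃! Z, ExpDeg.IsComponent Z (Y.stratum I) ∧ P.pt ∈ Z) ∧
        ∀ (D : ExpDeg.Arrow B) (i j : ℕ), P.pt ∈ Y.delta I D i →
          ExpDeg.Consecutive (insert 0 (insert (n + 2) I)) i j →
          (∀ l, i ≤ l → l + 1 < j → ExpDeg.extZero s l ≤ ExpDeg.extZero s (l + 1)) ∧
          -- (b.i)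
          ((∀ l, i ≤ l → l < j → ExpDeg.extZero s l ≠ 0) →
            i ≠ 0 ∧ (∃ m ∈ I, i < m) ∧
            ∃ a, i ≤ a ∧ a ≤ j ∧ (∀ l, i ≤ l → l < j → (ExpDeg.extZero s l < 0 ↔ l < a)) ∧
              (∃ a', ExpDeg.Consecutive (insert 0 J) a' a ∧
                P₀.pt ∈ Y.delta J D a' ∩ Y.delta J D a) ∧
              ExpDeg.hilbertMumford (ExpDeg.linearization B Y n) (ExpDeg.onePS s) P =
                ((∑ l ∈ Finset.Icc 1 n,
                  if l < a then -(l : ℤ) * ExpDeg.extZero s l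
                  else ((n : ℤ) + 1 - l) * ExpDeg.extZero s l : ℤ) : WithTop ℤ)) ∧
          -- (b.ii)
          ((∃ l, i ≤ l ∧ l < j ∧ ExpDeg.extZero s l = 0) →
            ∃ a b, i ≤ a ∧ a ≤ j ∧ i ≤ b ∧ b ≤ j ∧
              (∀ l, i ≤ l → l < j → (ExpDeg.extZero s l = 0 ↔ a ≤ l ∧ l < b)) ∧
              P₀.pt ∈ Y.delta J D a ∧ Y.SmoothStratumAt J P₀.pt ∧
              ExpDeg.hilbertMumford (ExpDeg.linearization B Y n) (ExpDeg.onePS s) P =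
                ((∑ l ∈ Finset.Icc 1 n,
                  if l < a then -(l : ℤ) * ExpDeg.extZero s l
                  else if b ≤ l then ((n : ℤ) + 1 - l) * ExpDeg.extZero s l
                  else 0 : ℤ) : WithTop ℤ))) ∧
      -- (c)
      (¬ Y.SmoothStratumAt I P.pt →
        (∃ (D : ExpDeg.Arrow B) (i j : ℕ), ExpDeg.Consecutive (insert 0 I) i j ∧
          Y.proj P.pt ∈ D.locus ∧ P.pt ∈ Y.delta I D i ∩ Y.delta I D j) ∧
        ∀ (D : ExpDeg.Arrow B) (i j : ℕ), ExpDeg.Consecutive (insert 0 I) i j →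
          Y.proj P.pt ∈ D.locus → P.pt ∈ Y.delta I D i ∩ Y.delta I D j →
          (∃ j', i ≤ j' ∧ ExpDeg.Consecutive (insert 0 J) j' j ∧
            P₀.pt ∈ Y.delta J D j' ∩ Y.delta J D j) ∧
          ExpDeg.hilbertMumford (ExpDeg.linearization B Y n) (ExpDeg.onePS s) P =
            ((∑ l ∈ Finset.Icc 1 n,
              if l < j then -(l : ℤ) * ExpDeg.extZero s l
              else ((n : ℤ) + 1 - l) * ExpDeg.extZero s l : ℤ) : WithTop ℤ)) := by
  have h := hY.isUniversal
  refine ⟨?_, fun P₀ hl => ?_⟩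
  · rw [ExpDeg.exists_isLimit_iff h P]
    refine forall₂_congr fun i hi => ?_
    rw [hI, ExpDeg.Family.Point.mem_vanishing, and_iff_right hi, ExpDeg.weight, sub_nonneg]
  have hJ₀ : P₀.vanishing n = J := by rw [hJ, hI, ExpDeg.vanishing_limit h hl]
  refine ⟨hJ₀, fun hsm => ⟨fun hne => ?_, fun D i j hmem hij => ⟨fun l hil hlj => ?_,
    ExpDeg.limit_of_ne_zero h hI hl hsm hmem hij hJ₀.symm,
    ExpDeg.limit_of_eq_zero h hI hl hsm hmem hij hJ₀.symm⟩⟩, fun hsing => ?_⟩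
  · subst hI
    exact ExpDeg.existsUnique_component h hne hsm
  · exact ExpDeg.extZero_monotone h hI hl hij hil hlj
  · exact ExpDeg.singular_limit h hI hJ₀.symm (hJ ▸ Finset.subset_union_left) hl hsing
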